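/- All functions are real valued; $\langle f,g\rangle=\int_{\mathbb R} f g$, $\|f\|=\langle f,f\rangle^{1/2}$, and $\mathcal N f=f/\|f\|$. For functions $g_1,\dots,g_n$ put $R_{g_1,\dots,g_n}f=f-\sum_{i}\langle f,g_i\rangle g_i$. "Orthonormalizing" a pair $u_1,u_2$ means passing to $\mathcal N u_1$ and $\mathcal N R_{\mathcal N u_1}u_2$. Let $\chi$ be the characteristic function of $[0,1]$. **Construction.** Let $\xi_1(x)=(1-|x|)^2(1+2|x|)$ and $\xi_2(x)=(1-|x|)^2x$ for $|x|\le 1$, and $\xi_1=\xi_2=0$ elsewhere; let $\xi_{j,2k+l-1}=2^{j/2}\xi_l(2^j\cdot-k)$, $l=1,2$. *Scaling generators.* Let $\phi_1=\mathcal N\xi_{1,2}$ and $\phi_2=\mathcal N\xi_{1,3}$. Let $b^1,\dots,b^4$ be a basis of the null space of the matrix $(\langle\xi_{1,i+1},\xi_{2,j+1}\rangle)_{i\le2,\,j\le6}$, let $w_i=\sum_{j=1}^6 b^i_j\xi_{2,j+1}$, and let $v_1,\dots,v_4$ be obtained from $w_1,\dots,w_4$ by Gram--Schmidt orthonormalization.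 Let $\phi_3=\sum_j s_{1,j}v_j$ and $\phi_4=\sum_j s_{2,j}v_j$, where the rows of $s\in\mathbb R^{2\times4}$ are orthonormal and, with $c_i=R_{\phi_1,\phi_2}(\xi_{1,i-1}\chi)$ for $i=1,2$ and $c_i=R_{\phi_1,\phi_2}(\xi_{1,i+1}\chi)$ for $i=3,4$, $$\langle R_{\phi_3,\phi_4}c_i,\;R_{\phi_3,\phi_4}c_k\rangle=0,\qquad i\in\{1,2\},\ k\in\{3,4\}.$$ Let $\phi_5=\mathcal N R\,\xi_{1,0}$, with $R$ taken with respect to $\phi_i,\phi_i(\cdot+1)$, $i\le4$, and $\phi_6=\mathcal N R\,\xi_{1,1}$, with $R$ taken with respect to $\phi_i,\phi_i(\cdot+1)$, $i\le5$. For $j\ge0$, $k\in\mathbb Z$ let $\phi^{\mathbb R}_{j,6k+l}=2^{j/2}\phi_l(2^j\cdot-k)$ if $1\le l\le4$ and $\phi^{\mathbb R}_{j,6k+l}=2^{j/2}\phi_l(2^j\cdot-k-1)$ if $l=5,6$. *Wavelet generators.* Let $p_1,\dots,p_{10}$ be $\phi_k(2\cdot)$, $k\le4$, and $\phi_k(2\cdot-1)$,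 $k\le6$; let $q_1,\dots,q_8$ be $\phi_1,\dots,\phi_6,\phi_5(\cdot-1),\phi_6(\cdot-1)$. Then $\psi_1,\psi_2$ are obtained by orthonormalizing $u_i=\sum_j b^i_jp_j$, $i=1,2$, where $b^1,b^2$ is a basis of the null space of $(\langle q_i,p_j\rangle)_{i,j}$. The functions $\psi_3,\psi_4$ are obtained by orthonormalizing $R_{\phi_5,\phi_6}(\phi_5(2\cdot))$ and $R_{\phi_5,\phi_6}(\phi_6(2\cdot))$. The functions $\psi_5,\psi_6$ are obtained by orthonormalizing $z_i=\sum_{k=-11}^{10}b^i_k\phi^{\mathbb R}_{1,k}$, $i=1,2$, where $b^1,b^2$ is a basis of the null space of the $20\times22$ matrix of inner products of the functions $\phi^{\mathbb R}_{0,-7},\dots,\phi^{\mathbb R}_{0,6}$, $\psi_1(\cdot+1),\psi_2(\cdot+1)$, $\psi_1,\dots,\psi_4$ (rows) with $\phi^{\mathbb R}_{1,-11},\dots,\phi^{\mathbb R}_{1,10}$ (columns). *Boundary functions.* Let $$\phi_L=\mathcal N\big((\phi_6(0)\phi_5-\phi_5(0)\phi_6)\chi\big),\qquad \phi_R=\mathcal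 N\big((\phi_6(0)\phi_5(\cdot-1)-\phi_5(0)\phi_6(\cdot-1))\chi\big).$$ The functions $\psi_{L_1},\psi_{L_2}$ are obtained by orthonormalizing $\chi\sum_{j=1}^4b^i_j\psi_{j+2}$, $i=1,2$, where $b^1,b^2$ is a basis of the null space of the $2\times4$ matrix with rows $(\psi_{j+2}(0))_j$ and $(\langle\phi_L,\psi_{j+2}\rangle)_j$. The functions $\psi_{R_1},\psi_{R_2}$ are obtained by orthonormalizing $\chi\sum_{j=1}^4c^i_j\psi_{j+2}(\cdot-1)$, $i=1,2$, where $c^1,c^2$ is a basis of the null space of the $2\times 4$ matrix with rows $(\psi_{j+2}(0))_j$ and $(\langle\phi_R,\psi_{j+2}(\cdot-1)\rangle)_j$. *Interval basis.* Let $(\phi_{0,1},\dots,\phi_{0,6})=(\phi_L,\phi_1,\phi_2,\phi_3,\phi_4,\phi_R)$. For $j\ge0$ let, for $i=1,2$, $$\psi_{j,i}=2^{j/2}\psi_{L_i}(2^j\cdot),\qquad \psi_{j,6\cdot2^j+i-2}=2^{j/2}\psi_{R_i}\big(1-2^j(1-\cdot)\big),$$ and define the inner wavelets, for $k\in\mathbb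 Z$, $1\le l\le6$ and $3\le 6k+l+2\le6\cdot2^j-2$, by $$\psi_{j,6k+l+2}=2^{j/2}\psi_l(2^j\cdot-k)\ \ (l=1,2),\qquad \psi_{j,6k+l+2}=2^{j/2}\psi_l(2^j\cdot-k-1)\ \ (l=3,\dots,6).$$ Let $\mathcal J_j=\{1,\dots,6\cdot2^j\}$ and $\Psi^I=\{\phi_{0,k}:k\in\mathcal J_0\}\cup\bigcup_{j\ge0}\{\psi_{j,k}:k\in\mathcal J_j\}$. **Theorem.** The construction can be carried out: admissible vectors $b^1,\dots,b^4$ and coefficients $s$ exist, and for every admissible choice of them the null spaces used for the wavelet generators and the boundary wavelets have bases of two vectors, as required. For every choice of all these parameters the following holds. a) All functions of $\Psi^I$ are cubic splines on $[0,1]$ (piecewise polynomials of degree at most $3$ on a finite partition) and belong to $C^1(0,1)$. b) With respect to the inner product of $L^2(0,1)$, $\langle\phi_{0,k},\phi_{0,l}\rangle=\delta_{k,l}$, $\langle\psi_{i,k},\psi_{j,l}\rangle=\delta_{i,j}\delta_{k,l}$ and $\langle\phi_{0,k},\psi_{j,l}\rangle=0$ for all indices. c) The inner wavelets $\psi_{j,k}$,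 $j\ge0$, $3\le k\le6\cdot2^j-2$, have four vanishing moments: $\int_0^1P\,\psi_{j,k}=0$ for every polynomial $P$ of degree less than $4$. d) $\Psi^I$ is an orthonormal basis of the Hilbert space $L^2(0,1)$. e) All these functions have compact support, $\operatorname{diam}\operatorname{supp}\phi_{0,k}\le2$ and $\operatorname{diam}\operatorname{supp}\psi_{j,k}\le2^{1-j}$. -/

import Mathlib

open MeasureTheory

noncomputable section

namespace SplineWavelet

/-! ### Elementary operations on functions `ℝ → ℝ` -/

/-- The `L²(ℝ)` inner product of two real functions. -/
def ip (f g : ℝ → ℝ) : ℝ := ∫ x, f x * g x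

/-- The `L²(ℝ)` norm of a real function. -/
def l2norm (f : ℝ → ℝ) : ℝ := Real.sqrt (ip f f)

/-- `f / ‖f‖`. -/
def normalize (f : ℝ → ℝ) : ℝ → ℝ := fun x => f x / l2norm f

/-- `f - ∑ i, ⟨f, g i⟩ g i`. -/
def resid {n : ℕ} (g : Fin n → ℝ → ℝ) (f : ℝ → ℝ) : ℝ → ℝ :=
  fun x => f x - ∑ i, ip f (g i) * g i x

/-- The function `f (a · - c)`. -/
def dil (a c : ℝ) (f : ℝ → ℝ) : ℝ → ℝ := fun x => f (a * x - c)

/-- The product of `f` with the characteristic function of `[0, 1]`. -/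
def restr (f : ℝ → ℝ) : ℝ → ℝ := (Set.Icc (0 : ℝ) 1).indicator f

/-- The linear combination `∑ j, c j • f j`. -/
def lincomb {n : ℕ} (c : Fin n → ℝ) (f : Fin n → ℝ → ℝ) : ℝ → ℝ := fun x => ∑ j, c j * f j x

/-- Gram-Schmidt orthogonalization and normalization of two functions. -/
def gsPair (u : Fin 2 → ℝ → ℝ) : Fin 2 → ℝ → ℝ :=
  ![normalize (u 0), normalize (resid ![normalize (u 0)] (u 1))]

/-- The vectors `b i` form a basis of the null space of the matrix `M`. -/
def IsNullBasis {m : Type} {k n : ℕ} (M : Matrix m (Fin n) ℝ) (b : Fin k → Fin n → ℝ) : Prop :=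
  LinearIndependent ℝ b ∧ Submodule.span ℝ (Set.range b) = LinearMap.ker M.mulVecLin

/-- Dilations and translations on the real line of six generators `g 0, …, g 5`, the first `m` of
which have support in `[0, 1]` and the remaining ones in `[-1, 1]`. With `n = 6 k + l`,
`1 ≤ l ≤ 6`, this is the function `2^(j/2) g_l (2^j · - k)` for `l ≤ m`, and
`2^(j/2) g_l (2^j · - k - 1)` for `l > m` (where `g_l` is `g (l - 1)`). -/
def lineFamily (m : ℕ) (g : Fin 6 → ℝ → ℝ) (j : ℕ) (n : ℤ) : ℝ → ℝ :=
  fun x => (2 : ℝ) ^ ((j : ℝ) / 2) *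
    g ⟨((n - 1) % 6).toNat, by omega⟩
      ((2 : ℝ) ^ j * x - (((n - 1) / 6 : ℤ) : ℝ) - if ((n - 1) % 6).toNat < m then 0 else 1)

/-! ### Hermite cubic splines -/

/-- The symmetric Hermite cubic spline. -/
def xi1 (x : ℝ) : ℝ :=
  if -1 ≤ x ∧ x ≤ 0 then (x + 1) ^ 2 * (1 - 2 * x)
  else if 0 ≤ x ∧ x ≤ 1 then (1 - x) ^ 2 * (1 + 2 * x) else 0

/-- The antisymmetric Hermite cubic spline. -/
def xi2 (x : ℝ) : ℝ :=
  if -1 ≤ x ∧ x ≤ 0 then (x + 1) ^ 2 * x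
  else if 0 ≤ x ∧ x ≤ 1 then (1 - x) ^ 2 * x else 0

/-- `xi j (2 k) = 2^(j/2) xi1 (2^j · - k)` and `xi j (2 k + 1) = 2^(j/2) xi2 (2^j · - k)`. -/
def xi (j : ℕ) (n : ℤ) : ℝ → ℝ :=
  fun x => (2 : ℝ) ^ ((j : ℝ) / 2) *
    (if n % 2 = 0 then xi1 else xi2) ((2 : ℝ) ^ j * x - ((n / 2 : ℤ) : ℝ))

/-! ### Scaling generators -/

def phi1 : ℝ → ℝ := normalize (xi 1 2)

def phi2 : ℝ → ℝ := normalize (xi 1 3)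

/-- The functions `ξ_{2,2}, …, ξ_{2,7}`, which span `𝒜₁`. -/
def xiLevel2 (j : Fin 6) : ℝ → ℝ := xi 2 ((j : ℤ) + 2)

/-- The matrix of the inner products of `ξ_{1,2}, ξ_{1,3}` with `ξ_{2,2}, …, ξ_{2,7}`. -/
def matC : Matrix (Fin 2) (Fin 6) ℝ := Matrix.of fun i j => ip (xi 1 ((i : ℤ) + 2)) (xiLevel2 j)

/-- The functions `c₁, c₂` (spanning `𝒞₀`) and `c₃, c₄` (spanning `𝒞₁`). -/
def cfun : Fin 4 → ℝ → ℝ :=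
  ![resid ![phi1, phi2] (restr (xi 1 0)), resid ![phi1, phi2] (restr (xi 1 1)),
    resid ![phi1, phi2] (restr (xi 1 4)), resid ![phi1, phi2] (restr (xi 1 5))]

/-- The free parameters of the construction of the scaling generators: the vectors `b¹, …, b⁴`
and the coefficients `s_{i,j}`. -/
structure ScalingChoice where
  b : Fin 4 → Fin 6 → ℝ
  s : Fin 2 → Fin 4 → ℝ

namespace ScalingChoice

variable (A : ScalingChoice)

def w (i : Fin 4) : ℝ → ℝ := lincomb (A.b i) xiLevel2

def v1 : ℝ → ℝ := normalize (A.w 0)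

def v2 : ℝ → ℝ := normalize (resid ![A.v1] (A.w 1))

def v3 : ℝ → ℝ := normalize (resid ![A.v1, A.v2] (A.w 2))

def v4 : ℝ → ℝ := normalize (resid ![A.v1, A.v2, A.v3] (A.w 3))

def phi3 : ℝ → ℝ := lincomb (A.s 0) ![A.v1, A.v2, A.v3, A.v4]

def phi4 : ℝ → ℝ := lincomb (A.s 1) ![A.v1, A.v2, A.v3, A.v4]

/-- `b¹, …, b⁴` is a basis of the null space of `matC`, the rows of `s` are orthonormal, and
`(I - P_W) 𝒞₀ ⟂ (I - P_W) 𝒞₁` for the span `W` of `phi3` and `phi4`. -/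
structure Admissible : Prop where
  null_b : IsNullBasis matC A.b
  unit_s : ∀ i, ∑ j, A.s i j ^ 2 = 1
  orth_s : ∑ j, A.s 0 j * A.s 1 j = 0
  orth_c : ∀ i ∈ ({0, 1} : Set (Fin 4)), ∀ k ∈ ({2, 3} : Set (Fin 4)),
    ip (resid ![A.phi3, A.phi4] (cfun i)) (resid ![A.phi3, A.phi4] (cfun k)) = 0

def phi5 : ℝ → ℝ :=
  normalize (resid ![phi1, phi2, A.phi3, A.phi4,
    dil 1 (-1) phi1, dil 1 (-1) phi2, dil 1 (-1) A.phi3, dil 1 (-1) A.phi4] (xi 1 0))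

def phi6 : ℝ → ℝ :=
  normalize (resid ![phi1, phi2, A.phi3, A.phi4, A.phi5,
    dil 1 (-1) phi1, dil 1 (-1) phi2, dil 1 (-1) A.phi3, dil 1 (-1) A.phi4,
    dil 1 (-1) A.phi5] (xi 1 1))

/-- The six scaling generators. -/
def phi : Fin 6 → ℝ → ℝ := ![phi1, phi2, A.phi3, A.phi4, A.phi5, A.phi6]

/-- The scaling functions `φ_{j,n}` on the real line. -/
def phiLine (j : ℕ) (n : ℤ) : ℝ → ℝ := lineFamily 4 A.phi j n

/-- The left boundary scaling function. -/
def phiL : ℝ → ℝ :=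
  normalize (restr fun x => A.phi6 0 * A.phi5 x - A.phi5 0 * A.phi6 x)

/-- The right boundary scaling function. -/
def phiR : ℝ → ℝ :=
  normalize (restr fun x => A.phi6 0 * A.phi5 (x - 1) - A.phi5 0 * A.phi6 (x - 1))

/-- The scaling functions `φ_{0,1}, …, φ_{0,6}` on the interval. -/
def phiInt (k : Fin 6) : ℝ → ℝ := ![A.phiL, phi1, phi2, A.phi3, A.phi4, A.phiR] k

/-- The basis functions of `V₁` supported in `[0, 1]` (up to normalization). -/
def p : Fin 10 → ℝ → ℝ :=
  ![dil 2 0 phi1, dil 2 0 phi2, dil 2 0 A.phi3, dil 2 0 A.phi4,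
    dil 2 1 phi1, dil 2 1 phi2, dil 2 1 A.phi3, dil 2 1 A.phi4, dil 2 1 A.phi5, dil 2 1 A.phi6]

/-- The basis functions of `V₀` whose support meets the interior of `[0, 1]`. -/
def q : Fin 8 → ℝ → ℝ :=
  ![phi1, phi2, A.phi3, A.phi4, A.phi5, A.phi6, dil 1 1 A.phi5, dil 1 1 A.phi6]

def matS : Matrix (Fin 8) (Fin 10) ℝ := Matrix.of fun i j => ip (A.q i) (A.p j)

/-- `h_i = φ_{i+4}(2 ·) - ⟨φ_{i+4}(2 ·), φ₅⟩ φ₅ - ⟨φ_{i+4}(2 ·), φ₆⟩ φ₆`, `i = 1, 2`. -/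
def h : Fin 2 → ℝ → ℝ :=
  ![resid ![A.phi5, A.phi6] (dil 2 0 A.phi5), resid ![A.phi5, A.phi6] (dil 2 0 A.phi6)]

def psi3 : ℝ → ℝ := gsPair A.h 0

def psi4 : ℝ → ℝ := gsPair A.h 1

end ScalingChoice

/-! ### Wavelet generators -/

/-- The free parameters of the construction of the wavelet generators: bases of the null spaces of
the matrices `matS`, `matT`, `matG`, `matH`. -/
structure WaveletChoice where
  bS : Fin 2 → Fin 10 → ℝ
  bT : Fin 2 → Fin 22 → ℝ
  bG : Fin 2 → Fin 4 → ℝ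
  bH : Fin 2 → Fin 4 → ℝ

namespace WaveletChoice

variable (B : WaveletChoice) (A : ScalingChoice)

def u (i : Fin 2) : ℝ → ℝ := lincomb (B.bS i) A.p

def psi1 : ℝ → ℝ := gsPair (B.u A) 0

def psi2 : ℝ → ℝ := gsPair (B.u A) 1

/-- The functions `φ_{1,-11}, …, φ_{1,10}`. -/
def colsT (j : Fin 22) : ℝ → ℝ := A.phiLine 1 ((j : ℤ) - 11)

/-- The functions `φ_{0,-7}, …, φ_{0,6}`, then `ψ₁(· + 1), ψ₂(· + 1)`, then `ψ₁, …, ψ₄`. -/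
def rowsT : Fin 14 ⊕ Fin 2 ⊕ Fin 4 → ℝ → ℝ :=
  Sum.elim (fun i => A.phiLine 0 ((i : ℤ) - 7))
    (Sum.elim ![dil 1 (-1) (B.psi1 A), dil 1 (-1) (B.psi2 A)]
      ![B.psi1 A, B.psi2 A, A.psi3, A.psi4])

def matT : Matrix (Fin 14 ⊕ Fin 2 ⊕ Fin 4) (Fin 22) ℝ :=
  Matrix.of fun i j => ip (B.rowsT A i) (colsT A j)

def z (i : Fin 2) : ℝ → ℝ := lincomb (B.bT i) (colsT A)

def psi5 : ℝ → ℝ := gsPair (B.z A) 0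

def psi6 : ℝ → ℝ := gsPair (B.z A) 1

/-- The six wavelet generators. -/
def psi : Fin 6 → ℝ → ℝ := ![B.psi1 A, B.psi2 A, A.psi3, A.psi4, B.psi5 A, B.psi6 A]

/-- The wavelets `ψ_{j,n}` on the real line. -/
def psiLine (j : ℕ) (n : ℤ) : ℝ → ℝ := lineFamily 2 (B.psi A) j n

/-- The wavelet generators `ψ₃, …, ψ₆`, whose support is `[-1, 1]`. -/
def psiLong : Fin 4 → ℝ → ℝ := ![A.psi3, A.psi4, B.psi5 A, B.psi6 A]

def matG : Matrix (Fin 2) (Fin 4) ℝ :=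
  Matrix.of ![fun j => B.psiLong A j 0, fun j => ip A.phiL (B.psiLong A j)]

def matH : Matrix (Fin 2) (Fin 4) ℝ :=
  Matrix.of ![fun j => B.psiLong A j 0, fun j => ip A.phiR (dil 1 1 (B.psiLong A j))]

def gL (i : Fin 2) : ℝ → ℝ := restr (lincomb (B.bG i) (B.psiLong A))

def hR (i : Fin 2) : ℝ → ℝ := restr (lincomb (B.bH i) fun j => dil 1 1 (B.psiLong A j))

/-- The left boundary wavelet generators. -/
def psiL : Fin 2 → ℝ → ℝ := gsPair (B.gL A)

/-- The right boundary wavelet generators. -/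
def psiR : Fin 2 → ℝ → ℝ := gsPair (B.hR A)

structure Admissible : Prop where
  null_S : IsNullBasis A.matS B.bS
  null_T : IsNullBasis (B.matT A) B.bT
  null_G : IsNullBasis (B.matG A) B.bG
  null_H : IsNullBasis (B.matH A) B.bH

/-- The wavelets `ψ_{j,n}`, `1 ≤ n ≤ 6 * 2^j`, on the interval: two left boundary wavelets,
inner wavelets, and two right boundary wavelets. -/
def psiInt (j : ℕ) (n : ℤ) : ℝ → ℝ :=
  if n = 1 then fun x => (2 : ℝ) ^ ((j : ℝ) / 2) * B.psiL A 0 ((2 : ℝ) ^ j * x)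
  else if n = 2 then fun x => (2 : ℝ) ^ ((j : ℝ) / 2) * B.psiL A 1 ((2 : ℝ) ^ j * x)
  else if n = 6 * 2 ^ j - 1 then
    fun x => (2 : ℝ) ^ ((j : ℝ) / 2) * B.psiR A 0 (1 - (2 : ℝ) ^ j * (1 - x))
  else if n = 6 * 2 ^ j then
    fun x => (2 : ℝ) ^ ((j : ℝ) / 2) * B.psiR A 1 (1 - (2 : ℝ) ^ j * (1 - x))
  else B.psiLine A j (n - 2)

end WaveletChoice

/-- The index set `𝒥_j = {k ∈ ℤ, 1 ≤ k ≤ 6 * 2^j}`. -/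
abbrev levelIndex (j : ℕ) : Set ℤ := Set.Icc 1 (6 * 2 ^ j)

/-- The index set of the interval basis: six scaling functions, and the wavelets of all levels. -/
abbrev BasisIndex : Type := Fin 6 ⊕ (Σ j : ℕ, levelIndex j)

/-- The interval basis `Ψ^I`. -/
def basisFun (A : ScalingChoice) (B : WaveletChoice) : BasisIndex → ℝ → ℝ
  | Sum.inl k => A.phiInt k
  | Sum.inr ⟨j, n⟩ => B.psiInt A j n

/-- `f` is a cubic spline on `[a, b]`, i.e. a piecewise polynomial of degree at most three. -/
def IsPiecewiseCubicOn (f : ℝ → ℝ) (a b : ℝ) : Prop :=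
  ∃ (n : ℕ) (t : Fin (n + 1) → ℝ), StrictMono t ∧ t 0 = a ∧ t (Fin.last n) = b ∧
    ∀ i : Fin n, ∃ P : Polynomial ℝ, P.natDegree ≤ 3 ∧
      ∀ x ∈ Set.Icc (t i.castSucc) (t i.succ), f x = P.eval x

/-- The inner product of `L²(0, 1)`. -/
def ip01 (f g : ℝ → ℝ) : ℝ := ∫ x in Set.Ioo (0 : ℝ) 1, f x * g x

end SplineWavelet

end

/-! The construction is an intertwined multiresolution analysis. Let `Sp j` be the space of
compactly supported C¹ cubic splines with nodes in 2⁻ʲℤ, and let `V` be the span of the integer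
translates of the six scaling generators. All generators lie in `Sp 2`, and undoing the Gram-Schmidt
steps recovers the Hermite splines of level 1, so `Sp 1 ≤ V ≤ Sp 2` (`Sp_one_le_V`, `V_le_Sp`).
Hence `Vs j ≤ Sp (j + 2) ≤ Vs (j + 1)`, and the dilated spaces are nested although no refinement
equation is ever computed.

The only nontrivial orthogonality among the translates of the generators is that of φ₅, φ₆ to their
shifts by 1. On the common interval [0,1] the unshifted function comes from the Hermite functions at
the node 0, the shifted one from those at the node 1, both modulo φ₁, …, φ₄. The condition on φ₃, φ₄
makes the two groups of residuals orthogonal, and this carries over to the generators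
(`ip_side_side`). Such φ₃, φ₄ exist because the condition amounts to a plane on which the bilinear
form `tauForm` vanishes; splitting by parity about 1/2 reduces the search for this plane to a
quadratic equation (`exists_roots`, `orth_of_tauForm`).

Two facts about `V` carry the wavelet part. First, the value and the derivative at an integer m are
governed by φ₅(· - m), φ₆(· - m) alone: an element of `V` has a double zero at m exactly when its
two coefficients there vanish, and then it can be truncated at m inside `V`
(`ip_e_eq_zero_of_mem_Z`, `mem_Z_of_ip`, `cut_mem_V`). Secondly, an element of `V` orthogonal to all
functions of `Vs 1` supported in [0,1] vanishes on [0,1] (`restr_eq_zero_of_ip_p`, `ip_q_eq_zero`);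
this rests on the nonsingular matrix of the numbers ⟨cᵢ,cₖ⟩. The second fact gives the ranks of the
matrices for ψ₁, ψ₂ and ψ₅, ψ₆, and, through `boundary_nondegenerate`, those of the boundary
matrices. The first shows that a wavelet is orthogonal to ψ₃, ψ₄ exactly when it has a double zero
at 0 (`ip_psi34_iff`). So ψ₅, ψ₆ can be cut at 0, and the orthogonality of their shifts becomes a
statement on [0,1] (`ip_shift_eq_zero`).

At an end point, an element of `V` vanishing there is a function with a double zero plus a multiple
of `bd`, the combination of φ₅ and φ₆ vanishing at 0. The two conditions on the boundary wavelets,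
vanishing at 0 and orthogonality to the cut `bd`, are exactly what makes them orthogonal to all such
elements (`ip_restr_bdWav`, `ip_restr_shift_bdWav`). Orthogonality between levels follows from the
nesting of the spaces `VI A j`.

For completeness, `VI A J` is spanned by 6·2^J functions and contains the 6 + ∑_{i<J} 6·2^i = 6·2^J
orthonormal basis functions of levels below J, which therefore span it (`VI_le_span_basisFun`); the
union of these spaces is dense by Hermite interpolation with zero slopes (`ae_eq_zero_of_ip_VI`).
The moments of the inner wavelets vanish because on the support of a generator a cubic polynomial
agrees with an element of `V`. -/

open MeasureTheory

noncomputable section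

namespace SplineWavelet

/-! ### Square integrable functions and the bilinear form `ip` -/

/-- Square integrability on the real line, as a type class. -/
class IsL2 (f : ℝ → ℝ) : Prop where
  memLp : MemLp f 2 volume

instance : IsL2 0 := ⟨MemLp.zero⟩

instance (f g : ℝ → ℝ) [hf : IsL2 f] [hg : IsL2 g] : IsL2 (f + g) := ⟨hf.memLp.add hg.memLp⟩

instance (f g : ℝ → ℝ) [hf : IsL2 f] [hg : IsL2 g] : IsL2 (f - g) := ⟨hf.memLp.sub hg.memLp⟩

instance (c : ℝ) (f : ℝ → ℝ) [hf : IsL2 f] : IsL2 (c • f) := ⟨hf.memLp.const_smul c⟩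

/-- The square integrable functions as a subspace. -/
def L2s : Submodule ℝ (ℝ → ℝ) where
  carrier := {f | IsL2 f}
  add_mem' := fun {f g} (_ : IsL2 f) (_ : IsL2 g) => inferInstanceAs (IsL2 (f + g))
  zero_mem' := inferInstanceAs (IsL2 0)
  smul_mem' := fun c f (_ : IsL2 f) => inferInstanceAs (IsL2 (c • f))

theorem isL2_sum {ι : Type*} (s : Finset ι) (f : ι → ℝ → ℝ) (hf : ∀ i ∈ s, IsL2 (f i)) :
    IsL2 (∑ i ∈ s, f i) := L2s.sum_mem hf

instance {ι : Type*} (s : Finset ι) (f : ι → ℝ → ℝ) [hf : ∀ i, IsL2 (f i)] :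
    IsL2 (∑ i ∈ s, f i) := isL2_sum s f fun i _ => hf i

theorem isL2_of_mem_span {S : Set (ℝ → ℝ)} (hS : ∀ f ∈ S, IsL2 f) {f : ℝ → ℝ}
    (hf : f ∈ Submodule.span ℝ S) : IsL2 f :=
  (Submodule.span_le (p := L2s)).2 hS hf

theorem lincomb_eq {n : ℕ} (c : Fin n → ℝ) (f : Fin n → ℝ → ℝ) :
    lincomb c f = ∑ i, c i • f i := by
  ext x; simp [lincomb]

instance {n : ℕ} (c : Fin n → ℝ) (f : Fin n → ℝ → ℝ) [∀ i, IsL2 (f i)] :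
    IsL2 (lincomb c f) := by
  rw [lincomb_eq]; infer_instance

theorem normalize_eq (f : ℝ → ℝ) : normalize f = (l2norm f)⁻¹ • f := by
  ext x; simp [normalize, div_eq_inv_mul]

instance (f : ℝ → ℝ) [IsL2 f] : IsL2 (normalize f) := by
  rw [normalize_eq]; infer_instance

theorem resid_eq {n : ℕ} (g : Fin n → ℝ → ℝ) (f : ℝ → ℝ) :
    resid g f = f - ∑ i, ip f (g i) • g i := by
  ext x; simp [resid]

instance {n : ℕ} (g : Fin n → ℝ → ℝ) (f : ℝ → ℝ) [∀ i, IsL2 (g i)] [IsL2 f] :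
    IsL2 (resid g f) := by
  rw [resid_eq]; infer_instance

instance (f : ℝ → ℝ) [hf : IsL2 f] : IsL2 (restr f) :=
  ⟨hf.memLp.indicator measurableSet_Icc⟩

instance vecConsL2 {n : ℕ} (f : ℝ → ℝ) (g : Fin n → ℝ → ℝ) [hf : IsL2 f] [hg : ∀ i, IsL2 (g i)]
    (i : Fin (n + 1)) : IsL2 (Matrix.vecCons f g i) := by
  refine Fin.cases ?_ (fun i => ?_) i
  · exact hf
  · exact hg i

instance vecEmptyL2 (i : Fin 0) : IsL2 ((![] : Fin 0 → ℝ → ℝ) i) := i.elim0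

theorem integrable_mul (f g : ℝ → ℝ) [hf : IsL2 f] [hg : IsL2 g] :
    Integrable (fun x => f x * g x) := hf.memLp.integrable_mul hg.memLp

theorem ip_comm (f g : ℝ → ℝ) : ip f g = ip g f := by
  simp only [ip, mul_comm]

theorem ip_add_left (f g h : ℝ → ℝ) [IsL2 f] [IsL2 g] [IsL2 h] :
    ip (f + g) h = ip f h + ip g h := by
  simp only [ip, Pi.add_apply, add_mul]
  exact integral_add (integrable_mul f h) (integrable_mul g h)

theorem ip_smul_left (c : ℝ) (f g : ℝ → ℝ) : ip (c • f) g = c * ip f g := by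
  simp only [ip, Pi.smul_apply, smul_eq_mul, mul_assoc]
  exact integral_const_mul _ _

theorem ip_smul_right (c : ℝ) (f g : ℝ → ℝ) : ip f (c • g) = c * ip f g := by
  rw [ip_comm, ip_smul_left, ip_comm]

theorem ip_add_right (f g h : ℝ → ℝ) [IsL2 f] [IsL2 g] [IsL2 h] :
    ip f (g + h) = ip f g + ip f h := by
  rw [ip_comm, ip_add_left, ip_comm g, ip_comm h]

theorem ip_sub_left (f g h : ℝ → ℝ) [IsL2 f] [IsL2 g] [IsL2 h] :
    ip (f - g) h = ip f h - ip g h := by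
  have : f - g = f + (-1 : ℝ) • g := by simp [sub_eq_add_neg]
  rw [this, ip_add_left, ip_smul_left]; ring

theorem ip_sub_right (f g h : ℝ → ℝ) [IsL2 f] [IsL2 g] [IsL2 h] :
    ip f (g - h) = ip f g - ip f h := by
  rw [ip_comm, ip_sub_left, ip_comm g, ip_comm h]

@[simp] theorem ip_zero_left (f : ℝ → ℝ) : ip 0 f = 0 := by simp [ip]

@[simp] theorem ip_zero_right (f : ℝ → ℝ) : ip f 0 = 0 := by simp [ip]

theorem ip_sum_left {ι : Type*} (s : Finset ι) (f : ι → ℝ → ℝ) (g : ℝ → ℝ)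
    [∀ i, IsL2 (f i)] [IsL2 g] : ip (∑ i ∈ s, f i) g = ∑ i ∈ s, ip (f i) g := by
  classical
  induction s using Finset.induction_on with
  | empty => simp
  | insert a s ha ih => rw [Finset.sum_insert ha, Finset.sum_insert ha, ip_add_left, ih]

theorem ip_sum_right {ι : Type*} (s : Finset ι) (g : ℝ → ℝ) (f : ι → ℝ → ℝ)
    [∀ i, IsL2 (f i)] [IsL2 g] : ip g (∑ i ∈ s, f i) = ∑ i ∈ s, ip g (f i) := by
  rw [ip_comm, ip_sum_left]; simp only [ip_comm]

theorem ip_sum_smul_left {ι : Type*} (s : Finset ι) (c : ι → ℝ) (f : ι → ℝ → ℝ) (g : ℝ → ℝ)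
    [∀ i, IsL2 (f i)] [IsL2 g] :
    ip (∑ i ∈ s, c i • f i) g = ∑ i ∈ s, c i * ip (f i) g := by
  rw [ip_sum_left]; simp only [ip_smul_left]

theorem ip_sum_smul_right {ι : Type*} (s : Finset ι) (g : ℝ → ℝ) (c : ι → ℝ) (f : ι → ℝ → ℝ)
    [∀ i, IsL2 (f i)] [IsL2 g] :
    ip g (∑ i ∈ s, c i • f i) = ∑ i ∈ s, c i * ip g (f i) := by
  rw [ip_sum_right]; simp only [ip_smul_right]

theorem ip_lincomb_right {n : ℕ} (g : ℝ → ℝ) (c : Fin n → ℝ) (f : Fin n → ℝ → ℝ)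
    [∀ i, IsL2 (f i)] [IsL2 g] : ip g (lincomb c f) = ∑ i, c i * ip g (f i) := by
  rw [lincomb_eq, ip_sum_smul_right]

theorem ip_self_nonneg (f : ℝ → ℝ) : 0 ≤ ip f f :=
  integral_nonneg fun x => mul_self_nonneg (f x)

theorem ip_eq_zero_of_mul {f g : ℝ → ℝ} (h : ∀ x, f x * g x = 0) : ip f g = 0 := by
  simp [ip, h]

theorem ip_congr {f g f' g' : ℝ → ℝ} (h : ∀ x, f x * g x = f' x * g' x) :
    ip f g = ip f' g' := by
  simp only [ip, h]

/-- The functions which are orthogonal to all functions of a set. -/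
def perp (S : Set (ℝ → ℝ)) : Submodule ℝ (ℝ → ℝ) where
  carrier := {f | IsL2 f ∧ ∀ g ∈ S, IsL2 g → ip f g = 0}
  add_mem' := by
    rintro f g ⟨hf, hf'⟩ ⟨hg, hg'⟩
    refine ⟨inferInstance, fun h hh hL => ?_⟩
    rw [ip_add_left, hf' h hh hL, hg' h hh hL, add_zero]
  zero_mem' := ⟨inferInstance, by simp⟩
  smul_mem' := by
    rintro c f ⟨hf, hf'⟩
    refine ⟨inferInstance, fun h hh hL => ?_⟩
    rw [ip_smul_left, hf' h hh hL, mul_zero]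

theorem ip_eq_zero_of_mem_span_left {S : Set (ℝ → ℝ)} (hS : ∀ f ∈ S, IsL2 f) {g : ℝ → ℝ}
    [IsL2 g] (h : ∀ f ∈ S, ip f g = 0) {f : ℝ → ℝ} (hf : f ∈ Submodule.span ℝ S) :
    ip f g = 0 :=
  ((Submodule.span_le (p := perp {g})).2
    (fun f hf => ⟨hS f hf, by rintro _ rfl _; exact h f hf⟩) hf).2 g rfl inferInstance

theorem ip_eq_zero_of_mem_span_right {S : Set (ℝ → ℝ)} (hS : ∀ f ∈ S, IsL2 f) {g : ℝ → ℝ}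
    [IsL2 g] (h : ∀ f ∈ S, ip g f = 0) {f : ℝ → ℝ} (hf : f ∈ Submodule.span ℝ S) :
    ip g f = 0 := by
  rw [ip_comm]
  exact ip_eq_zero_of_mem_span_left hS (fun f hf => by rw [ip_comm]; exact h f hf) hf

/-! ### Definiteness -/

theorem ae_eq_zero_of_ip_self (f : ℝ → ℝ) [IsL2 f] (h : ip f f = 0) : f =ᵐ[volume] 0 := by
  have := (integral_eq_zero_iff_of_nonneg (fun x => mul_self_nonneg (f x))
    (integrable_mul f f)).1 h
  filter_upwards [this] with x hx
  simpa using hx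

theorem eq_zero_on_of_ip_self (f : ℝ → ℝ) [IsL2 f] (h : ip f f = 0) {s : Set ℝ} (hs : IsOpen s)
    (hf : ContinuousOn f s) : ∀ x ∈ s, f x = 0 := by
  have h0 : f =ᵐ[volume.restrict s] 0 := ae_restrict_of_ae (ae_eq_zero_of_ip_self f h)
  have := Measure.eqOn_open_of_ae_eq h0 hs hf continuousOn_const
  exact fun x hx => this hx

theorem eq_zero_of_ip_self (f : ℝ → ℝ) [IsL2 f] (h : ip f f = 0) (hf : Continuous f) :
    f = 0 :=
  funext fun x => eq_zero_on_of_ip_self f h isOpen_univ hf.continuousOn x trivial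

/-- Cauchy-Schwarz for a null vector. -/
theorem ip_eq_zero_of_ip_self (f g : ℝ → ℝ) [IsL2 f] (h : ip f f = 0) : ip f g = 0 := by
  have := ae_eq_zero_of_ip_self f h
  rw [ip, integral_eq_zero_of_ae]
  filter_upwards [this] with x hx
  simp [hx]

/-! ### Orthonormal families -/

/-- Orthonormality of a family of square integrable functions. -/
structure ON {ι : Type*} [DecidableEq ι] (g : ι → ℝ → ℝ) : Prop where
  l2 : ∀ i, IsL2 (g i)
  ip_eq : ∀ i j, ip (g i) (g j) = if i = j then 1 else 0

section ON

variable {ι : Type*} [DecidableEq ι] {g : ι → ℝ → ℝ}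

theorem ON.ip_sum_smul (hg : ON g) [Fintype ι] (c : ι → ℝ) (j : ι) :
    ip (∑ i, c i • g i) (g j) = c j := by
  have := hg.l2
  rw [ip_sum_smul_left]
  simp [hg.ip_eq]

theorem ON.mem_span_of_forall (hg : ON g) {f : ℝ → ℝ} (hf : f ∈ Submodule.span ℝ (Set.range g))
    {S : Set ι} (hS : ∀ i ∉ S, ip f (g i) = 0) :
    f ∈ Submodule.span ℝ (g '' S) := by
  have := hg.l2
  obtain ⟨c, rfl⟩ := (Finsupp.mem_span_range_iff_exists_finsupp).1 hf
  rw [Finsupp.sum] at *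
  refine Submodule.sum_mem _ fun i hi => ?_
  by_cases hiS : i ∈ S
  · exact Submodule.smul_mem _ _ (Submodule.subset_span ⟨i, hiS, rfl⟩)
  · have := hS i hiS
    rw [ip_sum_smul_left] at this
    simp only [hg.ip_eq, mul_ite, mul_one, mul_zero, Finset.sum_ite_eq', hi, if_true] at this
    exact absurd this (Finsupp.mem_support_iff.1 hi)

theorem ON.eq_sum (hg : ON g) [Fintype ι] {f : ℝ → ℝ}
    (hf : f ∈ Submodule.span ℝ (Set.range g)) :
    f = ∑ i, ip f (g i) • g i := by
  obtain ⟨c, rfl⟩ := (Submodule.mem_span_range_iff_exists_fun ℝ).1 hf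
  simp only [hg.ip_sum_smul]

theorem ON.comp {κ : Type*} [DecidableEq κ] (hg : ON g) {e : κ → ι} (he : Function.Injective e) :
    ON (g ∘ e) where
  l2 i := hg.l2 _
  ip_eq i j := by simp [hg.ip_eq, he.eq_iff]

theorem ON.linearIndependent (hg : ON g) : LinearIndependent ℝ g := by
  have := hg.l2
  rw [linearIndependent_iff']
  intro s c h i hi
  have := congrArg (fun f => ip f (g i)) h
  simp only [ip_sum_smul_left, ip_zero_left, hg.ip_eq] at this
  simpa [hi] using this

end ON

theorem resid_ip {n : ℕ} {g : Fin n → ℝ → ℝ} (hg : ON g) (f : ℝ → ℝ) [IsL2 f] (i : Fin n) :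
    ip (resid g f) (g i) = 0 := by
  have := hg.l2
  rw [resid_eq, ip_sub_left, hg.ip_sum_smul, sub_self]

theorem resid_ip_right {n : ℕ} {g : Fin n → ℝ → ℝ} (hg : ON g) (f h : ℝ → ℝ) [IsL2 f] [IsL2 h]
    (hh : ∀ i, ip h (g i) = 0) : ip (resid g f) h = ip f h := by
  have := hg.l2
  rw [resid_eq, ip_sub_left, ip_sum_smul_left]
  simp [ip_comm _ h, hh]

theorem l2norm_mul_self (f : ℝ → ℝ) : l2norm f * l2norm f = ip f f :=
  Real.mul_self_sqrt (ip_self_nonneg f)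

theorem l2norm_ne_zero {f : ℝ → ℝ} (h : ip f f ≠ 0) : l2norm f ≠ 0 := by
  intro h0
  rw [← l2norm_mul_self, h0, mul_zero] at h
  exact h rfl

theorem ip_normalize_self {f : ℝ → ℝ} (h : ip f f ≠ 0) : ip (normalize f) (normalize f) = 1 := by
  have := l2norm_ne_zero h
  rw [normalize_eq, ip_smul_left, ip_smul_right, ← l2norm_mul_self]
  field_simp

theorem eq_smul_normalize {f : ℝ → ℝ} (h : ip f f ≠ 0) : f = l2norm f • normalize f := by
  rw [normalize_eq, smul_smul, mul_inv_cancel₀ (l2norm_ne_zero h), one_smul]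

theorem ip_normalize_left (f g : ℝ → ℝ) : ip (normalize f) g = (l2norm f)⁻¹ * ip f g := by
  rw [normalize_eq, ip_smul_left]

theorem normalize_mem {U : Submodule ℝ (ℝ → ℝ)} {f : ℝ → ℝ} (h : f ∈ U) : normalize f ∈ U := by
  rw [normalize_eq]; exact U.smul_mem _ h

theorem mem_of_normalize_mem {U : Submodule ℝ (ℝ → ℝ)} {f : ℝ → ℝ} (h0 : ip f f ≠ 0)
    (h : normalize f ∈ U) : f ∈ U := by
  rw [eq_smul_normalize h0]; exact U.smul_mem _ h

theorem resid_mem {U : Submodule ℝ (ℝ → ℝ)} {n : ℕ} {g : Fin n → ℝ → ℝ} {f : ℝ → ℝ} (h : f ∈ U)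
    (hg : ∀ i, g i ∈ U) : resid g f ∈ U := by
  rw [resid_eq]
  exact U.sub_mem h (U.sum_mem fun i _ => U.smul_mem _ (hg i))

/-- Together with `mem_of_normalize_mem` this undoes a Gram-Schmidt step: a subspace containing the
output contains the input. -/
theorem mem_of_resid_mem {U : Submodule ℝ (ℝ → ℝ)} {n : ℕ} {g : Fin n → ℝ → ℝ} {f : ℝ → ℝ}
    (h : resid g f ∈ U) (hg : ∀ i, g i ∈ U) : f ∈ U := by
  rw [resid_eq] at h
  have := U.add_mem h (U.sum_mem fun i (_ : i ∈ Finset.univ) => U.smul_mem (ip f (g i)) (hg i))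
  simpa using this

theorem lincomb_mem {U : Submodule ℝ (ℝ → ℝ)} {n : ℕ} {c : Fin n → ℝ} {f : Fin n → ℝ → ℝ}
    (hf : ∀ i, f i ∈ U) : lincomb c f ∈ U := by
  rw [lincomb_eq]; exact U.sum_mem fun i _ => U.smul_mem _ (hf i)

/-- A step of the Gram-Schmidt process. -/
theorem ON.snoc {n : ℕ} {g : Fin n → ℝ → ℝ} (hg : ON g) {f : ℝ → ℝ} [IsL2 f]
    (h0 : ip f f ≠ 0) (hf : ∀ i, ip f (g i) = 0) {g' : Fin (n + 1) → ℝ → ℝ}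
    (hg' : ∀ i : Fin n, g' i.castSucc = g i) (hl : g' (Fin.last n) = normalize f) : ON g' where
  l2 i := by
    have := hg.l2
    refine Fin.lastCases ?_ (fun i => ?_) i
    · rw [hl]; infer_instance
    · rw [hg']; infer_instance
  ip_eq i j := by
    refine Fin.lastCases ?_ (fun i => ?_) i <;> refine Fin.lastCases ?_ (fun j => ?_) j
    · simp [hl, ip_normalize_self h0]
    · simp [hl, hg', ip_normalize_left, hf, (Fin.castSucc_lt_last j).ne']
    · rw [ip_comm]; simp [hl, hg', ip_normalize_left, hf, (Fin.castSucc_lt_last i).ne]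
    · simp [hg', hg.ip_eq]

theorem ON.nil {g : Fin 0 → ℝ → ℝ} : ON g := ⟨fun i => i.elim0, fun i => i.elim0⟩

theorem ON.single {f : ℝ → ℝ} [IsL2 f] (h0 : ip f f ≠ 0) : ON ![normalize f] :=
  ON.nil.snoc (g := ![]) h0 (fun i => i.elim0) (fun i => i.elim0) rfl

section gsPair

variable {u : Fin 2 → ℝ → ℝ}

/-- Two functions are independent modulo null functions. -/
def Indep2 (u : Fin 2 → ℝ → ℝ) : Prop :=
  ∀ c : Fin 2 → ℝ, ip (∑ i, c i • u i) (∑ i, c i • u i) = 0 → c = 0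

theorem Indep2.ip_zero (h : Indep2 u) : ip (u 0) (u 0) ≠ 0 := by
  intro h0
  have := congrFun (h ![1, 0] (by simpa using h0)) 0
  simp at this

theorem Indep2.ip_one (h : Indep2 u) :
    ip (resid ![normalize (u 0)] (u 1)) (resid ![normalize (u 0)] (u 1)) ≠ 0 := by
  intro h0
  -- The residual is itself a combination of `u 0` and `u 1` with coefficient 1 at `u 1`, so it
  -- cannot be null.
  have := congrFun (h ![-(ip (u 1) (normalize (u 0)) * (l2norm (u 0))⁻¹), 1] (by
    convert h0 using 2 <;>
    · rw [resid_eq]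
      simp only [Fin.sum_univ_two, Matrix.cons_val_zero, Matrix.cons_val_one,
        Finset.univ_unique, Fin.default_eq_zero, Finset.sum_singleton]
      nth_rewrite 3 [normalize_eq]
      rw [smul_smul, neg_smul, one_smul]; abel)) 1
  simp at this

theorem gsPair_on [∀ i, IsL2 (u i)] (h : Indep2 u) : ON (gsPair u) := by
  have h1 := ON.single h.ip_zero
  refine h1.snoc (f := resid ![normalize (u 0)] (u 1)) h.ip_one (resid_ip h1 (u 1)) ?_ rfl
  intro i; fin_cases i; rfl

theorem gsPair_mem {U : Submodule ℝ (ℝ → ℝ)} (hu : ∀ i, u i ∈ U) (i : Fin 2) :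
    gsPair u i ∈ U := by
  have h0 : normalize (u 0) ∈ U := normalize_mem (hu 0)
  fin_cases i
  · exact h0
  · refine normalize_mem (resid_mem (hu 1) fun j => ?_)
    fin_cases j; exact h0

theorem mem_of_gsPair_mem {U : Submodule ℝ (ℝ → ℝ)} (h : Indep2 u)
    (hu : ∀ i, gsPair u i ∈ U) (i : Fin 2) : u i ∈ U := by
  have h0 : normalize (u 0) ∈ U := hu 0
  have h1 : normalize (resid ![normalize (u 0)] (u 1)) ∈ U := hu 1
  fin_cases i
  · exact mem_of_normalize_mem h.ip_zero h0
  · refine mem_of_resid_mem (mem_of_normalize_mem h.ip_one h1) fun j => ?_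
    fin_cases j; exact h0

instance (u : Fin 2 → ℝ → ℝ) [∀ i, IsL2 (u i)] (i : Fin 2) : IsL2 (gsPair u i) := by
  unfold gsPair; infer_instance

end gsPair

/-! ### Translations and dilations -/

theorem dil_eq (a c : ℝ) (f : ℝ → ℝ) (x : ℝ) : dil a c f x = f (a * x - c) := rfl

theorem ip_dil (a c : ℝ) (f g : ℝ → ℝ) :
    ip (dil a c f) (dil a c g) = |a|⁻¹ * ip f g := by
  simp only [ip, dil]
  rw [Measure.integral_comp_mul_left (fun x => f (x - c) * g (x - c)) a,
    integral_sub_right_eq_self (fun x => f x * g x) c, smul_eq_mul, abs_inv]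

theorem isL2_dil {a : ℝ} (ha : a ≠ 0) (c : ℝ) {f : ℝ → ℝ} (hf : IsL2 f) : IsL2 (dil a c f) := by
  obtain ⟨hf⟩ := hf
  constructor
  have hm : AEStronglyMeasurable (dil a c f) volume := by
    have : Measure.QuasiMeasurePreserving (fun x : ℝ => a * x - c) volume volume :=
      (measurePreserving_sub_right volume c).quasiMeasurePreserving.comp
        (Measure.quasiMeasurePreserving_smul volume ha)
    exact hf.1.comp_quasiMeasurePreserving this
  rw [memLp_two_iff_integrable_sq hm]
  have h2 := (memLp_two_iff_integrable_sq hf.1).1 hf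
  exact (h2.comp_sub_right c).comp_mul_left' ha

instance (a : ℝ) (c : ℝ) (f : ℝ → ℝ) [NeZero a] [hf : IsL2 f] : IsL2 (dil a c f) :=
  isL2_dil (NeZero.ne a) c hf

end SplineWavelet

end

open MeasureTheory

noncomputable section

namespace SplineWavelet

/-! ### Cubic splines of class `C¹` with compact support -/

/-- `f` coincides with a cubic polynomial on `[a, b]`. -/
def IsCubicOn (f : ℝ → ℝ) (a b : ℝ) : Prop :=
  ∃ P : Polynomial ℝ, P.natDegree ≤ 3 ∧ ∀ x ∈ Set.Icc a b, f x = P.eval x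

theorem IsCubicOn.comp {f : ℝ → ℝ} {a b : ℝ} (h : IsCubicOn f a b) (s c : ℝ) {a' b' : ℝ}
    (hs : ∀ x ∈ Set.Icc a' b', s * x - c ∈ Set.Icc a b) : IsCubicOn (dil s c f) a' b' := by
  obtain ⟨P, hP, hf⟩ := h
  refine ⟨P.comp (Polynomial.C s * Polynomial.X - Polynomial.C c), ?_, fun x hx => ?_⟩
  · refine Polynomial.natDegree_comp_le.trans ?_
    have : (Polynomial.C s * Polynomial.X - Polynomial.C c).natDegree ≤ 1 := by
      compute_degree
    nlinarith
  · rw [dil_eq, hf _ (hs x hx)]; simp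

/-- The space of `C¹` cubic splines with compact support and nodes in `2⁻ʲ ℤ`. -/
def Sp (j : ℕ) : Submodule ℝ (ℝ → ℝ) where
  carrier := {f | ContDiff ℝ 1 f ∧ HasCompactSupport f ∧
    ∀ k : ℤ, IsCubicOn f (k / 2 ^ j) ((k + 1) / 2 ^ j)}
  add_mem' := by
    rintro f g ⟨hf, hf1, hf2⟩ ⟨hg, hg1, hg2⟩
    refine ⟨hf.add hg, hf1.add hg1, fun k => ?_⟩
    obtain ⟨P, hP, h⟩ := hf2 k
    obtain ⟨Q, hQ, h'⟩ := hg2 k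
    refine ⟨P + Q, (Polynomial.natDegree_add_le _ _).trans (max_le hP hQ), fun x hx => ?_⟩
    simp [h x hx, h' x hx]
  zero_mem' := ⟨contDiff_const, HasCompactSupport.zero, fun k => ⟨0, by simp, by simp⟩⟩
  smul_mem' := by
    rintro c f ⟨hf, hf1, hf2⟩
    refine ⟨contDiff_const.smul hf, hf1.smul_left (f := fun _ => c), fun k => ?_⟩
    obtain ⟨P, hP, h⟩ := hf2 k
    refine ⟨Polynomial.C c * P, (Polynomial.natDegree_C_mul_le _ _).trans hP, fun x hx => ?_⟩
    simp [h x hx]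

theorem isL2_of_mem_Sp {j : ℕ} {f : ℝ → ℝ} (hf : f ∈ Sp j) : IsL2 f :=
  ⟨hf.1.continuous.memLp_of_hasCompactSupport hf.2.1⟩

theorem dil_mem_Sp {i j : ℕ} {f : ℝ → ℝ} (hf : f ∈ Sp i) {s : ℝ} (c : ℝ) (hs : s ≠ 0)
    (h : ∀ k : ℤ, ∃ k' : ℤ, ∀ x ∈ Set.Icc ((k : ℝ) / 2 ^ j) ((k + 1) / 2 ^ j),
      s * x - c ∈ Set.Icc ((k' : ℝ) / 2 ^ i) ((k' + 1) / 2 ^ i)) : dil s c f ∈ Sp j := by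
  refine ⟨?_, ?_, fun k => ?_⟩
  · exact hf.1.comp ((contDiff_const.mul contDiff_id).sub contDiff_const)
  · have := hf.2.1.comp_homeomorph ((Homeomorph.mulLeft₀ s hs).trans (Homeomorph.subRight c))
    exact this
  · obtain ⟨k', hk'⟩ := h k
    exact (hf.2.2 k').comp s c hk'

theorem dil_pow_mem_Sp {i : ℕ} {f : ℝ → ℝ} (hf : f ∈ Sp i) (j : ℕ) (m : ℤ) :
    dil (2 ^ j) m f ∈ Sp (i + j) := by
  refine dil_mem_Sp hf _ (by positivity) fun k => ⟨k - m * 2 ^ i, fun x hx => ?_⟩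
  have h2 : (0 : ℝ) < 2 ^ i := by positivity
  have h3 : (0 : ℝ) < 2 ^ (i + j) := by positivity
  have h4 : (2 : ℝ) ^ (i + j) = 2 ^ i * 2 ^ j := pow_add _ _ _
  rw [Set.mem_Icc, div_le_iff₀ h3, le_div_iff₀ h3] at hx
  rw [Set.mem_Icc, div_le_iff₀ h2, le_div_iff₀ h2]
  push_cast
  rw [h4] at hx
  constructor <;> nlinarith [hx.1, hx.2]

theorem Sp_succ_half {j : ℕ} {f : ℝ → ℝ} (hf : f ∈ Sp (j + 1)) : dil (1 / 2) 0 f ∈ Sp j := by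
  refine dil_mem_Sp hf _ (by norm_num) fun k => ⟨k, fun x hx => ?_⟩
  have h2 : (0 : ℝ) < 2 ^ j := by positivity
  rw [Set.mem_Icc, div_le_iff₀ h2, le_div_iff₀ h2] at hx
  rw [Set.mem_Icc, div_le_iff₀ (by positivity), le_div_iff₀ (by positivity), pow_succ]
  constructor <;> nlinarith [hx.1, hx.2]

theorem Sp_le_succ (j : ℕ) : Sp j ≤ Sp (j + 1) := by
  rintro f ⟨hf, hf1, hf2⟩
  refine ⟨hf, hf1, fun k => ?_⟩
  obtain ⟨P, hP, h⟩ := hf2 (k / 2)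
  refine ⟨P, hP, fun x hx => h x ?_⟩
  have h2 : (0 : ℝ) < 2 ^ j := by positivity
  rw [Set.mem_Icc, div_le_iff₀ (by positivity), le_div_iff₀ (by positivity), pow_succ] at hx
  rw [Set.mem_Icc, div_le_iff₀ h2, le_div_iff₀ h2]
  have e1 : ((2 * (k / 2) : ℤ) : ℝ) ≤ k := by exact_mod_cast (by omega)
  have e2 : (k : ℝ) + 1 ≤ ((2 * (k / 2) + 2 : ℤ) : ℝ) := by exact_mod_cast (by omega)
  push_cast at e1 e2
  constructor <;> nlinarith [hx.1, hx.2]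

/-! ### Hermite interpolation -/

/-- The cubic polynomial with given values and derivatives at `0` and `1`. -/
def herm (u : Fin 4 → ℝ) (t : ℝ) : ℝ :=
  u 0 * ((1 - t) ^ 2 * (1 + 2 * t)) + u 1 * ((1 - t) ^ 2 * t) + u 2 * (t ^ 2 * (3 - 2 * t)) +
    u 3 * (t ^ 2 * (t - 1))

theorem deriv_left {f : ℝ → ℝ} (hf : Differentiable ℝ f) {a b : ℝ} (hab : a < b)
    {P : Polynomial ℝ} (h : ∀ x ∈ Set.Icc a b, f x = P.eval x) :
    deriv f a = P.derivative.eval a := by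
  have h1 : HasDerivWithinAt f (deriv f a) (Set.Icc a b) a :=
    (hf a).hasDerivAt.hasDerivWithinAt
  have h2 : HasDerivWithinAt f (P.derivative.eval a) (Set.Icc a b) a :=
    (P.hasDerivAt a).hasDerivWithinAt.congr h (h a (Set.left_mem_Icc.2 hab.le))
  exact (uniqueDiffOn_Icc hab a (Set.left_mem_Icc.2 hab.le)).eq_deriv _ h1 h2

theorem deriv_right {f : ℝ → ℝ} (hf : Differentiable ℝ f) {a b : ℝ} (hab : a < b)
    {P : Polynomial ℝ} (h : ∀ x ∈ Set.Icc a b, f x = P.eval x) :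
    deriv f b = P.derivative.eval b := by
  have h1 : HasDerivWithinAt f (deriv f b) (Set.Icc a b) b :=
    (hf b).hasDerivAt.hasDerivWithinAt
  have h2 : HasDerivWithinAt f (P.derivative.eval b) (Set.Icc a b) b :=
    (P.hasDerivAt b).hasDerivWithinAt.congr h (h b (Set.right_mem_Icc.2 hab.le))
  exact (uniqueDiffOn_Icc hab b (Set.right_mem_Icc.2 hab.le)).eq_deriv _ h1 h2

/-- A cubic is determined by its values and slopes at two points. With `P` written through its four
coefficients this is a polynomial identity. The slopes carry the factor `h` because the cell is
rescaled to unit length. -/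
theorem polynomial_herm {P : Polynomial ℝ} (hP : P.natDegree ≤ 3) (a x : ℝ) {h : ℝ} (h0 : h ≠ 0) :
    P.eval x = herm ![P.eval a, h * P.derivative.eval a, P.eval (a + h),
      h * P.derivative.eval (a + h)] ((x - a) / h) := by
  have hd : P.derivative.natDegree < 3 :=
    lt_of_le_of_lt (Polynomial.natDegree_derivative_le P) (by omega)
  simp only [Polynomial.eval_eq_sum_range' (Nat.lt_succ_of_le hP),
    Polynomial.eval_eq_sum_range' hd, Finset.sum_range_succ, Finset.sum_range_zero,
    Polynomial.coeff_derivative, herm, Matrix.cons_val]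
  field_simp
  push_cast
  ring

theorem IsCubicOn.eq_herm {f : ℝ → ℝ} (hf : Differentiable ℝ f) {a b h : ℝ} (h0 : 0 < h)
    (hb : b = a + h) (hc : IsCubicOn f a b) {x : ℝ} (hx : x ∈ Set.Icc a b) :
    f x = herm ![f a, h * deriv f a, f b, h * deriv f b] ((x - a) / h) := by
  obtain ⟨P, hP, hfP⟩ := hc
  have hab : a < b := by linarith
  rw [hfP x hx, polynomial_herm hP a x h0.ne', deriv_left hf hab hfP, deriv_right hf hab hfP,
    hfP a (Set.left_mem_Icc.2 hab.le), hfP b (Set.right_mem_Icc.2 hab.le), hb]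

/-- The inner product of two cubic polynomials on `[0, 1]` in terms of the values and derivatives
at the end points. -/
def gram4 (u v : Fin 4 → ℝ) : ℝ :=
  (u 0 * (156 * v 0 + 22 * v 1 + 54 * v 2 - 13 * v 3) +
    u 1 * (22 * v 0 + 4 * v 1 + 13 * v 2 - 3 * v 3) +
    u 2 * (54 * v 0 + 13 * v 1 + 156 * v 2 - 22 * v 3) +
    u 3 * (-13 * v 0 - 3 * v 1 - 22 * v 2 + 4 * v 3)) / 420

/-- In the monomial basis the product of two cubics has an explicit primitive. Every inner product
of concrete splines below is reduced to this identity, cell by cell. -/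
theorem integral_herm (u v : Fin 4 → ℝ) : ∫ t in (0 : ℝ)..1, herm u t * herm v t = gram4 u v := by
  have e : ∀ (u : Fin 4 → ℝ) (t : ℝ), herm u t = u 0 + u 1 * t +
      (-3 * u 0 - 2 * u 1 + 3 * u 2 - u 3) * t ^ 2 +
      (2 * u 0 + u 1 - 2 * u 2 + u 3) * t ^ 3 := by
    intro u t; simp only [herm]; ring
  have key : ∀ a0 a1 a2 a3 b0 b1 b2 b3 : ℝ,
      ∫ t in (0 : ℝ)..1, (a0 + a1 * t + a2 * t ^ 2 + a3 * t ^ 3) *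
        (b0 + b1 * t + b2 * t ^ 2 + b3 * t ^ 3) =
      a0 * b0 + (a0 * b1 + a1 * b0) / 2 + (a0 * b2 + a1 * b1 + a2 * b0) / 3 +
        (a0 * b3 + a1 * b2 + a2 * b1 + a3 * b0) / 4 + (a1 * b3 + a2 * b2 + a3 * b1) / 5 +
        (a2 * b3 + a3 * b2) / 6 + a3 * b3 / 7 := by
    intro a0 a1 a2 a3 b0 b1 b2 b3
    have hd : ∀ t ∈ Set.uIcc (0 : ℝ) 1, HasDerivAt (fun t : ℝ =>
        a0 * b0 * t + (a0 * b1 + a1 * b0) / 2 * t ^ 2 +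
        (a0 * b2 + a1 * b1 + a2 * b0) / 3 * t ^ 3 +
        (a0 * b3 + a1 * b2 + a2 * b1 + a3 * b0) / 4 * t ^ 4 +
        (a1 * b3 + a2 * b2 + a3 * b1) / 5 * t ^ 5 +
        (a2 * b3 + a3 * b2) / 6 * t ^ 6 + a3 * b3 / 7 * t ^ 7)
        ((a0 + a1 * t + a2 * t ^ 2 + a3 * t ^ 3) * (b0 + b1 * t + b2 * t ^ 2 + b3 * t ^ 3)) t := by
      intro t _
      have h := fun (n : ℕ) (c : ℝ) => (hasDerivAt_pow n t).const_mul c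
      refine ((((((((hasDerivAt_id' t).const_mul (a0 * b0)).fun_add (h 2 _)).fun_add
        (h 3 _)).fun_add (h 4 _)).fun_add (h 5 _)).fun_add (h 6 _)).fun_add
        (h 7 _)).congr_deriv ?_
      push_cast
      ring
    rw [intervalIntegral.integral_eq_sub_of_hasDerivAt hd
      (Continuous.intervalIntegrable (by fun_prop) _ _)]
    ring
  simp only [e, key, gram4]
  ring

theorem integral_cell {f g : ℝ → ℝ} {a b h : ℝ} (h0 : 0 < h) (hb : b = a + h) {u v : Fin 4 → ℝ}
    (hf : ∀ x ∈ Set.Icc a b, f x = herm u ((x - a) / h))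
    (hg : ∀ x ∈ Set.Icc a b, g x = herm v ((x - a) / h)) :
    ∫ x in a..b, f x * g x = h * gram4 u v := by
  subst hb
  have : ∫ x in a..(a + h), f x * g x =
      ∫ x in a..(a + h), (fun t => herm u t * herm v t) (x / h - a / h) := by
    refine intervalIntegral.integral_congr fun x hx => ?_
    rw [Set.uIcc_of_le (by linarith)] at hx
    simp only [hf x hx, hg x hx, sub_div]
  rw [this, intervalIntegral.integral_comp_div_sub (fun t => herm u t * herm v t) h0.ne',
    smul_eq_mul]
  rw [show a / h - a / h = 0 by ring, show (a + h) / h - a / h = 1 by field_simp; ring,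
    integral_herm]

/-! ### The Hermite splines -/

/-- The truncated square is the building block for C¹ gluing: the Hermite splines are combinations
of its translates with polynomial coefficients. At 0 the bound by y² gives the derivative. -/
theorem hasDerivAt_max_sq (x : ℝ) :
    HasDerivAt (fun x : ℝ => max x 0 ^ 2) (2 * max x 0) x := by
  rcases lt_trichotomy x 0 with hx | rfl | hx
  · rw [max_eq_right hx.le, mul_zero]
    refine (hasDerivAt_const x (0 : ℝ)).congr_of_eventuallyEq ?_
    filter_upwards [Iio_mem_nhds hx] with y hy
    rw [max_eq_right (le_of_lt hy)]; simp
  · simp only [max_self, mul_zero]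
    rw [hasDerivAt_iff_isLittleO_nhds_zero]
    simp only [zero_add, max_self, smul_zero, sub_zero]
    refine (Asymptotics.IsBigO.of_bound 1 ?_).trans_isLittleO
      (Asymptotics.isLittleO_pow_id (one_lt_two))
    refine Filter.Eventually.of_forall fun y => ?_
    rw [one_mul, zero_pow two_ne_zero, sub_zero, norm_pow, norm_pow]
    gcongr
    rw [Real.norm_eq_abs, Real.norm_eq_abs, abs_of_nonneg (le_max_right _ _)]
    exact max_le (le_abs_self y) (abs_nonneg y)
  · rw [max_eq_left hx.le]
    have := hasDerivAt_pow 2 x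
    simp only [Nat.cast_ofNat, Nat.add_one_sub_one, pow_one] at this
    refine this.congr_of_eventuallyEq ?_
    filter_upwards [Ioi_mem_nhds hx] with y hy
    rw [max_eq_left (le_of_lt hy)]

theorem contDiff_max_sq : ContDiff ℝ 1 (fun x : ℝ => max x 0 ^ 2) := by
  rw [contDiff_one_iff_deriv]
  refine ⟨fun x => (hasDerivAt_max_sq x).differentiableAt, ?_⟩
  have : deriv (fun x : ℝ => max x 0 ^ 2) = fun x => 2 * max x 0 :=
    funext fun x => (hasDerivAt_max_sq x).deriv
  rw [this]; fun_prop

theorem contDiff_max_sq_shift (c : ℝ) : ContDiff ℝ 1 (fun x : ℝ => max (x + c) 0 ^ 2) :=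
  contDiff_max_sq.comp (contDiff_id.add contDiff_const)

/-- In this form the C¹ property holds at all three nodes at once, and the values on each piece
follow by evaluating the three maxima. -/
theorem xi1_eq (x : ℝ) : xi1 x = (3 - 2 * (x + 1)) * max (x + 1) 0 ^ 2 +
    4 * x * max (x + 0) 0 ^ 2 - (3 + 2 * (x + -1)) * max (x + -1) 0 ^ 2 := by
  unfold xi1
  split_ifs with h1 h2
  · rw [max_eq_left (by linarith [h1.1]), max_eq_right (by linarith [h1.2]),
      max_eq_right (by linarith [h1.2])]; ring
  · rw [max_eq_left (by linarith [h2.1]), max_eq_left (by linarith [h2.1]),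
      max_eq_right (by linarith [h2.2])]; ring
  · rcases le_total x 0 with h | h
    · have : x < -1 := by by_contra h'; exact h1 ⟨not_lt.1 h', h⟩
      rw [max_eq_right (by linarith), max_eq_right (by linarith), max_eq_right (by linarith)]
      ring
    · have : 1 < x := by by_contra h'; exact h2 ⟨h, not_lt.1 h'⟩
      rw [max_eq_left (by linarith), max_eq_left (by linarith), max_eq_left (by linarith)]
      ring

theorem xi2_eq (x : ℝ) : xi2 x = x * max (x + 1) 0 ^ 2 - 4 * max (x + 0) 0 ^ 2 -
    x * max (x + -1) 0 ^ 2 := by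
  unfold xi2
  split_ifs with h1 h2
  · rw [max_eq_left (by linarith [h1.1]), max_eq_right (by linarith [h1.2]),
      max_eq_right (by linarith [h1.2])]; ring
  · rw [max_eq_left (by linarith [h2.1]), max_eq_left (by linarith [h2.1]),
      max_eq_right (by linarith [h2.2])]; ring
  · rcases le_total x 0 with h | h
    · have : x < -1 := by by_contra h'; exact h1 ⟨not_lt.1 h', h⟩
      rw [max_eq_right (by linarith), max_eq_right (by linarith), max_eq_right (by linarith)]
      ring
    · have : 1 < x := by by_contra h'; exact h2 ⟨h, not_lt.1 h'⟩
      rw [max_eq_left (by linarith), max_eq_left (by linarith), max_eq_left (by linarith)]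
      ring

theorem xi1_right {t : ℝ} (ht : t ∈ Set.Icc (0 : ℝ) 1) : xi1 t = (1 - t) ^ 2 * (1 + 2 * t) := by
  rw [xi1_eq, max_eq_left (by linarith [ht.1]), max_eq_left (by linarith [ht.1]),
    max_eq_right (by linarith [ht.2])]; ring

theorem xi2_right {t : ℝ} (ht : t ∈ Set.Icc (0 : ℝ) 1) : xi2 t = (1 - t) ^ 2 * t := by
  rw [xi2_eq, max_eq_left (by linarith [ht.1]), max_eq_left (by linarith [ht.1]),
    max_eq_right (by linarith [ht.2])]; ring

theorem xi1_left {t : ℝ} (ht : t ∈ Set.Icc (0 : ℝ) 1) : xi1 (t - 1) = t ^ 2 * (3 - 2 * t) := by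
  rw [xi1_eq, max_eq_left (by linarith [ht.1]), max_eq_right (by linarith [ht.2]),
    max_eq_right (by linarith [ht.2])]; ring

theorem xi2_left {t : ℝ} (ht : t ∈ Set.Icc (0 : ℝ) 1) : xi2 (t - 1) = t ^ 2 * (t - 1) := by
  rw [xi2_eq, max_eq_left (by linarith [ht.1]), max_eq_right (by linarith [ht.2]),
    max_eq_right (by linarith [ht.2])]; ring

theorem xi1_of_abs {t : ℝ} (ht : 1 ≤ |t|) : xi1 t = 0 := by
  rw [xi1_eq]
  rcases le_abs.1 ht with h | h
  · rw [max_eq_left (by linarith), max_eq_left (by linarith), max_eq_left (by linarith)]; ring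
  · rw [max_eq_right (by linarith), max_eq_right (by linarith), max_eq_right (by linarith)]; ring

theorem xi2_of_abs {t : ℝ} (ht : 1 ≤ |t|) : xi2 t = 0 := by
  rw [xi2_eq]
  rcases le_abs.1 ht with h | h
  · rw [max_eq_left (by linarith), max_eq_left (by linarith), max_eq_left (by linarith)]; ring
  · rw [max_eq_right (by linarith), max_eq_right (by linarith), max_eq_right (by linarith)]; ring

/-- A function which vanishes outside of a compact interval has compact support. -/
theorem hasCompactSupport_of_Icc {f : ℝ → ℝ} (a b : ℝ) (h : ∀ x ∉ Set.Icc a b, f x = 0) :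
    HasCompactSupport f :=
  HasCompactSupport.intro isCompact_Icc fun {x} hx => h x hx

theorem mem_Sp_zero_of {f : ℝ → ℝ} (hf : ContDiff ℝ 1 f) (h : ∀ t, 1 ≤ |t| → f t = 0)
    {P Q : Polynomial ℝ} (hP : P.natDegree ≤ 3) (hQ : Q.natDegree ≤ 3)
    (h1 : ∀ t ∈ Set.Icc (-1 : ℝ) 0, f t = P.eval t) (h2 : ∀ t ∈ Set.Icc (0 : ℝ) 1, f t = Q.eval t) :
    f ∈ Sp 0 := by
  refine ⟨hf, hasCompactSupport_of_Icc (-1) 1 fun x hx => h x ?_, fun k => ?_⟩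
  · by_contra h'
    exact hx (abs_le.1 (not_le.1 h').le)
  · simp only [pow_zero, div_one]
    rcases lt_trichotomy k (-1) with hk | rfl | hk
    · refine ⟨0, by simp, fun x hx => ?_⟩
      have : (k : ℝ) + 1 ≤ -1 := by exact_mod_cast (by omega)
      rw [h x (le_abs.2 (Or.inr (by linarith [hx.2])))]; simp
    · exact ⟨P, hP, fun x hx => h1 x (by simpa using hx)⟩
    · rcases eq_or_lt_of_le (show 0 ≤ k by omega) with rfl | hk'
      · exact ⟨Q, hQ, fun x hx => h2 x (by simpa using hx)⟩
      · refine ⟨0, by simp, fun x hx => ?_⟩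
        have : (1 : ℝ) ≤ k := by exact_mod_cast hk'
        rw [h x (le_abs.2 (Or.inl (by linarith [hx.1])))]; simp

open Polynomial in
theorem xi1_mem : xi1 ∈ Sp 0 := by
  refine mem_Sp_zero_of (P := (X + 1) ^ 2 * (1 - 2 * X)) (Q := (1 - X) ^ 2 * (1 + 2 * X)) ?_
    (fun t => xi1_of_abs) (by compute_degree) (by compute_degree) (fun t ht => ?_) fun t ht => ?_
  · rw [funext xi1_eq]
    have h1 := contDiff_max_sq_shift 1
    have h0 := contDiff_max_sq_shift 0
    have h2 := contDiff_max_sq_shift (-1)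
    fun_prop
  · have := xi1_left (t := t + 1) ⟨by linarith [ht.1], by linarith [ht.2]⟩
    rw [add_sub_cancel_right] at this
    rw [this]; simp only [eval_mul, eval_pow, eval_add, eval_sub, eval_X, eval_one, eval_ofNat]; ring
  · rw [xi1_right ht]; simp

open Polynomial in
theorem xi2_mem : xi2 ∈ Sp 0 := by
  refine mem_Sp_zero_of (P := (X + 1) ^ 2 * X) (Q := (1 - X) ^ 2 * X) ?_
    (fun t => xi2_of_abs) (by compute_degree) (by compute_degree) (fun t ht => ?_) fun t ht => ?_
  · rw [funext xi2_eq]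
    have h1 := contDiff_max_sq_shift 1
    have h0 := contDiff_max_sq_shift 0
    have h2 := contDiff_max_sq_shift (-1)
    fun_prop
  · have := xi2_left (t := t + 1) ⟨by linarith [ht.1], by linarith [ht.2]⟩
    rw [add_sub_cancel_right] at this
    rw [this]; simp
  · rw [xi2_right ht]; simp

theorem xi_eq (j : ℕ) (k : ℤ) :
    xi j (2 * k) = (2 : ℝ) ^ ((j : ℝ) / 2) • dil (2 ^ j) k xi1 ∧
    xi j (2 * k + 1) = (2 : ℝ) ^ ((j : ℝ) / 2) • dil (2 ^ j) k xi2 := by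
  constructor
  · ext x
    simp [xi, dil]
  · ext x
    have h1 : (2 * k + 1) % 2 = 1 := by omega
    have h2 : (2 * k + 1) / 2 = k := by omega
    simp [xi, dil, h1, h2]

theorem xi_mem (j : ℕ) (n : ℤ) : xi j n ∈ Sp j := by
  obtain ⟨k, rfl | rfl⟩ := Int.even_or_odd' n
  · rw [(xi_eq j k).1]
    simpa using (Sp (0 + j)).smul_mem _ (dil_pow_mem_Sp xi1_mem j k)
  · rw [(xi_eq j k).2]
    simpa using (Sp (0 + j)).smul_mem _ (dil_pow_mem_Sp xi2_mem j k)

instance (j : ℕ) (n : ℤ) : IsL2 (xi j n) := isL2_of_mem_Sp (xi_mem j n)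

/-- The expansion of a spline with integer nodes in the Hermite basis. -/
theorem Sp_zero_le_span : Sp 0 ≤ Submodule.span ℝ
    (Set.range (fun k : ℤ => dil 1 k xi1) ∪ Set.range (fun k : ℤ => dil 1 k xi2)) := by
  rintro f hf
  have hd : Differentiable ℝ f := hf.1.differentiable one_ne_zero
  have hfin : {k : ℤ | f k ≠ 0 ∨ deriv f k ≠ 0}.Finite := by
    obtain ⟨R, hR⟩ := hf.2.1.isCompact.isBounded.subset_closedBall 0
    refine (Set.finite_Icc (-⌈R⌉) ⌈R⌉).subset fun k hk => ?_
    have hk' : (k : ℝ) ∈ tsupport f := by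
      rcases hk with hk | hk
      · exact subset_tsupport _ hk
      · exact support_deriv_subset hk
    have := hR hk'
    rw [Metric.mem_closedBall, dist_zero_right, Real.norm_eq_abs, abs_le] at this
    constructor
    · have h1 : -(⌈R⌉ : ℝ) ≤ k := by linarith [Int.le_ceil R]
      exact_mod_cast h1
    · have h1 : (k : ℝ) ≤ ⌈R⌉ := by linarith [Int.le_ceil R]
      exact_mod_cast h1
  have hf' : f = ∑ k ∈ hfin.toFinset, (f k • dil 1 k xi1 + deriv f k • dil 1 k xi2) := by
    ext x
    rw [Finset.sum_apply]
    simp only [Pi.add_apply, Pi.smul_apply, smul_eq_mul, dil_eq, one_mul]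
    set m := ⌊x⌋ with hm
    have hx : x ∈ Set.Icc (m : ℝ) (m + 1) := ⟨Int.floor_le x, (Int.lt_floor_add_one x).le⟩
    have hm1 : x - m ∈ Set.Icc (0 : ℝ) 1 := ⟨by linarith [hx.1], by linarith [hx.2]⟩
    have e1 : ∑ k ∈ hfin.toFinset, (f k * xi1 (x - k) + deriv f k * xi2 (x - k)) =
        ∑ k ∈ hfin.toFinset ∪ {m, m + 1}, (f k * xi1 (x - k) + deriv f k * xi2 (x - k)) := by
      refine Finset.sum_subset Finset.subset_union_left fun k _ hk => ?_
      simp only [Set.Finite.mem_toFinset, Set.mem_ofPred_eq, not_or, not_not] at hk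
      simp [hk.1, hk.2]
    have e2 : ∑ k ∈ {m, m + 1}, (f k * xi1 (x - k) + deriv f k * xi2 (x - k)) =
        ∑ k ∈ hfin.toFinset ∪ {m, m + 1}, (f k * xi1 (x - k) + deriv f k * xi2 (x - k)) := by
      refine Finset.sum_subset Finset.subset_union_right fun k _ hk => ?_
      simp only [Finset.mem_insert, Finset.mem_singleton, not_or] at hk
      have h1 : 1 ≤ |x - k| := by
        rcases lt_or_gt_of_ne hk.1 with h | h
        · have : (k : ℝ) + 1 ≤ m := by exact_mod_cast h
          exact le_abs.2 (Or.inl (by linarith [hx.1]))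
        · have : (m : ℝ) + 2 ≤ k := by exact_mod_cast (by omega)
          exact le_abs.2 (Or.inr (by linarith [hx.2]))
      rw [xi1_of_abs h1, xi2_of_abs h1]; ring
    -- On the cell [m, m + 1] only the Hermite functions at its two end points are nonzero, and the
    -- expansion becomes the interpolation formula `IsCubicOn.eq_herm`.
    rw [e1, ← e2, Finset.sum_pair (by omega)]
    have hc := hf.2.2 m
    simp only [pow_zero, div_one] at hc
    rw [hc.eq_herm hd one_pos rfl hx, xi1_right hm1, xi2_right hm1]
    push_cast
    rw [← sub_sub, xi1_left hm1, xi2_left hm1]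
    simp only [herm, Matrix.cons_val]
    ring
  rw [hf']
  refine Submodule.sum_mem _ fun k _ => Submodule.add_mem _ ?_ ?_
  · exact Submodule.smul_mem _ _ (Submodule.subset_span (Or.inl ⟨k, rfl⟩))
  · exact Submodule.smul_mem _ _ (Submodule.subset_span (Or.inr ⟨k, rfl⟩))

end SplineWavelet

end

open MeasureTheory

noncomputable section

set_option synthInstance.maxSize 100000

namespace SplineWavelet

/-! ### Supports -/

/-- The functions which vanish outside of `[a, b]`. -/
def SuppIn (a b : ℝ) : Submodule ℝ (ℝ → ℝ) where
  carrier := {f | ∀ x ∉ Set.Icc a b, f x = 0}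
  add_mem' := fun hf hg x hx => by simp [hf x hx, hg x hx]
  zero_mem' := fun _ _ => rfl
  smul_mem' := fun c f hf x hx => by simp [hf x hx]

theorem SuppIn_mono {a b a' b' : ℝ} (ha : a' ≤ a) (hb : b ≤ b') : SuppIn a b ≤ SuppIn a' b' :=
  fun _ hf x hx => hf x fun h => hx ⟨ha.trans h.1, h.2.trans hb⟩

/-- Membership in `SuppIn` gives vanishing strictly outside the interval; continuity adds the end
point. This makes products of functions with abutting supports vanish pointwise. -/
theorem SuppIn.eq_zero_left {a b : ℝ} {f : ℝ → ℝ} (h : f ∈ SuppIn a b) (hf : Continuous f)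
    {x : ℝ} (hx : x ≤ a) : f x = 0 := by
  have hc : IsClosed {y | f y = 0} := isClosed_eq hf continuous_const
  have : Set.Iio a ⊆ {y | f y = 0} := fun y hy => h y fun h' => absurd h'.1 (not_le.2 hy)
  have h2 := closure_minimal this hc
  rw [closure_Iio] at h2
  exact h2 hx

theorem SuppIn.eq_zero_right {a b : ℝ} {f : ℝ → ℝ} (h : f ∈ SuppIn a b) (hf : Continuous f)
    {x : ℝ} (hx : b ≤ x) : f x = 0 := by
  have hc : IsClosed {y | f y = 0} := isClosed_eq hf continuous_const
  have : Set.Ioi b ⊆ {y | f y = 0} := fun y hy => h y fun h' => absurd h'.2 (not_le.2 hy)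
  have h2 := closure_minimal this hc
  rw [closure_Ioi] at h2
  exact h2 hx

theorem ip_eq_zero_of_supp {a b c d : ℝ} {f g : ℝ → ℝ} (hf : f ∈ SuppIn a b)
    (hg : g ∈ SuppIn c d) (hfc : Continuous f) (h : b ≤ c) : ip f g = 0 := by
  refine ip_eq_zero_of_mul fun x => ?_
  by_cases hx : x ∈ Set.Icc c d
  · rw [SuppIn.eq_zero_right hf hfc (h.trans hx.1), zero_mul]
  · rw [hg x hx, mul_zero]

theorem dil_mem_SuppIn {a b a' b' s c : ℝ} {f : ℝ → ℝ} (hf : f ∈ SuppIn a b) (hs : 0 < s)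
    (ha : s * a' = a + c) (hb : s * b' = b + c) : dil s c f ∈ SuppIn a' b' := by
  intro x hx
  refine hf _ fun h => hx ⟨?_, ?_⟩
  · exact le_of_mul_le_mul_left (by linarith [h.1]) hs
  · exact le_of_mul_le_mul_left (by linarith [h.2]) hs

theorem restr_mem (f : ℝ → ℝ) : restr f ∈ SuppIn 0 1 := fun _ hx =>
  Set.indicator_of_notMem hx f

theorem restr_of_mem {f : ℝ → ℝ} {x : ℝ} (hx : x ∈ Set.Icc (0 : ℝ) 1) : restr f x = f x :=
  Set.indicator_of_mem hx f

theorem restr_eq_self {f : ℝ → ℝ} (hf : f ∈ SuppIn 0 1) : restr f = f := by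
  ext x
  by_cases hx : x ∈ Set.Icc (0 : ℝ) 1
  · exact restr_of_mem hx
  · rw [restr_mem f x hx, hf x hx]

theorem ip_restr_left (f : ℝ → ℝ) {g : ℝ → ℝ} (hg : g ∈ SuppIn 0 1) :
    ip (restr f) g = ip f g := by
  refine ip_congr fun x => ?_
  by_cases hx : x ∈ Set.Icc (0 : ℝ) 1
  · rw [restr_of_mem hx]
  · rw [hg x hx, mul_zero, mul_zero]

/-- Restriction to `[0, 1]` as a linear map. -/
def restrL : (ℝ → ℝ) →ₗ[ℝ] (ℝ → ℝ) where
  toFun := restr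
  map_add' f g := Set.indicator_add' _ f g
  map_smul' c f := Set.indicator_const_smul _ c f

theorem restrL_apply (f : ℝ → ℝ) : restrL f = restr f := rfl

/-- Composition with an affine map as a linear map. -/
def dilL (a c : ℝ) : (ℝ → ℝ) →ₗ[ℝ] (ℝ → ℝ) where
  toFun := dil a c
  map_add' _ _ := rfl
  map_smul' _ _ := rfl

theorem dilL_apply (a c : ℝ) (f : ℝ → ℝ) : dilL a c f = dil a c f := rfl

theorem xi_supp (j : ℕ) (n : ℤ) :
    xi j n ∈ SuppIn (((n / 2 : ℤ) - 1) / 2 ^ j) (((n / 2 : ℤ) + 1) / 2 ^ j) := by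
  intro x hx
  have h2 : (0 : ℝ) < 2 ^ j := by positivity
  have h : 1 ≤ |(2 : ℝ) ^ j * x - ((n / 2 : ℤ) : ℝ)| := by
    by_contra h'
    rw [not_le, abs_lt] at h'
    refine hx ⟨?_, ?_⟩
    · rw [div_le_iff₀ h2]; linarith [h'.1]
    · rw [le_div_iff₀ h2]; linarith [h'.2]
  unfold xi
  split_ifs
  · rw [xi1_of_abs h, mul_zero]
  · rw [xi2_of_abs h, mul_zero]

theorem xi_supp' (j : ℕ) (n k : ℤ) (hk : n / 2 = k) {a b : ℝ} (ha : 2 ^ j * a = k - 1)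
    (hb : 2 ^ j * b = k + 1) : xi j n ∈ SuppIn a b := by
  have := xi_supp j n
  have h2 : (0 : ℝ) < 2 ^ j := by positivity
  rwa [hk, ← ha, ← hb, mul_div_cancel_left₀ _ h2.ne', mul_div_cancel_left₀ _ h2.ne'] at this

/-! ### Inner products of piecewise cubics on `[0, 1]` -/

/-- On the `N` cells of `[0, 1]` the function `f` is given by the Hermite data `u`. -/
def HData (N : ℕ) (f : ℝ → ℝ) (u : ℕ → Fin 4 → ℝ) : Prop :=
  ∀ c < N, ∀ t ∈ Set.Icc (0 : ℝ) 1, f ((c + t) / N) = herm (u c) t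

/-- The integral splits into the N cells of length 1/N, and each contributes `gram4` of the two
data. Only `g` has to be supported in [0,1]; `f` may extend beyond. -/
theorem HData.ip {N : ℕ} (hN : 0 < N) {f g : ℝ → ℝ} {u v : ℕ → Fin 4 → ℝ} (hf : HData N f u)
    (hg : HData N g v) (hs : g ∈ SuppIn 0 1) :
    ip f g = (∑ c ∈ Finset.range N, gram4 (u c) (v c)) / N := by
  have hN' : (0 : ℝ) < N := by exact_mod_cast hN
  have e1 : SplineWavelet.ip f g = ∫ x in (0 : ℝ)..1, f x * g x := by
    rw [intervalIntegral.integral_of_le zero_le_one, ← integral_Icc_eq_integral_Ioc,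
      SplineWavelet.ip, setIntegral_eq_integral_of_forall_compl_eq_zero]
    intro x hx
    rw [hs x hx, mul_zero]
  have cell : ∀ {f : ℝ → ℝ} {u : ℕ → Fin 4 → ℝ}, HData N f u → ∀ c < N,
      ∀ x ∈ Set.Icc ((c : ℝ) / N) ((c + 1 : ℕ) / N),
        f x = herm (u c) ((x - c / N) / (1 / N)) := by
    intro f u hf c hc x hx
    rw [Set.mem_Icc, div_le_iff₀ hN', le_div_iff₀ hN'] at hx
    push_cast at hx
    have := hf c hc (x * N - c) ⟨by linarith [hx.1], by linarith [hx.2]⟩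
    rw [show ((c : ℝ) + (x * N - c)) / N = x by field_simp; ring] at this
    rw [this]
    congr 1
    field_simp
  have hint : ∀ c < N, ∫ x in ((c : ℝ) / N)..((c + 1 : ℕ) / N), f x * g x =
      1 / N * gram4 (u c) (v c) := fun c hc =>
    integral_cell (by positivity) (by push_cast; ring) (cell hf c hc) (cell hg c hc)
  have hcont : ∀ c < N, IntervalIntegrable (fun x => f x * g x) volume
      ((c : ℝ) / N) ((c + 1 : ℕ) / N) := by
    intro c hc
    have hle : (c : ℝ) / N ≤ (c + 1 : ℕ) / N := by gcongr; simp
    have : ContinuousOn (fun x => herm (u c) ((x - c / N) / (1 / N)) *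
        herm (v c) ((x - c / N) / (1 / N))) (Set.uIcc ((c : ℝ) / N) ((c + 1 : ℕ) / N)) := by
      unfold herm; fun_prop
    refine (this.intervalIntegrable).congr ?_
    intro x hx
    rw [Set.uIoc_of_le hle] at hx
    have hx' := Set.Ioc_subset_Icc_self hx
    simp only [cell hf c hc x hx', cell hg c hc x hx']
  have := intervalIntegral.sum_integral_adjacent_intervals (f := fun x => f x * g x)
    (μ := volume) (a := fun c : ℕ => (c : ℝ) / N) (n := N) hcont
  simp only [Nat.cast_zero, zero_div, div_self hN'.ne'] at this
  rw [e1, ← this, Finset.sum_congr rfl fun c hc => hint c (Finset.mem_range.1 hc),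
    ← Finset.mul_sum]
  ring

/-- A shift of the Hermite functions to the cells of the unit interval. -/
theorem xi_level (j : ℕ) (k : ℤ) (c : ℕ) {t : ℝ} (ht : t ∈ Set.Icc (0 : ℝ) 1) :
    xi j (2 * k) ((c + t) / (2 ^ j : ℕ)) = (2 : ℝ) ^ ((j : ℝ) / 2) *
      herm (if k = c then ![1, 0, 0, 0] else if k = c + 1 then ![0, 0, 1, 0] else 0) t ∧
    xi j (2 * k + 1) ((c + t) / (2 ^ j : ℕ)) = (2 : ℝ) ^ ((j : ℝ) / 2) *
      herm (if k = c then ![0, 1, 0, 0] else if k = c + 1 then ![0, 0, 0, 1] else 0) t := by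
  have h2 : ((2 ^ j : ℕ) : ℝ) ≠ 0 := by positivity
  have e : (2 : ℝ) ^ j * ((c + t) / (2 ^ j : ℕ)) - k = c - k + t := by
    push_cast; field_simp; ring
  rw [(xi_eq j k).1, (xi_eq j k).2]
  simp only [Pi.smul_apply, smul_eq_mul, dil_eq, e]
  split_ifs with h1 h3
  · subst h1
    simp only [Int.cast_natCast, sub_self, zero_add, xi1_right ht, xi2_right ht]
    simp [herm]
  · subst h3
    have : (c : ℝ) - ((c + 1 : ℤ) : ℝ) + t = t - 1 := by push_cast; ring
    rw [this, xi1_left ht, xi2_left ht]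
    simp [herm]
  · have : 1 ≤ |(c : ℝ) - k + t| := by
      rcases lt_or_gt_of_ne h1 with h | h
      · have : (k : ℝ) + 1 ≤ c := by exact_mod_cast h
        exact le_abs.2 (Or.inl (by linarith [ht.1]))
      · have : (c : ℝ) + 2 ≤ k := by exact_mod_cast (by omega)
        exact le_abs.2 (Or.inr (by linarith [ht.2]))
    rw [xi1_of_abs this, xi2_of_abs this]
    simp [herm]

theorem herm_smul (a : ℝ) (u : Fin 4 → ℝ) (t : ℝ) : a * herm u t = herm (a • u) t := by
  simp only [herm, Pi.smul_apply, smul_eq_mul]; ring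

/-- The Hermite data of `xi j n`. -/
def xiData (j : ℕ) (n : ℤ) (c : ℕ) : Fin 4 → ℝ :=
  (2 : ℝ) ^ ((j : ℝ) / 2) • if n % 2 = 0 then
    if n / 2 = c then ![1, 0, 0, 0] else if n / 2 = c + 1 then ![0, 0, 1, 0] else 0
  else if n / 2 = c then ![0, 1, 0, 0] else if n / 2 = c + 1 then ![0, 0, 0, 1] else 0

theorem xi_hdata (j : ℕ) (n : ℤ) : HData (2 ^ j) (xi j n) (xiData j n) := by
  intro c _ t ht
  obtain ⟨k, rfl | rfl⟩ := Int.even_or_odd' n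
  · rw [(xi_level j k c ht).1, herm_smul]
    simp [xiData]
  · have h1 : (2 * k + 1) % 2 = 1 := by omega
    have h2 : (2 * k + 1) / 2 = k := by omega
    rw [(xi_level j k c ht).2, herm_smul]
    simp [xiData, h1, h2]

theorem gram4_smul (a b : ℝ) (u v : Fin 4 → ℝ) :
    gram4 (a • u) (b • v) = a * b * gram4 u v := by
  simp only [gram4, Pi.smul_apply, smul_eq_mul]; ring

theorem two_rpow_half_mul (j : ℕ) : (2 : ℝ) ^ ((j : ℝ) / 2) * (2 : ℝ) ^ ((j : ℝ) / 2) = 2 ^ j := by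
  rw [← Real.rpow_add two_pos, add_halves, Real.rpow_natCast]

theorem xi_one_supp {n : ℤ} (h : n = 2 ∨ n = 3) : xi 1 n ∈ SuppIn 0 1 := by
  rcases h with rfl | rfl <;> exact xi_supp' 1 _ 1 (by norm_num) (by norm_num) (by norm_num)

/-- The two factors √2 of level 1 multiply to 2 and cancel the cell length 1/2, so the inner
products are rational. -/
theorem ip_xi_one (m n : ℤ) (h : n = 2 ∨ n = 3) : ip (xi 1 m) (xi 1 n) =
    ∑ c ∈ Finset.range 2, gram4
      (if m % 2 = 0 then
        if m / 2 = c then ![1, 0, 0, 0] else if m / 2 = c + 1 then ![0, 0, 1, 0] else 0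
      else if m / 2 = c then ![0, 1, 0, 0] else if m / 2 = c + 1 then ![0, 0, 0, 1] else 0)
      (if n % 2 = 0 then
        if n / 2 = c then ![1, 0, 0, 0] else if n / 2 = c + 1 then ![0, 0, 1, 0] else 0
      else if n / 2 = c then ![0, 1, 0, 0] else if n / 2 = c + 1 then ![0, 0, 0, 1] else 0) := by
  rw [HData.ip (by norm_num) (xi_hdata 1 m) (xi_hdata 1 n) (xi_one_supp h)]
  simp only [xiData, gram4_smul, two_rpow_half_mul, ← Finset.mul_sum]
  norm_num

theorem ip_xi_2_2 : ip (xi 1 2) (xi 1 2) = 26 / 35 := by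
  rw [ip_xi_one _ _ (by simp)]; simp [Finset.sum_range_succ, gram4]; norm_num
theorem ip_xi_3_3 : ip (xi 1 3) (xi 1 3) = 2 / 105 := by
  rw [ip_xi_one _ _ (by simp)]; simp [Finset.sum_range_succ, gram4]; norm_num
theorem ip_xi_3_2 : ip (xi 1 3) (xi 1 2) = 0 := by
  rw [ip_xi_one _ _ (by simp)]; simp [Finset.sum_range_succ, gram4]; norm_num
theorem ip_xi_0_2 : ip (xi 1 0) (xi 1 2) = 9 / 70 := by
  rw [ip_xi_one _ _ (by simp)]; simp [Finset.sum_range_succ, gram4]; norm_num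
theorem ip_xi_0_3 : ip (xi 1 0) (xi 1 3) = -13 / 420 := by
  rw [ip_xi_one _ _ (by simp)]; simp [Finset.sum_range_succ, gram4]
theorem ip_xi_1_2 : ip (xi 1 1) (xi 1 2) = 13 / 420 := by
  rw [ip_xi_one _ _ (by simp)]; simp [Finset.sum_range_succ, gram4]
theorem ip_xi_1_3 : ip (xi 1 1) (xi 1 3) = -1 / 140 := by
  rw [ip_xi_one _ _ (by simp)]; simp [Finset.sum_range_succ, gram4]; norm_num
theorem ip_xi_4_2 : ip (xi 1 4) (xi 1 2) = 9 / 70 := by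
  rw [ip_xi_one _ _ (by simp)]; simp [Finset.sum_range_succ, gram4]; norm_num
theorem ip_xi_4_3 : ip (xi 1 4) (xi 1 3) = 13 / 420 := by
  rw [ip_xi_one _ _ (by simp)]; simp [Finset.sum_range_succ, gram4]
theorem ip_xi_5_2 : ip (xi 1 5) (xi 1 2) = -13 / 420 := by
  rw [ip_xi_one _ _ (by simp)]; simp [Finset.sum_range_succ, gram4]
theorem ip_xi_5_3 : ip (xi 1 5) (xi 1 3) = -1 / 140 := by
  rw [ip_xi_one _ _ (by simp)]; simp [Finset.sum_range_succ, gram4]; norm_num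

instance : IsL2 phi1 := by unfold phi1; infer_instance
instance : IsL2 phi2 := by unfold phi2; infer_instance

theorem on_phi12 : ON ![phi1, phi2] := by
  have h1 : ip (xi 1 2) (xi 1 2) ≠ 0 := by rw [ip_xi_2_2]; norm_num
  have h2 : ip (xi 1 3) (xi 1 3) ≠ 0 := by rw [ip_xi_3_3]; norm_num
  refine (ON.single h1).snoc h2 (fun i => ?_) (fun i => ?_) rfl
  · fin_cases i
    change ip _ (normalize _) = 0
    rw [ip_comm, ip_normalize_left, ip_comm, ip_xi_3_2, mul_zero]
  · fin_cases i; rfl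

theorem phi1_mem : phi1 ∈ Sp 1 := normalize_mem (xi_mem 1 2)
theorem phi2_mem : phi2 ∈ Sp 1 := normalize_mem (xi_mem 1 3)
theorem phi1_supp : phi1 ∈ SuppIn 0 1 := normalize_mem (xi_one_supp (by simp))
theorem phi2_supp : phi2 ∈ SuppIn 0 1 := normalize_mem (xi_one_supp (by simp))

theorem ip_phi1_right (f : ℝ → ℝ) : ip f phi1 = (l2norm (xi 1 2))⁻¹ * ip f (xi 1 2) := by
  rw [ip_comm, phi1, ip_normalize_left, ip_comm]
theorem ip_phi2_right (f : ℝ → ℝ) : ip f phi2 = (l2norm (xi 1 3))⁻¹ * ip f (xi 1 3) := by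
  rw [ip_comm, phi2, ip_normalize_left, ip_comm]

/-- A residual is orthogonal to the family, so one of the two residuals may be replaced by the
original function. -/
theorem ip_resid_resid {n : ℕ} {g : Fin n → ℝ → ℝ} (hg : ON g) (f h : ℝ → ℝ) [IsL2 f] [IsL2 h] :
    ip (resid g f) (resid g h) = ip f h - ∑ i, ip f (g i) * ip h (g i) := by
  have := hg.l2
  have e : ip (resid g f) (resid g h) = ip (resid g h) f := by
    rw [ip_comm]
    nth_rewrite 2 [resid_eq]
    rw [ip_sub_right, ip_sum_smul_right]
    simp [resid_ip hg]
  rw [e, resid_eq, ip_sub_left, ip_sum_smul_left, ip_comm h f]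
  congr 1
  refine Finset.sum_congr rfl fun i _ => ?_
  rw [ip_comm (g i) f]; ring

theorem ip_restr_disjoint {m n : ℤ} (hm : m / 2 = 0) (hn : n / 2 = 2) :
    ip (restr (xi 1 m)) (restr (xi 1 n)) = 0 := by
  refine ip_eq_zero_of_mul fun x => ?_
  by_cases hx : x ∈ Set.Icc (0 : ℝ) 1
  · rw [restr_of_mem hx, restr_of_mem hx]
    rcases le_total x (1 / 2) with h | h
    · rw [SuppIn.eq_zero_left (xi_supp' 1 n 2 hn (a := 1 / 2) (b := 3 / 2) (by norm_num)
        (by norm_num)) (xi_mem 1 n).1.continuous h, mul_zero]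
    · rw [SuppIn.eq_zero_right (xi_supp' 1 m 0 hm (a := -(1 / 2)) (b := 1 / 2) (by norm_num)
        (by norm_num)) (xi_mem 1 m).1.continuous h, zero_mul]
  · rw [restr_mem _ x hx, zero_mul]

/-- After cutting to [0,1], the functions at the nodes 0 and 1 live on [0,1/2] and [1/2,1], so only
their projections on φ₁ and φ₂ contribute. The factors 35/26 and 105/2 are the inverse squared norms
of ξ_{1,2} and ξ_{1,3}. -/
theorem ip_resid_restr {m n : ℤ} (hm : m / 2 = 0) (hn : n / 2 = 2) :
    ip (resid ![phi1, phi2] (restr (xi 1 m))) (resid ![phi1, phi2] (restr (xi 1 n))) =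
    -(ip (xi 1 m) (xi 1 2) * ip (xi 1 n) (xi 1 2) * (35 / 26)) -
      ip (xi 1 m) (xi 1 3) * ip (xi 1 n) (xi 1 3) * (105 / 2) := by
  rw [ip_resid_resid on_phi12, ip_restr_disjoint hm hn]
  simp only [Fin.sum_univ_two, Matrix.cons_val_zero, Matrix.cons_val_one]
  rw [ip_restr_left _ phi1_supp, ip_restr_left _ phi1_supp, ip_restr_left _ phi2_supp,
    ip_restr_left _ phi2_supp, ip_phi1_right, ip_phi1_right, ip_phi2_right, ip_phi2_right]
  have h1 := l2norm_mul_self (xi 1 2)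
  have h2 := l2norm_mul_self (xi 1 3)
  rw [ip_xi_2_2] at h1
  rw [ip_xi_3_3] at h2
  have h1' : (l2norm (xi 1 2))⁻¹ * (l2norm (xi 1 2))⁻¹ = 35 / 26 := by
    rw [← mul_inv, h1]; norm_num
  have h2' : (l2norm (xi 1 3))⁻¹ * (l2norm (xi 1 3))⁻¹ = 105 / 2 := by
    rw [← mul_inv, h2]; norm_num
  linear_combination (-(ip (xi 1 m) (xi 1 2) * ip (xi 1 n) (xi 1 2))) * h1' -
    ip (xi 1 m) (xi 1 3) * ip (xi 1 n) (xi 1 3) * h2'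


instance (i : Fin 4) : IsL2 (cfun i) := by unfold cfun; infer_instance

/-- The four numbers ⟨cᵢ,cₖ⟩ with i at the left and k at the right node form a 2×2 matrix of
determinant 1/8985600. Its invertibility drives `coeff_eq_zero_left` and `coeff_eq_zero_right`, and
its inverse supplies the coefficients of `tauForm`. -/
theorem ip_c02 : ip (cfun 0) (cfun 2) = 35 / 1248 := by
  change ip (resid _ (restr (xi 1 0))) (resid _ (restr (xi 1 4))) = _
  rw [ip_resid_restr (by norm_num) (by norm_num), ip_xi_0_2, ip_xi_4_2, ip_xi_0_3, ip_xi_4_3]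
  norm_num
theorem ip_c03 : ip (cfun 0) (cfun 3) = -1 / 160 := by
  change ip (resid _ (restr (xi 1 0))) (resid _ (restr (xi 1 5))) = _
  rw [ip_resid_restr (by norm_num) (by norm_num), ip_xi_0_2, ip_xi_5_2, ip_xi_0_3, ip_xi_5_3]
  norm_num
theorem ip_c12 : ip (cfun 1) (cfun 2) = 1 / 160 := by
  change ip (resid _ (restr (xi 1 1))) (resid _ (restr (xi 1 4))) = _
  rw [ip_resid_restr (by norm_num) (by norm_num), ip_xi_1_2, ip_xi_4_2, ip_xi_1_3, ip_xi_4_3]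
  norm_num
theorem ip_c13 : ip (cfun 1) (cfun 3) = -1 / 720 := by
  change ip (resid _ (restr (xi 1 1))) (resid _ (restr (xi 1 5))) = _
  rw [ip_resid_restr (by norm_num) (by norm_num), ip_xi_1_2, ip_xi_5_2, ip_xi_1_3, ip_xi_5_3]
  norm_num

end SplineWavelet

end

open MeasureTheory

noncomputable section

set_option synthInstance.maxSize 100000

namespace SplineWavelet

/-! ### Double zeros -/

/-- The functions of class `C¹` with a double zero at `m`. -/
def Z (m : ℝ) : Submodule ℝ (ℝ → ℝ) where
  carrier := {f | ContDiff ℝ 1 f ∧ f m = 0 ∧ deriv f m = 0}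
  add_mem' := by
    rintro f g ⟨hf, hf0, hf1⟩ ⟨hg, hg0, hg1⟩
    refine ⟨hf.add hg, by simp [hf0, hg0], ?_⟩
    rw [deriv_add (hf.differentiable one_ne_zero m) (hg.differentiable one_ne_zero m), hf1, hg1,
      add_zero]
  zero_mem' := ⟨contDiff_const, rfl, by
    have : deriv (0 : ℝ → ℝ) = 0 := by ext x; exact deriv_const x (0 : ℝ)
    rw [this]; rfl⟩
  smul_mem' := by
    rintro c f ⟨hf, hf0, hf1⟩
    refine ⟨contDiff_const.smul hf, by simp [hf0], ?_⟩
    rw [deriv_const_smul _ (hf.differentiable one_ne_zero m), hf1, smul_zero]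

theorem mem_Z_of_zero_on {f : ℝ → ℝ} (hf : ContDiff ℝ 1 f) {a b m : ℝ} (hab : a < b)
    (h : ∀ x ∈ Set.Icc a b, f x = 0) (hm : m = a ∨ m = b) : f ∈ Z m := by
  have hd := hf.differentiable one_ne_zero
  have h' : ∀ x ∈ Set.Icc a b, f x = (0 : Polynomial ℝ).eval x := by simpa using h
  rcases hm with rfl | rfl
  · exact ⟨hf, h _ (Set.left_mem_Icc.2 hab.le), by simpa using deriv_left hd hab h'⟩
  · exact ⟨hf, h _ (Set.right_mem_Icc.2 hab.le), by simpa using deriv_right hd hab h'⟩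

/-- Vanishing on one side of `m` already forces the derivative at `m` to vanish, since for a C¹
function it can be computed from that side. -/
theorem mem_Z_of_supp {f : ℝ → ℝ} (hf : ContDiff ℝ 1 f) {a b m : ℝ} (hs : f ∈ SuppIn a b)
    (hm : m ≤ a ∨ b ≤ m) : f ∈ Z m := by
  rcases hm with h | h
  · exact mem_Z_of_zero_on hf (a := m - 1) (b := m) (by linarith)
      (fun x hx => SuppIn.eq_zero_left hs hf.continuous (hx.2.trans h)) (Or.inr rfl)
  · exact mem_Z_of_zero_on hf (a := m) (b := m + 1) (by linarith)
      (fun x hx => SuppIn.eq_zero_right hs hf.continuous (h.trans hx.1)) (Or.inl rfl)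

/-! ### Translates of generators with support in `[-1, 1]` -/

theorem dil_one_dil_one (a b : ℝ) (f : ℝ → ℝ) : dil 1 a (dil 1 b f) = dil 1 (a + b) f := by
  ext x; simp only [dil_eq]; congr 1; ring

theorem dil_one_zero (f : ℝ → ℝ) : dil 1 0 f = f := by
  ext x; simp [dil_eq]

theorem ip_dil_one (c : ℝ) (f g : ℝ → ℝ) : ip (dil 1 c f) (dil 1 c g) = ip f g := by
  rw [ip_dil]; simp

theorem ip_dil_one_left (c : ℝ) (f g : ℝ → ℝ) : ip (dil 1 c f) g = ip f (dil 1 (-c) g) := by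
  rw [← ip_dil_one (-c), dil_one_dil_one, neg_add_cancel, dil_one_zero]

theorem dil_one_supp {a b c : ℝ} {f : ℝ → ℝ} (hf : f ∈ SuppIn a b) :
    dil 1 c f ∈ SuppIn (a + c) (b + c) :=
  dil_mem_SuppIn hf one_pos (by ring) (by ring)

theorem continuous_dil {f : ℝ → ℝ} (hf : Continuous f) (a c : ℝ) : Continuous (dil a c f) :=
  hf.comp (by fun_prop)

/-- Supports in [-1,1] meet in at most one point after a shift by 2 or more, so only the shifts 0
and 1 have to be checked. -/
theorem on_translates {n : ℕ} {g : Fin n → ℝ → ℝ} (hL : ∀ i, IsL2 (g i))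
    (hc : ∀ i, Continuous (g i)) (hs : ∀ i, g i ∈ SuppIn (-1) 1)
    (h0 : ∀ i j, ip (g i) (g j) = if i = j then 1 else 0)
    (h1 : ∀ i j, ip (g i) (dil 1 1 (g j)) = 0) :
    ON (fun p : Fin n × ℤ => dil 1 p.2 (g p.1)) where
  l2 p := inferInstance
  ip_eq := by
    have key : ∀ (i j : Fin n) (m : ℤ), 1 ≤ m → ip (g i) (dil 1 m (g j)) = 0 := by
      intro i j m hm
      rcases eq_or_lt_of_le hm with rfl | hm
      · simpa using h1 i j
      · have hm' : (2 : ℝ) ≤ m := by exact_mod_cast hm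
        exact ip_eq_zero_of_supp (hs i) (dil_one_supp (hs j)) (hc i) (by linarith)
    rintro ⟨i, k⟩ ⟨j, l⟩
    simp only [Prod.mk.injEq]
    rcases lt_trichotomy k l with h | rfl | h
    · rw [if_neg (by rintro ⟨_, rfl⟩; exact lt_irrefl _ h), ← ip_dil_one (-(k : ℝ)),
        dil_one_dil_one, dil_one_dil_one, neg_add_cancel, dil_one_zero, neg_add_eq_sub]
      exact_mod_cast key i j (l - k) (by omega)
    · rw [ip_dil_one, h0]; simp
    · rw [if_neg (by rintro ⟨_, rfl⟩; exact lt_irrefl _ h), ← ip_dil_one (-(l : ℝ)),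
        dil_one_dil_one, dil_one_dil_one, neg_add_cancel, dil_one_zero, ip_comm,
        neg_add_eq_sub]
      exact_mod_cast key j i (k - l) (by omega)

/-! ### Null space bases -/

/-- The kernel of a matrix of inner products consists of the coefficient vectors whose combinations
of the column functions are orthogonal to all row functions. `IsNullBasis.mem_span` is the converse.
-/
theorem ip_lincomb_of_nullBasis {m : Type} {k n : ℕ} {r : m → ℝ → ℝ} {f : Fin n → ℝ → ℝ}
    [∀ i, IsL2 (r i)] [∀ i, IsL2 (f i)] {b : Fin k → Fin n → ℝ}
    (hb : IsNullBasis (Matrix.of fun i j => ip (r i) (f j)) b) (i : m) (l : Fin k) :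
    ip (r i) (lincomb (b l) f) = 0 := by
  have h1 : b l ∈ LinearMap.ker (Matrix.of fun i j => ip (r i) (f j)).mulVecLin := by
    rw [← hb.2]; exact Submodule.subset_span ⟨l, rfl⟩
  have h2 := congrFun (LinearMap.mem_ker.1 h1) i
  rw [ip_lincomb_right]
  simp only [Matrix.mulVecLin_apply, Matrix.mulVec, dotProduct, Matrix.of_apply,
    Pi.zero_apply] at h2
  rw [← h2]
  exact Finset.sum_congr rfl fun j _ => mul_comm _ _

theorem lincomb_linearIndependent {k n : ℕ} {f : Fin n → ℝ → ℝ} {b : Fin k → Fin n → ℝ}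
    (hb : LinearIndependent ℝ b) (hf : LinearIndependent ℝ f) :
    LinearIndependent ℝ fun i => lincomb (b i) f := by
  have h := hb.map' (Fintype.linearCombination ℝ f)
    (LinearMap.ker_eq_bot.2 hf.fintypeLinearCombination_injective)
  have e : (fun i => lincomb (b i) f) = Fintype.linearCombination ℝ f ∘ b := by
    ext i x
    simp [lincomb_eq, Fintype.linearCombination_apply]
  rwa [e]

/-! ### The functions `ξ_{2,j}` -/

theorem xiLevel2_mem (j : Fin 6) : xiLevel2 j ∈ Sp 2 := xi_mem 2 _

instance (j : Fin 6) : IsL2 (xiLevel2 j) := by unfold xiLevel2; infer_instance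

theorem xiLevel2_supp (j : Fin 6) : xiLevel2 j ∈ SuppIn 0 1 := by
  have h1 : 1 ≤ (((j : ℕ) : ℤ) + 2) / 2 := by omega
  have h2 : (((j : ℕ) : ℤ) + 2) / 2 ≤ 3 := by omega
  refine SuppIn_mono ?_ ?_ (xi_supp 2 _)
  · have : (1 : ℝ) ≤ ((((j : ℕ) : ℤ) + 2) / 2 : ℤ) := by exact_mod_cast h1
    apply div_nonneg <;> linarith
  · have : ((((j : ℕ) : ℤ) + 2) / 2 : ℤ) ≤ (3 : ℝ) := by exact_mod_cast h2
    rw [div_le_one (by norm_num)]; linarith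

/-- Hermite data of linear combinations of the functions `ξ_{2,j}`. -/
def levelTwoData (x : Fin 6 → ℝ) (c : ℕ) : Fin 4 → ℝ :=
  match c with
  | 0 => (2 : ℝ) • ![0, 0, x 0, x 1]
  | 1 => (2 : ℝ) • ![x 0, x 1, x 2, x 3]
  | 2 => (2 : ℝ) • ![x 2, x 3, x 4, x 5]
  | 3 => (2 : ℝ) • ![x 4, x 5, 0, 0]
  | _ => 0

theorem lincomb_xiLevel2_hdata (x : Fin 6 → ℝ) :
    HData 4 (lincomb x xiLevel2) (levelTwoData x) := by
  intro c hc t ht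
  have h := fun n : ℤ => xi_hdata 2 n c (by simpa using hc) t ht
  have e : ((2 ^ 2 : ℕ) : ℝ) = (4 : ℕ) := by norm_num
  simp only [e] at h
  simp only [lincomb, xiLevel2, h, Fin.sum_univ_six]
  interval_cases c <;>
  · simp [xiData, levelTwoData, herm]
    ring

theorem xiLevel2_linearIndependent : LinearIndependent ℝ xiLevel2 := by
  rw [Fintype.linearIndependent_iff]
  intro x hx
  have h0 : lincomb x xiLevel2 = 0 := by rw [lincomb_eq, hx]
  have key := fun c hc t ht => lincomb_xiLevel2_hdata x c hc t ht
  simp only [h0, Pi.zero_apply] at key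
  -- Values at the interior nodes give the even-indexed coefficients; the midpoint values of three
  -- cells then determine the slope coefficients.
  have a1 := key 0 (by norm_num) 1 (by norm_num)
  have a2 := key 1 (by norm_num) 1 (by norm_num)
  have a3 := key 2 (by norm_num) 1 (by norm_num)
  have b1 := key 0 (by norm_num) (1 / 2) (by norm_num)
  have b2 := key 1 (by norm_num) (1 / 2) (by norm_num)
  have b3 := key 3 (by norm_num) (1 / 2) (by norm_num)
  simp [levelTwoData, herm] at a1 a2 a3 b1 b2 b3
  norm_num at a1 a2 a3 b1 b2 b3
  intro i
  fin_cases i <;> simp <;> linarith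

/-! ### A step of the Gram-Schmidt process for independent continuous functions -/

/-- A null residual is zero by continuity, which would place `f` in every subspace containing the `g
i`. The subspace `U` is free: a span in `v_on`, and spaces of functions with a zero or a flat
tangent at 0 for φ₅ and φ₆. -/
theorem resid_ip_ne_zero {n : ℕ} {g : Fin n → ℝ → ℝ} {f : ℝ → ℝ} [∀ i, IsL2 (g i)] [IsL2 f]
    (hg : ∀ i, Continuous (g i)) (hf : Continuous f) {U : Submodule ℝ (ℝ → ℝ)}
    (hU : ∀ i, g i ∈ U) (h : f ∉ U) : ip (resid g f) (resid g f) ≠ 0 := by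
  intro h0
  have hc : Continuous (resid g f) := by
    unfold resid
    exact hf.sub (continuous_finsetSum _ fun i _ => continuous_const.mul (hg i))
  have := eq_zero_of_ip_self _ h0 hc
  exact h (mem_of_resid_mem (g := g) (by rw [this]; exact U.zero_mem) hU)

theorem ON.gs_step {n : ℕ} {g : Fin n → ℝ → ℝ} (hg : ON g) {f : ℝ → ℝ} [IsL2 f]
    (hgc : ∀ i, Continuous (g i)) (hf : Continuous f) {U : Submodule ℝ (ℝ → ℝ)}
    (hU : ∀ i, g i ∈ U) (h : f ∉ U) {g' : Fin (n + 1) → ℝ → ℝ}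
    (hg' : ∀ i : Fin n, g' i.castSucc = g i) (hl : g' (Fin.last n) = normalize (resid g f)) :
    ON g' := by
  have := hg.l2
  exact hg.snoc (resid_ip_ne_zero hgc hf hU h) (resid_ip hg f) hg' hl

namespace ScalingChoice

variable (A : ScalingChoice)

instance (i : Fin 4) : IsL2 (A.w i) := by unfold w; infer_instance
instance : IsL2 A.v1 := by unfold v1; infer_instance
instance : IsL2 A.v2 := by unfold v2; infer_instance
instance : IsL2 A.v3 := by unfold v3; infer_instance
instance : IsL2 A.v4 := by unfold v4; infer_instance
instance : IsL2 A.phi3 := by unfold phi3; infer_instance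
instance : IsL2 A.phi4 := by unfold phi4; infer_instance
instance : IsL2 A.phi5 := by unfold phi5; infer_instance
instance : IsL2 A.phi6 := by unfold phi6; infer_instance
instance (i : Fin 6) : IsL2 (A.phi i) := by unfold phi; infer_instance

/-- The functions `v₁, …, v₄`. -/
def v : Fin 4 → ℝ → ℝ := ![A.v1, A.v2, A.v3, A.v4]

instance (i : Fin 4) : IsL2 (A.v i) := by unfold v; infer_instance

/-- Triangularity of the Gram-Schmidt process, phrased for an arbitrary subspace, so that
smoothness, support, orthogonality to φ₁, φ₂ and the span of the first few `w i` are all covered by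
one statement. -/
theorem v_mem_of_w_mem {U : Submodule ℝ (ℝ → ℝ)} (k : Fin 4) (hU : ∀ i ≤ k, A.w i ∈ U) :
    A.v k ∈ U := by
  have h1 : A.v1 ∈ U := normalize_mem (hU 0 (Fin.zero_le _))
  have h2 : 1 ≤ k → A.v2 ∈ U := fun h => normalize_mem (resid_mem (hU 1 h) fun i => by
    fin_cases i; exact h1)
  have h3 : 2 ≤ k → A.v3 ∈ U := fun h => by
    have h' := h2 (le_trans (by decide) h)
    refine normalize_mem (resid_mem (hU 2 h) fun i => ?_)
    fin_cases i
    exacts [h1, h']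
  have h4 : 3 ≤ k → A.v4 ∈ U := fun h => by
    have h' := h2 (le_trans (by decide) h)
    have h'' := h3 (le_trans (by decide) h)
    refine normalize_mem (resid_mem (hU 3 h) fun i => ?_)
    fin_cases i
    exacts [h1, h', h'']
  fin_cases k
  exacts [h1, h2 le_rfl, h3 le_rfl, h4 le_rfl]

theorem w_mem_Sp (i : Fin 4) : A.w i ∈ Sp 2 := lincomb_mem xiLevel2_mem
theorem v_mem_Sp (i : Fin 4) : A.v i ∈ Sp 2 := A.v_mem_of_w_mem i fun j _ => A.w_mem_Sp j
theorem v_supp (i : Fin 4) : A.v i ∈ SuppIn 0 1 :=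
  A.v_mem_of_w_mem i fun _ _ => lincomb_mem xiLevel2_supp

section NullBasis

variable {A} (hA : IsNullBasis matC A.b)

include hA

theorem w_linearIndependent : LinearIndependent ℝ A.w :=
  lincomb_linearIndependent hA.1 xiLevel2_linearIndependent

/-- By triangularity the earlier `v i` lie in the span of the earlier `w i`, which misses `w k` by
independence, so no residual is null. The second part inverts the triangular change of basis. -/
theorem v_on : ON A.v ∧ ∀ i, A.w i ∈ Submodule.span ℝ (Set.range A.v) := by
  have hw := w_linearIndependent hA
  have hwc : ∀ i, Continuous (A.w i) := fun i => (A.w_mem_Sp i).1.continuous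
  have hvc : ∀ i, Continuous (A.v i) := fun i => (A.v_mem_Sp i).1.continuous
  have hn : ∀ k : Fin 4, A.w k ∉ Submodule.span ℝ (A.w '' {i | i < k}) := fun k =>
    hw.notMem_span_image (lt_irrefl k)
  have hv : ∀ i k : Fin 4, i < k → A.v i ∈ Submodule.span ℝ (A.w '' {i | i < k}) :=
    fun i k hik => A.v_mem_of_w_mem i fun j hj =>
      Submodule.subset_span ⟨j, lt_of_le_of_lt hj hik, rfl⟩
  have g1 : ON ![A.v1] := by
    refine ON.single fun h0 => hn 0 ?_
    rw [eq_zero_of_ip_self _ h0 (hwc 0)]; exact Submodule.zero_mem _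
  have n1 : ip (A.w 0) (A.w 0) ≠ 0 := fun h0 => hn 0 (by
    rw [eq_zero_of_ip_self _ h0 (hwc 0)]; exact Submodule.zero_mem _)
  have c2 : ∀ i : Fin 1, (![A.v1] i) ∈ Submodule.span ℝ (A.w '' {i | i < 1}) := fun i => by
    fin_cases i; exact hv 0 1 (by decide)
  have c3 : ∀ i : Fin 2, (![A.v1, A.v2] i) ∈ Submodule.span ℝ (A.w '' {i | i < 2}) :=
    fun i => by
      fin_cases i
      exacts [hv 0 2 (by decide), hv 1 2 (by decide)]
  have c4 : ∀ i : Fin 3, (![A.v1, A.v2, A.v3] i) ∈ Submodule.span ℝ (A.w '' {i | i < 3}) :=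
    fun i => by
      fin_cases i
      exacts [hv 0 3 (by decide), hv 1 3 (by decide), hv 2 3 (by decide)]
  have d2 : ∀ i : Fin 1, Continuous (![A.v1] i) := fun i => by fin_cases i; exact hvc 0
  have d3 : ∀ i : Fin 2, Continuous (![A.v1, A.v2] i) := fun i => by
    fin_cases i
    exacts [hvc 0, hvc 1]
  have d4 : ∀ i : Fin 3, Continuous (![A.v1, A.v2, A.v3] i) := fun i => by
    fin_cases i
    exacts [hvc 0, hvc 1, hvc 2]
  have n2 := resid_ip_ne_zero d2 (hwc 1) c2 (hn 1)
  have n3 := resid_ip_ne_zero d3 (hwc 2) c3 (hn 2)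
  have n4 := resid_ip_ne_zero d4 (hwc 3) c4 (hn 3)
  have g2 : ON ![A.v1, A.v2] :=
    g1.gs_step d2 (hwc 1) c2 (hn 1) (fun i => by fin_cases i; rfl) rfl
  have g3 : ON ![A.v1, A.v2, A.v3] :=
    g2.gs_step d3 (hwc 2) c3 (hn 2) (fun i => by fin_cases i <;> rfl) rfl
  refine ⟨g3.gs_step d4 (hwc 3) c4 (hn 3) (fun i => by fin_cases i <;> rfl) rfl, fun i => ?_⟩
  have m : ∀ i, A.v i ∈ Submodule.span ℝ (Set.range A.v) := fun i =>
    Submodule.subset_span ⟨i, rfl⟩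
  fin_cases i
  · exact mem_of_normalize_mem n1 (m 0)
  · refine mem_of_resid_mem (mem_of_normalize_mem n2 (m 1)) fun i => ?_
    fin_cases i; exact m 0
  · refine mem_of_resid_mem (mem_of_normalize_mem n3 (m 2)) fun i => ?_
    fin_cases i
    exacts [m 0, m 1]
  · refine mem_of_resid_mem (mem_of_normalize_mem n4 (m 3)) fun i => ?_
    fin_cases i
    exacts [m 0, m 1, m 2]

theorem ip_phi12_w (i : Fin 4) : ip phi1 (A.w i) = 0 ∧ ip phi2 (A.w i) = 0 := by
  have h := fun k : Fin 2 => ip_lincomb_of_nullBasis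
    (r := fun i : Fin 2 => xi 1 ((i : ℤ) + 2)) (f := xiLevel2) hA k i
  constructor
  · rw [phi1, ip_normalize_left]
    exact mul_eq_zero_of_right _ (h 0)
  · rw [phi2, ip_normalize_left]
    exact mul_eq_zero_of_right _ (h 1)

theorem ip_phi12_v (i : Fin 4) : ip phi1 (A.v i) = 0 ∧ ip phi2 (A.v i) = 0 := by
  have h1 : A.v i ∈ perp {phi1} := A.v_mem_of_w_mem i fun j _ =>
    ⟨inferInstance, by rintro _ rfl _; rw [ip_comm]; exact (ip_phi12_w hA j).1⟩
  have h2 : A.v i ∈ perp {phi2} := A.v_mem_of_w_mem i fun j _ =>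
    ⟨inferInstance, by rintro _ rfl _; rw [ip_comm]; exact (ip_phi12_w hA j).2⟩
  exact ⟨by rw [ip_comm]; exact h1.2 _ rfl inferInstance,
    by rw [ip_comm]; exact h2.2 _ rfl inferInstance⟩

end NullBasis

theorem phi3_eq : A.phi3 = lincomb (A.s 0) A.v := rfl
theorem phi4_eq : A.phi4 = lincomb (A.s 1) A.v := rfl

/-- The generators with support in `[0, 1]`. -/
def short : Fin 4 → ℝ → ℝ := ![phi1, phi2, A.phi3, A.phi4]

instance (i : Fin 4) : IsL2 (A.short i) := by unfold short; infer_instance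

theorem short_mem_Sp (i : Fin 4) : A.short i ∈ Sp 2 := by
  fin_cases i
  · exact Sp_le_succ 1 phi1_mem
  · exact Sp_le_succ 1 phi2_mem
  · exact lincomb_mem A.v_mem_Sp
  · exact lincomb_mem A.v_mem_Sp

theorem short_supp (i : Fin 4) : A.short i ∈ SuppIn 0 1 := by
  fin_cases i
  · exact phi1_supp
  · exact phi2_supp
  · exact lincomb_mem A.v_supp
  · exact lincomb_mem A.v_supp

theorem ip_lincomb_on {n : ℕ} {g : Fin n → ℝ → ℝ} (hg : ON g) (c d : Fin n → ℝ) :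
    ip (lincomb c g) (lincomb d g) = ∑ i, c i * d i := by
  have := hg.l2
  rw [ip_lincomb_right, lincomb_eq]
  simp only [hg.ip_sum_smul]
  exact Finset.sum_congr rfl fun i _ => mul_comm _ _

variable {A} (hA : A.Admissible)

include hA

theorem on_phi34 : ON ![A.phi3, A.phi4] where
  l2 := inferInstance
  ip_eq i j := by
    have h := ip_lincomb_on (v_on hA.null_b).1
    have h1 : ∀ i, ∑ j, A.s i j * A.s i j = 1 := fun i => by
      rw [← hA.unit_s i]; exact Finset.sum_congr rfl fun j _ => (sq _).symm
    fin_cases i <;> fin_cases j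
    · exact (h _ _).trans (h1 0)
    · exact (h _ _).trans hA.orth_s
    · exact (h _ _).trans ((Finset.sum_congr rfl fun j _ => mul_comm _ _).trans hA.orth_s)
    · exact (h _ _).trans (h1 1)

theorem ip_phi12_phi34 (i j : Fin 2) : ip (![phi1, phi2] i) (![A.phi3, A.phi4] j) = 0 := by
  have h : ∀ c : Fin 4 → ℝ, ip phi1 (lincomb c A.v) = 0 ∧ ip phi2 (lincomb c A.v) = 0 := by
    intro c
    rw [ip_lincomb_right, ip_lincomb_right]
    simp [fun i => (ip_phi12_v hA.null_b i).1, fun i => (ip_phi12_v hA.null_b i).2]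
  fin_cases i <;> fin_cases j
  exacts [(h _).1, (h _).1, (h _).2, (h _).2]

theorem short_on : ON A.short where
  l2 := inferInstance
  ip_eq i j := by
    have h1 := on_phi12.ip_eq
    have h2 := (on_phi34 hA).ip_eq
    have h3 := ip_phi12_phi34 hA
    have h4 := fun i j => (ip_comm _ _).trans (h3 i j)
    fin_cases i <;> fin_cases j
    exacts [h1 0 0, h1 0 1, h3 0 0, h3 0 1, h1 1 0, h1 1 1, h3 1 0, h3 1 1,
      h4 0 0, h4 1 0, h2 0 0, h2 0 1, h4 0 1, h4 1 1, h2 1 0, h2 1 1]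

end ScalingChoice

/-! ### One-sided functions on [0,1] and their residuals -/

/-- The functions whose residuals are the functions `cfun`. -/
def zeta : Fin 4 → ℝ → ℝ :=
  ![restr (xi 1 0), restr (xi 1 1), restr (xi 1 4), restr (xi 1 5)]

instance (i : Fin 4) : IsL2 (zeta i) := by unfold zeta; infer_instance

theorem cfun_eq (i : Fin 4) : cfun i = resid ![phi1, phi2] (zeta i) := by
  fin_cases i <;> rfl

theorem ip_phi12_cfun (i : Fin 2) (k : Fin 4) : ip (![phi1, phi2] i) (cfun k) = 0 := by
  rw [cfun_eq, ip_comm, resid_ip on_phi12]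

theorem ip_zeta_cfun (i k : Fin 4) : ip (zeta i) (cfun k) = ip (cfun i) (cfun k) := by
  rw [cfun_eq i, resid_ip_right on_phi12]
  intro i; rw [ip_comm]; exact ip_phi12_cfun i k

namespace ScalingChoice

variable (A : ScalingChoice)

/-- The residual of `cfun i` with respect to `φ₃, φ₄`. -/
def ct (i : Fin 4) : ℝ → ℝ := resid ![A.phi3, A.phi4] (cfun i)

instance (i : Fin 4) : IsL2 (A.ct i) := by unfold ct; infer_instance

variable {A} (hA : A.Admissible)

include hA

theorem ip_short_ct (i k : Fin 4) : ip (A.short i) (A.ct k) = 0 := by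
  have h1 : ∀ i, ip (![A.phi3, A.phi4] i) (A.ct k) = 0 := fun i => by
    rw [ct, ip_comm, resid_ip (on_phi34 hA)]
  have h2 : ∀ i, ip (![phi1, phi2] i) (A.ct k) = 0 := fun i => by
    rw [ct, ip_comm, resid_ip_right (on_phi34 hA), ip_comm, ip_phi12_cfun]
    intro j; exact ip_phi12_phi34 hA i j
  fin_cases i
  exacts [h2 0, h2 1, h1 0, h1 1]

/-- The functions `ct k`, `cfun k` and `zeta k` differ by combinations of φ₁, …, φ₄ only, which a
function orthogonal to these generators does not see. -/
theorem ip_ct_right {g : ℝ → ℝ} [IsL2 g] (hg : ∀ i, ip g (A.short i) = 0) (k : Fin 4) :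
    ip g (A.ct k) = ip g (cfun k) ∧ ip g (A.ct k) = ip g (zeta k) := by
  have h1 : ip g (A.ct k) = ip g (cfun k) := by
    rw [ct, ip_comm, resid_ip_right (on_phi34 hA), ip_comm]
    intro i; fin_cases i
    exacts [hg 2, hg 3]
  refine ⟨h1, h1.trans ?_⟩
  rw [cfun_eq, ip_comm, resid_ip_right on_phi12, ip_comm]
  intro i; fin_cases i
  exacts [hg 0, hg 1]

theorem ip_zeta_ct (i k : Fin 4) : ip (zeta i) (A.ct k) = ip (A.ct i) (A.ct k) := by
  have h := ip_short_ct hA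
  have h' : ∀ i, ip (A.ct k) (A.short i) = 0 := fun i => (ip_comm _ _).trans (h i k)
  rw [ip_comm, ← (ip_ct_right hA h' i).2, ip_comm]

theorem ip_ct_ct {i k : Fin 4} (hik : i ≤ 1 ∧ 2 ≤ k ∨ k ≤ 1 ∧ 2 ≤ i) :
    ip (A.ct i) (A.ct k) = 0 := by
  have h : ∀ i k : Fin 4, i ≤ 1 → 2 ≤ k → ip (A.ct i) (A.ct k) = 0 := by
    intro i k hi hk
    refine hA.orth_c i ?_ k ?_
    · fin_cases i <;> simp_all
    · fin_cases k <;> simp_all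
  rcases hik with ⟨h1, h2⟩ | ⟨h1, h2⟩
  · exact h i k h1 h2
  · rw [ip_comm]; exact h k i h1 h2

omit hA in
variable (A) in
/-- The span of the functions `ζ i`, `i ∈ s`, and the generators with support in `[0, 1]`. -/
def side (s : Set (Fin 4)) : Submodule ℝ (ℝ → ℝ) :=
  Submodule.span ℝ (zeta '' s ∪ Set.range A.short)

theorem ip_side_ct {s : Set (Fin 4)} {k : Fin 4} (hs : ∀ i ∈ s, i ≤ 1 ∧ 2 ≤ k ∨ k ≤ 1 ∧ 2 ≤ i)
    {g : ℝ → ℝ} (hg : g ∈ A.side s) : ip g (A.ct k) = 0 := by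
  refine ip_eq_zero_of_mem_span_left ?_ ?_ hg
  · rintro _ (⟨i, _, rfl⟩ | ⟨i, rfl⟩) <;> infer_instance
  · rintro _ (⟨i, hi, rfl⟩ | ⟨i, rfl⟩)
    · rw [ip_zeta_ct hA, ip_ct_ct hA (hs i hi)]
    · exact ip_short_ct hA i k

/-- This is the mechanism behind the choice of φ₃, φ₄. As `g` is orthogonal to φ₁, …, φ₄, each
right-hand `zeta k` may be replaced by its residual `ct k`, which is orthogonal to the whole left
side by admissibility. -/
theorem ip_side_side {g h : ℝ → ℝ} (hg : g ∈ A.side {0, 1}) (hh : h ∈ A.side {2, 3})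
    (hgs : ∀ i, ip g (A.short i) = 0) : ip g h = 0 := by
  have hL : ∀ s, ∀ f ∈ zeta '' s ∪ Set.range A.short, IsL2 f := by
    rintro s _ (⟨i, _, rfl⟩ | ⟨i, rfl⟩) <;> infer_instance
  have : IsL2 g := isL2_of_mem_span (hL _) hg
  refine ip_eq_zero_of_mem_span_right (hL _) ?_ hh
  rintro _ (⟨k, hk, rfl⟩ | ⟨i, rfl⟩)
  · rw [← (ip_ct_right hA hgs k).2]
    refine ip_side_ct hA (fun i hi => Or.inl ⟨?_, ?_⟩) hg
    · rcases hi with rfl | rfl <;> decide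
    · rcases hk with rfl | rfl <;> decide
  · exact hgs i

/-- Pairing `g` with c₃ and c₄ gives zero by the previous mechanism. On the other hand φ₁, φ₂ are
orthogonal to these functions, so the pairings are two linear equations in `a`, `b` with the
invertible matrix of the ⟨cᵢ,cₖ⟩. It matters that φ₃ and φ₄ do not occur in `g`. -/
theorem coeff_eq_zero_left {a b c d : ℝ} {g : ℝ → ℝ}
    (hg : g = a • zeta 0 + b • zeta 1 + c • phi1 + d • phi2)
    (hgs : ∀ i, ip g (A.short i) = 0) : a = 0 ∧ b = 0 := by
  have : IsL2 g := by rw [hg]; infer_instance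
  have hmem : g ∈ A.side {0, 1} := by
    have hz : ∀ i ∈ ({0, 1} : Set (Fin 4)), zeta i ∈ A.side {0, 1} := fun i hi =>
      Submodule.subset_span (Or.inl ⟨i, hi, rfl⟩)
    have hs : ∀ i, A.short i ∈ A.side {0, 1} := fun i =>
      Submodule.subset_span (Or.inr ⟨i, rfl⟩)
    rw [hg]
    refine Submodule.add_mem _ (Submodule.add_mem _ (Submodule.add_mem _ ?_ ?_) ?_) ?_
    exacts [Submodule.smul_mem _ _ (hz 0 (by simp)), Submodule.smul_mem _ _ (hz 1 (by simp)),
      Submodule.smul_mem _ _ (hs 0), Submodule.smul_mem _ _ (hs 1)]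
  have key : ∀ k : Fin 4, 2 ≤ k → a * ip (cfun 0) (cfun k) + b * ip (cfun 1) (cfun k) = 0 := by
    intro k hk
    have h1 : ip g (cfun k) = 0 := by
      rw [← (ip_ct_right hA hgs k).1]
      refine ip_side_ct hA (fun i hi => Or.inl ⟨?_, hk⟩) hmem
      rcases hi with rfl | rfl <;> decide
    have h2 := ip_phi12_cfun 0 k
    have h3 := ip_phi12_cfun 1 k
    simp only [Matrix.cons_val_zero, Matrix.cons_val_one] at h2 h3
    rw [hg, ip_add_left, ip_add_left, ip_add_left, ip_smul_left, ip_smul_left, ip_smul_left,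
      ip_smul_left, ip_zeta_cfun, ip_zeta_cfun, h2, h3] at h1
    linarith
  have k2 := key 2 (by decide)
  have k3 := key 3 (by decide)
  rw [ip_c02, ip_c12] at k2
  rw [ip_c03, ip_c13] at k3
  constructor <;> linarith

theorem coeff_eq_zero_right {a b c d : ℝ} {g : ℝ → ℝ}
    (hg : g = a • zeta 2 + b • zeta 3 + c • phi1 + d • phi2)
    (hgs : ∀ i, ip g (A.short i) = 0) : a = 0 ∧ b = 0 := by
  have : IsL2 g := by rw [hg]; infer_instance
  have hmem : g ∈ A.side {2, 3} := by
    have hz : ∀ i ∈ ({2, 3} : Set (Fin 4)), zeta i ∈ A.side {2, 3} := fun i hi =>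
      Submodule.subset_span (Or.inl ⟨i, hi, rfl⟩)
    have hs : ∀ i, A.short i ∈ A.side {2, 3} := fun i =>
      Submodule.subset_span (Or.inr ⟨i, rfl⟩)
    rw [hg]
    refine Submodule.add_mem _ (Submodule.add_mem _ (Submodule.add_mem _ ?_ ?_) ?_) ?_
    exacts [Submodule.smul_mem _ _ (hz 2 (by simp)), Submodule.smul_mem _ _ (hz 3 (by simp)),
      Submodule.smul_mem _ _ (hs 0), Submodule.smul_mem _ _ (hs 1)]
  have key : ∀ k : Fin 4, k ≤ 1 → a * ip (cfun k) (cfun 2) + b * ip (cfun k) (cfun 3) = 0 := by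
    intro k hk
    have h1 : ip g (cfun k) = 0 := by
      rw [← (ip_ct_right hA hgs k).1]
      refine ip_side_ct hA (fun i hi => Or.inr ⟨hk, ?_⟩) hmem
      rcases hi with rfl | rfl <;> decide
    have h2 := ip_phi12_cfun 0 k
    have h3 := ip_phi12_cfun 1 k
    simp only [Matrix.cons_val_zero, Matrix.cons_val_one] at h2 h3
    rw [hg, ip_add_left, ip_add_left, ip_add_left, ip_smul_left, ip_smul_left, ip_smul_left,
      ip_smul_left, ip_zeta_cfun, ip_zeta_cfun, h2, h3] at h1
    rw [ip_comm (cfun k) (cfun 2), ip_comm (cfun k) (cfun 3)]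
    linarith
  have k2 := key 0 (by decide)
  have k3 := key 1 (by decide)
  rw [ip_c02, ip_c03] at k2
  rw [ip_c12, ip_c13] at k3
  constructor <;> linarith

end ScalingChoice

end SplineWavelet

end

/-! ### The generators supported in [-1,1] and orthonormality of all translates -/

open MeasureTheory

noncomputable section

set_option synthInstance.maxSize 100000

namespace SplineWavelet

/-- Members of the family with zero coefficient need not lie in `U`. This is needed for φ₆, whose
definition mentions φ₅(· + 1), a function that may reach outside [-1,1]. -/
theorem resid_mem' {U : Submodule ℝ (ℝ → ℝ)} {n : ℕ} {g : Fin n → ℝ → ℝ} {f : ℝ → ℝ} (h : f ∈ U)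
    (hg : ∀ i, ip f (g i) = 0 ∨ g i ∈ U) : resid g f ∈ U := by
  rw [resid_eq]
  refine U.sub_mem h (U.sum_mem fun i _ => ?_)
  rcases hg i with h | h
  · rw [h, zero_smul]; exact U.zero_mem
  · exact U.smul_mem _ h

theorem shift_mem_Sp {j : ℕ} {f : ℝ → ℝ} (hf : f ∈ Sp j) (m : ℤ) : dil 1 m f ∈ Sp j := by
  simpa using dil_pow_mem_Sp hf 0 m

theorem shift_one_mem_Sp {j : ℕ} {f : ℝ → ℝ} (hf : f ∈ Sp j) :
    dil 1 1 f ∈ Sp j ∧ dil 1 (-1) f ∈ Sp j :=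
  ⟨by simpa using shift_mem_Sp hf 1, by simpa using shift_mem_Sp hf (-1)⟩

theorem restr_eq_zero {a b : ℝ} {f : ℝ → ℝ} (hf : f ∈ SuppIn a b) (hc : Continuous f)
    (h : b ≤ 0 ∨ 1 ≤ a) : restr f = 0 := by
  ext x
  by_cases hx : x ∈ Set.Icc (0 : ℝ) 1
  · rw [restr_of_mem hx]
    rcases h with h | h
    · exact SuppIn.eq_zero_right hf hc (h.trans hx.1)
    · exact SuppIn.eq_zero_left hf hc (hx.2.trans h)
  · exact restr_mem f x hx

theorem ip_restr_restr {f g : ℝ → ℝ} {a b : ℝ} (hf : f ∈ SuppIn a 1) (hg : g ∈ SuppIn 0 b) :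
    ip (restr f) (restr g) = ip f g := by
  refine ip_congr fun x => ?_
  by_cases hx : x ∈ Set.Icc (0 : ℝ) 1
  · rw [restr_of_mem hx, restr_of_mem hx]
  · rw [restr_mem f x hx, zero_mul]
    by_cases hx1 : x ≤ 1
    · rw [hg x fun h => hx ⟨h.1, hx1⟩, mul_zero]
    · rw [hf x fun h => hx1 h.2, zero_mul]

theorem deriv_dil (a c x : ℝ) (f : ℝ → ℝ) (hf : Differentiable ℝ f) :
    deriv (dil a c f) x = a * deriv f (a * x - c) := by
  have h : HasDerivAt (fun x : ℝ => a * x - c) a x := by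
    simpa using ((hasDerivAt_id x).const_mul a).sub_const c
  have := (hf (a * x - c)).hasDerivAt.comp x h
  rw [mul_comm]
  exact this.deriv

theorem dil_mem_Z {f : ℝ → ℝ} {a c m m' : ℝ} (hf : f ∈ Z m) (h : a * m' - c = m) :
    dil a c f ∈ Z m' := by
  refine ⟨hf.1.comp (by fun_prop), ?_, ?_⟩
  · rw [dil_eq, h, hf.2.1]
  · rw [deriv_dil _ _ _ _ (hf.1.differentiable one_ne_zero), h, hf.2.2, mul_zero]

theorem xi1_zero : xi1 0 = 1 ∧ deriv xi1 0 = 0 := by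
  refine ⟨by rw [xi1_right (by simp)]; norm_num, ?_⟩
  rw [deriv_left (xi1_mem.1.differentiable one_ne_zero) one_pos
    (P := (1 - Polynomial.X) ^ 2 * (1 + 2 * Polynomial.X)) fun x hx => by
      rw [xi1_right hx]; simp]
  simp [Polynomial.derivative_pow]

theorem xi2_zero : xi2 0 = 0 ∧ deriv xi2 0 = 1 := by
  refine ⟨by rw [xi2_right (by simp)]; norm_num, ?_⟩
  rw [deriv_left (xi2_mem.1.differentiable one_ne_zero) one_pos
    (P := (1 - Polynomial.X) ^ 2 * Polynomial.X) fun x hx => by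
      rw [xi2_right hx]; simp]
  simp [Polynomial.derivative_pow]

theorem xi_zero (j : ℕ) : xi j 0 0 ≠ 0 ∧ deriv (xi j 0) 0 = 0 ∧ deriv (xi j 1) 0 ≠ 0 := by
  have h := xi_eq j 0
  simp only [mul_zero, zero_add, Int.cast_zero] at h
  have hp : (2 : ℝ) ^ ((j : ℝ) / 2) ≠ 0 := by positivity
  have hp2 : (2 : ℝ) ^ j ≠ 0 := by positivity
  have d1 := xi1_mem.1.differentiable one_ne_zero
  have d2 := xi2_mem.1.differentiable one_ne_zero
  have e1 : Differentiable ℝ (dil (2 ^ j) 0 xi1) := d1.comp (by fun_prop)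
  have e2 : Differentiable ℝ (dil (2 ^ j) 0 xi2) := d2.comp (by fun_prop)
  rw [h.1, h.2, deriv_const_smul _ (e1 0), deriv_const_smul _ (e2 0), deriv_dil _ _ _ _ d1,
    deriv_dil _ _ _ _ d2]
  simp [dil_eq, xi1_zero.1, xi1_zero.2, xi2_zero.2, hp]

/-- The supports leave only the shifts -1, 0 and 1 of the new generator to be checked against the
old ones. -/
theorem snoc_translates {n : ℕ} {g : Fin n → ℝ → ℝ} {f : ℝ → ℝ} {g' : Fin (n + 1) → ℝ → ℝ}
    (hg : ON fun p : Fin n × ℤ => dil 1 p.2 (g p.1)) (hc : ∀ i, Continuous (g' i))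
    (hs : ∀ i, g' i ∈ SuppIn (-1) 1) (hL : ∀ i, IsL2 (g' i))
    (hg' : ∀ i : Fin n, g' i.castSucc = g i) (hl : g' (Fin.last n) = f) (h1 : ip f f = 1)
    (h2 : ip f (dil 1 1 f) = 0) (h3 : ∀ i, ip f (g i) = 0) (h4 : ∀ i, ip f (dil 1 1 (g i)) = 0)
    (h5 : ∀ i, ip f (dil 1 (-1) (g i)) = 0) :
    ON fun p : Fin (n + 1) × ℤ => dil 1 p.2 (g' p.1) := by
  refine on_translates hL hc hs (fun i j => ?_) fun i j => ?_
  · refine Fin.lastCases ?_ (fun i => ?_) i <;> refine Fin.lastCases ?_ (fun j => ?_) j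
    · simp [hl, h1]
    · simp [hl, hg', h3, (Fin.castSucc_lt_last j).ne']
    · rw [ip_comm]; simp [hl, hg', h3, (Fin.castSucc_lt_last i).ne]
    · have := hg.ip_eq (i, 0) (j, 0)
      simpa [hg', dil_one_zero] using this
  · refine Fin.lastCases ?_ (fun i => ?_) i <;> refine Fin.lastCases ?_ (fun j => ?_) j
    · simp [hl, h2]
    · simp [hl, hg', h4]
    · rw [ip_comm, ip_dil_one_left]; simp [hl, hg', h5]
    · have := hg.ip_eq (i, 0) (j, 1)
      simpa [hg', dil_one_zero] using this

namespace ScalingChoice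

variable (A : ScalingChoice)

/-! ### The generators `φ₅` and `φ₆` -/

theorem short_continuous (i : Fin 4) : Continuous (A.short i) := (A.short_mem_Sp i).1.continuous

/-- The functions with respect to which the residual in the definition of `φ₅` is taken. -/
def fam5 : Fin 8 → ℝ → ℝ := ![phi1, phi2, A.phi3, A.phi4,
    dil 1 (-1) phi1, dil 1 (-1) phi2, dil 1 (-1) A.phi3, dil 1 (-1) A.phi4]

theorem phi5_eq : A.phi5 = normalize (resid A.fam5 (xi 1 0)) := rfl

/-- The functions with respect to which the residual in the definition of `φ₆` is taken. -/
def fam6 : Fin 10 → ℝ → ℝ := ![phi1, phi2, A.phi3, A.phi4, A.phi5,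
    dil 1 (-1) phi1, dil 1 (-1) phi2, dil 1 (-1) A.phi3, dil 1 (-1) A.phi4,
    dil 1 (-1) A.phi5]

theorem phi6_eq : A.phi6 = normalize (resid A.fam6 (xi 1 1)) := rfl

theorem fam5_mem {U : Submodule ℝ (ℝ → ℝ)} (h : ∀ i, A.short i ∈ U ∧ dil 1 (-1) (A.short i) ∈ U)
    (i : Fin 8) : A.fam5 i ∈ U := by
  fin_cases i
  exacts [(h 0).1, (h 1).1, (h 2).1, (h 3).1, (h 0).2, (h 1).2, (h 2).2, (h 3).2]

instance (i : Fin 8) : IsL2 (A.fam5 i) := by unfold fam5; infer_instance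
instance (i : Fin 10) : IsL2 (A.fam6 i) := by unfold fam6; infer_instance

/-- Being a normalized residual, φ₅ lies in every subspace containing its ingredients. This is
applied to splines, to supports, and to pullbacks of one-sided spaces under restriction. -/
theorem phi5_mem_of {U : Submodule ℝ (ℝ → ℝ)} (h0 : xi 1 0 ∈ U)
    (h : ∀ i, A.short i ∈ U ∧ dil 1 (-1) (A.short i) ∈ U) : A.phi5 ∈ U :=
  normalize_mem (resid_mem h0 (A.fam5_mem h))

theorem phi6_mem_of {U : Submodule ℝ (ℝ → ℝ)} (h0 : xi 1 1 ∈ U)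
    (h : ∀ i, A.short i ∈ U ∧ dil 1 (-1) (A.short i) ∈ U) (h5 : A.phi5 ∈ U)
    (h5' : ip (xi 1 1) (dil 1 (-1) A.phi5) = 0 ∨ dil 1 (-1) A.phi5 ∈ U) : A.phi6 ∈ U := by
  refine normalize_mem (resid_mem' h0 fun i => ?_)
  fin_cases i
  exacts [Or.inr (h 0).1, Or.inr (h 1).1, Or.inr (h 2).1, Or.inr (h 3).1, Or.inr h5,
    Or.inr (h 0).2, Or.inr (h 1).2, Or.inr (h 2).2, Or.inr (h 3).2, h5']

theorem short_supp' (i : Fin 4) : A.short i ∈ SuppIn (-1) 1 ∧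
    dil 1 (-1) (A.short i) ∈ SuppIn (-1) 1 :=
  ⟨SuppIn_mono (by norm_num) le_rfl (A.short_supp i),
    SuppIn_mono (by norm_num) (by norm_num) (dil_one_supp (A.short_supp i))⟩

theorem xi_10_supp : xi 1 0 ∈ SuppIn (-1) 1 :=
  SuppIn_mono (by norm_num) (by norm_num)
    (xi_supp' 1 0 0 rfl (a := -(1 / 2)) (b := 1 / 2) (by norm_num) (by norm_num))

theorem xi_11_supp : xi 1 1 ∈ SuppIn (-1) 1 :=
  SuppIn_mono (by norm_num) (by norm_num)
    (xi_supp' 1 1 0 rfl (a := -(1 / 2)) (b := 1 / 2) (by norm_num) (by norm_num))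

theorem phi5_mem_Sp : A.phi5 ∈ Sp 2 :=
  A.phi5_mem_of (Sp_le_succ 1 (xi_mem 1 0))
    fun i => ⟨A.short_mem_Sp i, (shift_one_mem_Sp (A.short_mem_Sp i)).2⟩

theorem phi6_mem_Sp : A.phi6 ∈ Sp 2 :=
  A.phi6_mem_of (Sp_le_succ 1 (xi_mem 1 1))
    (fun i => ⟨A.short_mem_Sp i, (shift_one_mem_Sp (A.short_mem_Sp i)).2⟩) A.phi5_mem_Sp
    (Or.inr (shift_one_mem_Sp A.phi5_mem_Sp).2)

theorem phi5_supp : A.phi5 ∈ SuppIn (-1) 1 := A.phi5_mem_of xi_10_supp A.short_supp'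

theorem phi5_continuous : Continuous A.phi5 := A.phi5_mem_Sp.1.continuous
theorem phi6_continuous : Continuous A.phi6 := A.phi6_mem_Sp.1.continuous

theorem short_mem_Z (i : Fin 4) : A.short i ∈ Z 0 ∧ dil 1 (-1) (A.short i) ∈ Z 0 :=
  ⟨mem_Z_of_supp (A.short_mem_Sp i).1 (A.short_supp i) (Or.inl le_rfl),
    mem_Z_of_supp (shift_one_mem_Sp (A.short_mem_Sp i)).2.1 (dil_one_supp (A.short_supp i))
      (Or.inr (by norm_num))⟩

variable {A} (hA : A.Admissible)

include hA

theorem on_short_translates : ON fun p : Fin 4 × ℤ => dil 1 p.2 (A.short p.1) :=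
  on_translates (fun i => inferInstance) A.short_continuous (fun i => (A.short_supp' i).1)
    (short_on hA).ip_eq fun i j =>
      ip_eq_zero_of_supp (A.short_supp i) (dil_one_supp (A.short_supp j)) (A.short_continuous i)
        (by norm_num)

theorem fam5_on : ON A.fam5 := by
  have h : A.fam5 = (fun p : Fin 4 × ℤ => dil 1 p.2 (A.short p.1)) ∘
      ![(0, 0), (1, 0), (2, 0), (3, 0), (0, -1), (1, -1), (2, -1), (3, -1)] := by
    funext i
    fin_cases i <;> simp [fam5, dil_one_zero, short]
  rw [h]
  exact (on_short_translates hA).comp (by decide)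

omit hA in
-- All the subtracted functions have a double zero at 0, while ξ_{1,0} does not vanish there.
theorem resid5_ne_zero : ip (resid A.fam5 (xi 1 0)) (resid A.fam5 (xi 1 0)) ≠ 0 := by
  refine resid_ip_ne_zero (U := Z 0) (fun i => ?_) (xi_mem 1 0).1.continuous
    (A.fam5_mem A.short_mem_Z) fun h => (xi_zero 1).1 h.2.1
  exact (A.fam5_mem (U := Z 0) A.short_mem_Z i).1.continuous

omit hA in
-- Up to a factor φ₅ differs from ξ_{1,0} by a function with a double zero at 0, so it inherits the
-- nonzero value and the zero slope.
theorem phi5_zero : A.phi5 0 ≠ 0 ∧ deriv A.phi5 0 = 0 := by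
  have h : resid A.fam5 (xi 1 0) - xi 1 0 ∈ Z 0 := by
    rw [resid_eq, sub_sub_cancel_left]
    exact Submodule.neg_mem _ (Submodule.sum_mem _ fun i _ =>
      Submodule.smul_mem _ _ (A.fam5_mem A.short_mem_Z i))
  have hd : ContDiff ℝ 1 (resid A.fam5 (xi 1 0)) := by
    have := h.1.add (xi_mem 1 0).1
    simpa using this
  have h0 := h.2.1
  have h1 := h.2.2
  rw [deriv_sub (hd.differentiable one_ne_zero 0)
    ((xi_mem 1 0).1.differentiable one_ne_zero 0), (xi_zero 1).2.1, sub_zero] at h1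
  rw [Pi.sub_apply, sub_eq_zero] at h0
  rw [phi5_eq, normalize_eq, deriv_const_smul _ (hd.differentiable one_ne_zero 0), h1,
    smul_zero, Pi.smul_apply, h0]
  exact ⟨smul_ne_zero (inv_ne_zero (l2norm_ne_zero resid5_ne_zero)) (xi_zero 1).1, rfl⟩

omit hA in
theorem phi5_ip_self : ip A.phi5 A.phi5 = 1 := ip_normalize_self resid5_ne_zero

theorem phi5_ip_fam (i : Fin 8) : ip A.phi5 (A.fam5 i) = 0 := by
  rw [phi5_eq, ip_normalize_left, resid_ip (fam5_on hA), mul_zero]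

theorem phi5_ip_short (i : Fin 4) : ip A.phi5 (A.short i) = 0 ∧
    ip A.phi5 (dil 1 (-1) (A.short i)) = 0 := by
  have h := phi5_ip_fam hA
  fin_cases i
  exacts [⟨h 0, h 4⟩, ⟨h 1, h 5⟩, ⟨h 2, h 6⟩, ⟨h 3, h 7⟩]

omit hA in
theorem restr_short_mem (s : Set (Fin 4)) (i : Fin 4) :
    A.short i ∈ (A.side s).comap restrL ∧
      dil 1 (-1) (A.short i) ∈ (A.side s).comap restrL ∧
      dil 1 1 (A.short i) ∈ (A.side s).comap restrL := by
  refine ⟨?_, ?_, ?_⟩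
  · rw [Submodule.mem_comap, restrL_apply, restr_eq_self (A.short_supp i)]
    exact Submodule.subset_span (Or.inr ⟨i, rfl⟩)
  · rw [Submodule.mem_comap, restrL_apply, restr_eq_zero (dil_one_supp (A.short_supp i))
      (continuous_dil (A.short_continuous i) _ _) (Or.inl (by norm_num))]
    exact Submodule.zero_mem _
  · rw [Submodule.mem_comap, restrL_apply, restr_eq_zero (dil_one_supp (A.short_supp i))
      (continuous_dil (A.short_continuous i) _ _) (Or.inr (by norm_num))]
    exact Submodule.zero_mem _

omit hA in
theorem dil_neg_one_one (f : ℝ → ℝ) : dil 1 1 (dil 1 (-1) f) = f := by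
  rw [dil_one_dil_one, add_neg_cancel, dil_one_zero]

omit hA in
theorem zeta_mem (s : Set (Fin 4)) (i : Fin 4) (hi : i ∈ s) : zeta i ∈ A.side s :=
  Submodule.subset_span (Or.inl ⟨i, hi, rfl⟩)

omit hA in
theorem xi_shift (n : ℤ) : dil 1 1 (xi 1 n) = xi 1 (n + 4) := by
  obtain ⟨k, rfl | rfl⟩ := Int.even_or_odd' n
  · rw [show 2 * k + 4 = 2 * (k + 2) by ring, (xi_eq 1 k).1, (xi_eq 1 (k + 2)).1]
    ext x
    simp only [dil_eq, Pi.smul_apply]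
    congr 2
    push_cast; ring
  · rw [show 2 * k + 1 + 4 = 2 * (k + 2) + 1 by ring, (xi_eq 1 k).2, (xi_eq 1 (k + 2)).2]
    ext x
    simp only [dil_eq, Pi.smul_apply]
    congr 2
    push_cast; ring

omit hA in
theorem phi5_mem_side : restr A.phi5 ∈ A.side {0, 1} :=
  A.phi5_mem_of (U := (A.side {0, 1}).comap restrL) (zeta_mem _ 0 (by simp))
    fun i => ⟨(restr_short_mem _ i).1, (restr_short_mem _ i).2.1⟩

omit hA in
theorem phi5_shift_mem_side : restr (dil 1 1 A.phi5) ∈ A.side {2, 3} := by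
  refine A.phi5_mem_of (U := ((A.side {2, 3}).comap restrL).comap (dilL 1 1)) ?_ fun i => ⟨?_, ?_⟩
  · rw [Submodule.mem_comap, dilL_apply, xi_shift]
    exact zeta_mem _ 2 (by simp)
  · exact (restr_short_mem _ i).2.2
  · rw [Submodule.mem_comap, dilL_apply, dil_neg_one_one]
    exact (restr_short_mem _ i).1

theorem restr_phi5_ip_short (i : Fin 4) : ip (restr A.phi5) (A.short i) = 0 := by
  rw [ip_restr_left _ (A.short_supp i), (phi5_ip_short hA i).1]

/-- The supports overlap in [0,1]. There φ₅ belongs to the left side, since the generators shifted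
by -1 disappear, and φ₅(· - 1) belongs to the right side. -/
theorem phi5_ip_shift : ip A.phi5 (dil 1 1 A.phi5) = 0 := by
  rw [← ip_restr_restr A.phi5_supp (b := 2) (by
    simpa using (dil_one_supp A.phi5_supp (c := 1) |> SuppIn_mono (by norm_num : (0 : ℝ) ≤ _)
      (by norm_num : _ ≤ (2 : ℝ))))]
  exact ip_side_side hA phi5_mem_side phi5_shift_mem_side (restr_phi5_ip_short hA)

omit hA in
variable (A) in
/-- The first five generators. -/
def gen5 : Fin 5 → ℝ → ℝ := ![phi1, phi2, A.phi3, A.phi4, A.phi5]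

theorem on_gen5_translates : ON fun p : Fin 5 × ℤ => dil 1 p.2 (A.gen5 p.1) := by
  refine snoc_translates (on_short_translates hA) (fun i => ?_) (fun i => ?_) (fun i => ?_)
    (fun i => ?_) rfl phi5_ip_self (phi5_ip_shift hA) (fun i => (phi5_ip_short hA i).1)
    (fun i => ?_) (fun i => (phi5_ip_short hA i).2)
  · fin_cases i
    exacts [A.short_continuous 0, A.short_continuous 1, A.short_continuous 2,
      A.short_continuous 3, A.phi5_continuous]
  · fin_cases i
    exacts [(A.short_supp' 0).1, (A.short_supp' 1).1, (A.short_supp' 2).1,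
      (A.short_supp' 3).1, A.phi5_supp]
  · unfold gen5; infer_instance
  · fin_cases i <;> rfl
  · exact ip_eq_zero_of_supp A.phi5_supp (dil_one_supp (A.short_supp i)) A.phi5_continuous
      (by norm_num)

theorem fam6_on : ON A.fam6 := by
  have h : A.fam6 = (fun p : Fin 5 × ℤ => dil 1 p.2 (A.gen5 p.1)) ∘
      ![(0, 0), (1, 0), (2, 0), (3, 0), (4, 0), (0, -1), (1, -1), (2, -1), (3, -1), (4, -1)] := by
    funext i
    fin_cases i <;> simp [fam6, dil_one_zero, gen5]
  rw [h]
  exact (on_gen5_translates hA).comp (by decide)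

/-- After a shift this is the orthogonality of φ₅ to ξ_{1,5}, a right-sided function on [0,1]. It
removes the φ₅(· + 1) term from φ₆ and so keeps the support of φ₆ inside [-1,1]. -/
theorem ip_xi_11_phi5 : ip (xi 1 1) (dil 1 (-1) A.phi5) = 0 := by
  rw [ip_comm, ip_dil_one_left, neg_neg, xi_shift, show (1 : ℤ) + 4 = 5 by norm_num,
    ← ip_restr_restr A.phi5_supp (b := 2) (SuppIn_mono (by norm_num) (by norm_num)
      (xi_supp' 1 5 2 (by norm_num) (a := 1 / 2) (b := 3 / 2) (by norm_num) (by norm_num)))]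
  exact ip_side_side hA phi5_mem_side (zeta_mem _ 3 (by simp)) (restr_phi5_ip_short hA)

theorem phi6_supp : A.phi6 ∈ SuppIn (-1) 1 :=
  A.phi6_mem_of xi_11_supp A.short_supp' A.phi5_supp (Or.inl (ip_xi_11_phi5 hA))

theorem phi6_mem_side : restr A.phi6 ∈ A.side {0, 1} :=
  A.phi6_mem_of (U := (A.side {0, 1}).comap restrL) (zeta_mem _ 1 (by simp))
    (fun i => ⟨(restr_short_mem _ i).1, (restr_short_mem _ i).2.1⟩) phi5_mem_side
    (Or.inl (ip_xi_11_phi5 hA))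

theorem phi6_shift_mem_side : restr (dil 1 1 A.phi6) ∈ A.side {2, 3} := by
  refine A.phi6_mem_of (U := ((A.side {2, 3}).comap restrL).comap (dilL 1 1)) ?_
    (fun i => ⟨?_, ?_⟩) phi5_shift_mem_side (Or.inl (ip_xi_11_phi5 hA))
  · rw [Submodule.mem_comap, dilL_apply, xi_shift]
    exact zeta_mem _ 3 (by simp)
  · exact (restr_short_mem _ i).2.2
  · rw [Submodule.mem_comap, dilL_apply, dil_neg_one_one]
    exact (restr_short_mem _ i).1

omit hA in
-- Everything subtracted from ξ_{1,1} in the definition of φ₆ therefore has slope zero at 0, whereas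
-- ξ_{1,1} has nonzero slope there; this is why the residual does not vanish.
theorem fam6_mem_cspan (i : Fin 10) : A.fam6 i ∈ Z 0 ⊔ Submodule.span ℝ {A.phi5} := by
  have h := fun i => (A.short_mem_Z i)
  have hl : ∀ f ∈ Z 0, f ∈ Z 0 ⊔ Submodule.span ℝ {A.phi5} := fun f hf =>
    Submodule.mem_sup_left hf
  have h5 : dil 1 (-1) A.phi5 ∈ Z 0 := mem_Z_of_supp (shift_one_mem_Sp A.phi5_mem_Sp).2.1
    (dil_one_supp A.phi5_supp) (Or.inr (by norm_num))
  fin_cases i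
  exacts [hl _ (h 0).1, hl _ (h 1).1, hl _ (h 2).1, hl _ (h 3).1,
    Submodule.mem_sup_right (Submodule.mem_span_singleton_self _),
    hl _ (h 0).2, hl _ (h 1).2, hl _ (h 2).2, hl _ (h 3).2, hl _ h5]

omit hA in
theorem deriv_eq_zero_of_mem_cspan {f : ℝ → ℝ} (hf : f ∈ Z 0 ⊔ Submodule.span ℝ {A.phi5}) :
    deriv f 0 = 0 := by
  obtain ⟨g, hg, h, hh, rfl⟩ := Submodule.mem_sup.1 hf
  obtain ⟨c, rfl⟩ := Submodule.mem_span_singleton.1 hh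
  have hd := A.phi5_mem_Sp.1.differentiable one_ne_zero 0
  rw [deriv_add (hg.1.differentiable one_ne_zero 0) (hd.const_smul c), deriv_const_smul _ hd,
    hg.2.2, phi5_zero.2, smul_zero, add_zero]

omit hA in
theorem resid6_ne_zero : ip (resid A.fam6 (xi 1 1)) (resid A.fam6 (xi 1 1)) ≠ 0 := by
  refine resid_ip_ne_zero (U := Z 0 ⊔ Submodule.span ℝ {A.phi5}) (fun i => ?_)
    (xi_mem 1 1).1.continuous fam6_mem_cspan
    fun h => (xi_zero 1).2.2 (deriv_eq_zero_of_mem_cspan h)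
  obtain ⟨g, hg, h, hh, hgh⟩ := Submodule.mem_sup.1 (A.fam6_mem_cspan i)
  obtain ⟨c, rfl⟩ := Submodule.mem_span_singleton.1 hh
  rw [← hgh]
  exact hg.1.continuous.add (A.phi5_continuous.const_smul c)

omit hA in
-- With `phi5_zero` this makes the matrix of values and slopes of φ₅, φ₆ at 0 triangular and
-- invertible: the two functions can be told apart by their 1-jet at 0.
theorem phi6_deriv_zero : deriv A.phi6 0 ≠ 0 := by
  intro h0
  have hd : ContDiff ℝ 1 A.phi6 := A.phi6_mem_Sp.1
  have e : xi 1 1 = l2norm (resid A.fam6 (xi 1 1)) • A.phi6 +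
      ∑ i, ip (xi 1 1) (A.fam6 i) • A.fam6 i := by
    rw [phi6_eq, ← eq_smul_normalize resid6_ne_zero, resid_eq, sub_add_cancel]
  have hm : ∑ i, ip (xi 1 1) (A.fam6 i) • A.fam6 i ∈ Z 0 ⊔ Submodule.span ℝ {A.phi5} :=
    Submodule.sum_mem _ fun i _ => Submodule.smul_mem _ _ (fam6_mem_cspan i)
  have e' : ∑ i, ip (xi 1 1) (A.fam6 i) • A.fam6 i =
      xi 1 1 - l2norm (resid A.fam6 (xi 1 1)) • A.phi6 := by
    exact eq_sub_of_add_eq' e.symm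
  have h1 := deriv_eq_zero_of_mem_cspan hm
  have hdx := (xi_mem 1 1).1.differentiable one_ne_zero 0
  have hd0 := hd.differentiable one_ne_zero 0
  rw [e', deriv_sub hdx (hd0.const_smul _), deriv_const_smul _ hd0, h0, smul_zero, sub_zero] at h1
  exact (xi_zero 1).2.2 h1

omit hA in
theorem phi6_ip_self : ip A.phi6 A.phi6 = 1 := ip_normalize_self resid6_ne_zero

theorem phi6_ip_fam (i : Fin 10) : ip A.phi6 (A.fam6 i) = 0 := by
  rw [phi6_eq, ip_normalize_left, resid_ip (fam6_on hA), mul_zero]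

theorem phi6_ip_short (i : Fin 4) : ip A.phi6 (A.short i) = 0 := by
  have h := phi6_ip_fam hA
  fin_cases i
  exacts [h 0, h 1, h 2, h 3]

theorem restr_phi6_ip_short (i : Fin 4) : ip (restr A.phi6) (A.short i) = 0 := by
  rw [ip_restr_left _ (A.short_supp i), phi6_ip_short hA i]

omit hA in
theorem dil_one_one_supp {f : ℝ → ℝ} (hf : f ∈ SuppIn (-1) 1) : dil 1 1 f ∈ SuppIn 0 2 :=
  SuppIn_mono (by norm_num) (by norm_num) (dil_one_supp hf)

theorem phi6_ip_shift : ip A.phi6 (dil 1 1 A.phi5) = 0 ∧ ip A.phi6 (dil 1 1 A.phi6) = 0 := by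
  rw [← ip_restr_restr (phi6_supp hA) (dil_one_one_supp A.phi5_supp),
    ← ip_restr_restr (phi6_supp hA) (dil_one_one_supp (phi6_supp hA))]
  exact ⟨ip_side_side hA (phi6_mem_side hA) phi5_shift_mem_side (restr_phi6_ip_short hA),
    ip_side_side hA (phi6_mem_side hA) (phi6_shift_mem_side hA) (restr_phi6_ip_short hA)⟩

omit hA in
variable (A) in
/-- The scaling functions on the real line. -/
def e (p : Fin 6 × ℤ) : ℝ → ℝ := dil 1 p.2 (A.phi p.1)

omit hA in
instance (p : Fin 6 × ℤ) : IsL2 (A.e p) := by unfold e; infer_instance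

omit hA in
variable (A) in
theorem phi_mem_Sp (i : Fin 6) : A.phi i ∈ Sp 2 := by
  fin_cases i
  exacts [A.short_mem_Sp 0, A.short_mem_Sp 1, A.short_mem_Sp 2, A.short_mem_Sp 3, A.phi5_mem_Sp,
    A.phi6_mem_Sp]

omit hA in
variable (A) in
theorem phi_continuous (i : Fin 6) : Continuous (A.phi i) := (A.phi_mem_Sp i).1.continuous

theorem phi_supp (i : Fin 6) : A.phi i ∈ SuppIn (-1) 1 := by
  fin_cases i
  exacts [(A.short_supp' 0).1, (A.short_supp' 1).1, (A.short_supp' 2).1, (A.short_supp' 3).1,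
    A.phi5_supp, phi6_supp hA]

omit hA in
theorem phi_eq_short (i : Fin 6) (hi : i < 4) : A.phi i = A.short ⟨i, hi⟩ := by
  fin_cases i <;> first | rfl | (exact absurd hi (by decide))

omit hA in
theorem phi_supp_short (i : Fin 6) (hi : i < 4) : A.phi i ∈ SuppIn 0 1 := by
  rw [phi_eq_short i hi]; exact A.short_supp _

theorem e_on : ON A.e := by
  refine snoc_translates (on_gen5_translates hA) A.phi_continuous (phi_supp hA)
    (fun i => inferInstance) (fun i => ?_) rfl phi6_ip_self (phi6_ip_shift hA).2
    (fun i => ?_) (fun i => ?_) (fun i => ?_)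
  · fin_cases i <;> rfl
  · have h := phi6_ip_fam hA
    fin_cases i
    exacts [h 0, h 1, h 2, h 3, h 4]
  · have h : ∀ i, ip A.phi6 (dil 1 1 (A.short i)) = 0 := fun i =>
      ip_eq_zero_of_supp (phi6_supp hA) (dil_one_supp (A.short_supp i)) A.phi6_continuous
        (by norm_num)
    fin_cases i
    exacts [h 0, h 1, h 2, h 3, (phi6_ip_shift hA).1]
  · have h := phi6_ip_fam hA
    fin_cases i
    exacts [h 5, h 6, h 7, h 8, h 9]

end ScalingChoice

end SplineWavelet

end

open MeasureTheory

noncomputable section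

set_option synthInstance.maxSize 100000

namespace SplineWavelet

namespace ScalingChoice

variable (A : ScalingChoice)

/-! ### The multiresolution analysis on the real line -/

/-- The space `V₀` on the real line. -/
def V : Submodule ℝ (ℝ → ℝ) := Submodule.span ℝ (Set.range A.e)

/-- The space `V_j` on the real line. -/
def Vs (j : ℕ) : Submodule ℝ (ℝ → ℝ) := A.V.map (dilL (2 ^ j) 0)

theorem e_mem_V (p : Fin 6 × ℤ) : A.e p ∈ A.V := Submodule.subset_span ⟨p, rfl⟩

theorem phi_mem_V (i : Fin 6) : A.phi i ∈ A.V := by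
  have := A.e_mem_V (i, 0)
  simpa [e, dil_one_zero] using this

theorem e_mem_Sp (p : Fin 6 × ℤ) : A.e p ∈ Sp 2 := shift_mem_Sp (A.phi_mem_Sp p.1) p.2

theorem V_le_Sp : A.V ≤ Sp 2 := by
  refine Submodule.span_le.2 ?_
  rintro _ ⟨p, rfl⟩
  exact A.e_mem_Sp p

variable {A}

theorem isL2_of_mem_V {f : ℝ → ℝ} (hf : f ∈ A.V) : IsL2 f := isL2_of_mem_Sp (A.V_le_Sp hf)

theorem shift_e (m : ℤ) (p : Fin 6 × ℤ) : dil 1 m (A.e p) = A.e (p.1, p.2 + m) := by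
  simp only [e, dil_one_dil_one]
  push_cast
  rw [add_comm]

theorem shift_mem_V {f : ℝ → ℝ} (hf : f ∈ A.V) (m : ℤ) : dil 1 m f ∈ A.V := by
  have h : A.V ≤ A.V.comap (dilL 1 m) := by
    refine Submodule.span_le.2 ?_
    rintro _ ⟨p, rfl⟩
    rw [SetLike.mem_coe, Submodule.mem_comap, dilL_apply, shift_e]
    exact A.e_mem_V _
  exact h hf

theorem mem_Vs_iff {j : ℕ} {f : ℝ → ℝ} : f ∈ A.Vs j ↔ dil (1 / 2 ^ j) 0 f ∈ A.V := by
  have h2 : (2 : ℝ) ^ j ≠ 0 := by positivity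
  constructor
  · rintro ⟨g, hg, rfl⟩
    have e : dil (1 / 2 ^ j) 0 (dilL (2 ^ j) 0 g) = g := by
      ext x
      simp only [dilL_apply, dil_eq]
      congr 1
      field_simp
      ring
    rwa [e]
  · intro h
    refine ⟨_, h, ?_⟩
    ext x
    simp only [dilL_apply, dil_eq]
    congr 1
    field_simp
    ring

theorem dil_mem_Vs {f : ℝ → ℝ} (hf : f ∈ A.V) (j : ℕ) : dil (2 ^ j) 0 f ∈ A.Vs j := ⟨f, hf, rfl⟩

theorem Vs_zero : A.Vs 0 = A.V := by
  ext f
  rw [mem_Vs_iff]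
  simp [dil_one_zero]

theorem Vs_le_Sp (j : ℕ) : A.Vs j ≤ Sp (j + 2) := by
  rintro _ ⟨f, hf, rfl⟩
  have := dil_pow_mem_Sp (A.V_le_Sp hf) j 0
  rw [add_comm] at this
  simpa [dilL_apply] using this

theorem isL2_of_mem_Vs {j : ℕ} {f : ℝ → ℝ} (hf : f ∈ A.Vs j) : IsL2 f :=
  isL2_of_mem_Sp (Vs_le_Sp j hf)

theorem short_mem_V (i : Fin 4) : A.short i ∈ A.V := by
  fin_cases i
  exacts [A.phi_mem_V 0, A.phi_mem_V 1, A.phi_mem_V 2, A.phi_mem_V 3]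

theorem short_shift_mem_V (i : Fin 4) : A.short i ∈ A.V ∧ dil 1 (-1) (A.short i) ∈ A.V :=
  ⟨short_mem_V i, by simpa using shift_mem_V (short_mem_V (A := A) i) (-1)⟩

theorem xi_2_3_mem_V : xi 1 2 ∈ A.V ∧ xi 1 3 ∈ A.V :=
  ⟨mem_of_normalize_mem (by rw [ip_xi_2_2]; norm_num) (A.phi_mem_V 0),
    mem_of_normalize_mem (by rw [ip_xi_3_3]; norm_num) (A.phi_mem_V 1)⟩

theorem dil_two_mem_of_xi {U : Submodule ℝ (ℝ → ℝ)} {k : ℤ} :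
    (xi 1 (2 * k) ∈ U → dil 2 k xi1 ∈ U) ∧ (xi 1 (2 * k + 1) ∈ U → dil 2 k xi2 ∈ U) := by
  have h := xi_eq 1 k
  have hp : (2 : ℝ) ^ (((1 : ℕ) : ℝ) / 2) ≠ 0 := by positivity
  rw [h.1, h.2, Submodule.smul_mem_iff _ hp, Submodule.smul_mem_iff _ hp]
  simp

theorem cut_e {p : Fin 6 × ℤ} {a b : ℝ} (hs : A.e p ∈ SuppIn a b) (m : ℝ) :
    (m ≤ a → (Set.Ici m).indicator (A.e p) = A.e p) ∧
      (b ≤ m → (Set.Ici m).indicator (A.e p) = 0) := by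
  constructor
  · intro h
    ext x
    by_cases hx : x ∈ Set.Ici m
    · rw [Set.indicator_of_mem hx]
    · rw [Set.indicator_of_notMem hx]
      exact (hs x fun h' => hx (h.trans h'.1)).symm
  · intro h
    ext x
    by_cases hx : x ∈ Set.Ici m
    · rw [Set.indicator_of_mem hx]
      exact SuppIn.eq_zero_right hs (A.e_mem_Sp p).1.continuous (h.trans hx)
    · rw [Set.indicator_of_notMem hx]; rfl

theorem e_supp_short (p : Fin 6 × ℤ) (h : p.1 < 4) : A.e p ∈ SuppIn p.2 (p.2 + 1) :=
  SuppIn_mono (by simp) (by rw [add_comm]) (dil_one_supp (phi_supp_short p.1 h))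

variable (hA : A.Admissible)

include hA

theorem e_supp (p : Fin 6 × ℤ) : A.e p ∈ SuppIn (p.2 - 1) (p.2 + 1) :=
  SuppIn_mono (by rw [neg_add_eq_sub]) (by rw [add_comm]) (dil_one_supp (phi_supp hA p.1))

omit hA in
theorem xi_0_1_mem_V : xi 1 0 ∈ A.V ∧ xi 1 1 ∈ A.V := by
  have h5' : dil 1 (-1) A.phi5 ∈ A.V := by
    have := shift_mem_V (A.phi_mem_V 4) (-1)
    rw [Int.cast_neg, Int.cast_one] at this
    exact this
  constructor
  · exact mem_of_resid_mem (mem_of_normalize_mem resid5_ne_zero (A.phi_mem_V 4))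
      (A.fam5_mem short_shift_mem_V)
  · refine mem_of_resid_mem (mem_of_normalize_mem resid6_ne_zero (A.phi_mem_V 5)) fun i => ?_
    have h := short_shift_mem_V (A := A)
    fin_cases i
    exacts [(h 0).1, (h 1).1, (h 2).1, (h 3).1, A.phi_mem_V 4, (h 0).2, (h 1).2, (h 2).2, (h 3).2,
      h5']

omit hA in
theorem dil_two_xi_mem_V (k : ℤ) : dil 2 k xi1 ∈ A.V ∧ dil 2 k xi2 ∈ A.V := by
  have h0 := dil_two_mem_of_xi (U := A.V) (k := 0)
  have h1 := dil_two_mem_of_xi (U := A.V) (k := 1)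
  have e : ∀ (f : ℝ → ℝ) (m c : ℤ), dil 2 ((2 * m + c : ℤ) : ℝ) f = dil 1 m (dil 2 c f) := by
    intro f m c; ext x; simp only [dil_eq]; congr 1; push_cast; ring
  obtain ⟨m, hm | hm⟩ := Int.even_or_odd' k
  · rw [show k = 2 * m + 0 by omega, e, e]
    exact ⟨shift_mem_V (h0.1 (by simpa using xi_0_1_mem_V.1)) m,
      shift_mem_V (h0.2 (by simpa using xi_0_1_mem_V.2)) m⟩
  · rw [hm, e, e]
    exact ⟨shift_mem_V (h1.1 (by simpa using xi_2_3_mem_V.1)) m,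
      shift_mem_V (h1.2 (by simpa using xi_2_3_mem_V.2)) m⟩

omit hA in
-- One half of the intertwining. The Hermite functions of level 1 at the nodes 0 and 1/2 lie in `V`
-- because the residuals defining the generators can be undone; integer translates provide the other
-- half-integer nodes, and the Hermite functions span `Sp 1`.
theorem Sp_one_le_V : Sp 1 ≤ A.V := by
  intro f hf
  have h1 := Sp_zero_le_span (Sp_succ_half hf)
  have h2 : Submodule.span ℝ (Set.range (fun k : ℤ => dil 1 k xi1) ∪
      Set.range (fun k : ℤ => dil 1 k xi2)) ≤ A.V.comap (dilL 2 0) := by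
    have e : ∀ (f : ℝ → ℝ) (k : ℤ), dil 2 0 (dil 1 k f) = dil 2 k f := by
      intro f k; ext x; simp only [dil_eq]; congr 1; ring
    rw [Submodule.span_le]
    rintro _ (⟨k, rfl⟩ | ⟨k, rfl⟩)
    · rw [SetLike.mem_coe, Submodule.mem_comap, dilL_apply, e]; exact (dil_two_xi_mem_V k).1
    · rw [SetLike.mem_coe, Submodule.mem_comap, dilL_apply, e]; exact (dil_two_xi_mem_V k).2
  have h3 := h2 h1
  rw [Submodule.mem_comap, dilL_apply] at h3
  have e : dil 2 0 (dil (1 / 2) 0 f) = f := by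
    ext x
    simp only [dil_eq]; congr 1; ring
  rwa [e] at h3

omit hA in
theorem Sp_le_Vs (j : ℕ) : Sp (j + 1) ≤ A.Vs j := by
  intro f hf
  rw [mem_Vs_iff]
  refine Sp_one_le_V ?_
  induction j generalizing f with
  | zero => simpa [dil_one_zero] using hf
  | succ j ih =>
    have := ih (Sp_succ_half hf)
    have e : dil (1 / 2 ^ j) 0 (dil (1 / 2) 0 f) = dil (1 / 2 ^ (j + 1)) 0 f := by
      ext x
      simp only [dil_eq]
      congr 1
      rw [pow_succ]
      field_simp
      ring
    rwa [e] at this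

omit hA in
-- The spline space `Sp (j + 2)` sits between consecutive spaces of the multiresolution analysis,
-- which replaces a refinement equation.
theorem Vs_le_succ (j : ℕ) : A.Vs j ≤ A.Vs (j + 1) := fun _ hf =>
  Sp_le_Vs (j + 1) (Vs_le_Sp j hf)

omit hA in
theorem V_le_Vs_one : A.V ≤ A.Vs 1 := by
  have := Vs_le_succ (A := A) 0
  rwa [Vs_zero] at this

/-! ### Values and derivatives at the integers -/

omit hA in
theorem phi56_eq_zero_of_mem_Z {a b : ℝ} (h : a • A.phi 4 + b • A.phi 5 ∈ Z 0) :
    a = 0 ∧ b = 0 := by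
  have d4 := (A.phi_mem_Sp 4).1.differentiable one_ne_zero 0
  have d5 := (A.phi_mem_Sp 5).1.differentiable one_ne_zero 0
  have h1 := h.2.1
  have h2 := h.2.2
  have z1 : A.phi 4 0 ≠ 0 := phi5_zero.1
  have z2 : deriv (A.phi 4) 0 = 0 := phi5_zero.2
  have z3 : deriv (A.phi 5) 0 ≠ 0 := phi6_deriv_zero
  rw [deriv_add (d4.const_smul a) (d5.const_smul b), deriv_const_smul _ d4,
    deriv_const_smul _ d5, z2, smul_zero, zero_add] at h2
  have hb : b = 0 := (smul_eq_zero.1 h2).resolve_right z3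
  refine ⟨?_, hb⟩
  rw [hb] at h1
  simpa [z1] using h1

theorem e_mem_Z {p : Fin 6 × ℤ} {m : ℤ} (h : p ≠ (4, m)) (h' : p ≠ (5, m)) : A.e p ∈ Z m := by
  obtain ⟨i, k⟩ := p
  have hC := (A.e_mem_Sp (i, k)).1
  by_cases hi : i < 4
  · refine mem_Z_of_supp hC (e_supp_short (i, k) hi) ?_
    rcases le_or_gt m k with h | h
    · exact Or.inl (by exact_mod_cast h)
    · exact Or.inr (by exact_mod_cast h)
  · have hk : k ≠ m := by
      rintro rfl
      have : i = 4 ∨ i = 5 := by omega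
      rcases this with rfl | rfl
      · exact h rfl
      · exact h' rfl
    refine mem_Z_of_supp hC (e_supp hA (i, k)) ?_
    rcases lt_or_gt_of_ne hk with h | h
    · have : k + 1 ≤ m := h
      exact Or.inr (by exact_mod_cast this)
    · have : m ≤ k - 1 := by omega
      exact Or.inl (by exact_mod_cast this)

/-- The part of a function which comes from the scaling functions with centre `m`. -/
def center (f : ℝ → ℝ) (m : ℤ) : ℝ → ℝ :=
  ip f (A.e (4, m)) • A.e (4, m) + ip f (A.e (5, m)) • A.e (5, m)

omit hA in
theorem center_add {f g : ℝ → ℝ} [IsL2 f] [IsL2 g] (m : ℤ) :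
    center (A := A) (f + g) m = center (A := A) f m + center (A := A) g m := by
  simp only [center, ip_add_left, add_smul]; abel

omit hA in
theorem center_smul (c : ℝ) (f : ℝ → ℝ) (m : ℤ) :
    center (A := A) (c • f) m = c • center (A := A) f m := by
  simp only [center, ip_smul_left, smul_add, smul_smul]

theorem center_e (p : Fin 6 × ℤ) (m : ℤ) :
    center (A := A) (A.e p) m = if p = (4, m) ∨ p = (5, m) then A.e p else 0 := by
  simp only [center, (e_on hA).ip_eq]
  by_cases h4 : p = (4, m)
  · subst h4
    simp
  · by_cases h5 : p = (5, m)
    · subst h5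
      simp
    · simp [h4, h5]

/-- For `f ∈ V₀` the function `f - center f m` has a double zero at `m`, and its truncation
belongs to `V₀`. -/
theorem sub_center_mem {f : ℝ → ℝ} (hf : f ∈ A.V) (m : ℤ) :
    f - center (A := A) f m ∈ Z m ∧
      (Set.Ici (m : ℝ)).indicator (f - center (A := A) f m) ∈ A.V := by
  refine Submodule.span_induction (p := fun f _ => f - center (A := A) f m ∈ Z m ∧
      (Set.Ici (m : ℝ)).indicator (f - center (A := A) f m) ∈ A.V) ?_ ?_ ?_ ?_ hf
  · rintro _ ⟨p, rfl⟩
    rw [center_e hA]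
    split_ifs with h
    · rw [sub_self]
      exact ⟨Submodule.zero_mem _, by rw [Set.indicator_zero']; exact Submodule.zero_mem _⟩
    · rw [not_or] at h
      rw [sub_zero]
      refine ⟨e_mem_Z hA h.1 h.2, ?_⟩
      suffices h : (Set.Ici (m : ℝ)).indicator (A.e p) = A.e p ∨
          (Set.Ici (m : ℝ)).indicator (A.e p) = 0 by
        rcases h with h | h <;> rw [h]
        · exact A.e_mem_V p
        · exact Submodule.zero_mem _
      obtain ⟨i, k⟩ := p
      by_cases hi : i < 4
      · have := cut_e (e_supp_short (A := A) (i, k) hi) m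
        rcases le_or_gt m k with h | h
        · exact Or.inl (this.1 (by exact_mod_cast h))
        · exact Or.inr (this.2 (by exact_mod_cast h))
      · have hk : k ≠ m := by
          rintro rfl
          have : i = 4 ∨ i = 5 := by omega
          rcases this with rfl | rfl
          · exact h.1 rfl
          · exact h.2 rfl
        have := cut_e (e_supp hA (i, k)) m
        rcases lt_or_gt_of_ne hk with h | h
        · have h' : k + 1 ≤ m := h
          exact Or.inr (this.2 (by exact_mod_cast h'))
        · have h' : m ≤ k - 1 := by omega
          exact Or.inl (this.1 (by exact_mod_cast h'))
  · have : center (A := A) 0 m = 0 := by simp [center]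
    rw [this, sub_zero]
    exact ⟨Submodule.zero_mem _, by rw [Set.indicator_zero']; exact Submodule.zero_mem _⟩
  · intro f g hf hg h1 h2
    have := isL2_of_mem_V hf
    have := isL2_of_mem_V hg
    rw [center_add, add_sub_add_comm, Set.indicator_add']
    exact ⟨Submodule.add_mem _ h1.1 h2.1, Submodule.add_mem _ h1.2 h2.2⟩
  · intro c f hf h
    rw [center_smul, ← smul_sub]
    refine ⟨Submodule.smul_mem _ _ h.1, ?_⟩
    rw [show (Set.Ici (m : ℝ)).indicator (c • (f - center (A := A) f m)) =
      c • (Set.Ici (m : ℝ)).indicator (f - center (A := A) f m) from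
        Set.indicator_const_smul _ c _]
    exact Submodule.smul_mem _ _ h.2

/-- Since `f` minus its centre part has a double zero at `m`, so has the centre part; the 1-jets of
φ₅ and φ₆ being independent, both coefficients vanish. `mem_Z_of_ip` is the converse. -/
theorem ip_e_eq_zero_of_mem_Z {f : ℝ → ℝ} (hf : f ∈ A.V) {m : ℤ} (hz : f ∈ Z m) :
    ip f (A.e (4, m)) = 0 ∧ ip f (A.e (5, m)) = 0 := by
  have h := Submodule.sub_mem _ hz (sub_center_mem hA hf m).1
  rw [sub_sub_cancel] at h
  have h0 : dil 1 (-(m : ℝ)) (A.e (4, m)) = A.phi 4 := by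
    simp only [e]
    rw [dil_one_dil_one, neg_add_cancel, dil_one_zero]
  have h1 : dil 1 (-(m : ℝ)) (A.e (5, m)) = A.phi 5 := by
    simp only [e]
    rw [dil_one_dil_one, neg_add_cancel, dil_one_zero]
  have h2 := dil_mem_Z h (a := 1) (c := -(m : ℝ)) (m' := 0) (by ring)
  have h3 : dil 1 (-(m : ℝ)) (center (A := A) f m) =
      ip f (A.e (4, m)) • A.phi 4 + ip f (A.e (5, m)) • A.phi 5 := by
    rw [center, ← h0, ← h1]; rfl
  rw [h3] at h2
  exact phi56_eq_zero_of_mem_Z h2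

theorem center_eq_zero_of_mem_Z {f : ℝ → ℝ} (hf : f ∈ A.V) {m : ℤ} (hz : f ∈ Z m) :
    center (A := A) f m = 0 := by
  have := ip_e_eq_zero_of_mem_Z hA hf hz
  rw [center, this.1, this.2, zero_smul, zero_smul, add_zero]

/-- With a double zero at `m` no scaling function straddling `m` occurs in `f`, and the truncation
keeps or drops each remaining one entirely. -/
theorem cut_mem_V {f : ℝ → ℝ} (hf : f ∈ A.V) {m : ℤ} (hz : f ∈ Z m) :
    (Set.Ici (m : ℝ)).indicator f ∈ A.V := by
  have := (sub_center_mem hA hf m).2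
  rwa [center_eq_zero_of_mem_Z hA hf hz, sub_zero] at this

/-- The indices of the scaling functions with support in `[a, b]`. -/
def inside (a b : ℤ) : Set (Fin 6 × ℤ) :=
  {p | (p.1 < 4 ∧ a ≤ p.2 ∧ p.2 + 1 ≤ b) ∨ (4 ≤ p.1 ∧ a + 1 ≤ p.2 ∧ p.2 + 1 ≤ b)}

/-- A function of `V₀` with support in `[a, b]` is a linear combination of the scaling functions
with support in `[a, b]`. -/
theorem mem_span_inside {f : ℝ → ℝ} (hf : f ∈ A.V) {a b : ℤ} (hs : f ∈ SuppIn a b) :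
    f ∈ Submodule.span ℝ (A.e '' inside a b) := by
  refine (e_on hA).mem_span_of_forall hf fun p hp => ?_
  have hC := (A.V_le_Sp hf).1
  obtain ⟨i, k⟩ := p
  simp only [inside, Set.mem_ofPred_eq, not_or, not_and] at hp
  by_cases hi : i < 4
  · have hp' := hp.1 hi
    by_cases hak : a ≤ k
    · have : b ≤ k := by have := hp' hak; omega
      exact ip_eq_zero_of_supp hs (e_supp_short (i, k) hi) hC.continuous (by exact_mod_cast this)
    · rw [ip_comm]
      have : k + 1 ≤ a := by omega
      exact ip_eq_zero_of_supp (e_supp_short (i, k) hi) hs (A.e_mem_Sp _).1.continuous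
        (by exact_mod_cast this)
  · have hp' := hp.2 (not_lt.1 hi)
    have hz : f ∈ Z k := by
      refine mem_Z_of_supp hC hs ?_
      by_cases hak : a + 1 ≤ k
      · right
        have : b ≤ k := by have := hp' hak; omega
        exact_mod_cast this
      · left
        have : k ≤ a := by omega
        exact_mod_cast this
    have := ip_e_eq_zero_of_mem_Z hA hf hz
    have hi' : i = 4 ∨ i = 5 := by omega
    rcases hi' with rfl | rfl
    exacts [this.1, this.2]

end ScalingChoice

end SplineWavelet

end

open MeasureTheory

noncomputable section

set_option synthInstance.maxSize 100000

namespace SplineWavelet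

/-! ### Existence of null space bases -/

/-- Independent rows give full row rank, so the kernel has dimension `k` by rank-nullity. All
existence statements for null bases reduce to the independence of rows. -/
theorem exists_isNullBasis {m : Type} [Fintype m] {k n : ℕ} (M : Matrix m (Fin n) ℝ)
    (hM : ∀ a : m → ℝ, (∀ j, ∑ i, a i * M i j = 0) → a = 0) (hc : Fintype.card m + k = n) :
    ∃ b : Fin k → Fin n → ℝ, IsNullBasis M b := by
  classical
  have hr : M.rank = Fintype.card m := by
    refine LinearIndependent.rank_matrix (Fintype.linearIndependent_iff.2 fun a ha => ?_)
    refine congrFun (hM a fun j => ?_)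
    have := congrFun ha j
    simpa [Finset.sum_apply] using this
  have hk : Module.finrank ℝ (LinearMap.ker M.mulVecLin) = k := by
    have h := LinearMap.finrank_range_add_finrank_ker M.mulVecLin
    rw [Module.finrank_fin_fun] at h
    have : Module.finrank ℝ (LinearMap.range M.mulVecLin) = Fintype.card m := hr
    omega
  let b := Module.finBasisOfFinrankEq ℝ (LinearMap.ker M.mulVecLin) hk
  refine ⟨fun i => (b i : Fin n → ℝ),
    b.linearIndependent.map' (Submodule.subtype _) (Submodule.ker_subtype _), ?_⟩
  have : Set.range (fun i => (b i : Fin n → ℝ)) =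
      (Submodule.subtype (LinearMap.ker M.mulVecLin)) '' Set.range b := by
    rw [← Set.range_comp]; rfl
  rw [this, Submodule.span_image, b.span_eq, Submodule.map_top, Submodule.range_subtype]

theorem exists_isNullBasis_ip {m : Type} [Fintype m] {k n : ℕ} (r : m → ℝ → ℝ)
    (f : Fin n → ℝ → ℝ) [∀ i, IsL2 (r i)] [∀ i, IsL2 (f i)]
    (hM : ∀ a : m → ℝ, (∀ j, ip (∑ i, a i • r i) (f j) = 0) → a = 0)
    (hc : Fintype.card m + k = n) :
    ∃ b : Fin k → Fin n → ℝ, IsNullBasis (Matrix.of fun i j => ip (r i) (f j)) b := by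
  refine exists_isNullBasis _ (fun a ha => hM a fun j => ?_) hc
  rw [ip_sum_smul_left]
  exact ha j

/-- A functional which vanishes on the null space is a combination of the rows. -/
theorem IsNullBasis.exists_combination {m : Type} [Fintype m] {k n : ℕ}
    {M : Matrix m (Fin n) ℝ} {b : Fin k → Fin n → ℝ} (hb : IsNullBasis M b) (y : Fin n → ℝ)
    (hy : ∀ l, ∑ j, b l j * y j = 0) : ∃ a : m → ℝ, ∀ j, y j = ∑ i, a i * M i j := by
  let func : (Fin n → ℝ) → (Fin n → ℝ) →ₗ[ℝ] ℝ := fun y => Fintype.linearCombination ℝ y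
  have hf : ∀ y x, func y x = ∑ j, x j * y j := fun y x => by
    simp [func, Fintype.linearCombination_apply]
  have h : func y ∈ Submodule.span ℝ (Set.range fun i : m => func (M i)) := by
    refine mem_span_of_iInf_ker_le_ker fun x hx => ?_
    have hx' : x ∈ LinearMap.ker M.mulVecLin := by
      rw [LinearMap.mem_ker]
      ext i
      have := LinearMap.mem_ker.1 ((Submodule.mem_iInf _).1 hx i)
      rw [hf] at this
      rw [Matrix.mulVecLin_apply, Matrix.mulVec, dotProduct, Pi.zero_apply, ← this]
      exact Finset.sum_congr rfl fun j _ => mul_comm _ _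
    rw [← hb.2] at hx'
    refine (Submodule.span_le.2 ?_ : Submodule.span ℝ (Set.range b) ≤ LinearMap.ker (func y)) hx'
    rintro _ ⟨l, rfl⟩
    rw [SetLike.mem_coe, LinearMap.mem_ker, hf]
    exact hy l
  obtain ⟨a, ha⟩ := (Submodule.mem_span_range_iff_exists_fun ℝ).1 h
  refine ⟨a, fun j => ?_⟩
  have := congrArg (fun g => g (Pi.single j 1)) ha
  simp only [LinearMap.sum_apply, LinearMap.smul_apply, hf, Pi.single_apply, ite_mul, one_mul,
    zero_mul, Finset.sum_ite_eq', Finset.mem_univ, if_true, smul_eq_mul] at this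
  exact this.symm

theorem IsNullBasis.mem_span {m : Type} {k n : ℕ} {r : m → ℝ → ℝ} {f : Fin n → ℝ → ℝ}
    [∀ i, IsL2 (r i)] [∀ i, IsL2 (f i)] {b : Fin k → Fin n → ℝ}
    (hb : IsNullBasis (Matrix.of fun i j => ip (r i) (f j)) b) {t : ℝ → ℝ}
    (ht : t ∈ Submodule.span ℝ (Set.range f)) (hr : ∀ i, ip (r i) t = 0) :
    t ∈ Submodule.span ℝ (Set.range fun l => lincomb (b l) f) := by
  obtain ⟨c, rfl⟩ := (Submodule.mem_span_range_iff_exists_fun ℝ).1 ht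
  have hc : c ∈ Submodule.span ℝ (Set.range b) := by
    rw [hb.2, LinearMap.mem_ker]
    ext i
    have := hr i
    rw [ip_sum_smul_right] at this
    rw [Matrix.mulVecLin_apply, Matrix.mulVec, dotProduct, Pi.zero_apply, ← this]
    exact Finset.sum_congr rfl fun j _ => mul_comm _ _
  have e : (Set.range fun l => lincomb (b l) f) =
      Fintype.linearCombination ℝ f '' Set.range b := by
    rw [← Set.range_comp]
    congr 1
    ext l x
    simp [lincomb_eq, Fintype.linearCombination_apply]
  rw [e, Submodule.span_image]
  exact ⟨c, hc, by simp [Fintype.linearCombination_apply]⟩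

/-- The inner product with a function whose inner products with the `f j` are a combination of
rows. -/
theorem indep2_lincomb {n : ℕ} {f : Fin n → ℝ → ℝ} {b : Fin 2 → Fin n → ℝ}
    [∀ i, IsL2 (f i)] (hc : ∀ i, Continuous (f i)) (hf : LinearIndependent ℝ f)
    (hb : LinearIndependent ℝ b) : Indep2 fun i => lincomb (b i) f := by
  intro c hc0
  have hli := lincomb_linearIndependent hb hf
  have hcont : Continuous (∑ i, c i • lincomb (b i) f) := by
    have h : ∀ i, Continuous (lincomb (b i) f) := fun i =>
      continuous_finsetSum _ fun j _ => continuous_const.mul (hc j)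
    rw [Fin.sum_univ_two]
    exact ((h 0).const_smul (c 0)).add ((h 1).const_smul (c 1))
  have := eq_zero_of_ip_self _ hc0 hcont
  exact funext (Fintype.linearIndependent_iff.1 hli c this)

/-! ### Splines with nodes in `ℤ/2` on the unit interval -/

theorem exists_cell {N : ℕ} (hN : 0 < N) {x : ℝ} (hx : x ∈ Set.Icc (0 : ℝ) 1) :
    ∃ c < N, ∃ t ∈ Set.Icc (0 : ℝ) 1, x = (c + t) / N := by
  have hN' : (0 : ℝ) < N := by exact_mod_cast hN
  rcases eq_or_lt_of_le hx.2 with rfl | h1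
  · refine ⟨N - 1, by omega, 1, by simp, ?_⟩
    rw [Nat.cast_sub (by omega)]
    field_simp
    push_cast; ring
  · have h0 : 0 ≤ x * N := mul_nonneg hx.1 hN'.le
    refine ⟨⌊x * N⌋₊, ?_, x * N - ⌊x * N⌋₊, ⟨?_, ?_⟩, ?_⟩
    · rw [Nat.floor_lt h0]; nlinarith
    · linarith [Nat.floor_le h0]
    · linarith [Nat.lt_floor_add_one (x * N)]
    · field_simp; ring

/-- This is the Hermite expansion on the nodes 0, 1/2, 1. The functions at 1/2 are multiples of φ₁
and φ₂, those at 0 and 1 are cut to [0,1], and a double zero at 1 removes the last pair. -/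
theorem Sp_one_restr {g : ℝ → ℝ} (hg : g ∈ Sp 1) : ∃ a b c d : ℝ,
    restr g = (g 0 / 2 ^ ((1 : ℝ) / 2)) • zeta 0 +
      (deriv g 0 / (2 * 2 ^ ((1 : ℝ) / 2))) • zeta 1 + a • phi1 + b • phi2 + c • zeta 2 +
      d • zeta 3 ∧ (g ∈ Z 1 → c = 0 ∧ d = 0) := by
  set r : ℝ := 2 ^ ((1 : ℝ) / 2) with hr
  have hr0 : r ≠ 0 := by positivity
  -- The coefficients are values and slopes at the nodes divided by the normalization of level 1: √2
  -- for values, 2√2 for slopes because of the inner dilation. At 1/2 the norms enter since φ₁, φ₂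
  -- are normalized.
  refine ⟨g (1 / 2) / r * l2norm (xi 1 2), deriv g (1 / 2) / (2 * r) * l2norm (xi 1 3), g 1 / r,
    deriv g 1 / (2 * r), ?_, fun hz => by simp [hz.2.1, hz.2.2]⟩
  have e1 : xi 1 2 = l2norm (xi 1 2) • phi1 :=
    eq_smul_normalize (by rw [ip_xi_2_2]; norm_num)
  have e2 : xi 1 3 = l2norm (xi 1 3) • phi2 :=
    eq_smul_normalize (by rw [ip_xi_3_3]; norm_num)
  rw [mul_smul, mul_smul, ← e1, ← e2]
  ext x
  by_cases hx : x ∈ Set.Icc (0 : ℝ) 1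
  swap
  · have hz : ∀ i, zeta i x = 0 := fun i => by fin_cases i <;> exact restr_mem _ x hx
    simp [hz, restr_mem g x hx, xi_one_supp (Or.inl rfl) x hx, xi_one_supp (Or.inr rfl) x hx]
  have hz : zeta 0 x = xi 1 0 x ∧ zeta 1 x = xi 1 1 x ∧ zeta 2 x = xi 1 4 x ∧
      zeta 3 x = xi 1 5 x :=
    ⟨restr_of_mem hx, restr_of_mem hx, restr_of_mem hx, restr_of_mem hx⟩
  simp only [Pi.add_apply, Pi.smul_apply, smul_eq_mul, hz, restr_of_mem hx]
  obtain ⟨c, hc, t, ht, rfl⟩ := exists_cell (N := 2) (by norm_num) hx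
  have hd := hg.1.differentiable one_ne_zero
  have hcell := (hg.2.2 c).eq_herm hd (h := 1 / 2) (by norm_num) (by push_cast; ring)
    (x := (c + t) / 2) (by
      simp only [pow_one, Int.cast_natCast]
      constructor <;> linarith [ht.1, ht.2])
  have hdata := fun n => xi_hdata 1 n c hc t ht
  simp only [pow_one, Nat.cast_ofNat] at hdata
  simp only [Nat.cast_ofNat] at hcell ⊢
  rw [hcell]
  simp only [hdata]
  interval_cases c
  · simp [xiData, herm]
    field_simp
    ring
  · have e2 : (1 + 1 : ℝ) / 2 = 1 := by norm_num
    simp [xiData, herm, e2]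
    field_simp
    ring

namespace ScalingChoice

variable (A : ScalingChoice)

instance (j : Fin 10) : IsL2 (A.p j) := by unfold p; infer_instance
instance (j : Fin 8) : IsL2 (A.q j) := by unfold q; infer_instance
instance (i : Fin 2) : IsL2 (A.h i) := by unfold h; infer_instance
instance : IsL2 A.psi3 := by unfold psi3; infer_instance
instance : IsL2 A.psi4 := by unfold psi4; infer_instance

/-- The indices of the functions `p j`. -/
def pidx : Fin 10 → Fin 6 × ℤ :=
  ![(0, 0), (1, 0), (2, 0), (3, 0), (0, 1), (1, 1), (2, 1), (3, 1), (4, 1), (5, 1)]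

/-- The indices of the functions `q i`. -/
def qidx : Fin 8 → Fin 6 × ℤ :=
  ![(0, 0), (1, 0), (2, 0), (3, 0), (4, 0), (5, 0), (4, 1), (5, 1)]

theorem p_eq (j : Fin 10) : A.p j = dil 2 0 (A.e (pidx j)) := by
  have h : ∀ f : ℝ → ℝ, dil 2 0 (dil 1 0 f) = dil 2 0 f ∧ dil 2 0 (dil 1 1 f) = dil 2 1 f := by
    intro f
    constructor <;>
    · ext x; simp only [dil_eq]; congr 1; ring
  fin_cases j <;> simp [p, pidx, e, h, phi]

theorem q_eq (i : Fin 8) : A.q i = A.e (qidx i) := by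
  fin_cases i <;> simp [q, qidx, e, dil_one_zero, phi]

variable {A}

theorem range_pidx : Set.range pidx = inside 0 2 := by
  ext ⟨i, k⟩
  constructor
  · rintro ⟨j, hj⟩
    rw [← hj]
    fin_cases j <;> simp [pidx, inside]
  · intro h
    have hk : k = 0 ∨ k = 1 := by
      rcases h with h | h <;> simp at h <;> omega
    rcases hk with rfl | rfl
    · have hi : i < 4 := by rcases h with h | h <;> simp at h <;> omega
      fin_cases i
      exacts [⟨0, rfl⟩, ⟨1, rfl⟩, ⟨2, rfl⟩, ⟨3, rfl⟩, absurd hi (by decide), absurd hi (by decide)]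
    · fin_cases i
      exacts [⟨4, rfl⟩, ⟨5, rfl⟩, ⟨6, rfl⟩, ⟨7, rfl⟩, ⟨8, rfl⟩, ⟨9, rfl⟩]

theorem dil_half_two (f : ℝ → ℝ) : dil 2 0 (dil (1 / 2) 0 f) = f ∧
    dil (1 / 2) 0 (dil 2 0 f) = f := by
  constructor <;>
  · ext x; simp only [dil_eq]; congr 1; ring

theorem ip_dil_two_right (f g : ℝ → ℝ) : ip f (dil 2 0 g) = 1 / 2 * ip (dil (1 / 2) 0 f) g := by
  conv_lhs => rw [← (dil_half_two f).1]
  rw [ip_dil]; norm_num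

theorem mem_Vs_one {f : ℝ → ℝ} : f ∈ A.Vs 1 ↔ dil (1 / 2) 0 f ∈ A.V := by
  rw [mem_Vs_iff, pow_one]

theorem dil_two_mem {f : ℝ → ℝ} (hf : f ∈ A.V) : dil 2 0 f ∈ A.Vs 1 := by
  rw [mem_Vs_one, (dil_half_two f).2]; exact hf

variable (hA : A.Admissible)

include hA

/-- The double zero removes the functions at the node 1, `coeff_eq_zero_left` those at 0, and
orthogonality to φ₁ and φ₂ the remaining ones. -/
theorem restr_eq_zero_left {g : ℝ → ℝ} (hg : g ∈ Sp 1) (hz : g ∈ Z 1)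
    (hs : ∀ i, ip g (A.short i) = 0) : restr g = 0 := by
  have hL := isL2_of_mem_Sp hg
  obtain ⟨a, b, c, d, he, hcd⟩ := Sp_one_restr hg
  obtain ⟨rfl, rfl⟩ := hcd hz
  rw [zero_smul, zero_smul, add_zero, add_zero] at he
  have hs' : ∀ i, ip (restr g) (A.short i) = 0 := fun i => by
    rw [ip_restr_left _ (A.short_supp i), hs i]
  have h := coeff_eq_zero_left hA he hs'
  rw [h.1, h.2, zero_smul, zero_smul, zero_add, zero_add] at he
  have h0 := on_phi12.ip_eq 0 0
  have h1 := on_phi12.ip_eq 0 1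
  have h2 := on_phi12.ip_eq 1 0
  have h3 := on_phi12.ip_eq 1 1
  have k0 := hs' 0
  have k1 := hs' 1
  simp only [Matrix.cons_val_zero, Matrix.cons_val_one] at h0 h1 h2 h3
  change ip _ phi1 = 0 at k0
  change ip _ phi2 = 0 at k1
  rw [he, ip_add_left, ip_smul_left, ip_smul_left] at k0 k1
  simp [h0, h1, h2, h3] at k0 k1
  rw [he, k0, k1, zero_smul, zero_smul, add_zero]

theorem restr_eq_zero_right {g : ℝ → ℝ} (hg : g ∈ Sp 1) (hz : g ∈ Z 0)
    (hs : ∀ i, ip g (A.short i) = 0) : restr g = 0 := by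
  have hL := isL2_of_mem_Sp hg
  obtain ⟨a, b, c, d, he, -⟩ := Sp_one_restr hg
  rw [hz.2.1, hz.2.2, zero_div, zero_div, zero_smul, zero_smul, zero_add, zero_add] at he
  have he' : restr g = c • zeta 2 + d • zeta 3 + a • phi1 + b • phi2 := by rw [he]; abel
  have hs' : ∀ i, ip (restr g) (A.short i) = 0 := fun i => by
    rw [ip_restr_left _ (A.short_supp i), hs i]
  have h := coeff_eq_zero_right hA he' hs'
  rw [h.1, h.2, zero_smul, zero_smul, add_zero, add_zero] at he
  have h0 := on_phi12.ip_eq 0 0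
  have h1 := on_phi12.ip_eq 0 1
  have h2 := on_phi12.ip_eq 1 0
  have h3 := on_phi12.ip_eq 1 1
  have k0 := hs' 0
  have k1 := hs' 1
  simp only [Matrix.cons_val_zero, Matrix.cons_val_one] at h0 h1 h2 h3
  change ip _ phi1 = 0 at k0
  change ip _ phi2 = 0 at k1
  rw [he, ip_add_left, ip_smul_left, ip_smul_left] at k0 k1
  simp [h0, h1, h2, h3] at k0 k1
  rw [he, k0, k1, zero_smul, zero_smul, add_zero]

theorem mem_Z_of_ip {f : ℝ → ℝ} (hf : f ∈ A.V) {m : ℤ} (h4 : ip f (A.e (4, m)) = 0)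
    (h5 : ip f (A.e (5, m)) = 0) : f ∈ Z m := by
  have h := (sub_center_mem hA hf m).1
  rwa [center, h4, h5, zero_smul, zero_smul, add_zero, sub_zero] at h

/-- A function of `V₀` which is orthogonal to the functions `p j` vanishes on `[0, 1]`. -/
theorem restr_eq_zero_of_ip_p {f : ℝ → ℝ} (hf : f ∈ A.V) (h : ∀ j, ip f (A.p j) = 0) :
    restr f = 0 := by
  set g := dil (1 / 2) 0 f with hg
  -- Stretching by 2 puts `g` into `V`, where its coefficients at 1 control its 1-jet there, and
  -- also into `Sp 1`, so that [0,1] and [1,2] can be treated separately by the preceding two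
  -- lemmas.
  have hgV : g ∈ A.V := mem_Vs_one.1 (V_le_Vs_one hf)
  have hgS : g ∈ Sp 1 := Sp_succ_half (A.V_le_Sp hf)
  have hp : ∀ p ∈ inside 0 2, ip g (A.e p) = 0 := by
    intro p hp
    rw [← range_pidx] at hp
    obtain ⟨j, rfl⟩ := hp
    have := h j
    rw [p_eq, ip_dil_two_right] at this
    linarith
  have hz : g ∈ Z ((1 : ℤ) : ℝ) :=
    mem_Z_of_ip hA hgV (hp _ (by simp [inside])) (hp _ (by simp [inside]))
  rw [Int.cast_one] at hz
  have hL : restr g = 0 := by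
    refine restr_eq_zero_left hA hgS hz fun i => ?_
    have := hp (⟨i, by omega⟩, 0) (by left; exact ⟨i.2, by simp⟩)
    simp only [e, Int.cast_zero, dil_one_zero] at this
    rwa [phi_eq_short _ i.2] at this
  have hR : restr (dil 1 (-1) g) = 0 := by
    refine restr_eq_zero_right hA (shift_one_mem_Sp hgS).2 (dil_mem_Z hz (by ring)) fun i => ?_
    have := hp (⟨i, by omega⟩, 1) (by left; exact ⟨i.2, by simp⟩)
    simp only [e, Int.cast_one] at this
    rw [phi_eq_short _ i.2] at this
    rw [ip_dil_one_left, neg_neg]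
    exact this
  ext x
  by_cases hx : x ∈ Set.Icc (0 : ℝ) 1
  · rw [restr_of_mem hx]
    have e : f x = g (2 * x) := by
      rw [hg, dil_eq]; congr 1; ring
    rw [e]
    rcases le_total x (1 / 2) with h1 | h1
    · have h2 : 2 * x ∈ Set.Icc (0 : ℝ) 1 := ⟨by linarith [hx.1], by linarith⟩
      rw [← restr_of_mem (f := g) h2, hL]; rfl
    · have h2 : 2 * x - 1 ∈ Set.Icc (0 : ℝ) 1 := ⟨by linarith, by linarith [hx.2]⟩
      have h3 := restr_of_mem (f := dil 1 (-1) g) h2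
      rw [hR, dil_eq] at h3
      rw [show 1 * (2 * x - 1) - -1 = 2 * x by ring] at h3
      exact h3.symm
  · exact restr_mem f x hx

theorem ip_q_eq_zero_of_restr {f : ℝ → ℝ} (hf : f ∈ A.V) (h : restr f = 0) (i : Fin 8) :
    ip f (A.q i) = 0 := by
  have h0 : ∀ x ∈ Set.Icc (0 : ℝ) 1, f x = 0 := fun x hx => by
    rw [← restr_of_mem (f := f) hx, h]; rfl
  have hC := (A.V_le_Sp hf).1
  have hs : ∀ i, ip f (A.short i) = 0 := fun i => by
    rw [← ip_restr_left f (A.short_supp i), h, ip_zero_left]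
  have z0 := ip_e_eq_zero_of_mem_Z hA hf (m := 0)
    (by simpa using mem_Z_of_zero_on hC one_pos h0 (Or.inl rfl))
  have z1 := ip_e_eq_zero_of_mem_Z hA hf (m := 1)
    (by simpa using mem_Z_of_zero_on hC one_pos h0 (Or.inr rfl))
  rw [q_eq]
  have e0 : ∀ i : Fin 6, A.e (i, 0) = A.phi i := fun i => by simp [e, dil_one_zero]
  fin_cases i
  · exact (congrArg _ (e0 0)).trans (hs 0)
  · exact (congrArg _ (e0 1)).trans (hs 1)
  · exact (congrArg _ (e0 2)).trans (hs 2)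
  · exact (congrArg _ (e0 3)).trans (hs 3)
  · exact z0.1
  · exact z0.2
  · exact z1.1
  · exact z1.2

/-- The key nondegeneracy property of the generators. -/
theorem ip_q_eq_zero {f : ℝ → ℝ} (hf : f ∈ A.V) (h : ∀ j, ip f (A.p j) = 0) (i : Fin 8) :
    ip f (A.q i) = 0 :=
  ip_q_eq_zero_of_restr hA hf (restr_eq_zero_of_ip_p hA hf h) i

theorem q_on : ON A.q := by
  have : A.q = A.e ∘ qidx := funext A.q_eq
  rw [this]
  exact (e_on hA).comp (by decide)

omit hA in
theorem q_mem_V (i : Fin 8) : A.q i ∈ A.V := by rw [q_eq]; exact A.e_mem_V _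

/-- The eight rows of `matS` are independent; with ten columns the null space has dimension two. -/
theorem q_coeff_eq_zero {a : Fin 8 → ℝ} (h : ∀ j, ip (∑ i, a i • A.q i) (A.p j) = 0) : a = 0 := by
  have hV : ∑ i, a i • A.q i ∈ A.V :=
    Submodule.sum_mem _ fun i _ => Submodule.smul_mem _ _ (q_mem_V i)
  ext i
  have := ip_q_eq_zero hA hV h i
  rwa [(q_on hA).ip_sum_smul] at this

theorem exists_null_S : ∃ b : Fin 2 → Fin 10 → ℝ, IsNullBasis A.matS b :=
  exists_isNullBasis_ip A.q A.p (fun _ ha => q_coeff_eq_zero hA ha) (by simp)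

end ScalingChoice

end SplineWavelet

end

open MeasureTheory

noncomputable section

set_option synthInstance.maxSize 100000

namespace SplineWavelet

theorem ON.dilate {ι : Type*} [DecidableEq ι] {g : ι → ℝ → ℝ} (hg : ON g) (j : ℕ) :
    ON fun i => (2 : ℝ) ^ ((j : ℝ) / 2) • dil (2 ^ j) 0 (g i) := by
  refine ⟨fun i => ?_, fun i k => ?_⟩
  · have := hg.l2 i
    have : IsL2 (dil (2 ^ j) 0 (g i)) := isL2_dil (by positivity) _ (hg.l2 i)
    infer_instance
  · have h2 : (0 : ℝ) < 2 ^ j := by positivity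
    rw [ip_smul_left, ip_smul_right, ip_dil, hg.ip_eq, ← mul_assoc, two_rpow_half_mul,
      abs_of_pos h2, ← mul_assoc, mul_inv_cancel₀ h2.ne', one_mul]

theorem dil_mem_SuppIn_of_le {a b a' b' s c : ℝ} {f : ℝ → ℝ} (hf : f ∈ SuppIn a b) (hs : 0 < s)
    (ha : s * a' ≤ a + c) (hb : b + c ≤ s * b') : dil s c f ∈ SuppIn a' b' := by
  intro x hx
  refine hf _ fun h => hx ⟨?_, ?_⟩
  · exact le_of_mul_le_mul_left (by linarith [h.1]) hs
  · exact le_of_mul_le_mul_left (by linarith [h.2]) hs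

theorem Indep2.of_forall {u : Fin 2 → ℝ → ℝ} (hc : ∀ i, Continuous (u i)) (hL : ∀ i, IsL2 (u i))
    (h : ∀ c : Fin 2 → ℝ, ∑ i, c i • u i = 0 → c = 0) : Indep2 u := by
  intro c h0
  refine h c (eq_zero_of_ip_self _ h0 ?_)
  have : ∑ i, c i • u i = fun x => ∑ i, (c i • u i) x := by ext x; simp
  rw [this]
  exact continuous_finsetSum _ fun i _ => (hc i).const_smul (c i)

namespace ScalingChoice

variable {A : ScalingChoice}

/-! ### The spaces of the first level -/

theorem Vs_continuous {j : ℕ} {f : ℝ → ℝ} (hf : f ∈ A.Vs j) : ContDiff ℝ 1 f ∧ Continuous f :=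
  ⟨(A.Vs_le_Sp j hf).1, (A.Vs_le_Sp j hf).1.continuous⟩

theorem shift_mem_Vs_one {f : ℝ → ℝ} (hf : f ∈ A.Vs 1) (m : ℤ) : dil 1 m f ∈ A.Vs 1 := by
  rw [mem_Vs_one] at hf ⊢
  have : dil (1 / 2) 0 (dil 1 m f) = dil 1 ((2 * m : ℤ) : ℝ) (dil (1 / 2) 0 f) := by
    ext x; simp only [dil_eq]; push_cast; congr 1; ring
  rw [this]
  exact shift_mem_V hf _

theorem phi_e (i : Fin 6) : A.e (i, 0) = A.phi i := by simp [e, dil_one_zero]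

theorem e_mem_Vs_one (p : Fin 6 × ℤ) : A.e p ∈ A.Vs 1 := A.V_le_Vs_one (A.e_mem_V p)

/-- The functions of `V₁` which are orthogonal to `V₀`. -/
def wav (A : ScalingChoice) : Submodule ℝ (ℝ → ℝ) := A.Vs 1 ⊓ perp (Set.range A.e)

theorem mem_wav {f : ℝ → ℝ} : f ∈ A.wav ↔ f ∈ A.Vs 1 ∧ ∀ p, ip f (A.e p) = 0 := by
  constructor
  · rintro ⟨h1, h2⟩
    exact ⟨h1, fun p => h2.2 _ ⟨p, rfl⟩ inferInstance⟩
  · rintro ⟨h1, h2⟩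
    refine ⟨h1, isL2_of_mem_Vs h1, ?_⟩
    rintro _ ⟨p, rfl⟩ _
    exact h2 p

theorem ip_wav {f g : ℝ → ℝ} (hf : f ∈ A.wav) (hg : g ∈ A.V) : ip f g = 0 := by
  have := isL2_of_mem_Vs hf.1
  refine ip_eq_zero_of_mem_span_right ?_ ?_ hg
  · rintro _ ⟨p, rfl⟩; infer_instance
  · rintro _ ⟨p, rfl⟩; exact (mem_wav.1 hf).2 p

theorem shift_mem_wav {f : ℝ → ℝ} (hf : f ∈ A.wav) (m : ℤ) : dil 1 m f ∈ A.wav := by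
  rw [mem_wav] at hf ⊢
  refine ⟨shift_mem_Vs_one hf.1 m, fun p => ?_⟩
  rw [ip_dil_one_left, ← Int.cast_neg, shift_e]
  exact hf.2 _

theorem p_mem (j : Fin 10) : A.p j ∈ A.Vs 1 := by
  rw [p_eq]; exact dil_two_mem (A.e_mem_V _)

variable (hA : A.Admissible)

include hA

theorem ip_dil_two_e (p q : Fin 6 × ℤ) :
    ip (dil 2 0 (A.e p)) (dil 2 0 (A.e q)) = if p = q then 1 / 2 else 0 := by
  rw [ip_dil, (e_on hA).ip_eq]
  split_ifs <;> norm_num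

theorem mem_span_dil_inside {f : ℝ → ℝ} (hf : f ∈ A.Vs 1) {a b : ℤ} (hs : f ∈ SuppIn a b) :
    f ∈ Submodule.span ℝ ((fun p => dil 2 0 (A.e p)) '' inside (2 * a) (2 * b)) := by
  have h1 : dil (1 / 2) 0 f ∈ SuppIn ((2 * a : ℤ) : ℝ) ((2 * b : ℤ) : ℝ) := by
    refine dil_mem_SuppIn hs (by norm_num) ?_ ?_ <;> push_cast <;> linarith
  have h2 := mem_span_inside hA (mem_Vs_one.1 hf) h1
  have h3 := Submodule.mem_map_of_mem (f := dilL 2 0) h2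
  rw [dilL_apply, (dil_half_two f).1, Submodule.map_span, ← Set.image_comp] at h3
  exact h3

theorem mem_span_p {f : ℝ → ℝ} (hf : f ∈ A.Vs 1) (hs : f ∈ SuppIn 0 1) :
    f ∈ Submodule.span ℝ (Set.range A.p) := by
  have h := mem_span_dil_inside hA hf (a := 0) (b := 1) (by simpa using hs)
  have e1 : (2 * 0 : ℤ) = 0 := rfl
  have e2 : (2 * 1 : ℤ) = 2 := rfl
  rw [e1, e2, ← range_pidx, ← Set.range_comp] at h
  have : A.p = (fun p => dil 2 0 (A.e p)) ∘ pidx := funext A.p_eq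
  rwa [this]

theorem p_supp (j : Fin 10) : A.p j ∈ SuppIn 0 1 := by
  rw [p_eq]
  have h : pidx j ∈ inside 0 2 := by rw [← range_pidx]; exact ⟨j, rfl⟩
  rcases h with h | h
  · have h1 : (0 : ℝ) ≤ (pidx j).2 := by exact_mod_cast h.2.1
    have h2 : ((pidx j).2 : ℝ) + 1 ≤ 2 := by exact_mod_cast h.2.2
    exact dil_mem_SuppIn_of_le (e_supp_short _ h.1) two_pos (by linarith) (by linarith)
  · have h1 : (0 : ℝ) + 1 ≤ (pidx j).2 := by exact_mod_cast h.2.1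
    have h2 : ((pidx j).2 : ℝ) + 1 ≤ 2 := by exact_mod_cast h.2.2
    exact dil_mem_SuppIn_of_le (e_supp hA _) two_pos (by linarith) (by linarith)

theorem mem_span_p_iff {f : ℝ → ℝ} :
    f ∈ Submodule.span ℝ (Set.range A.p) ↔ f ∈ A.Vs 1 ∧ f ∈ SuppIn 0 1 := by
  refine ⟨fun h => ?_, fun h => mem_span_p hA h.1 h.2⟩
  have : Submodule.span ℝ (Set.range A.p) ≤ A.Vs 1 ⊓ SuppIn 0 1 := by
    refine Submodule.span_le.2 ?_
    rintro _ ⟨j, rfl⟩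
    exact ⟨p_mem j, p_supp hA j⟩
  exact this h

/-- After stretching, φ₅(2·) and φ₆(2·) become φ₅ and φ₆, whose coefficients vanish at a double
zero. `mem_Z_of_ip_big` is the converse. -/
theorem ip_big {f : ℝ → ℝ} (hf : f ∈ A.Vs 1) (hz : f ∈ Z 0) :
    ip f (dil 2 0 A.phi5) = 0 ∧ ip f (dil 2 0 A.phi6) = 0 := by
  have h1 : dil (1 / 2) 0 f ∈ Z ((0 : ℤ) : ℝ) := dil_mem_Z hz (by simp)
  have h2 := ip_e_eq_zero_of_mem_Z hA (mem_Vs_one.1 hf) h1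
  rw [phi_e, phi_e] at h2
  rw [ip_dil_two_right, ip_dil_two_right]
  exact ⟨by rw [show A.phi5 = A.phi 4 from rfl, h2.1, mul_zero],
    by rw [show A.phi6 = A.phi 5 from rfl, h2.2, mul_zero]⟩

theorem mem_Z_of_ip_big {f : ℝ → ℝ} (hf : f ∈ A.Vs 1) (h4 : ip f (dil 2 0 A.phi5) = 0)
    (h5 : ip f (dil 2 0 A.phi6) = 0) : f ∈ Z 0 := by
  rw [ip_dil_two_right] at h4 h5
  have h : dil (1 / 2) 0 f ∈ Z ((0 : ℤ) : ℝ) := by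
    refine mem_Z_of_ip hA (mem_Vs_one.1 hf) ?_ ?_
    · rw [phi_e]; exact (mul_eq_zero.1 h4).resolve_left (by norm_num)
    · rw [phi_e]; exact (mul_eq_zero.1 h5).resolve_left (by norm_num)
  have := dil_mem_Z (a := 2) (c := 0) (m' := 0) h (by simp)
  rwa [(dil_half_two f).1] at this

/-! ### The wavelets with support in `[-1, 1]` obtained from `φ₅(2 ·)`, `φ₆(2 ·)` -/

omit hA in
theorem phi56_mem : A.phi5 ∈ A.V ∧ A.phi6 ∈ A.V := ⟨A.phi_mem_V 4, A.phi_mem_V 5⟩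

theorem on_phi56 : ON ![A.phi5, A.phi6] := by
  have := (e_on hA).comp (e := ![((4 : Fin 6), (0 : ℤ)), (5, 0)]) (by decide)
  have e : A.e ∘ ![((4 : Fin 6), (0 : ℤ)), (5, 0)] = ![A.phi5, A.phi6] := by
    ext i; fin_cases i <;> simp [phi_e] <;> rfl
  rwa [e] at this

omit hA in
theorem h_eq (i : Fin 2) : A.h i = resid ![A.phi5, A.phi6] (![dil 2 0 A.phi5, dil 2 0 A.phi6] i) := by
  fin_cases i <;> rfl

omit hA in
theorem big_mem (i : Fin 2) : ![dil 2 0 A.phi5, dil 2 0 A.phi6] i ∈ A.Vs 1 := by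
  fin_cases i
  · exact dil_two_mem phi56_mem.1
  · exact dil_two_mem phi56_mem.2

/-- Every scaling function of level 0 other than φ₅, φ₆ has a double zero at 0 and so is orthogonal
to φ₅(2·) and φ₆(2·). Subtracting the projections on φ₅ and φ₆ is therefore enough to reach the
complement of `V`. -/
theorem h_mem_wav (i : Fin 2) : A.h i ∈ A.wav := by
  have hb : A.h i ∈ A.Vs 1 := by
    rw [h_eq]
    refine resid_mem (big_mem i) fun k => ?_
    fin_cases k
    · exact A.V_le_Vs_one phi56_mem.1
    · exact A.V_le_Vs_one phi56_mem.2
  refine mem_wav.2 ⟨hb, fun p => ?_⟩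
  have hL : IsL2 (![dil 2 0 A.phi5, dil 2 0 A.phi6] i) := isL2_of_mem_Vs (big_mem i)
  by_cases h4 : p = (4, 0)
  · rw [h4, phi_e, h_eq]; exact resid_ip (on_phi56 hA) _ 0
  by_cases h5 : p = (5, 0)
  · rw [h5, phi_e, h_eq]; exact resid_ip (on_phi56 hA) _ 1
  have hz := e_mem_Z hA h4 h5
  have hbig := ip_big hA (e_mem_Vs_one p) (by simpa using hz)
  rw [h_eq, resid_ip_right (on_phi56 hA), ip_comm]
  · fin_cases i
    exacts [hbig.1, hbig.2]
  · intro k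
    have q1 := (e_on hA).ip_eq p (4, 0)
    have q2 := (e_on hA).ip_eq p (5, 0)
    rw [if_neg h4, phi_e] at q1
    rw [if_neg h5, phi_e] at q2
    fin_cases k
    exacts [q1, q2]

theorem h_supp (i : Fin 2) : A.h i ∈ SuppIn (-1) 1 := by
  have s5 := phi_supp hA 4
  have s6 := phi_supp hA 5
  rw [h_eq]
  refine resid_mem ?_ fun k => ?_
  · fin_cases i
    · exact dil_mem_SuppIn_of_le s5 two_pos (by norm_num) (by norm_num)
    · exact dil_mem_SuppIn_of_le s6 two_pos (by norm_num) (by norm_num)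
  · fin_cases k
    exacts [s5, s6]

/-- Wavelets with a double zero at `0` are orthogonal to `h₁` and `h₂`. -/
theorem ip_h_iff {f : ℝ → ℝ} (hf : f ∈ A.wav) : (∀ i, ip f (A.h i) = 0) ↔ f ∈ Z 0 := by
  have hL := isL2_of_mem_Vs hf.1
  have key : ∀ i, ip f (A.h i) = ip f (![dil 2 0 A.phi5, dil 2 0 A.phi6] i) := by
    intro i
    have hL' : IsL2 (![dil 2 0 A.phi5, dil 2 0 A.phi6] i) := isL2_of_mem_Vs (big_mem i)
    rw [h_eq, ip_comm, resid_ip_right (on_phi56 hA), ip_comm]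
    intro k
    fin_cases k
    exacts [ip_wav hf phi56_mem.1, ip_wav hf phi56_mem.2]
  constructor
  · intro h
    exact mem_Z_of_ip_big hA hf.1 ((key 0).symm.trans (h 0)) ((key 1).symm.trans (h 1))
  · intro h i
    rw [key]
    have := ip_big hA hf.1 h
    fin_cases i
    exacts [this.1, this.2]

theorem ip_phi56_big_p (c : Fin 2 → ℝ) (j : Fin 10) :
    ip (c 0 • dil 2 0 A.phi5 + c 1 • dil 2 0 A.phi6) (A.p j) = 0 := by
  have h4 := ip_dil_two_e hA (4, 0) (pidx j)
  have h5 := ip_dil_two_e hA (5, 0) (pidx j)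
  have n4 : ∀ j, ((4 : Fin 6), (0 : ℤ)) ≠ pidx j := by decide
  have n5 : ∀ j, ((5 : Fin 6), (0 : ℤ)) ≠ pidx j := by decide
  rw [if_neg (n4 j)] at h4
  rw [if_neg (n5 j)] at h5
  rw [phi_e, ← p_eq] at h4 h5
  rw [ip_add_left, ip_smul_left, ip_smul_left]
  rw [show A.phi5 = A.phi 4 from rfl, show A.phi6 = A.phi 5 from rfl, h4, h5]; ring

theorem ip_phi56_big_self (c : Fin 2 → ℝ) :
    ip (c 0 • dil 2 0 A.phi5 + c 1 • dil 2 0 A.phi6) (c 0 • dil 2 0 A.phi5 + c 1 • dil 2 0 A.phi6) =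
      1 / 2 * (c 0 ^ 2 + c 1 ^ 2) := by
  have h := ip_lincomb_on (on_phi56 hA) c c
  have e : c 0 • dil 2 0 A.phi5 + c 1 • dil 2 0 A.phi6 = dil 2 0 (lincomb c ![A.phi5, A.phi6]) := by
    ext x; simp [dil_eq, lincomb]
  rw [e, ip_dil, h]
  simp [Fin.sum_univ_two]; ring

omit hA in
theorem sum_h (c : Fin 2 → ℝ) : ∃ d : Fin 2 → ℝ, ∑ i, c i • A.h i =
    c 0 • dil 2 0 A.phi5 + c 1 • dil 2 0 A.phi6 - (d 0 • A.phi5 + d 1 • A.phi6) := by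
  refine ⟨![c 0 * ip (dil 2 0 A.phi5) A.phi5 + c 1 * ip (dil 2 0 A.phi6) A.phi5,
    c 0 * ip (dil 2 0 A.phi5) A.phi6 + c 1 * ip (dil 2 0 A.phi6) A.phi6], ?_⟩
  simp only [Fin.sum_univ_two, h, Matrix.cons_val_zero, Matrix.cons_val_one, resid_eq]
  module

/-- A function of `V₀` orthogonal to all functions of `V₁` with support in `[0, 1]` is orthogonal
to `φ₅` and `φ₆`. -/
theorem ip_phi56_of_ip_p {f : ℝ → ℝ} (hf : f ∈ A.V) (h : ∀ j, ip f (A.p j) = 0) :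
    ip f A.phi5 = 0 ∧ ip f A.phi6 = 0 :=
  ⟨ip_q_eq_zero hA hf h 4, ip_q_eq_zero hA hf h 5⟩

omit hA in
theorem comb56_mem (d : Fin 2 → ℝ) : d 0 • A.phi5 + d 1 • A.phi6 ∈ A.V :=
  Submodule.add_mem _ (Submodule.smul_mem _ _ phi56_mem.1) (Submodule.smul_mem _ _ phi56_mem.2)

theorem comb56_eq_zero {d : Fin 2 → ℝ}
    (h : ip (d 0 • A.phi5 + d 1 • A.phi6) A.phi5 = 0 ∧
      ip (d 0 • A.phi5 + d 1 • A.phi6) A.phi6 = 0) : d = 0 := by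
  have q := (on_phi56 hA).ip_sum_smul d
  ext i
  rw [← q i]
  simp only [Fin.sum_univ_two]
  fin_cases i
  exacts [h.1, h.2]

/-- A relation would identify a combination of φ₅(2·), φ₆(2·) with one of φ₅, φ₆. The former is
orthogonal to all the `p j`, so by nondegeneracy the latter is orthogonal to φ₅ and φ₆, hence zero,
and then so is the former. -/
theorem h_indep : Indep2 A.h := by
  refine Indep2.of_forall (fun i => (Vs_continuous (h_mem_wav hA i).1).2) inferInstance ?_
  intro c hc
  obtain ⟨d, hd⟩ := sum_h (A := A) c
  rw [hc] at hd
  have hd' := sub_eq_zero.1 hd.symm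
  have h1 := ip_phi56_of_ip_p hA (comb56_mem d) fun j => by
    rw [← hd']; exact ip_phi56_big_p hA c j
  have h2 := comb56_eq_zero hA h1
  have h3 := ip_phi56_big_self hA c
  rw [hd', h2] at h3
  simp at h3
  ext i
  fin_cases i <;> simp <;> nlinarith [sq_nonneg (c 0), sq_nonneg (c 1)]

/-- Let c = (φ₅(0), φ₆(0)), F = c₀φ₅(2·) + c₁φ₆(2·) and G = c₀φ₅ + c₁φ₆. If both functions vanished
at 0, then ⟨F,G⟩ = |c|², while ‖F‖² = |c|²/2 and ‖G‖² = |c|². This gives ‖2F - G‖² = -|c|² < 0,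
which is absurd. -/
theorem h_zero : A.h 0 0 ≠ 0 ∨ A.h 1 0 ≠ 0 := by
  by_contra hcon
  push Not at hcon
  set c : Fin 2 → ℝ := ![A.phi5 0, A.phi6 0] with hc
  set F := c 0 • dil 2 0 A.phi5 + c 1 • dil 2 0 A.phi6 with hF
  set G := c 0 • A.phi5 + c 1 • A.phi6 with hG
  have hFF := ip_phi56_big_self hA c
  have hGG : ip G G = c 0 ^ 2 + c 1 ^ 2 := by
    have h := ip_lincomb_on (on_phi56 hA) c c
    have e : lincomb c ![A.phi5, A.phi6] = G := by
      ext x; simp [lincomb, hG]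
    rw [e] at h
    rw [h]; simp [Fin.sum_univ_two]; ring
  have e5 : dil 2 0 A.phi5 0 = A.phi5 0 := by simp [dil_eq]
  have e6 : dil 2 0 A.phi6 0 = A.phi6 0 := by simp [dil_eq]
  have k0 : c 0 = ip (dil 2 0 A.phi5) A.phi5 * c 0 + ip (dil 2 0 A.phi5) A.phi6 * c 1 := by
    have := hcon.1
    simp [h, resid, Fin.sum_univ_two, e5, hc] at this ⊢
    linarith
  have k1 : c 1 = ip (dil 2 0 A.phi6) A.phi5 * c 0 + ip (dil 2 0 A.phi6) A.phi6 * c 1 := by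
    have := hcon.2
    simp [h, resid, Fin.sum_univ_two, e6, hc] at this ⊢
    linarith
  have hFG : ip F G = c 0 ^ 2 + c 1 ^ 2 := by
    simp only [hF, hG, ip_add_left, ip_add_right, ip_smul_left, ip_smul_right]
    linear_combination -(c 0) * k0 - c 1 * k1
  have hpos := ip_self_nonneg ((2 : ℝ) • F - G)
  rw [ip_sub_left, ip_sub_right, ip_sub_right, ip_smul_left, ip_smul_right, ip_smul_left,
    ip_smul_right, ip_comm G F, hFF, hGG, hFG] at hpos
  have hc0 : c 0 ≠ 0 := phi5_zero.1
  nlinarith [sq_nonneg (c 1), pow_pos (abs_pos.2 hc0) 2, sq_abs (c 0)]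

theorem psi34_on : ON (gsPair A.h) := gsPair_on (h_indep hA)

theorem psi34_mem_wav (i : Fin 2) : gsPair A.h i ∈ A.wav := gsPair_mem (h_mem_wav hA) i

theorem psi34_supp (i : Fin 2) : gsPair A.h i ∈ SuppIn (-1) 1 := gsPair_mem (h_supp hA) i

theorem psi34_zero : A.psi3 0 ≠ 0 ∨ A.psi4 0 ≠ 0 := by
  by_contra hcon
  push Not at hcon
  let U : Submodule ℝ (ℝ → ℝ) := LinearMap.ker (LinearMap.proj (0 : ℝ))
  have h := mem_of_gsPair_mem (U := U) (h_indep hA) fun i => by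
    fin_cases i
    exacts [hcon.1, hcon.2]
  rcases h_zero hA with h' | h'
  exacts [h' (h 0), h' (h 1)]

theorem ip_psi34_iff {f : ℝ → ℝ} (hf : f ∈ A.wav) :
    (∀ i, ip f (gsPair A.h i) = 0) ↔ f ∈ Z 0 := by
  have hL := isL2_of_mem_Vs hf.1
  rw [← ip_h_iff hA hf]
  have mem : ∀ g, IsL2 g → (g ∈ perp {f} ↔ ip f g = 0) := by
    intro g hg
    constructor
    · intro h; rw [ip_comm]; exact h.2 f rfl hL
    · rintro h
      refine ⟨hg, ?_⟩
      rintro _ rfl _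
      rw [ip_comm]; exact h
  constructor
  · intro h i
    rw [← mem _ inferInstance]
    exact mem_of_gsPair_mem (h_indep hA) (fun i => (mem _ inferInstance).2 (h i)) i
  · intro h i
    rw [← mem _ inferInstance]
    exact gsPair_mem (fun i => (mem _ inferInstance).2 (h i)) i

end ScalingChoice

end SplineWavelet

end

/-! ### Indexing by integers, the short wavelets ψ₁, ψ₂ and the matrix for ψ₅, ψ₆ -/

open MeasureTheory

noncomputable section

set_option synthInstance.maxSize 100000

namespace SplineWavelet

/-- The generator and the translation of the `n`-th function of a family `lineFamily m g j`. -/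
def lineIdx (m : ℕ) (n : ℤ) : Fin 6 × ℤ :=
  (⟨((n - 1) % 6).toNat, by omega⟩, (n - 1) / 6 + if ((n - 1) % 6).toNat < m then 0 else 1)

theorem lineFamily_eq (m : ℕ) (g : Fin 6 → ℝ → ℝ) (j : ℕ) (n : ℤ) :
    lineFamily m g j n = (2 : ℝ) ^ ((j : ℝ) / 2) •
      dil (2 ^ j) 0 (dil 1 (lineIdx m n).2 (g (lineIdx m n).1)) := by
  ext x
  simp only [lineFamily, Pi.smul_apply, smul_eq_mul, dil_eq, lineIdx]
  congr 2
  split_ifs <;> push_cast <;> ring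

theorem lineIdx_injective (m : ℕ) : Function.Injective (lineIdx m) := by
  intro n n' h
  simp only [lineIdx, Prod.mk.injEq, Fin.mk.injEq] at h
  obtain ⟨h1, h2⟩ := h
  rw [h1] at h2
  omega

theorem lineIdx_surjective (m : ℕ) : Function.Surjective (lineIdx m) := by
  rintro ⟨l, k⟩
  by_cases hl : (l : ℕ) < m
  · refine ⟨6 * k + l + 1, ?_⟩
    have e1 : ((6 * k + l + 1 - 1) % 6).toNat = l := by omega
    simp only [lineIdx, e1, if_pos hl, Prod.mk.injEq]
    exact ⟨trivial, by omega⟩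
  · refine ⟨6 * (k - 1) + l + 1, ?_⟩
    have e1 : ((6 * (k - 1) + l + 1 - 1) % 6).toNat = l := by omega
    simp only [lineIdx, e1, if_neg hl, Prod.mk.injEq]
    exact ⟨trivial, by omega⟩

theorem range_comp_lineIdx (m N : ℕ) (c : ℤ) (S : Set (Fin 6 × ℤ))
    (h : ∀ n, lineIdx m n ∈ S ↔ -c ≤ n ∧ n < N - c) :
    (Set.range fun i : Fin N => lineIdx m ((i : ℤ) - c)) = S := by
  ext p
  constructor
  · rintro ⟨i, rfl⟩
    exact (h _).2 ⟨by omega, by omega⟩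
  · intro hp
    obtain ⟨n, rfl⟩ := lineIdx_surjective m p
    have := (h n).1 hp
    refine ⟨⟨(n + c).toNat, by omega⟩, ?_⟩
    simp only
    congr 1
    omega

namespace ScalingChoice

variable {A : ScalingChoice}

theorem lineIdx_mem_inside (n a b : ℤ) :
    lineIdx 4 n ∈ inside a b ↔ 6 * a + 1 ≤ n ∧ n ≤ 6 * b - 2 := by
  have e4 : ((4 : Fin 6) : ℕ) = 4 := rfl
  simp only [e4, inside, lineIdx, Set.mem_ofPred_eq, Fin.lt_def, Fin.le_def]
  split_ifs <;> omega

theorem phiLine_eq (j : ℕ) (n : ℤ) : A.phiLine j n =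
    (2 : ℝ) ^ ((j : ℝ) / 2) • dil (2 ^ j) 0 (A.e (lineIdx 4 n)) := lineFamily_eq 4 A.phi j n

instance (j : ℕ) (n : ℤ) : IsL2 (A.phiLine j n) := by
  rw [phiLine_eq]
  have : IsL2 (dil (2 ^ j) 0 (A.e (lineIdx 4 n))) := isL2_dil (by positivity) _ inferInstance
  infer_instance

theorem phiLine_on (hA : A.Admissible) (j : ℕ) : ON (A.phiLine j) := by
  have := ((e_on hA).dilate j).comp (lineIdx_injective 4)
  have e : A.phiLine j = (fun p => (2 : ℝ) ^ ((j : ℝ) / 2) • dil (2 ^ j) 0 (A.e p)) ∘ lineIdx 4 :=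
    funext fun n => phiLine_eq j n
  rwa [e]

theorem phiLine_zero (n : ℤ) : A.phiLine 0 n = A.e (lineIdx 4 n) := by
  rw [phiLine_eq]
  ext x
  simp [dil_eq]

end ScalingChoice

namespace WaveletChoice

open ScalingChoice

variable {B : WaveletChoice} {A : ScalingChoice}

instance (i : Fin 2) : IsL2 (B.u A i) := by unfold u; infer_instance
instance : IsL2 (B.psi1 A) := by unfold psi1; infer_instance
instance : IsL2 (B.psi2 A) := by unfold psi2; infer_instance
instance (j : Fin 22) : IsL2 (colsT A j) := by unfold colsT; infer_instance
instance (i : Fin 2) : IsL2 (B.z A i) := by unfold z; infer_instance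
instance : IsL2 (B.psi5 A) := by unfold psi5; infer_instance
instance : IsL2 (B.psi6 A) := by unfold psi6; infer_instance
instance (j : Fin 6) : IsL2 (B.psi A j) := by unfold psi; infer_instance
instance (j : Fin 4) : IsL2 (B.psiLong A j) := by unfold psiLong; infer_instance
instance (i : Fin 14 ⊕ Fin 2 ⊕ Fin 4) : IsL2 (B.rowsT A i) := by
  rcases i with i | i | i
  · exact inferInstanceAs (IsL2 (A.phiLine 0 _))
  · exact inferInstanceAs (IsL2 (![dil 1 (-1) (B.psi1 A), dil 1 (-1) (B.psi2 A)] i))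
  · exact inferInstanceAs (IsL2 (![B.psi1 A, B.psi2 A, A.psi3, A.psi4] i))

/-! ### The wavelets with support in `[0, 1]` -/

section S

variable (hA : A.Admissible) (hS : IsNullBasis A.matS B.bS)

include hA hS

omit hS in
theorem u_supp (i : Fin 2) : B.u A i ∈ SuppIn 0 1 := lincomb_mem (p_supp hA)

theorem u_mem_wav (i : Fin 2) : B.u A i ∈ A.wav := by
  have hV : B.u A i ∈ A.Vs 1 := lincomb_mem p_mem
  have hc := (Vs_continuous hV).2
  refine mem_wav.2 ⟨hV, fun p => ?_⟩
  have hs := u_supp (B := B) hA i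
  obtain ⟨l, k⟩ := p
  have hq : ∀ j, qidx j = (l, k) → ip (B.u A i) (A.e (l, k)) = 0 := by
    intro j hj
    rw [ip_comm, ← hj, ← q_eq]
    exact ip_lincomb_of_nullBasis (r := A.q) (f := A.p) hS j i
  by_cases hl : l < 4
  · rcases lt_trichotomy k 0 with hk | rfl | hk
    · rw [ip_comm]
      refine ip_eq_zero_of_supp (e_supp_short _ hl) hs (e_mem_Sp A _).1.continuous ?_
      have : k + 1 ≤ 0 := by omega
      exact_mod_cast this
    · have : ∀ l : Fin 6, l < 4 → ∃ j, qidx j = (l, 0) := by decide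
      obtain ⟨j, hj⟩ := this l hl
      exact hq j hj
    · refine ip_eq_zero_of_supp hs (e_supp_short _ hl) hc ?_
      have : 1 ≤ k := by omega
      exact_mod_cast this
  · by_cases hk : k < 0
    · rw [ip_comm]
      refine ip_eq_zero_of_supp (e_supp hA _) hs (e_mem_Sp A _).1.continuous ?_
      have : k + 1 ≤ 0 := by omega
      exact_mod_cast this
    by_cases hk' : 1 < k
    · refine ip_eq_zero_of_supp hs (e_supp hA _) hc ?_
      have : 1 ≤ k - 1 := by omega
      exact_mod_cast this
    have hl' : l = 4 ∨ l = 5 := by omega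
    have hk0 : k = 0 ∨ k = 1 := by omega
    rcases hl' with rfl | rfl <;> rcases hk0 with rfl | rfl
    exacts [hq 4 rfl, hq 6 rfl, hq 5 rfl, hq 7 rfl]

omit hS in
theorem p_linearIndependent : LinearIndependent ℝ A.p := by
  have h := ((e_on hA).comp (e := pidx) (by decide)).linearIndependent
  have h2 := h.map' (dilL 2 0) (LinearMap.ker_eq_bot.2 fun f g hfg => by
    have := congrArg (dil (1 / 2) 0) hfg
    simpa only [dilL_apply, (dil_half_two _).2] using this)
  have : A.p = dilL 2 0 ∘ A.e ∘ pidx := funext A.p_eq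
  rwa [this]

theorem u_indep : Indep2 (B.u A) :=
  indep2_lincomb (fun j => (Vs_continuous (p_mem j)).2) (p_linearIndependent hA) hS.1

theorem psi12_on : ON (gsPair (B.u A)) := gsPair_on (u_indep hA hS)

theorem psi12_mem_wav (i : Fin 2) : gsPair (B.u A) i ∈ A.wav := gsPair_mem (u_mem_wav hA hS) i

omit hS in
theorem psi12_supp (i : Fin 2) : gsPair (B.u A) i ∈ SuppIn 0 1 := gsPair_mem (u_supp hA) i

/-- A wavelet on [0,1] is a combination of the `p j` orthogonal to all the `q i`, so its coefficient
vector lies in the null space. Hence ψ₁ and ψ₂ exhaust the wavelets supported in [0,1]. -/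
theorem mem_span_psi12 {f : ℝ → ℝ} (hf : f ∈ A.wav) (hs : f ∈ SuppIn 0 1) :
    f ∈ Submodule.span ℝ (Set.range (gsPair (B.u A))) := by
  have h := IsNullBasis.mem_span (r := A.q) hS (mem_span_p hA hf.1 hs) fun i => by
    rw [ip_comm]; exact ip_wav hf (q_mem_V i)
  refine Submodule.span_le.2 ?_ h
  rintro _ ⟨i, rfl⟩
  exact mem_of_gsPair_mem (U := Submodule.span ℝ (Set.range (gsPair (B.u A)))) (u_indep hA hS)
    (fun i => Submodule.subset_span ⟨i, rfl⟩) i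

theorem psi12_mem_Z (i : Fin 2) (k : ℤ) : dil 1 k (gsPair (B.u A) i) ∈ Z 0 := by
  refine mem_Z_of_supp (Vs_continuous (shift_mem_wav (psi12_mem_wav hA hS i) k).1).1
    (dil_one_supp (psi12_supp hA i)) ?_
  rcases le_or_gt 0 k with h | h
  · left; simpa using h
  · right
    have : 1 + k ≤ 0 := by omega
    exact_mod_cast this

/-- An integer translate of ψ₁ or ψ₂ is supported on one side of 0, so it has a double zero there
and is orthogonal to ψ₃ and ψ₄. -/
theorem ip_psi12_psi34 (i j : Fin 2) (k : ℤ) :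
    ip (dil 1 k (gsPair (B.u A) i)) (gsPair A.h j) = 0 :=
  (ip_psi34_iff hA (shift_mem_wav (psi12_mem_wav hA hS i) k)).2 (psi12_mem_Z hA hS i k) j

theorem psi12_translates :
    ON (fun p : Fin 2 × ℤ => dil 1 p.2 (gsPair (B.u A) p.1)) := by
  have hc := fun i => (Vs_continuous (psi12_mem_wav hA hS i).1).2
  refine on_translates (g := gsPair (B.u A)) (fun i => inferInstance) hc
    (fun i => SuppIn_mono (by norm_num) le_rfl (psi12_supp hA i)) (psi12_on hA hS).ip_eq
    fun i j => ?_
  exact ip_eq_zero_of_supp (psi12_supp hA i) (dil_one_supp (psi12_supp hA j))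
    (Vs_continuous (psi12_mem_wav hA hS i).1).2 (by norm_num)

end S

/-! ### The matrix for `ψ₅`, `ψ₆` -/

/-- The wavelets among the rows of `matT`. -/
def wrows (B : WaveletChoice) (A : ScalingChoice) : Fin 2 ⊕ Fin 4 → ℝ → ℝ :=
  Sum.elim ![dil 1 (-1) (B.psi1 A), dil 1 (-1) (B.psi2 A)] ![B.psi1 A, B.psi2 A, A.psi3, A.psi4]

instance (i : Fin 2 ⊕ Fin 4) : IsL2 (B.wrows A i) := by
  rcases i with i | i
  · exact inferInstanceAs (IsL2 (![dil 1 (-1) (B.psi1 A), dil 1 (-1) (B.psi2 A)] i))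
  · exact inferInstanceAs (IsL2 (![B.psi1 A, B.psi2 A, A.psi3, A.psi4] i))

theorem wrows_cases {C : (ℝ → ℝ) → Prop} (h1 : ∀ i, C (dil 1 (-1) (gsPair (B.u A) i)))
    (h2 : ∀ i, C (gsPair (B.u A) i)) (h3 : ∀ i, C (gsPair A.h i)) (i : Fin 2 ⊕ Fin 4) :
    C (B.wrows A i) := by
  rcases i with i | i <;> fin_cases i
  exacts [h1 0, h1 1, h2 0, h2 1, h3 0, h3 1]

/-- The indices of the scaling functions whose support meets `(-1, 1)`. -/
def ridx (i : Fin 14) : Fin 6 × ℤ := lineIdx 4 ((i : ℤ) - 7)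

theorem rowsT_inl (i : Fin 14) : B.rowsT A (Sum.inl i) = A.e (ridx i) := phiLine_zero _

theorem range_ridx : Set.range ridx =
    {p | (p.1 < 4 ∧ -1 ≤ p.2 ∧ p.2 ≤ 0) ∨ (4 ≤ p.1 ∧ -1 ≤ p.2 ∧ p.2 ≤ 1)} := by
  refine range_comp_lineIdx 4 14 7 _ fun n => ?_
  have e4 : ((4 : Fin 6) : ℕ) = 4 := rfl
  simp only [e4, lineIdx, Set.mem_ofPred_eq, Fin.lt_def, Fin.le_def]
  split_ifs <;> omega

section T

variable (hA : A.Admissible)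

include hA

theorem mem_span_colsT_iff {f : ℝ → ℝ} :
    f ∈ Submodule.span ℝ (Set.range (colsT A)) ↔ f ∈ A.Vs 1 ∧ f ∈ SuppIn (-1) 1 := by
  have hr : (Set.range fun i : Fin 22 => lineIdx 4 ((i : ℤ) - 11)) = inside (-2) 2 :=
    range_comp_lineIdx 4 22 11 _ fun n => by rw [lineIdx_mem_inside]; norm_num; omega
  have e : ∀ i, colsT A i = (2 : ℝ) ^ ((1 : ℝ) / 2) • dil 2 0 (A.e (lineIdx 4 ((i : ℤ) - 11))) := by
    intro i
    rw [colsT, phiLine_eq, Nat.cast_one, pow_one]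
  have h2 : (2 : ℝ) ^ ((1 : ℝ) / 2) ≠ 0 := by positivity
  constructor
  · intro h
    have : Submodule.span ℝ (Set.range (colsT A)) ≤ A.Vs 1 ⊓ SuppIn (-1) 1 := by
      refine Submodule.span_le.2 ?_
      rintro _ ⟨i, rfl⟩
      rw [e]
      refine Submodule.smul_mem _ _ ⟨dil_two_mem (A.e_mem_V _), ?_⟩
      have h : lineIdx 4 ((i : ℤ) - 11) ∈ inside (-2) 2 := by rw [← hr]; exact ⟨i, rfl⟩
      generalize lineIdx 4 ((i : ℤ) - 11) = p at h
      rcases h with h | h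
      · have h1 : (-2 : ℝ) ≤ p.2 := by exact_mod_cast h.2.1
        have h2 : (p.2 : ℝ) + 1 ≤ 2 := by exact_mod_cast h.2.2
        exact dil_mem_SuppIn_of_le (e_supp_short _ h.1) two_pos (by linarith) (by linarith)
      · have h1 : (-2 : ℝ) + 1 ≤ p.2 := by exact_mod_cast h.2.1
        have h2 : (p.2 : ℝ) + 1 ≤ 2 := by exact_mod_cast h.2.2
        exact dil_mem_SuppIn_of_le (e_supp hA _) two_pos (by linarith) (by linarith)
    exact this h
  · rintro ⟨h, hs⟩
    have h := mem_span_dil_inside hA h (a := -1) (b := 1) (by simpa using hs)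
    have e1 : (2 * (-1) : ℤ) = -2 := rfl
    have e2 : (2 * 1 : ℤ) = 2 := rfl
    rw [e1, e2, ← hr, ← Set.range_comp] at h
    refine Submodule.span_le.2 ?_ h
    rintro _ ⟨i, rfl⟩
    have : dil 2 0 (A.e (lineIdx 4 ((i : ℤ) - 11))) =
        ((2 : ℝ) ^ ((1 : ℝ) / 2))⁻¹ • colsT A i := by rw [e, inv_smul_smul₀ h2]
    simp only [Function.comp, this]
    exact Submodule.smul_mem _ _ (Submodule.subset_span ⟨i, rfl⟩)

theorem colsT_mem (j : Fin 22) : colsT A j ∈ A.Vs 1 ∧ colsT A j ∈ SuppIn (-1) 1 :=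
  (mem_span_colsT_iff hA).1 (Submodule.subset_span ⟨j, rfl⟩)

theorem colsT_on : ON (colsT A) := by
  refine (phiLine_on hA 1).comp (e := fun j : Fin 22 => (j : ℤ) - 11) fun i j h => ?_
  simp only at h
  omega

theorem ip_eq_zero_of_colsT {f t : ℝ → ℝ} [IsL2 f] (h : ∀ j, ip f (colsT A j) = 0)
    (ht : t ∈ A.Vs 1) (hs : t ∈ SuppIn (-1) 1) : ip f t = 0 := by
  refine ip_eq_zero_of_mem_span_right ?_ ?_ ((mem_span_colsT_iff hA).2 ⟨ht, hs⟩)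
  · rintro _ ⟨j, rfl⟩; infer_instance
  · rintro _ ⟨j, rfl⟩; exact h j

theorem shift_p_supp (j : Fin 10) : dil 1 (-1) (A.p j) ∈ SuppIn (-1) 0 := by
  have := dil_one_supp (c := -1) (p_supp hA j)
  simpa using this

omit hA in
theorem shift_p_mem (j : Fin 10) : dil 1 (-1) (A.p j) ∈ A.Vs 1 := by
  have := shift_mem_Vs_one (p_mem (A := A) j) (-1)
  simpa using this

/-- A function of `V₀` orthogonal to all functions of `V₁` with support in `[-1, 0]` or in `[0, 1]`
is orthogonal to the scaling functions overlapping `(-1, 1)`. -/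
theorem ip_ridx_eq_zero {f : ℝ → ℝ} (hf : f ∈ A.V) (h1 : ∀ j, ip f (A.p j) = 0)
    (h2 : ∀ j, ip f (dil 1 (-1) (A.p j)) = 0) (i : Fin 14) : ip f (A.e (ridx i)) = 0 := by
  have hL := isL2_of_mem_V hf
  have k1 := ip_q_eq_zero hA hf h1
  have k2 : ∀ i, ip f (dil 1 (-1) (A.q i)) = 0 := by
    intro i
    have := ip_q_eq_zero hA (shift_mem_V hf 1) (fun j => by
      rw [Int.cast_one, ip_dil_one_left]; exact h2 j) i
    rwa [Int.cast_one, ip_dil_one_left] at this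
  have hi : ridx i ∈ Set.range ridx := ⟨i, rfl⟩
  rw [range_ridx] at hi
  have k3 : ∀ i, ip f (A.e ((qidx i).1, (qidx i).2 - 1)) = 0 := by
    intro i
    have := k2 i
    rw [q_eq] at this
    have e : dil 1 (-1) (A.e (qidx i)) = A.e ((qidx i).1, (qidx i).2 - 1) := by
      have := shift_e (A := A) (-1) (qidx i)
      rw [Int.cast_neg, Int.cast_one] at this
      rw [this]; rfl
    rwa [e] at this
  simp only [q_eq] at k1
  generalize ridx i = p at hi
  obtain ⟨l, k⟩ := p
  have hk : k = -1 ∨ k = 0 ∨ k = 1 := by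
    rcases hi with h | h <;> simp only at h <;> omega
  rcases hk with rfl | rfl | rfl
  · fin_cases l
    exacts [k3 0, k3 1, k3 2, k3 3, k3 4, k3 5]
  · fin_cases l
    exacts [k1 0, k1 1, k1 2, k1 3, k1 4, k1 5]
  · have : ¬ l < 4 := by
      intro hl
      rcases hi with h | h <;> simp only at h <;> omega
    fin_cases l
    exacts [absurd (by decide) this, absurd (by decide) this, absurd (by decide) this,
      absurd (by decide) this, k1 6, k1 7]

variable (hS : IsNullBasis A.matS B.bS)

include hS

theorem wrows_mem_wav (i : Fin 2 ⊕ Fin 4) : B.wrows A i ∈ A.wav := by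
  refine wrows_cases ?_ (psi12_mem_wav hA hS) (psi34_mem_wav hA) i
  intro i
  have := shift_mem_wav (psi12_mem_wav hA hS i) (-1)
  simpa using this

omit hS in
theorem wrows_supp (i : Fin 2 ⊕ Fin 4) : B.wrows A i ∈ SuppIn (-1) 1 := by
  refine wrows_cases ?_ ?_ (psi34_supp hA) i
  · intro i
    exact SuppIn_mono (by norm_num) (by norm_num)
      (dil_one_supp (c := -1) (psi12_supp hA i))
  · exact fun i => SuppIn_mono (by norm_num) le_rfl (psi12_supp hA i)

theorem wrows_on : ON (B.wrows A) := by
  have h1 := (psi12_translates hA hS).ip_eq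
  have h2 := (psi34_on hA).ip_eq
  have h12 : ∀ i j, ip (dil 1 (-1) (gsPair (B.u A) i)) (gsPair (B.u A) j) = 0 := by
    intro i j
    have := h1 (i, -1) (j, 0)
    rw [if_neg (by simp)] at this
    simpa [dil_one_zero] using this
  have h11 : ∀ i j, ip (dil 1 (-1) (gsPair (B.u A) i)) (dil 1 (-1) (gsPair (B.u A) j)) =
      if i = j then 1 else 0 := by
    intro i j
    rw [ip_dil_one, (psi12_on hA hS).ip_eq]
  have h22 := (psi12_on hA hS).ip_eq
  have h13 : ∀ i j, ip (dil 1 (-1) (gsPair (B.u A) i)) (gsPair A.h j) = 0 := by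
    intro i j
    have := ip_psi12_psi34 hA hS i j (-1)
    simpa using this
  have h23 : ∀ i j, ip (gsPair (B.u A) i) (gsPair A.h j) = 0 := by
    intro i j
    have := ip_psi12_psi34 hA hS i j 0
    simpa [dil_one_zero] using this
  have h21 : ∀ i j, ip (gsPair (B.u A) i) (dil 1 (-1) (gsPair (B.u A) j)) = 0 := by
    intro i j; rw [ip_comm]; exact h12 j i
  have h31 : ∀ i j, ip (gsPair A.h i) (dil 1 (-1) (gsPair (B.u A) j)) = 0 := by
    intro i j; rw [ip_comm]; exact h13 j i
  have h32 : ∀ i j, ip (gsPair A.h i) (gsPair (B.u A) j) = 0 := by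
    intro i j; rw [ip_comm]; exact h23 j i
  refine ⟨inferInstance, ?_⟩
  rintro (i | i) (j | j) <;> fin_cases i <;> fin_cases j
  exacts [h11 0 0, h11 0 1, h11 1 0, h11 1 1, h12 0 0, h12 0 1, h13 0 0, h13 0 1, h12 1 0, h12 1 1,
    h13 1 0, h13 1 1, h21 0 0, h21 0 1, h21 1 0, h21 1 1, h31 0 0, h31 0 1, h31 1 0, h31 1 1,
    h22 0 0, h22 0 1, h23 0 0, h23 0 1, h22 1 0, h22 1 1, h23 1 0, h23 1 1,
    h32 0 0, h32 0 1, h2 0 0, h2 0 1, h32 1 0, h32 1 1, h2 1 0, h2 1 1]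

/-- A vanishing combination of rows is v + w with v in `V` and w a combination of six orthonormal
wavelets supported in [-1,1]. Testing with these wavelets gives w = 0; then v is orthogonal to the
level 1 functions on [-1,0] and on [0,1], and nondegeneracy on both intervals gives v = 0. This
leaves 22 - 20 = 2 dimensions. -/
theorem exists_null_T : ∃ b : Fin 2 → Fin 22 → ℝ, IsNullBasis (B.matT A) b := by
  refine exists_isNullBasis_ip (B.rowsT A) (colsT A) (fun a ha => ?_) (by simp)
  set v := ∑ i, a (Sum.inl i) • A.e (ridx i) with hv
  set w := ∑ i, a (Sum.inr i) • B.wrows A i with hw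
  have hvw : ∑ i, a i • B.rowsT A i = v + w := by
    rw [Fintype.sum_sum_type]
    simp only [rowsT_inl]
    rfl
  rw [hvw] at ha
  have hvV : v ∈ A.V := Submodule.sum_mem _ fun i _ => Submodule.smul_mem _ _ (A.e_mem_V _)
  have hLv := isL2_of_mem_V hvV
  have hLw : IsL2 w := inferInstance
  have hw0 : ∀ i, a (Sum.inr i) = 0 := by
    intro i
    have h1 := ip_eq_zero_of_colsT hA ha (wrows_mem_wav hA hS i).1 (wrows_supp hA i)
    rw [ip_add_left, ip_comm, ip_wav (wrows_mem_wav hA hS i) hvV, zero_add,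
      (wrows_on hA hS).ip_sum_smul] at h1
    exact h1
  have hw' : w = 0 := by rw [hw]; simp [hw0]
  rw [hw', add_zero] at ha
  have hv0 := ip_ridx_eq_zero hA hvV
    (fun j => ip_eq_zero_of_colsT hA ha (p_mem j) (SuppIn_mono (by norm_num) le_rfl (p_supp hA j)))
    (fun j => ip_eq_zero_of_colsT hA ha (shift_p_mem j)
      (SuppIn_mono le_rfl (by norm_num) (shift_p_supp hA j)))
  have hr : ON (A.e ∘ ridx) := (e_on hA).comp fun i j h => by
    have := lineIdx_injective 4 h
    omega
  ext i
  rcases i with i | i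
  · have h1 := hr.ip_sum_smul (fun i => a (Sum.inl i)) i
    exact h1.symm.trans (hv0 i)
  · exact hw0 i

end T

end WaveletChoice

end SplineWavelet

end

/-! ### Projections on the unit interval and orthogonality of shifted wavelets -/

open MeasureTheory

noncomputable section

set_option synthInstance.maxSize 100000

namespace SplineWavelet

theorem ON.sumElim {ι κ : Type*} [DecidableEq ι] [DecidableEq κ] {f : ι → ℝ → ℝ} {g : κ → ℝ → ℝ}
    (hf : ON f) (hg : ON g) (h : ∀ i j, ip (f i) (g j) = 0) : ON (Sum.elim f g) := by
  refine ⟨?_, ?_⟩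
  · rintro (i | i)
    exacts [hf.l2 i, hg.l2 i]
  · rintro (i | i) (j | j)
    · simp [hf.ip_eq]
    · simp [h]
    · simp [ip_comm (g i), h]
    · simp [hg.ip_eq]

namespace ScalingChoice

variable {A : ScalingChoice}

variable (hA : A.Admissible)

include hA

theorem cut_mem_Vs_one {f : ℝ → ℝ} (hf : f ∈ A.Vs 1) {m : ℤ} (hz : f ∈ Z m) :
    (Set.Ici (m : ℝ)).indicator f ∈ A.Vs 1 := by
  have h1 : dil (1 / 2) 0 f ∈ Z ((2 * m : ℤ) : ℝ) := dil_mem_Z hz (by push_cast; ring)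
  have h2 := dil_two_mem (cut_mem_V hA (mem_Vs_one.1 hf) h1)
  have e : dil 2 0 ((Set.Ici ((2 * m : ℤ) : ℝ)).indicator (dil (1 / 2) 0 f)) =
      (Set.Ici (m : ℝ)).indicator f := by
    ext x
    by_cases hx : (m : ℝ) ≤ x
    · have hx' : 2 * x - 0 ∈ Set.Ici ((2 * m : ℤ) : ℝ) := by
        simp only [Set.mem_Ici]; push_cast; linarith
      rw [dil_eq, Set.indicator_of_mem hx', Set.indicator_of_mem (Set.mem_Ici.2 hx), dil_eq]
      congr 1; ring
    · have hx' : 2 * x - 0 ∉ Set.Ici ((2 * m : ℤ) : ℝ) := by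
        simp only [Set.mem_Ici]; push_cast; linarith
      rw [dil_eq, Set.indicator_of_notMem hx', Set.indicator_of_notMem (by simpa using hx)]
  rwa [e] at h2

theorem restr_mem_Vs_one {f : ℝ → ℝ} (hf : f ∈ A.Vs 1) (h0 : f ∈ Z 0) (h1 : f ∈ Z 1) :
    restr f ∈ A.Vs 1 := by
  have k0 := cut_mem_Vs_one hA hf (m := 0) (by simpa using h0)
  have k1 := cut_mem_Vs_one hA hf (m := 1) (by simpa using h1)
  have e : restr f = (Set.Ici ((0 : ℤ) : ℝ)).indicator f - (Set.Ici ((1 : ℤ) : ℝ)).indicator f := by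
    ext x
    simp only [restr, Set.indicator, Set.mem_Icc, Set.mem_Ici, Int.cast_zero, Int.cast_one,
      Pi.sub_apply]
    have := h1.2.1
    rcases lt_trichotomy x 1 with h | rfl | h
    · simp [h.le, h.not_ge]
    · simp [this]
    · simp [h.le, h.not_ge, (zero_lt_one.trans h).le]
  rw [e]
  exact Submodule.sub_mem _ k0 k1

theorem ip_p_p (i j : Fin 10) : ip (A.p i) (A.p j) = if i = j then 1 / 2 else 0 := by
  rw [p_eq, p_eq, ip_dil_two_e hA]
  have : Function.Injective pidx := by decide
  simp [this.eq_iff]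

/-- Parseval's identity for the functions of `V₁` with support in `[0, 1]`. -/
theorem ip_eq_sum_p {t g : ℝ → ℝ} [IsL2 g] (ht : t ∈ Submodule.span ℝ (Set.range A.p)) :
    ip t g = 2 * ∑ j, ip t (A.p j) * ip g (A.p j) := by
  obtain ⟨c, rfl⟩ := (Submodule.mem_span_range_iff_exists_fun ℝ).1 ht
  have h : ∀ j, ip (∑ i, c i • A.p i) (A.p j) = c j / 2 := by
    intro j
    rw [ip_sum_smul_left]
    simp [ip_p_p hA]; ring
  simp only [h]
  rw [ip_sum_smul_left, Finset.mul_sum]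
  refine Finset.sum_congr rfl fun j _ => ?_
  rw [ip_comm g]; ring

/-- The projections of `φ₅, φ₆` and of `φ₅(· - 1), φ₆(· - 1)` on the functions of `V₁` with support
in `[0, 1]` are orthogonal. -/
theorem sum_ip_p_eq_zero {r s : ℝ → ℝ} (hr : r ∈ A.V) (hs : s ∈ A.V) (hr' : r ∈ SuppIn (-1) 1)
    (hs' : s ∈ SuppIn 0 2) (hrs : ip r s = 0) : ∑ j, ip r (A.p j) * ip s (A.p j) = 0 := by
  have hLr := isL2_of_mem_V hr
  have hLs := isL2_of_mem_V hs
  -- The projection of `s` on the span of the `p j`; the factor 2 compensates for their squared norm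
  -- 1/2.
  set t := ∑ j, (2 * ip s (A.p j)) • A.p j with ht
  have htV : t ∈ A.Vs 1 := Submodule.sum_mem _ fun j _ => Submodule.smul_mem _ _ (p_mem j)
  have htS : t ∈ SuppIn 0 2 := SuppIn_mono le_rfl one_le_two
    (Submodule.sum_mem _ fun j _ => Submodule.smul_mem _ _ (p_supp hA j))
  have htp : ∀ i, ip t (A.p i) = ip s (A.p i) := by
    intro i
    rw [ht, ip_sum_smul_left]
    simp [ip_p_p hA]; ring
  have hLt : IsL2 t := inferInstance
  set X := dil (1 / 2) 0 (s - t) with hX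
  have hXV : X ∈ A.V := mem_Vs_one.1 (Submodule.sub_mem _ (A.V_le_Vs_one hs) htV)
  have hXS : X ∈ SuppIn 0 4 :=
    dil_mem_SuppIn (Submodule.sub_mem _ hs' htS) (by norm_num) (by norm_num) (by norm_num)
  have hXC := (A.V_le_Sp hXV).1
  -- The projection has removed the components inside [0,2] in the stretched picture, and the
  -- support in [0,4] gives a double zero at 0. Only translates by at least 2 survive.
  have hXspan : X ∈ Submodule.span ℝ (A.e '' {p | 2 ≤ p.2}) := by
    refine (e_on hA).mem_span_of_forall hXV fun p hp => ?_
    by_cases hin : p ∈ inside 0 2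
    · rw [← range_pidx] at hin
      obtain ⟨j, rfl⟩ := hin
      have : ip (s - t) (A.p j) = 0 := by rw [ip_sub_left, htp, sub_self]
      rw [p_eq, ip_dil_two_right] at this
      exact (mul_eq_zero.1 this).resolve_left (by norm_num)
    · have hp2 : p.2 < 2 := not_le.1 hp
      by_cases hneg : p.2 < 0
      · rw [ip_comm]
        refine ip_eq_zero_of_supp (e_supp hA p) hXS (e_mem_Sp A p).1.continuous ?_
        have : p.2 + 1 ≤ 0 := by omega
        exact_mod_cast this
      · have h0 : p.2 = 0 ∧ (p.1 = 4 ∨ p.1 = 5) := by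
          simp only [inside, Set.mem_ofPred_eq] at hin
          omega
        have hz := ip_e_eq_zero_of_mem_Z hA hXV (m := 0)
          (by simpa using mem_Z_of_supp hXC hXS (m := 0) (Or.inl le_rfl))
        obtain ⟨l, k⟩ := p
        obtain ⟨rfl, rfl | rfl⟩ := h0
        exacts [hz.1, hz.2]
  set R := dil (1 / 2) 0 r with hR
  have hRV : R ∈ A.V := mem_Vs_one.1 (A.V_le_Vs_one hr)
  have hRS : R ∈ SuppIn (-2) 2 := dil_mem_SuppIn hr' (by norm_num) (by norm_num) (by norm_num)
  have hRC := (A.V_le_Sp hRV).1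
  have hLR := isL2_of_mem_V hRV
  -- The stretched `r` is supported in [-2,2], so it has double zeros at all k ≥ 2 and pairs to zero
  -- even with the functions straddling 2. Thus `r` is orthogonal to s - t, hence to t.
  have h0 : ip R X = 0 := by
    refine ip_eq_zero_of_mem_span_right ?_ ?_ hXspan
    · rintro _ ⟨p, -, rfl⟩; infer_instance
    · rintro _ ⟨⟨l, k⟩, hk, rfl⟩
      simp only [Set.mem_ofPred_eq] at hk
      by_cases hl : l < 4
      · exact ip_eq_zero_of_supp hRS (e_supp_short _ hl) hRC.continuous (by exact_mod_cast hk)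
      · have hz := ip_e_eq_zero_of_mem_Z hA hRV (m := k)
          (mem_Z_of_supp hRC hRS (Or.inr (by exact_mod_cast hk)))
        have hl' : l = 4 ∨ l = 5 := by omega
        rcases hl' with rfl | rfl
        exacts [hz.1, hz.2]
  have h1 : ip r (s - t) = 0 := by
    have := ip_dil (1 / 2) 0 r (s - t)
    rw [← hR, ← hX, h0] at this
    norm_num at this
    exact this
  have htP : t ∈ Submodule.span ℝ (Set.range A.p) :=
    Submodule.sum_mem _ fun j _ => Submodule.smul_mem _ _ (Submodule.subset_span ⟨j, rfl⟩)
  rw [ip_sub_right, hrs, zero_sub, neg_eq_zero, ip_comm, ip_eq_sum_p hA htP] at h1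
  simp only [htp] at h1
  rw [← (mul_eq_zero.1 h1).resolve_left two_ne_zero]
  exact Finset.sum_congr rfl fun j _ => mul_comm _ _

theorem ip_phi56_of_ip_shift_p {f : ℝ → ℝ} (hf : f ∈ A.V)
    (h : ∀ j, ip f (dil 1 (-1) (A.p j)) = 0) : ip f A.phi5 = 0 ∧ ip f A.phi6 = 0 := by
  have hq := ip_q_eq_zero hA (shift_mem_V hf 1) fun j => by
    rw [Int.cast_one, ip_dil_one_left]; exact h j
  have h6 : ip (dil 1 1 f) (dil 1 1 A.phi5) = 0 := by
    have := hq 6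
    rw [Int.cast_one] at this
    exact this
  have h7 : ip (dil 1 1 f) (dil 1 1 A.phi6) = 0 := by
    have := hq 7
    rw [Int.cast_one] at this
    exact this
  rw [ip_dil_one] at h6 h7
  exact ⟨h6, h7⟩

end ScalingChoice

namespace WaveletChoice

open ScalingChoice

variable {B : WaveletChoice} {A : ScalingChoice}

section S

variable (hA : A.Admissible) (hS : IsNullBasis A.matS B.bS)

include hA hS

/-- A function of `V₁` with support in `[0, 1]` which is orthogonal to `ψ₁, ψ₂` and `φ₁, …, φ₄` is
the projection of a combination of `φ₅, φ₆, φ₅(· - 1), φ₆(· - 1)`. -/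
theorem exists_projection {t : ℝ → ℝ} (ht : t ∈ Submodule.span ℝ (Set.range A.p))
    (h12 : ∀ i, ip t (gsPair (B.u A) i) = 0) (hq : ∀ i : Fin 8, i < 4 → ip t (A.q i) = 0) :
    ∃ d d' : Fin 2 → ℝ, ∀ j, ip t (A.p j) = ip (d 0 • A.phi5 + d 1 • A.phi6) (A.p j) +
      ip (dil 1 1 (d' 0 • A.phi5 + d' 1 • A.phi6)) (A.p j) := by
  have hLt : IsL2 t := isL2_of_mem_Vs ((mem_span_p_iff hA).1 ht).1
  have hu : ∀ l, ip t (B.u A l) = 0 := by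
    intro l
    have := mem_of_gsPair_mem (U := perp {t}) (u_indep hA hS) (fun i => ⟨inferInstance, by
      rintro _ rfl _; rw [ip_comm]; exact h12 i⟩) l
    rw [ip_comm]
    exact this.2 t rfl hLt
  obtain ⟨a, ha⟩ := IsNullBasis.exists_combination hS (fun j => ip t (A.p j)) fun l => by
    rw [← hu l, u, ip_lincomb_right]
  have ha' : ∀ j, ip t (A.p j) = ip (∑ i, a i • A.q i) (A.p j) := by
    intro j
    rw [ha, ip_sum_smul_left]; rfl
  -- The four short `q i` lie in the span of the `p j`, so Parseval applied to them identifies the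
  -- coefficient with ⟨t, q i⟩ = 0.
  have h0 : ∀ i : Fin 8, i < 4 → a i = 0 := by
    intro i hi
    have hqp : A.q i ∈ Submodule.span ℝ (Set.range A.p) := by
      refine mem_span_p hA (A.V_le_Vs_one (q_mem_V i)) ?_
      have hi' : (qidx i).1 < 4 ∧ (qidx i).2 = 0 := by
        revert i; decide
      rw [q_eq]
      simpa [hi'.2] using e_supp_short (A := A) (qidx i) hi'.1
    have h1 := ip_eq_sum_p hA (g := A.q i) ht
    have h2 := ip_eq_sum_p hA (g := ∑ i, a i • A.q i) hqp
    rw [ip_comm, (q_on hA).ip_sum_smul] at h2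
    rw [hq i hi] at h1
    rw [h2, h1]
    congr 1
    exact Finset.sum_congr rfl fun j _ => by rw [ha' j, mul_comm]
  refine ⟨![a 4, a 5], ![a 6, a 7], fun j => ?_⟩
  rw [ha' j, Fin.sum_univ_eight, h0 0 (by decide), h0 1 (by decide), h0 2 (by decide),
    h0 3 (by decide)]
  simp only [zero_smul, zero_add]
  rw [← ip_add_left]
  congr 1
  ext x
  simp [q, dil_eq]; ring

omit hS in
theorem ip_comb56_shift (d d' : Fin 2 → ℝ) :
    ∑ j, ip (d 0 • A.phi5 + d 1 • A.phi6) (A.p j) *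
      ip (dil 1 1 (d' 0 • A.phi5 + d' 1 • A.phi6)) (A.p j) = 0 := by
  have hs : ∀ d : Fin 2 → ℝ, d 0 • A.phi5 + d 1 • A.phi6 ∈ SuppIn (-1) 1 := fun d =>
    Submodule.add_mem _ (Submodule.smul_mem _ _ (phi_supp hA 4))
      (Submodule.smul_mem _ _ (phi_supp hA 5))
  have hV : dil 1 1 (d' 0 • A.phi5 + d' 1 • A.phi6) ∈ A.V := by
    have := shift_mem_V (comb56_mem (A := A) d') 1
    simpa using this
  refine sum_ip_p_eq_zero hA (comb56_mem d) hV (hs d) (dil_one_one_supp (hs d')) ?_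
  have hE := (e_on hA).ip_eq
  have e1 : ∀ i, dil 1 1 (A.phi i) = A.e (i, 1) := fun i => by simp [e]
  have h : ∀ i j, ip (A.phi i) (dil 1 1 (A.phi j)) = 0 := by
    intro i j
    rw [e1, ← phi_e, hE, if_neg (by simp)]
  have e2 : dil 1 1 (d' 0 • A.phi5 + d' 1 • A.phi6) =
      d' 0 • dil 1 1 A.phi5 + d' 1 • dil 1 1 A.phi6 := by ext x; simp [dil_eq]
  rw [e2]
  simp only [ip_add_left, ip_add_right, ip_smul_left, ip_smul_right]
  have k1 := h 4 4
  have k2 := h 4 5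
  have k3 := h 5 4
  have k4 := h 5 5
  rw [show A.phi 4 = A.phi5 from rfl] at *
  rw [show A.phi 5 = A.phi6 from rfl] at *
  rw [k1, k2, k3, k4]; ring

/-- Pairing t with the right-hand combination gives zero by assumption. By Parseval and the
orthogonality of left and right projections this pairing is twice the sum of squares of the
right-hand terms, which must therefore vanish. -/
theorem exists_projection_left {t : ℝ → ℝ} (ht : t ∈ Submodule.span ℝ (Set.range A.p))
    (h12 : ∀ i, ip t (gsPair (B.u A) i) = 0) (hq : ∀ i : Fin 8, i < 4 ∨ 6 ≤ i → ip t (A.q i) = 0) :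
    ∃ d : Fin 2 → ℝ, ∀ j, ip t (A.p j) = ip (d 0 • A.phi5 + d 1 • A.phi6) (A.p j) := by
  obtain ⟨d, d', h⟩ := exists_projection hA hS ht h12 fun i hi => hq i (Or.inl hi)
  refine ⟨d, fun j => ?_⟩
  set s := dil 1 1 (d' 0 • A.phi5 + d' 1 • A.phi6) with hs
  have e2 : s = d' 0 • dil 1 1 A.phi5 + d' 1 • dil 1 1 A.phi6 := by ext x; simp [hs, dil_eq]
  have hLs : IsL2 s := inferInstance
  have hLt : IsL2 t := isL2_of_mem_Vs ((mem_span_p_iff hA).1 ht).1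
  have h0 : ip t s = 0 := by
    have h6 : ip t (dil 1 1 A.phi5) = 0 := hq 6 (by decide)
    have h7 : ip t (dil 1 1 A.phi6) = 0 := hq 7 (by decide)
    rw [e2, ip_add_right, ip_smul_right, ip_smul_right, h6, h7]; ring
  rw [ip_eq_sum_p hA ht] at h0
  simp only [h, add_mul, Finset.sum_add_distrib] at h0
  rw [ip_comb56_shift hA d d', zero_add] at h0
  have h1 := (mul_eq_zero.1 h0).resolve_left two_ne_zero
  have h2 := (Finset.sum_eq_zero_iff_of_nonneg fun i _ => mul_self_nonneg _).1 h1 j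
    (Finset.mem_univ j)
  rw [h j, mul_self_eq_zero.1 h2, add_zero]

theorem exists_projection_right {t : ℝ → ℝ} (ht : t ∈ Submodule.span ℝ (Set.range A.p))
    (h12 : ∀ i, ip t (gsPair (B.u A) i) = 0) (hq : ∀ i : Fin 8, i < 6 → ip t (A.q i) = 0) :
    ∃ d : Fin 2 → ℝ, ∀ j, ip t (A.p j) = ip (dil 1 1 (d 0 • A.phi5 + d 1 • A.phi6)) (A.p j) := by
  obtain ⟨d, d', h⟩ := exists_projection hA hS ht h12 fun i hi => hq i (by omega)
  refine ⟨d', fun j => ?_⟩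
  have hLt : IsL2 t := isL2_of_mem_Vs ((mem_span_p_iff hA).1 ht).1
  have h0 : ip t (d 0 • A.phi5 + d 1 • A.phi6) = 0 := by
    have h6 : ip t A.phi5 = 0 := hq 4 (by decide)
    have h7 : ip t A.phi6 = 0 := hq 5 (by decide)
    rw [ip_add_right, ip_smul_right, ip_smul_right, h6, h7]; ring
  rw [ip_eq_sum_p hA ht] at h0
  simp only [h, add_mul, Finset.sum_add_distrib] at h0
  rw [Finset.sum_congr rfl fun j _ => mul_comm (ip (dil 1 1 _) (A.p j)) _,
    ip_comb56_shift hA d d', add_zero] at h0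
  have h1 := (mul_eq_zero.1 h0).resolve_left two_ne_zero
  have h2 := (Finset.sum_eq_zero_iff_of_nonneg fun i _ => mul_self_nonneg _).1 h1 j
    (Finset.mem_univ j)
  rw [h j, mul_self_eq_zero.1 h2, zero_add]

/-- Two wavelets with a double zero at `0` which are orthogonal to `ψ₁, ψ₂` and their translates
have orthogonal translates. -/
theorem ip_shift_eq_zero {f g : ℝ → ℝ} (hf : f ∈ A.wav) (hg : g ∈ A.wav) (hfs : f ∈ SuppIn (-1) 1)
    (hgs : g ∈ SuppIn (-1) 1) (hfz : f ∈ Z 0) (hgz : g ∈ Z 0)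
    (hf1 : ∀ i, ip f (gsPair (B.u A) i) = 0)
    (hg1 : ∀ i, ip g (dil 1 (-1) (gsPair (B.u A) i)) = 0) : ip f (dil 1 1 g) = 0 := by
  have hGw : dil 1 1 g ∈ A.wav := by simpa using shift_mem_wav hg 1
  have hGs : dil 1 1 g ∈ SuppIn 0 2 := dil_one_one_supp hgs
  -- The double zero at the centre allows cutting at the ends of the overlap [0,1] without leaving
  -- `Vs 1`.
  have hft : restr f ∈ A.Vs 1 := restr_mem_Vs_one hA hf.1 hfz
    (mem_Z_of_supp (Vs_continuous hf.1).1 hfs (Or.inr le_rfl))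
  have hgt : restr (dil 1 1 g) ∈ A.Vs 1 := restr_mem_Vs_one hA hGw.1
    (mem_Z_of_supp (Vs_continuous hGw.1).1 hGs (Or.inl le_rfl)) (dil_mem_Z hgz (by ring))
  have hfP := mem_span_p hA hft (restr_mem f)
  have hgP := mem_span_p hA hgt (restr_mem (dil 1 1 g))
  have hqs : ∀ i : Fin 8, i < 4 → A.q i ∈ SuppIn 0 1 := by
    intro i hi
    have hi' : (qidx i).1 < 4 ∧ (qidx i).2 = 0 := by revert i; decide
    rw [q_eq]
    simpa [hi'.2] using e_supp_short (A := A) (qidx i) hi'.1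
  have hql : ∀ i : Fin 8, i < 6 → A.q i ∈ SuppIn (-1) 1 := by
    intro i hi
    have hi' : (qidx i).2 = 0 := by revert i; decide
    rw [q_eq]
    simpa [hi'] using e_supp hA (qidx i)
  have hqr : ∀ i : Fin 8, i < 4 ∨ 6 ≤ i → A.q i ∈ SuppIn 0 2 := by
    intro i hi
    rcases hi with hi | hi
    · exact SuppIn_mono le_rfl one_le_two (hqs i hi)
    · have hi' : (qidx i).2 = 1 := by revert i; decide
      rw [q_eq]
      have := e_supp hA (qidx i)
      rw [hi'] at this
      norm_num at this
      exact this
  have hrr : ∀ f g : ℝ → ℝ, ip (restr f) g = ip (restr f) (restr g) := by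
    intro f g
    rw [ip_comm (restr f) (restr g), ip_restr_left _ (restr_mem f), ip_comm]
  obtain ⟨d, hd⟩ := exists_projection_left hA hS hfP
    (fun i => by rw [ip_restr_left _ (psi12_supp hA i)]; exact hf1 i)
    (fun i hi => by
      rw [hrr, ip_restr_restr hfs (hqr i hi)]; exact ip_wav hf (q_mem_V i))
  obtain ⟨d', hd'⟩ := exists_projection_right hA hS hgP
    (fun i => by
      rw [ip_restr_left _ (psi12_supp hA i), ip_dil_one_left]; exact hg1 i)
    (fun i hi => by
      rw [hrr, ip_comm, ip_restr_restr (hql i hi) hGs, ip_comm]; exact ip_wav hGw (q_mem_V i))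
  -- On the overlap, one function acts as a projection from the left end point and the other as one
  -- from the right, and those are orthogonal.
  rw [← ip_restr_restr hfs hGs]
  have : IsL2 (restr (dil 1 1 g)) := isL2_of_mem_Vs hgt
  rw [ip_eq_sum_p hA hfP]
  simp only [hd, hd']
  rw [ip_comb56_shift hA, mul_zero]

end S

end WaveletChoice

end SplineWavelet

end

/-! ### The wavelets ψ₅, ψ₆, orthonormality on the line and independence at the boundary -/

open MeasureTheory

noncomputable section

set_option synthInstance.maxSize 100000

namespace SplineWavelet

namespace WaveletChoice

open ScalingChoice

variable {B : WaveletChoice} {A : ScalingChoice}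

section T

variable (hA : A.Admissible) (hS : IsNullBasis A.matS B.bS) (hT : IsNullBasis (B.matT A) B.bT)

include hA hS hT

omit hS hT in
theorem z_supp (i : Fin 2) : B.z A i ∈ SuppIn (-1) 1 :=
  lincomb_mem fun j => (colsT_mem hA j).2

omit hA hS in
theorem ip_rowsT_z (r : Fin 14 ⊕ Fin 2 ⊕ Fin 4) (i : Fin 2) : ip (B.rowsT A r) (B.z A i) = 0 :=
  ip_lincomb_of_nullBasis (r := B.rowsT A) (f := colsT A) hT r i

omit hS in
theorem z_mem_wav (i : Fin 2) : B.z A i ∈ A.wav := by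
  have hV : B.z A i ∈ A.Vs 1 := lincomb_mem fun j => (colsT_mem hA j).1
  have hc := (Vs_continuous hV).2
  have hs := z_supp (B := B) hA i
  refine mem_wav.2 ⟨hV, fun p => ?_⟩
  by_cases hp : p ∈ Set.range ridx
  · obtain ⟨r, rfl⟩ := hp
    rw [ip_comm, ← rowsT_inl (B := B)]
    exact ip_rowsT_z hT _ i
  · rw [range_ridx] at hp
    simp only [Set.mem_ofPred_eq] at hp
    obtain ⟨l, k⟩ := p
    simp only at hp
    by_cases hl : l < 4
    · by_cases hk : k < -1
      · rw [ip_comm]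
        refine ip_eq_zero_of_supp (e_supp_short _ hl) hs (e_mem_Sp A _).1.continuous ?_
        have : k + 1 ≤ -1 := by omega
        exact_mod_cast this
      · refine ip_eq_zero_of_supp hs (e_supp_short _ hl) hc ?_
        have : 1 ≤ k := by omega
        exact_mod_cast this
    · by_cases hk : k < -1
      · rw [ip_comm]
        refine ip_eq_zero_of_supp (e_supp hA _) hs (e_mem_Sp A _).1.continuous ?_
        have : k + 1 ≤ -1 := by omega
        exact_mod_cast this
      · refine ip_eq_zero_of_supp hs (e_supp hA _) hc ?_
        have : 1 ≤ k - 1 := by omega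
        exact_mod_cast this

omit hS in
theorem z_indep : Indep2 (B.z A) :=
  indep2_lincomb (fun j => (Vs_continuous (colsT_mem hA j).1).2) (colsT_on hA).linearIndependent
    hT.1

omit hS in
theorem psi56_on : ON (gsPair (B.z A)) := gsPair_on (z_indep hA hT)

omit hS in
theorem psi56_mem_wav (i : Fin 2) : gsPair (B.z A) i ∈ A.wav := gsPair_mem (z_mem_wav hA hT) i

omit hS hT in
theorem psi56_supp (i : Fin 2) : gsPair (B.z A) i ∈ SuppIn (-1) 1 := gsPair_mem (z_supp hA) i

omit hA hS in
theorem ip_wrows_psi56 (r : Fin 2 ⊕ Fin 4) (i : Fin 2) :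
    ip (B.wrows A r) (gsPair (B.z A) i) = 0 := by
  have h : gsPair (B.z A) i ∈ perp {B.wrows A r} := by
    refine gsPair_mem (U := perp {B.wrows A r}) (fun i => ⟨inferInstance, ?_⟩) i
    rintro _ rfl _
    rw [ip_comm]
    exact ip_rowsT_z hT (Sum.inr r) i
  rw [ip_comm]
  exact h.2 _ rfl inferInstance

omit hA hS in
theorem ip_psi12_psi56 (i j : Fin 2) : ip (gsPair (B.u A) i) (gsPair (B.z A) j) = 0 ∧
    ip (dil 1 (-1) (gsPair (B.u A) i)) (gsPair (B.z A) j) = 0 := by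
  have h := fun r => ip_wrows_psi56 hT r j
  fin_cases i
  exacts [⟨h (Sum.inr 0), h (Sum.inl 0)⟩, ⟨h (Sum.inr 1), h (Sum.inl 1)⟩]

omit hA hS in
theorem ip_psi34_psi56 (i j : Fin 2) : ip (gsPair A.h i) (gsPair (B.z A) j) = 0 := by
  have h := fun r => ip_wrows_psi56 hT r j
  fin_cases i
  exacts [h (Sum.inr 2), h (Sum.inr 3)]

omit hS in
-- Orthogonality to ψ₃ and ψ₄, which is built into the rows of `matT`, is equivalent to this double
-- zero.
theorem psi56_mem_Z (i : Fin 2) : gsPair (B.z A) i ∈ Z 0 :=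
  (ip_psi34_iff hA (psi56_mem_wav hA hT i)).1 fun j => by
    rw [ip_comm]; exact ip_psi34_psi56 hT j i

/-! ### Orthonormality of the wavelets on the real line -/

omit hA hS hT in
theorem psi_cases {C : (ℝ → ℝ) → Prop} (h1 : ∀ i, C (gsPair (B.u A) i)) (h2 : ∀ i, C (gsPair A.h i))
    (h3 : ∀ i, C (gsPair (B.z A) i)) (i : Fin 6) : C (B.psi A i) := by
  fin_cases i
  exacts [h1 0, h1 1, h2 0, h2 1, h3 0, h3 1]

theorem psi_mem_wav (i : Fin 6) : B.psi A i ∈ A.wav :=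
  psi_cases (psi12_mem_wav hA hS) (psi34_mem_wav hA) (psi56_mem_wav hA hT) i

omit hS hT in
theorem psi_supp (i : Fin 6) : B.psi A i ∈ SuppIn (-1) 1 :=
  psi_cases (fun i => SuppIn_mono (by norm_num) le_rfl (psi12_supp hA i)) (psi34_supp hA)
    (psi56_supp hA) i

theorem psi_on : ON (B.psi A) := by
  have h12 : ON (Sum.elim (gsPair (B.u A)) (gsPair A.h)) :=
    (psi12_on hA hS).sumElim (psi34_on hA) fun i j => by
      have := ip_psi12_psi34 hA hS i j 0
      rwa [Int.cast_zero, dil_one_zero] at this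
  have h := h12.sumElim (psi56_on hA hT) (by
    rintro (i | i) j
    exacts [(ip_psi12_psi56 hT i j).1, ip_psi34_psi56 hT i j])
  let e : Fin 6 → (Fin 2 ⊕ Fin 2) ⊕ Fin 2 := ![Sum.inl (Sum.inl 0), Sum.inl (Sum.inl 1),
    Sum.inl (Sum.inr 0), Sum.inl (Sum.inr 1), Sum.inr 0, Sum.inr 1]
  have h2 := h.comp (e := e) (by decide)
  have : B.psi A = Sum.elim (Sum.elim (gsPair (B.u A)) (gsPair A.h)) (gsPair (B.z A)) ∘ e := by
    funext i; fin_cases i <;> rfl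
  rwa [this]

/-- A long wavelet shifted by ±1 has a double zero at 0, which settles every pair containing ψ₃ or
ψ₄ together with a long wavelet. Pairs with ψ₁ or ψ₂ follow from supports, the rows of `matT` or
`ip_psi12_psi34`; the pairs within ψ₅, ψ₆ need `ip_shift_eq_zero`. -/
theorem psi_ip_shift (i j : Fin 6) : ip (B.psi A i) (dil 1 1 (B.psi A j)) = 0 := by
  have hZ : ∀ {f : ℝ → ℝ}, f ∈ A.wav → f ∈ SuppIn (-1) 1 → dil 1 1 f ∈ A.wav ∧ dil 1 1 f ∈ Z 0 := by
    intro f hf hs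
    have hw : dil 1 1 f ∈ A.wav := by simpa using shift_mem_wav hf 1
    exact ⟨hw, mem_Z_of_supp (Vs_continuous hw.1).1 (dil_one_one_supp hs) (Or.inl le_rfl)⟩
  have hZ' : ∀ {f : ℝ → ℝ}, f ∈ A.wav → f ∈ SuppIn (-1) 1 →
      dil 1 (-1) f ∈ A.wav ∧ dil 1 (-1) f ∈ Z 0 := by
    intro f hf hs
    have hw : dil 1 (-1) f ∈ A.wav := by simpa using shift_mem_wav hf (-1)
    refine ⟨hw, mem_Z_of_supp (Vs_continuous hw.1).1 (dil_one_supp hs) (Or.inr (by norm_num))⟩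
  have flip : ∀ f g : ℝ → ℝ, ip f (dil 1 1 g) = ip (dil 1 (-1) f) g := by
    intro f g; rw [ip_dil_one_left, neg_neg]
  have c12 := fun i => (Vs_continuous (psi12_mem_wav hA hS i).1).2
  refine psi_cases (C := fun f => ∀ j, ip f (dil 1 1 (B.psi A j)) = 0) (fun i => ?_) (fun i => ?_)
    (fun i => ?_) i j
  · refine psi_cases (C := fun g => ip _ (dil 1 1 g) = 0) (fun j => ?_) (fun j => ?_) fun j => ?_
    · exact ip_eq_zero_of_supp (psi12_supp hA i) (dil_one_supp (psi12_supp hA j)) (c12 i)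
        (by norm_num)
    · rw [flip]
      simpa using ip_psi12_psi34 hA hS i j (-1)
    · rw [flip]
      exact (ip_psi12_psi56 hT i j).2
  · refine psi_cases (C := fun g => ip _ (dil 1 1 g) = 0) (fun j => ?_) (fun j => ?_) fun j => ?_
    · rw [ip_comm]
      simpa using ip_psi12_psi34 hA hS j i 1
    · have := hZ (psi34_mem_wav hA j) (psi34_supp hA j)
      rw [ip_comm]
      exact (ip_psi34_iff hA this.1).2 this.2 i
    · have := hZ (psi56_mem_wav hA hT j) (psi56_supp hA j)
      rw [ip_comm]
      exact (ip_psi34_iff hA this.1).2 this.2 i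
  · refine psi_cases (C := fun g => ip _ (dil 1 1 g) = 0) (fun j => ?_) (fun j => ?_) fun j => ?_
    · exact ip_eq_zero_of_supp (psi56_supp hA i) (dil_one_supp (psi12_supp hA j))
        (Vs_continuous (psi56_mem_wav hA hT i).1).2 (by norm_num)
    · rw [flip]
      have := hZ' (psi56_mem_wav hA hT i) (psi56_supp hA i)
      exact (ip_psi34_iff hA this.1).2 this.2 j
    · exact ip_shift_eq_zero hA hS (psi56_mem_wav hA hT i) (psi56_mem_wav hA hT j)
        (psi56_supp hA i) (psi56_supp hA j) (psi56_mem_Z hA hT i) (psi56_mem_Z hA hT j)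
        (fun k => by rw [ip_comm]; exact (ip_psi12_psi56 hT k i).1)
        (fun k => by rw [ip_comm]; exact (ip_psi12_psi56 hT k j).2)

theorem psi_translates : ON (fun p : Fin 6 × ℤ => dil 1 p.2 (B.psi A p.1)) := by
  have hc := fun i => (Vs_continuous (psi_mem_wav hA hS hT i).1).2
  exact on_translates inferInstance hc (psi_supp hA) (psi_on hA hS hT).ip_eq
    (psi_ip_shift hA hS hT)

/-! ### The boundary wavelets -/

omit hA hS hT in
theorem psiLong_eq (i : Fin 4) : B.psiLong A i = B.psi A (i.natAdd 2) := by fin_cases i <;> rfl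

theorem psiLong_on : ON (B.psiLong A) := by
  have := (psi_on hA hS hT).comp (Fin.natAdd_injective 4 2)
  have e : B.psiLong A = B.psi A ∘ Fin.natAdd 2 := funext psiLong_eq
  rwa [e]

theorem psiLong_mem_wav (i : Fin 4) : B.psiLong A i ∈ A.wav := by
  rw [psiLong_eq]; exact psi_mem_wav hA hS hT _

omit hS hT in
theorem psiLong_supp (i : Fin 4) : B.psiLong A i ∈ SuppIn (-1) 1 := by
  rw [psiLong_eq]; exact psi_supp hA _

theorem ip_psi12_psiLong (i : Fin 2) (j : Fin 4) : ip (gsPair (B.u A) i) (B.psiLong A j) = 0 ∧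
    ip (dil 1 (-1) (gsPair (B.u A) i)) (B.psiLong A j) = 0 := by
  have h1 := fun j => ip_psi12_psi56 hT i j
  have h2 := fun j => ip_psi12_psi34 hA hS i j 0
  have h3 := fun j => ip_psi12_psi34 hA hS i j (-1)
  simp only [Int.cast_neg, Int.cast_one, Int.cast_zero, dil_one_zero] at h2 h3
  fin_cases j
  exacts [⟨h2 0, h3 0⟩, ⟨h2 1, h3 1⟩, h1 0, h1 1]

/-- A wavelet supported in a single unit interval is a combination of ψ₁, ψ₂ or of their translates
by -1, and the long wavelets are orthogonal to all of these. -/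
theorem psiLong_coeff_eq_zero {c : Fin 4 → ℝ}
    (h : ∑ j, c j • B.psiLong A j ∈ SuppIn 0 1 ∨ ∑ j, c j • B.psiLong A j ∈ SuppIn (-1) 0) :
    c = 0 := by
  set F := ∑ j, c j • B.psiLong A j with hF
  have hFw : F ∈ A.wav := Submodule.sum_mem _ fun j _ =>
    Submodule.smul_mem _ _ (psiLong_mem_wav hA hS hT j)
  have hL : IsL2 F := inferInstance
  have key : ∀ G : ℝ → ℝ, G ∈ A.wav → G ∈ SuppIn 0 1 → (∀ i, ip G (gsPair (B.u A) i) = 0) →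
      G = 0 := by
    intro G hG hGs h0
    have hLG := isL2_of_mem_Vs hG.1
    refine eq_zero_of_ip_self _ ?_ (Vs_continuous hG.1).2
    refine ip_eq_zero_of_mem_span_right ?_ ?_ (mem_span_psi12 hA hS hG hGs)
    · rintro _ ⟨i, rfl⟩; infer_instance
    · rintro _ ⟨i, rfl⟩; exact h0 i
  have h0 : F = 0 := by
    rcases h with h | h
    · refine key F hFw h fun i => ?_
      rw [hF, ip_sum_smul_left]
      refine Finset.sum_eq_zero fun j _ => ?_
      rw [ip_comm, (ip_psi12_psiLong hA hS hT i j).1, mul_zero]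
    · have h1 : dil 1 1 F = 0 := by
        refine key _ (by simpa using shift_mem_wav hFw 1)
          (by simpa using dil_one_supp (c := 1) h) fun i => ?_
        rw [ip_dil_one_left, hF, ip_sum_smul_left]
        refine Finset.sum_eq_zero fun j _ => ?_
        rw [ip_comm, (ip_psi12_psiLong hA hS hT i j).2, mul_zero]
      ext x
      have := congrFun h1 (x + 1)
      simpa [dil_eq] using this
  have h1 := (psiLong_on hA hS hT).ip_sum_smul c
  ext j
  rw [← h1 j, ← hF, h0, ip_zero_left]; rfl

omit hA hS hT in
theorem supp_of_restr_eq_zero {f : ℝ → ℝ} (hf : Continuous f) {a b a' b' : ℝ}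
    (hs : f ∈ SuppIn a' b') (h : ∀ x ∈ Set.Ioo a b, f x = 0) :
    (b = b' → f ∈ SuppIn a' a) ∧ (a = a' → f ∈ SuppIn b b') := by
  constructor
  · rintro rfl x hx
    simp only [Set.mem_Icc, not_and, not_le] at hx
    rcases lt_or_ge x a' with h1 | h1
    · exact hs x fun h2 => absurd h2.1 (not_le.2 h1)
    rcases lt_or_ge x b with h2 | h2
    · exact h x ⟨hx h1, h2⟩
    · exact SuppIn.eq_zero_right hs hf h2
  · rintro rfl x hx
    simp only [Set.mem_Icc, not_and, not_le] at hx
    rcases le_or_gt x a with h1 | h1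
    · exact SuppIn.eq_zero_left hs hf h1
    rcases lt_or_ge x b with h2 | h2
    · exact h x ⟨h1, h2⟩
    · exact hs x fun h3 => absurd h3.2 (not_le.2 (hx h2))

omit hA hS hT in
theorem eq_zero_of_ip_restr {f : ℝ → ℝ} (hf : Continuous f) [IsL2 f]
    (h : ip (restr f) (restr f) = 0) : ∀ x ∈ Set.Ioo (0 : ℝ) 1, f x = 0 := by
  have hr : ∀ x ∈ Set.Ioo (0 : ℝ) 1, restr f x = f x :=
    fun x hx => restr_of_mem (Set.Ioo_subset_Icc_self hx)
  intro x hx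
  rw [← hr x hx]
  exact eq_zero_on_of_ip_self _ h isOpen_Ioo (hf.continuousOn.congr hr) x hx

omit hA hS hT in
theorem sum_lincomb {m n : ℕ} (c : Fin m → ℝ) (b : Fin m → Fin n → ℝ) (f : Fin n → ℝ → ℝ) :
    ∑ i, c i • lincomb (b i) f = ∑ j, (∑ i, c i • b i) j • f j := by
  simp only [lincomb_eq, Finset.smul_sum, smul_smul, Finset.sum_apply, Pi.smul_apply, smul_eq_mul,
    Finset.sum_smul]
  exact Finset.sum_comm

/-- If the restriction to [0,1] of a combination of long wavelets is null, the combination is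
supported in [-1,0] and must vanish. So cutting loses no independence. -/
theorem gL_indep (hG : LinearIndependent ℝ B.bG) : Indep2 (B.gL A) := by
  intro c hc
  set F := ∑ i, c i • lincomb (B.bG i) (B.psiLong A) with hF
  have e : ∑ i, c i • B.gL A i = restr F := by
    simp only [hF, gL, ← restrL_apply, map_sum, map_smul]
  rw [e] at hc
  have hF' := hF
  rw [sum_lincomb] at hF'
  have hFw : F ∈ A.wav := by
    rw [hF']
    exact Submodule.sum_mem _ fun j _ => Submodule.smul_mem _ _ (psiLong_mem_wav hA hS hT j)
  have hFs : F ∈ SuppIn (-1) 1 := by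
    rw [hF']
    exact Submodule.sum_mem _ fun j _ => Submodule.smul_mem _ _ (psiLong_supp hA j)
  have hFL := isL2_of_mem_Vs hFw.1
  have h0 := eq_zero_of_ip_restr (Vs_continuous hFw.1).2 hc
  have h1 := (supp_of_restr_eq_zero (Vs_continuous hFw.1).2 hFs h0).1 rfl
  have h2 := psiLong_coeff_eq_zero hA hS hT (Or.inr (by rw [← hF']; exact h1))
  exact funext (Fintype.linearIndependent_iff.1 hG c h2)

omit hA hS hT in
theorem hR_eq (i : Fin 2) : B.hR A i = restr (dil 1 1 (lincomb (B.bH i) (B.psiLong A))) := rfl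

theorem hR_indep (hH : LinearIndependent ℝ B.bH) : Indep2 (B.hR A) := by
  intro c hc
  set F := ∑ i, c i • lincomb (B.bH i) (B.psiLong A) with hF
  have e : ∑ i, c i • B.hR A i = restr (dil 1 1 F) := by
    simp only [hF, hR_eq, ← restrL_apply, ← dilL_apply, map_sum, map_smul]
  rw [e] at hc
  have hF' := hF
  rw [sum_lincomb] at hF'
  have hFw : F ∈ A.wav := by
    rw [hF']
    exact Submodule.sum_mem _ fun j _ => Submodule.smul_mem _ _ (psiLong_mem_wav hA hS hT j)
  have hFs : F ∈ SuppIn (-1) 1 := by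
    rw [hF']
    exact Submodule.sum_mem _ fun j _ => Submodule.smul_mem _ _ (psiLong_supp hA j)
  have hFL := isL2_of_mem_Vs hFw.1
  have h0 := eq_zero_of_ip_restr (continuous_dil (Vs_continuous hFw.1).2 1 1) hc
  have h0' : ∀ x ∈ Set.Ioo (-1 : ℝ) 0, F x = 0 := by
    intro x hx
    have := h0 (x + 1) ⟨by linarith [hx.1], by linarith [hx.2]⟩
    simpa [dil_eq] using this
  have h1 := (supp_of_restr_eq_zero (Vs_continuous hFw.1).2 hFs h0').2 rfl
  have h2 := psiLong_coeff_eq_zero hA hS hT (Or.inl (by rw [← hF']; exact h1))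
  exact funext (Fintype.linearIndependent_iff.1 hH c h2)

end T

end WaveletChoice

end SplineWavelet

end

/-! ### The boundary function and the rank of the boundary matrices -/

open MeasureTheory

noncomputable section

set_option synthInstance.maxSize 100000

namespace SplineWavelet

namespace ScalingChoice

variable {A : ScalingChoice}

/-- The combination of `φ₅` and `φ₆` vanishing at `0`. -/
def bd (A : ScalingChoice) : ℝ → ℝ := A.phi6 0 • A.phi5 - A.phi5 0 • A.phi6

instance : IsL2 A.bd := by unfold bd; infer_instance

/-- The part of `bd` on `[-1, 0]`. -/
def bdLeft (A : ScalingChoice) : ℝ → ℝ := dil 1 (-1) (restr (dil 1 1 A.bd))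

instance : IsL2 A.bdLeft := by unfold bdLeft; infer_instance

theorem bd_zero : A.bd 0 = 0 := by simp [bd]; ring

theorem bd_mem : A.bd ∈ A.V :=
  Submodule.sub_mem _ (Submodule.smul_mem _ _ phi56_mem.1) (Submodule.smul_mem _ _ phi56_mem.2)

theorem phiL_eq : A.phiL = normalize (restr A.bd) := rfl

theorem phiR_eq : A.phiR = normalize (restr (dil 1 1 A.bd)) := by
  unfold phiR
  congr 2
  ext x
  simp [bd, dil_eq]

variable (hA : A.Admissible)

include hA

theorem bd_supp : A.bd ∈ SuppIn (-1) 1 :=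
  Submodule.sub_mem _ (Submodule.smul_mem _ _ (phi_supp hA 4))
    (Submodule.smul_mem _ _ (phi_supp hA 5))

theorem ip_bd_phi5_ne_zero : ¬ (ip A.bd A.phi5 = 0 ∧ ip A.bd A.phi6 = 0) := by
  intro h
  have h1 := on_phi56 hA
  have k1 := h1.ip_eq 1 0
  have k2 := h1.ip_eq 1 1
  simp only [Matrix.cons_val_zero, Matrix.cons_val_one] at k1 k2
  have h2 := h.2
  rw [bd, ip_sub_left, ip_smul_left, ip_smul_left, ip_comm, k1, k2] at h2
  simp at h2
  exact phi5_zero.1 h2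

omit hA in
theorem ip_restr_bd {t : ℝ → ℝ} (ht : t ∈ A.Vs 1) : (t ∈ SuppIn 0 1 → ip (restr A.bd) t = ip A.bd t) ∧
    (t ∈ SuppIn (-1) 0 → ip (restr A.bd) t = 0) := by
  refine ⟨fun hs => ip_restr_left _ hs, fun hs => ?_⟩
  rw [ip_comm]
  exact ip_eq_zero_of_supp hs (restr_mem _) (Vs_continuous ht).2 le_rfl

omit hA in
theorem ip_bdLeft {t : ℝ → ℝ} (ht : t ∈ A.Vs 1) : (t ∈ SuppIn 0 1 → ip A.bdLeft t = 0) ∧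
    (t ∈ SuppIn (-1) 0 → ip A.bdLeft t = ip A.bd t) := by
  have h : ip A.bdLeft t = ip (restr (dil 1 1 A.bd)) (dil 1 1 t) := by
    rw [bdLeft, ip_dil_one_left, neg_neg]
  rw [h]
  refine ⟨fun hs => ?_, fun hs => ?_⟩
  · exact ip_eq_zero_of_mul fun x => by
      by_cases hx : x ∈ Set.Icc (0 : ℝ) 1
      · rw [SuppIn.eq_zero_left (dil_one_supp (c := 1) hs) (continuous_dil (Vs_continuous ht).2 1 1)
          (by linarith [hx.2]), mul_zero]
      · rw [restr_mem _ x hx, zero_mul]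
  · rw [ip_restr_left _ (by simpa using dil_one_supp (c := 1) hs), ip_dil_one]

/-- If `bd` were null on [0,1], it would be orthogonal to all the `p j`, hence by nondegeneracy to
φ₅ and φ₆; but ⟨bd, φ₆⟩ = -φ₅(0) ≠ 0. -/
theorem restr_bd_ne_zero : ip (restr A.bd) (restr A.bd) ≠ 0 := by
  intro h
  have h1 := fun g => ip_eq_zero_of_ip_self (restr A.bd) g h
  refine ip_bd_phi5_ne_zero hA (ip_phi56_of_ip_p hA bd_mem fun j => ?_)
  rw [← (ip_restr_bd (p_mem j)).1 (p_supp hA j), h1]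

theorem restr_shift_bd_ne_zero : ip (restr (dil 1 1 A.bd)) (restr (dil 1 1 A.bd)) ≠ 0 := by
  intro h
  have h1 := fun g => ip_eq_zero_of_ip_self (restr (dil 1 1 A.bd)) g h
  refine ip_bd_phi5_ne_zero hA (ip_phi56_of_ip_shift_p hA bd_mem fun j => ?_)
  rw [← (ip_bdLeft (WaveletChoice.shift_p_mem j)).2 (WaveletChoice.shift_p_supp hA j), bdLeft,
    ip_dil_one_left, h1]

end ScalingChoice

namespace WaveletChoice

open ScalingChoice

variable {B : WaveletChoice} {A : ScalingChoice}

section T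

variable (hA : A.Admissible) (hS : IsNullBasis A.matS B.bS) (hT : IsNullBasis (B.matT A) B.bT)

include hA hS hT

omit hS hT in
/-- Modulo functions orthogonal to the functions of `V₁` with support in `[0, 1]` or `[-1, 0]`, the
wavelets `ψ₃, ψ₄` belong to `V₀`. -/
theorem psi34_mem_sup (i : Fin 2) : gsPair A.h i ∈
    perp (Set.range A.p ∪ Set.range fun j => dil 1 (-1) (A.p j)) ⊔
      Submodule.span ℝ {A.phi5, A.phi6} := by
  refine gsPair_mem (fun i => ?_) i
  rw [h_eq]
  refine resid_mem ?_ fun k => ?_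
  · refine Submodule.mem_sup_left ⟨isL2_of_mem_Vs (big_mem i), ?_⟩
    have h2 : ∀ f : ℝ → ℝ, f ∈ A.Vs 1 → f ∈ Z 0 → ip (![dil 2 0 A.phi5, dil 2 0 A.phi6] i) f = 0 := by
      intro f hf hz
      have := ip_big hA hf hz
      rw [ip_comm]
      fin_cases i
      exacts [this.1, this.2]
    rintro _ (⟨j, rfl⟩ | ⟨j, rfl⟩) _
    · exact h2 _ (p_mem j)
        (mem_Z_of_supp (Vs_continuous (p_mem j)).1 (p_supp hA j) (Or.inl le_rfl))
    · exact h2 _ (shift_p_mem j)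
        (mem_Z_of_supp (Vs_continuous (shift_p_mem j)).1 (shift_p_supp hA j) (Or.inr le_rfl))
  · refine Submodule.mem_sup_right (Submodule.subset_span ?_)
    fin_cases k <;> simp

/-- Here `l` acts as `bd` on one side of 0 and as zero on the other. If it were orthogonal to ψ₅ and
ψ₆, it would act on the functions of `Vs 1` supported in [-1,1] as a combination v + w of the rows
of `matT`. The components along ψ₁, ψ₂ and their translates vanish, because `bd` is orthogonal to
wavelets, and the remaining ψ₃, ψ₄ part acts on one-sided functions like an element of `V`. So some
x in `V` acts as zero on one side and as `bd` on the other. Nondegeneracy on each side makes x and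
bd - x orthogonal to φ₅ and φ₆, hence also `bd`, which is impossible. -/
theorem boundary_nondegenerate {l : ℝ → ℝ} [IsL2 l]
    (hl : (∀ t ∈ A.Vs 1, (t ∈ SuppIn 0 1 → ip l t = ip A.bd t) ∧ (t ∈ SuppIn (-1) 0 → ip l t = 0)) ∨
      ∀ t ∈ A.Vs 1, (t ∈ SuppIn 0 1 → ip l t = 0) ∧ (t ∈ SuppIn (-1) 0 → ip l t = ip A.bd t))
    (h56 : ∀ i, ip l (gsPair (B.z A) i) = 0) : False := by
  have hz : ∀ i, ip l (B.z A i) = 0 := by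
    intro i
    have := mem_of_gsPair_mem (U := perp {l}) (z_indep hA hT) (fun i => ⟨inferInstance, by
      rintro _ rfl _; rw [ip_comm]; exact h56 i⟩) i
    rw [ip_comm]
    exact this.2 l rfl inferInstance
  obtain ⟨a, ha⟩ := IsNullBasis.exists_combination hT (fun j => ip l (colsT A j)) fun i => by
    rw [← hz i, z, ip_lincomb_right]
  set v := ∑ i, a (Sum.inl i) • A.e (ridx i) with hv
  set w := ∑ i, a (Sum.inr i) • B.wrows A i with hw
  have hvV : v ∈ A.V := Submodule.sum_mem _ fun i _ => Submodule.smul_mem _ _ (A.e_mem_V _)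
  have hLv := isL2_of_mem_V hvV
  have hLw : IsL2 w := inferInstance
  have hvw : ∑ i, a i • B.rowsT A i = v + w := by
    rw [Fintype.sum_sum_type]
    simp only [rowsT_inl]
    rfl
  have ha' : ∀ j, ip (l - (v + w)) (colsT A j) = 0 := by
    intro j
    have h1 := ha j
    rw [ip_sub_left, h1, ← hvw, ip_sum_smul_left]
    exact sub_self _
  have hT' : ∀ t ∈ A.Vs 1, t ∈ SuppIn (-1) 1 → ip l t = ip v t + ip w t := by
    intro t ht hs
    have hLt := isL2_of_mem_Vs ht
    have := ip_eq_zero_of_colsT hA ha' ht hs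
    rw [ip_sub_left, ip_add_left] at this
    linarith
  have hcoef : ∀ i, ip l (B.wrows A i) = a (Sum.inr i) := by
    intro i
    rw [hT' _ (wrows_mem_wav hA hS i).1 (wrows_supp hA i), ip_comm v,
      ip_wav (wrows_mem_wav hA hS i) hvV, zero_add, (wrows_on hA hS).ip_sum_smul]
  have hl0 : ∀ t ∈ A.wav, t ∈ SuppIn 0 1 ∨ t ∈ SuppIn (-1) 0 → ip l t = 0 := by
    intro t ht hs
    have hb : ip A.bd t = 0 := by rw [ip_comm]; exact ip_wav ht bd_mem
    rcases hl with h | h <;> rcases hs with hs | hs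
    · rw [(h t ht.1).1 hs, hb]
    · exact (h t ht.1).2 hs
    · exact (h t ht.1).1 hs
    · rw [(h t ht.1).2 hs, hb]
  have h12 : ∀ i, ip l (gsPair (B.u A) i) = 0 := fun i =>
    hl0 _ (psi12_mem_wav hA hS i) (Or.inl (psi12_supp hA i))
  have h12' : ∀ i, ip l (dil 1 (-1) (gsPair (B.u A) i)) = 0 := fun i =>
    hl0 _ (by simpa using shift_mem_wav (psi12_mem_wav hA hS i) (-1))
      (Or.inr (by simpa using dil_one_supp (c := -1) (psi12_supp (B := B) hA i)))
  have hw' : w = a (Sum.inr (Sum.inr 2)) • gsPair A.h 0 + a (Sum.inr (Sum.inr 3)) • gsPair A.h 1 := by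
    have c0 : a (Sum.inr (Sum.inl 0)) = 0 := by rw [← hcoef]; exact h12' 0
    have c1 : a (Sum.inr (Sum.inl 1)) = 0 := by rw [← hcoef]; exact h12' 1
    have c2 : a (Sum.inr (Sum.inr 0)) = 0 := by rw [← hcoef]; exact h12 0
    have c3 : a (Sum.inr (Sum.inr 1)) = 0 := by rw [← hcoef]; exact h12 1
    rw [hw, Fintype.sum_sum_type, Fin.sum_univ_two, Fin.sum_univ_four, c0, c1, c2, c3]
    simp only [zero_smul, zero_add]
    rfl
  have hwm : w ∈ perp (Set.range A.p ∪ Set.range fun j => dil 1 (-1) (A.p j)) ⊔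
      Submodule.span ℝ {A.phi5, A.phi6} := by
    rw [hw']
    exact Submodule.add_mem _ (Submodule.smul_mem _ _ (psi34_mem_sup hA 0))
      (Submodule.smul_mem _ _ (psi34_mem_sup hA 1))
  obtain ⟨y, hy, w', hw'm, hyw⟩ := Submodule.mem_sup.1 hwm
  have hw'V : w' ∈ A.V := by
    refine Submodule.span_le.2 ?_ hw'm
    rintro _ (rfl | rfl)
    exacts [phi56_mem.1, phi56_mem.2]
  have hLy : IsL2 y := hy.1
  have hLw' := isL2_of_mem_V hw'V
  have hx : v + w' ∈ A.V := Submodule.add_mem _ hvV hw'V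
  have hp : ∀ j, ip l (A.p j) = ip (v + w') (A.p j) := by
    intro j
    rw [hT' _ (p_mem j) (SuppIn_mono (by norm_num) le_rfl (p_supp hA j)), ← hyw, ip_add_left,
      ip_add_left, hy.2 _ (Or.inl ⟨j, rfl⟩) inferInstance, zero_add]
  have hp' : ∀ j, ip l (dil 1 (-1) (A.p j)) = ip (v + w') (dil 1 (-1) (A.p j)) := by
    intro j
    rw [hT' _ (shift_p_mem j) (SuppIn_mono le_rfl (by norm_num) (shift_p_supp hA j)), ← hyw,
      ip_add_left, ip_add_left, hy.2 _ (Or.inr ⟨j, rfl⟩) inferInstance, zero_add]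
  have hLx := isL2_of_mem_V hx
  have hdiff : A.bd - (v + w') ∈ A.V := Submodule.sub_mem _ bd_mem hx
  refine ip_bd_phi5_ne_zero hA ?_
  have fin : (ip (v + w') A.phi5 = 0 ∧ ip (v + w') A.phi6 = 0) →
      (ip (A.bd - (v + w')) A.phi5 = 0 ∧ ip (A.bd - (v + w')) A.phi6 = 0) →
      ip A.bd A.phi5 = 0 ∧ ip A.bd A.phi6 = 0 := by
    rintro ⟨h1, h2⟩ ⟨h3, h4⟩
    rw [ip_sub_left, h1, sub_zero] at h3
    rw [ip_sub_left, h2, sub_zero] at h4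
    exact ⟨h3, h4⟩
  rcases hl with h | h
  · refine fin (ip_phi56_of_ip_shift_p hA hx fun j => ?_) (ip_phi56_of_ip_p hA hdiff fun j => ?_)
    · rw [← hp' j, (h _ (shift_p_mem j)).2 (shift_p_supp hA j)]
    · rw [ip_sub_left, ← hp j, (h _ (p_mem j)).1 (p_supp hA j), sub_self]
  · refine fin (ip_phi56_of_ip_p hA hx fun j => ?_) (ip_phi56_of_ip_shift_p hA hdiff fun j => ?_)
    · rw [← hp j, (h _ (p_mem j)).1 (p_supp hA j)]
    · rw [ip_sub_left, ← hp' j, (h _ (shift_p_mem j)).2 (shift_p_supp hA j), sub_self]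

/-- The two conditions on the boundary wavelets are independent. -/
theorem exists_null_boundary {l : ℝ → ℝ} [IsL2 l]
    (hl : (∀ t ∈ A.Vs 1, (t ∈ SuppIn 0 1 → ip l t = ip A.bd t) ∧ (t ∈ SuppIn (-1) 0 → ip l t = 0)) ∨
      ∀ t ∈ A.Vs 1, (t ∈ SuppIn 0 1 → ip l t = 0) ∧ (t ∈ SuppIn (-1) 0 → ip l t = ip A.bd t))
    {r : ℝ} (hr : r ≠ 0) :
    ∃ b : Fin 2 → Fin 4 → ℝ, IsNullBasis (Matrix.of ![fun j => B.psiLong A j 0,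
      fun j => r * ip l (B.psiLong A j)]) b := by
  refine exists_isNullBasis _ (fun a ha => ?_) (by simp)
  simp only [Fin.sum_univ_two, Matrix.of_apply, Matrix.cons_val_zero, Matrix.cons_val_one] at ha
  have hz : ∀ i, gsPair (B.z A) i 0 = 0 := fun i => (psi56_mem_Z hA hT i).2.1
  -- Since ψ₅ and ψ₆ vanish at 0, their two columns see only the second row; the first row is then
  -- nonzero because ψ₃ or ψ₄ does not vanish at 0.
  have h1 : a 1 = 0 := by
    by_contra h1
    refine boundary_nondegenerate hA hS hT hl fun i => ?_
    have h2 := ha 2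
    have h3 := ha 3
    rw [show B.psiLong A 2 = gsPair (B.z A) 0 from rfl, hz] at h2
    rw [show B.psiLong A 3 = gsPair (B.z A) 1 from rfl, hz] at h3
    simp [h1, hr] at h2 h3
    fin_cases i
    exacts [h2, h3]
  have h0 : a 0 = 0 := by
    have h2 := ha 0
    have h3 := ha 1
    rw [h1] at h2 h3
    simp only [zero_mul, add_zero, mul_eq_zero] at h2 h3
    rcases psi34_zero hA with h | h
    exacts [h2.resolve_right h, h3.resolve_right h]
  ext i
  fin_cases i
  exacts [h0, h1]

theorem exists_null_G : ∃ b : Fin 2 → Fin 4 → ℝ, IsNullBasis (B.matG A) b := by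
  have := exists_null_boundary hA hS hT (l := restr A.bd) (Or.inl fun t ht => ip_restr_bd ht)
    (inv_ne_zero (l2norm_ne_zero (restr_bd_ne_zero hA)))
  simp only [← ip_normalize_left] at this
  exact this

theorem exists_null_H : ∃ b : Fin 2 → Fin 4 → ℝ, IsNullBasis (B.matH A) b := by
  have := exists_null_boundary hA hS hT (l := A.bdLeft) (Or.inr fun t ht => ip_bdLeft ht)
    (inv_ne_zero (l2norm_ne_zero (restr_shift_bd_ne_zero hA)))
  have e : ∀ f, ip A.bdLeft f = ip (restr (dil 1 1 A.bd)) (dil 1 1 f) := fun f => by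
    rw [bdLeft, ip_dil_one_left, neg_neg]
  simp only [e, ← ip_normalize_left, ← phiR_eq] at this
  exact this

end T

theorem exists_admissible (hA : A.Admissible) : ∃ B : WaveletChoice, B.Admissible A := by
  obtain ⟨bS, hS⟩ := exists_null_S hA
  -- The zeros are placeholders: the matrix of each stage depends only on the null bases chosen at
  -- earlier stages.
  obtain ⟨bT, hT⟩ := exists_null_T (B := ⟨bS, 0, 0, 0⟩) hA hS
  obtain ⟨bG, hG⟩ := exists_null_G (B := ⟨bS, bT, 0, 0⟩) hA hS hT
  obtain ⟨bH, hH⟩ := exists_null_H (B := ⟨bS, bT, 0, 0⟩) hA hS hT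
  exact ⟨⟨bS, bT, bG, bH⟩, hS, hT, hG, hH⟩

end WaveletChoice

end SplineWavelet

end

open MeasureTheory

noncomputable section

set_option synthInstance.maxSize 100000

namespace SplineWavelet

/-! ### Existence of admissible scaling generators -/

/-- Subdivision of the Hermite data on a cell. -/
def subdivide (u : ℕ → Fin 4 → ℝ) (c : ℕ) : Fin 4 → ℝ :=
  let w := u (c / 2)
  -- `m` is the value and `s` the slope at the midpoint, the latter rescaled to the half cell; this
  -- is also why the end slopes are halved.
  let m := (w 0 + w 2) / 2 + (w 1 - w 3) / 8
  let s := 3 / 4 * (w 2 - w 0) - (w 1 + w 3) / 8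
  if c % 2 = 0 then ![w 0, w 1 / 2, m, s] else ![m, s, w 2, w 3 / 2]

theorem HData.subdivide {N : ℕ} {f : ℝ → ℝ} {u : ℕ → Fin 4 → ℝ} (hf : HData N f u) :
    HData (2 * N) f (subdivide u) := by
  intro c hc t ht
  obtain ⟨k, rfl | rfl⟩ := Nat.even_or_odd' c
  · have h := hf k (by omega) (t / 2) ⟨by linarith [ht.1], by linarith [ht.2]⟩
    have e1 : ((2 * k : ℕ) + t) / ((2 * N : ℕ) : ℝ) = (k + t / 2) / N := by
      push_cast
      rw [show (2 * k + t : ℝ) = 2 * (k + t / 2) by ring, mul_div_mul_left _ _ two_ne_zero]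
    have e2 : 2 * k / 2 = k := by omega
    have e3 : 2 * k % 2 = 0 := by omega
    rw [e1, h]
    simp [SplineWavelet.subdivide, e2, e3, herm]
    ring
  · have h := hf k (by omega) ((1 + t) / 2) ⟨by linarith [ht.1], by linarith [ht.2]⟩
    have e1 : ((2 * k + 1 : ℕ) + t) / ((2 * N : ℕ) : ℝ) = (k + (1 + t) / 2) / N := by
      push_cast
      rw [show (2 * k + 1 + t : ℝ) = 2 * (k + (1 + t) / 2) by ring,
        mul_div_mul_left _ _ two_ne_zero]
    have e2 : (2 * k + 1) / 2 = k := by omega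
    have e3 : (2 * k + 1) % 2 = 1 := by omega
    rw [e1, h]
    simp [SplineWavelet.subdivide, e2, e3, herm]
    ring

theorem lincomb_xiLevel2_supp (x : Fin 6 → ℝ) : lincomb x xiLevel2 ∈ SuppIn 0 1 :=
  lincomb_mem xiLevel2_supp

theorem ip_xi_lincomb (n : ℤ) (x : Fin 6 → ℝ) : ip (xi 1 n) (lincomb x xiLevel2) =
    (∑ c ∈ Finset.range 4, gram4 (subdivide (xiData 1 n) c) (levelTwoData x c)) / 4 := by
  have h := HData.ip (by norm_num) (xi_hdata 1 n).subdivide (lincomb_xiLevel2_hdata x)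
    (lincomb_xiLevel2_supp x)
  norm_num at h
  exact h

theorem ip_xi_level (x : Fin 6 → ℝ) :
    ip (xi 1 0) (lincomb x xiLevel2) = 2 ^ ((1 : ℝ) / 2) *
      (1 / 4 * x 0 - 19 / 840 * x 1 + 23 / 1120 * x 2 - 17 / 3360 * x 3) ∧
    ip (xi 1 1) (lincomb x xiLevel2) = 2 ^ ((1 : ℝ) / 2) *
      (13 / 240 * x 0 - 1 / 336 * x 1 + 41 / 6720 * x 2 - 1 / 672 * x 3) ∧
    ip (xi 1 2) (lincomb x xiLevel2) = 2 ^ ((1 : ℝ) / 2) *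
      (1 / 4 * x 0 + 19 / 840 * x 1 + 257 / 560 * x 2 + 1 / 4 * x 4 - 19 / 840 * x 5) ∧
    ip (xi 1 3) (lincomb x xiLevel2) = 2 ^ ((1 : ℝ) / 2) *
      (-13 / 240 * x 0 - 1 / 336 * x 1 + 1 / 105 * x 3 + 13 / 240 * x 4 - 1 / 336 * x 5) ∧
    ip (xi 1 4) (lincomb x xiLevel2) = 2 ^ ((1 : ℝ) / 2) *
      (23 / 1120 * x 2 + 17 / 3360 * x 3 + 1 / 4 * x 4 + 19 / 840 * x 5) ∧
    ip (xi 1 5) (lincomb x xiLevel2) = 2 ^ ((1 : ℝ) / 2) *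
      (-41 / 6720 * x 2 - 1 / 672 * x 3 - 13 / 240 * x 4 - 1 / 336 * x 5) := by
  refine ⟨?_, ?_, ?_, ?_, ?_, ?_⟩ <;>
  · rw [ip_xi_lincomb]
    simp [Finset.sum_range_succ, subdivide, xiData, levelTwoData, gram4]
    ring

theorem ip_lincomb_lincomb (x y : Fin 6 → ℝ) :
    ip (lincomb x xiLevel2) (lincomb y xiLevel2) =
      (∑ c ∈ Finset.range 4, gram4 (levelTwoData x c) (levelTwoData y c)) / 4 := by
  have h := HData.ip (by norm_num) (lincomb_xiLevel2_hdata x) (lincomb_xiLevel2_hdata y)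
    (lincomb_xiLevel2_supp y)
  simpa using h

/-- The bilinear form which has to vanish on the span of `φ₃` and `φ₄`. -/
def tauForm (f g : ℝ → ℝ) : ℝ :=
  -12480 * (ip f (cfun 2) * ip g (cfun 0)) + 56160 * (ip f (cfun 2) * ip g (cfun 1)) -
    56160 * (ip f (cfun 3) * ip g (cfun 0)) + 252000 * (ip f (cfun 3) * ip g (cfun 1)) - ip f g

theorem tauForm_lincomb {f : Fin 2 → ℝ → ℝ} [∀ i, IsL2 (f i)]
    (h : ∀ i j, tauForm (f i) (f j) = 0) {g h : ℝ → ℝ}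
    (hg : g ∈ Submodule.span ℝ (Set.range f)) (hh : h ∈ Submodule.span ℝ (Set.range f)) :
    tauForm g h = 0 := by
  obtain ⟨c, rfl⟩ := (Submodule.mem_span_range_iff_exists_fun ℝ).1 hg
  obtain ⟨d, rfl⟩ := (Submodule.mem_span_range_iff_exists_fun ℝ).1 hh
  have h00 := h 0 0
  have h01 := h 0 1
  have h10 := h 1 0
  have h11 := h 1 1
  simp only [tauForm, Fin.sum_univ_two, ip_add_left, ip_add_right, ip_smul_left,
    ip_smul_right] at *
  linear_combination c 0 * d 0 * h00 + c 0 * d 1 * h01 + c 1 * d 0 * h10 + c 1 * d 1 * h11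

/-- Coordinates of functions orthogonal to `φ₁` and `φ₂`. -/
def xvec (a b c d : ℝ) : Fin 6 → ℝ :=
  ![-257 * a - 19 * b - 5009391 * c - 366417 * d, 210 * b + 2187153 * c + 9566511 * d,
    280 * a, -55614852 * c + 1811076 * d,
    -257 * a - 19 * b + 5009391 * c + 366417 * d, -210 * b + 2187153 * c + 9566511 * d]

/-- The parameters a, b describe functions even about 1/2 and c, d odd ones. The odd coordinates are
normalized with a view to `tauForm_xvec`. -/
theorem ip_xvec (a b c d : ℝ) : ip (xi 1 2) (lincomb (xvec a b c d) xiLevel2) = 0 ∧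
    ip (xi 1 3) (lincomb (xvec a b c d) xiLevel2) = 0 := by
  have h := ip_xi_level (xvec a b c d)
  rw [h.2.2.1, h.2.2.2.1]
  simp only [xvec, Matrix.cons_val]
  constructor <;> ring

theorem ip_phi12_xvec (a b c d : ℝ) (i : Fin 2) :
    ip (lincomb (xvec a b c d) xiLevel2) (![phi1, phi2] i) = 0 := by
  have h := ip_xvec a b c d
  fin_cases i
  · exact (ip_phi1_right _).trans (by rw [ip_comm, h.1, mul_zero])
  · exact (ip_phi2_right _).trans (by rw [ip_comm, h.2, mul_zero])

theorem ip_xvec_cfun (a b c d : ℝ) (k : Fin 4) :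
    ip (lincomb (xvec a b c d) xiLevel2) (cfun k) =
      ip (![xi 1 0, xi 1 1, xi 1 4, xi 1 5] k) (lincomb (xvec a b c d) xiLevel2) := by
  rw [cfun_eq, ip_comm, resid_ip_right on_phi12 _ _ (ip_phi12_xvec a b c d)]
  have h := fun f => ip_restr_left f (lincomb_xiLevel2_supp (xvec a b c d))
  fin_cases k
  exacts [h _, h _, h _, h _]

theorem two_rpow_sq (a b : ℝ) : 2 ^ ((1 : ℝ) / 2) * a * (2 ^ ((1 : ℝ) / 2) * b) = 2 * (a * b) := by
  have := two_rpow_half_mul 1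
  rw [Nat.cast_one, pow_one] at this
  linear_combination a * b * this

/-- The symmetric parts of the form `tauForm` on even and on odd functions. -/
def evenForm (a b a' b' : ℝ) : ℝ :=
  (-30526257 * (a * a') - 22724239 * (a * b' + b * a') - 14533553 * (b * b')) / 140

def oddForm (a b a' b' : ℝ) : ℝ :=
  (2867393439 * (a * a') + 2140685793 * (a * b' + b * a') + 1366828191 * (b * b')) / 13175

/-- The form splits by parity. The odd coordinates are chosen so that the mixed terms are
antisymmetric and given by the same form `oddForm` as the odd part; this reduces the search for a
null plane to a pair of quadratic forms in two variables. -/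
theorem tauForm_xvec (a b c d a' b' c' d' : ℝ) :
    tauForm (lincomb (xvec a b (c / 42160) (d / 42160)) xiLevel2)
      (lincomb (xvec a' b' (c' / 42160) (d' / 42160)) xiLevel2) =
    evenForm a b a' b' + oddForm c d c' d' - oddForm a b c' d' + oddForm c d a' b' := by
  have h := ip_xi_level (xvec a b (c / 42160) (d / 42160))
  have h' := ip_xi_level (xvec a' b' (c' / 42160) (d' / 42160))
  simp only [tauForm, ip_xvec_cfun, Matrix.cons_val]
  rw [h.2.2.2.2.1, h.2.2.2.2.2, h'.1, h'.2.1, two_rpow_sq, two_rpow_sq, two_rpow_sq, two_rpow_sq,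
    ip_lincomb_lincomb]
  simp only [Finset.sum_range_succ, Finset.sum_range_zero, levelTwoData, gram4, Pi.smul_apply,
    smul_eq_mul, xvec, Matrix.cons_val, evenForm, oddForm]
  ring

/-- The vectors (1,s) and (1,t) are to be conjugate for both forms. These two equations are linear
in s + t and st, so s and t are the roots of 197038861 X² - 193582554 X - 716540211. The factors l
and m exist because at each root the two forms have opposite signs. -/
theorem exists_roots : ∃ s t l m : ℝ, s ≠ t ∧ evenForm 1 s 1 t = 0 ∧ oddForm 1 s 1 t = 0 ∧
    evenForm 1 s 1 s + l ^ 2 * oddForm 1 s 1 s = 0 ∧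
    evenForm 1 t 1 t + m ^ 2 * oddForm 1 t 1 t = 0 := by
  -- The square root of the discriminant of this quadratic.
  set δ := Real.sqrt 602219273357721600 with hδ
  have h2 : δ ^ 2 = 602219273357721600 := Real.sq_sqrt (by norm_num)
  have lo : 776027881 ≤ δ := Real.le_sqrt_of_sq_le (by norm_num)
  have hi : δ ≤ 776027882 := Real.sqrt_le_iff.2 (by norm_num)
  have sol : ∀ x y : ℝ, x * y < 0 → ∃ l : ℝ, x + l ^ 2 * y = 0 := by
    intro x y hxy
    have hy : y ≠ 0 := by rintro rfl; simp at hxy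
    refine ⟨Real.sqrt (-(x * y) / y ^ 2), ?_⟩
    rw [Real.sq_sqrt (div_nonneg (by linarith) (sq_nonneg y))]
    field_simp; ring
  set s := (193582554 + δ) / 394077722 with hs
  set t := (193582554 - δ) / 394077722 with ht
  have s2 : s * s = 193582554 / 197038861 * s + 716540211 / 197038861 := by
    rw [hs]; linear_combination h2 / 394077722 ^ 2
  have t2 : t * t = 193582554 / 197038861 * t + 716540211 / 197038861 := by
    rw [ht]; linear_combination h2 / 394077722 ^ 2
  have st : s * t = -716540211 / 197038861 := by
    rw [hs, ht]; linear_combination -h2 / 394077722 ^ 2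
  have sst : s + t = 193582554 / 197038861 := by rw [hs, ht]; ring
  -- These enclosures are sharp enough to decide the signs of both forms at the roots.
  have sl : 2.46 ≤ s ∧ s ≤ 2.461 := by
    rw [hs, le_div_iff₀ (by norm_num), div_le_iff₀ (by norm_num)]; constructor <;> linarith
  have tl : -1.478 ≤ t ∧ t ≤ -1.4779 := by
    rw [ht, le_div_iff₀ (by norm_num), div_le_iff₀ (by norm_num)]; constructor <;> linarith
  obtain ⟨l, hl⟩ := sol (evenForm 1 s 1 s) (oddForm 1 s 1 s) (by
    refine mul_neg_of_neg_of_pos ?_ ?_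
    · rw [evenForm]; linarith [sl.1, sl.2]
    · rw [oddForm]; linarith [sl.1, sl.2])
  obtain ⟨m, hm⟩ := sol (evenForm 1 t 1 t) (oddForm 1 t 1 t) (by
    refine mul_neg_of_pos_of_neg ?_ ?_
    · rw [evenForm]; linarith [tl.1, tl.2]
    · rw [oddForm]; linarith [tl.1, tl.2])
  refine ⟨s, t, l, m, by linarith [sl.1, tl.2], ?_, ?_, hl, hm⟩
  · rw [evenForm, st]; linarith
  · rw [oddForm, st]; linarith

theorem exists_tauForm_eq_zero : ∃ x : Fin 2 → Fin 6 → ℝ, LinearIndependent ℝ x ∧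
    (∀ i j, tauForm (lincomb (x i) xiLevel2) (lincomb (x j) xiLevel2) = 0) ∧
    (∀ i k, ip (lincomb (x i) xiLevel2) (![phi1, phi2] k) = 0) ∧
    ∀ i, ip (xi 1 2) (lincomb (x i) xiLevel2) = 0 ∧ ip (xi 1 3) (lincomb (x i) xiLevel2) = 0 := by
  obtain ⟨s, t, l, m, hst, he, ho, hs, ht⟩ := exists_roots
  -- The odd coordinates are l times (1,s) and m times (1,t). Then the mixed terms cancel on the
  -- diagonal, and off the diagonal every term is a multiple of one of the two vanishing conjugacy
  -- expressions.
  refine ⟨![xvec 1 s (l / 42160) (l * s / 42160), xvec 1 t (m / 42160) (m * t / 42160)],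
    ?_, ?_, ?_, ?_⟩
  · rw [Fintype.linearIndependent_iff]
    intro c hc
    have h2 := congrFun hc 2
    have h1 := congrFun hc 1
    have h5 := congrFun hc 5
    simp only [Fin.sum_univ_two, Pi.add_apply, Pi.smul_apply, smul_eq_mul, xvec,
      Matrix.cons_val, Pi.zero_apply] at h1 h2 h5
    have k1 : c 1 = -c 0 := by linarith
    have k2 : c 0 * (s - t) = 0 := by rw [k1] at h1 h5; linarith
    have k3 : c 0 = 0 := (mul_eq_zero.1 k2).resolve_right (sub_ne_zero.2 hst)
    intro i
    fin_cases i
    · exact k3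
    · rw [k3, neg_zero] at k1; exact k1
  · intro i j
    simp only [evenForm, oddForm] at he ho hs ht
    fin_cases i <;> fin_cases j <;> simp only [Fin.zero_eta, Fin.mk_one, Matrix.cons_val] <;>
      rw [tauForm_xvec] <;> simp only [evenForm, oddForm]
    · linear_combination hs
    · linear_combination he + (l * m - m + l) * ho
    · linear_combination he + (l * m - l + m) * ho
    · linear_combination ht
  · intro i k
    fin_cases i
    exacts [ip_phi12_xvec _ _ _ _ k, ip_phi12_xvec _ _ _ _ k]
  · intro i
    fin_cases i
    exacts [ip_xvec _ _ _ _, ip_xvec _ _ _ _]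

theorem exists_null_C : ∃ b : Fin 4 → Fin 6 → ℝ, IsNullBasis matC b := by
  refine exists_isNullBasis_ip (fun i : Fin 2 => xi 1 ((i : ℤ) + 2)) xiLevel2 (fun a ha => ?_)
    (by simp)
  have h : ∀ x : Fin 6 → ℝ, a 0 * ip (xi 1 2) (lincomb x xiLevel2) +
      a 1 * ip (xi 1 3) (lincomb x xiLevel2) = 0 := by
    intro x
    have h1 : ip (∑ i : Fin 2, a i • xi 1 ((i : ℤ) + 2)) (lincomb x xiLevel2) = 0 := by
      rw [ip_lincomb_right]
      exact Finset.sum_eq_zero fun j _ => by rw [ha, mul_zero]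
    rw [Fin.sum_univ_two, ip_add_left, ip_smul_left, ip_smul_left] at h1
    simpa using h1
  -- By parity, ξ_{2,4} pairs to zero with ξ_{1,3}, and ξ_{2,5} with ξ_{1,2}, so each test isolates
  -- one coefficient.
  have k2 := h ![0, 0, 1, 0, 0, 0]
  have k3 := h ![0, 0, 0, 1, 0, 0]
  rw [(ip_xi_level _).2.2.1, (ip_xi_level _).2.2.2.1] at k2 k3
  simp at k2 k3
  ext i
  fin_cases i
  exacts [k2, k3]

/-- Let X and Y be the matrices of inner products of g₀, g₁ with the left and the right functions c,
and let M be the matrix of the ⟨cᵢ,cₖ⟩. The claim is XᵀY = M. The coefficients of `tauForm` are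
those of N = M⁻¹, so for orthonormal g the hypothesis reads Y N Xᵀ = 1. A one-sided inverse of a
square matrix is two-sided, whence Xᵀ Y N = 1 and the claim. -/
theorem orth_of_tauForm {g : Fin 2 → ℝ → ℝ} (hg : ON g) (h : ∀ i j, tauForm (g i) (g j) = 0)
    {i k : Fin 4} (hi : i = 0 ∨ i = 1) (hk : k = 2 ∨ k = 3) :
    ip (resid g (cfun i)) (resid g (cfun k)) = 0 := by
  rw [ip_resid_resid hg]
  let X : Matrix (Fin 2) (Fin 2) ℝ := !![ip (g 0) (cfun 0), ip (g 0) (cfun 1);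
    ip (g 1) (cfun 0), ip (g 1) (cfun 1)]
  let Y : Matrix (Fin 2) (Fin 2) ℝ := !![ip (g 0) (cfun 2), ip (g 0) (cfun 3);
    ip (g 1) (cfun 2), ip (g 1) (cfun 3)]
  let N : Matrix (Fin 2) (Fin 2) ℝ := !![-12480, 56160; -56160, 252000]
  let M : Matrix (Fin 2) (Fin 2) ℝ := !![35 / 1248, -1 / 160; 1 / 160, -1 / 720]
  have hNM : N * M = 1 := by
    ext i j
    fin_cases i <;> fin_cases j <;> simp [N, M, Matrix.mul_apply, Fin.sum_univ_two] <;> norm_num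
  have h1 : Y * N * X.transpose = 1 := by
    ext i j
    have := h i j
    rw [tauForm, hg.ip_eq] at this
    fin_cases i <;> fin_cases j <;>
    · simp [Y, N, X, Matrix.mul_apply, Fin.sum_univ_two] at this ⊢
      linarith
  have h2 : X.transpose * Y = M := by
    have h3 : X.transpose * (Y * N) = 1 := mul_eq_one_comm.1 h1
    calc X.transpose * Y = X.transpose * Y * (N * M) := by rw [hNM, mul_one]
      _ = X.transpose * (Y * N) * M := by simp only [Matrix.mul_assoc]
      _ = M := by rw [h3, one_mul]
  have e : ∀ a b, (X.transpose * Y) a b = M a b := fun a b => by rw [h2]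
  have e00 := e 0 0
  have e01 := e 0 1
  have e10 := e 1 0
  have e11 := e 1 1
  simp [X, Y, M, Matrix.mul_apply, Fin.sum_univ_two] at e00 e01 e10 e11
  rw [Fin.sum_univ_two, ip_comm (cfun i) (g 0), ip_comm (cfun i) (g 1), ip_comm (cfun k) (g 0),
    ip_comm (cfun k) (g 1)]
  rcases hi with rfl | rfl <;> rcases hk with rfl | rfl
  · rw [ip_c02]; linarith
  · rw [ip_c03]; linarith
  · rw [ip_c12]; linarith
  · rw [ip_c13]; linarith

theorem ScalingChoice.exists_admissible : ∃ A : ScalingChoice, A.Admissible := by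
  obtain ⟨b, hb⟩ := exists_null_C
  obtain ⟨x, hx, htau, -, hperp⟩ := exists_tauForm_eq_zero
  let f : Fin 2 → ℝ → ℝ := fun i => lincomb (x i) xiLevel2
  have hf : Indep2 f :=
    indep2_lincomb (fun j => (xiLevel2_mem j).1.continuous) xiLevel2_linearIndependent hx
  have hfL : ∀ i, IsL2 (f i) := fun i => by simp only [f]; infer_instance
  let A0 : ScalingChoice := ⟨b, 0⟩
  have hv := v_on (A := A0) hb
  have hfv : ∀ i, f i ∈ Submodule.span ℝ (Set.range A0.v) := by
    intro i
    have h1 : f i ∈ Submodule.span ℝ (Set.range xiLevel2) := by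
      simp only [f, lincomb_eq]
      exact Submodule.sum_mem _ fun j _ => Submodule.smul_mem _ _ (Submodule.subset_span ⟨j, rfl⟩)
    have h2 := IsNullBasis.mem_span (r := fun i : Fin 2 => xi 1 ((i : ℤ) + 2)) (f := xiLevel2) hb h1
      (fun k => by
        fin_cases k
        exacts [(hperp i).1, (hperp i).2])
    refine Submodule.span_le.2 ?_ h2
    rintro _ ⟨l, rfl⟩
    exact hv.2 l
  have hg := gsPair_on hf
  have hgv := fun i => gsPair_mem hfv i
  -- The rows of `s` are the coordinates of the orthonormalized null plane in the basis v, so that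
  -- φ₃ and φ₄ become this pair. The functions v depend only on `b`, so the auxiliary choice with s
  -- = 0 has the same ones.
  let A : ScalingChoice := ⟨b, fun i j => ip (gsPair f i) (A0.v j)⟩
  have hAv : A.v = A0.v := rfl
  have hphi : ∀ i, lincomb (A.s i) A.v = gsPair f i := fun i => by
    rw [lincomb_eq, hAv]
    exact (hv.1.eq_sum (hgv i)).symm
  have h3 : A.phi3 = gsPair f 0 := by rw [← hphi 0]; exact A.phi3_eq
  have h4 : A.phi4 = gsPair f 1 := by rw [← hphi 1]; exact A.phi4_eq
  have hs : ∀ i j, ∑ k, A.s i k * A.s j k = if i = j then 1 else 0 := by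
    intro i j
    rw [← hg.ip_eq i j, ← hphi i, ← hphi j, hAv, ip_lincomb_on hv.1]
  have hfam : ![A.phi3, A.phi4] = gsPair f := by
    rw [h3, h4]
    funext i; fin_cases i <;> rfl
  refine ⟨A, hb, fun i => ?_, ?_, fun i hi k hk => ?_⟩
  · have := hs i i
    rw [if_pos rfl] at this
    rw [← this]
    exact Finset.sum_congr rfl fun j _ => sq _
  · have := hs 0 1
    rwa [if_neg (by decide)] at this
  · rw [hfam]
    refine orth_of_tauForm hg (fun i j => ?_) hi hk
    have hm : ∀ i, gsPair f i ∈ Submodule.span ℝ (Set.range f) :=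
      gsPair_mem fun i => Submodule.subset_span ⟨i, rfl⟩
    exact tauForm_lincomb htau (hm i) (hm j)

end SplineWavelet

end

/-! ### Boundary wavelets and the orthonormal wavelets on [0, N] -/

open MeasureTheory

noncomputable section

set_option synthInstance.maxSize 100000

namespace SplineWavelet

theorem ip_restr_half {f g : ℝ → ℝ} {a b : ℝ} (hf : f ∈ SuppIn a 1) (hg : g ∈ SuppIn 0 b) :
    ip (restr f) g = ip f g ∧ ip f (restr g) = ip f g := by
  have h : ∀ x ∉ Set.Icc (0 : ℝ) 1, f x * g x = 0 := by
    intro x hx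
    rcases lt_or_ge x 0 with h0 | h0
    · rw [hg x fun h => absurd h.1 (not_le.2 h0), mul_zero]
    · rw [hf x fun h => hx ⟨h0, h.2⟩, zero_mul]
  constructor <;> refine ip_congr fun x => ?_ <;> by_cases hx : x ∈ Set.Icc (0 : ℝ) 1
  · rw [restr_of_mem hx]
  · rw [restr_mem f x hx, zero_mul, h x hx]
  · rw [restr_of_mem hx]
  · rw [restr_mem g x hx, mul_zero, h x hx]

theorem IsNullBasis.row_eq_zero {m : Type} {k n : ℕ} {M : Matrix m (Fin n) ℝ}
    {b : Fin k → Fin n → ℝ} (hb : IsNullBasis M b) (r : m) (l : Fin k) :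
    ∑ j, M r j * b l j = 0 := by
  have h : b l ∈ LinearMap.ker M.mulVecLin := by
    rw [← hb.2]; exact Submodule.subset_span ⟨l, rfl⟩
  exact congrFun (LinearMap.mem_ker.1 h) r

namespace ScalingChoice

variable {A : ScalingChoice}

variable (hA : A.Admissible)

include hA

/-- A function of `V₀` vanishing at `m` is, up to a multiple of a translate of `bd`, a function with
a double zero at `m`. -/
theorem exists_sub_bd_mem_Z {g : ℝ → ℝ} (hg : g ∈ A.V) {m : ℤ} (h0 : g m = 0) :
    ∃ c : ℝ, g - c • dil 1 m A.bd ∈ Z m := by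
  have h := (sub_center_mem hA hg m).1
  set a := ip g (A.e (4, m)) with ha
  set b := ip g (A.e (5, m)) with hb
  have hv := h.2.1
  have e4 : A.e (4, m) m = A.phi5 0 := by simp [e, dil_eq]; rfl
  have e5 : A.e (5, m) m = A.phi6 0 := by simp [e, dil_eq]; rfl
  simp only [center, Pi.sub_apply, Pi.add_apply, Pi.smul_apply, smul_eq_mul, h0, e4, e5] at hv
  rw [← ha, ← hb] at hv
  have h5 := phi5_zero (A := A).1
  -- Vanishing at m means aφ₅(0) + bφ₆(0) = 0, so (a, b) is proportional to (φ₆(0), -φ₅(0)), the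
  -- coefficients of `bd`.
  refine ⟨-b / A.phi5 0, ?_⟩
  have : (-b / A.phi5 0) • dil 1 m A.bd = center (A := A) g m := by
    have k : a = -b / A.phi5 0 * A.phi6 0 := by field_simp; linarith
    have hc : center (A := A) g m =
        fun x => a * A.phi5 (1 * x - m) + b * A.phi6 (1 * x - m) := rfl
    rw [hc]
    ext x
    rw [k]
    change -b / A.phi5 0 * (A.phi6 0 * A.phi5 (1 * x - m) - A.phi5 0 * A.phi6 (1 * x - m)) =
      -b / A.phi5 0 * A.phi6 0 * A.phi5 (1 * x - m) + b * A.phi6 (1 * x - m)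
    field_simp
    ring
  rw [this]
  exact h

omit hA in
theorem shift_bd_mem (m : ℤ) : dil 1 m A.bd ∈ A.V := shift_mem_V bd_mem m

end ScalingChoice

namespace WaveletChoice

open ScalingChoice

variable {B : WaveletChoice} {A : ScalingChoice}

/-- Evaluation at `x`. -/
def evL (x : ℝ) : (ℝ → ℝ) →ₗ[ℝ] ℝ := LinearMap.proj x

theorem mem_ker_evL {x : ℝ} {f : ℝ → ℝ} : f ∈ LinearMap.ker (evL x) ↔ f x = 0 := Iff.rfl

/-- The combinations of `ψ₃, …, ψ₆` which vanish at `0` and are orthogonal to `l`. -/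
def bdWav (B : WaveletChoice) (A : ScalingChoice) (l : ℝ → ℝ) : Submodule ℝ (ℝ → ℝ) :=
  Submodule.span ℝ (Set.range (B.psiLong A)) ⊓ LinearMap.ker (evL 0) ⊓ perp {l}

variable (hA : A.Admissible) (hB : B.Admissible A)

include hA hB

omit hA hB in
theorem lincomb_mem_bdWav {b : Fin 4 → ℝ} {l : ℝ → ℝ} (h0 : ∑ j, B.psiLong A j 0 * b j = 0)
    (hl : ∑ j, ip l (B.psiLong A j) * b j = 0) : lincomb b (B.psiLong A) ∈ B.bdWav A l := by
  refine ⟨⟨lincomb_mem fun j => Submodule.subset_span ⟨j, rfl⟩, ?_⟩, inferInstance, ?_⟩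
  · exact (Finset.sum_congr rfl fun j _ => mul_comm _ _).trans h0
  · rintro _ rfl _
    rw [ip_comm, ip_lincomb_right, ← hl]
    exact Finset.sum_congr rfl fun j _ => mul_comm _ _

theorem psiL_mem (i : Fin 2) : B.psiL A i ∈ (B.bdWav A (restr A.bd)).map restrL := by
  refine gsPair_mem (fun i => ?_) i
  refine ⟨lincomb (B.bG i) (B.psiLong A), lincomb_mem_bdWav (hB.null_G.row_eq_zero 0 i) ?_, rfl⟩
  have h := hB.null_G.row_eq_zero 1 i
  have h1 := inv_ne_zero (l2norm_ne_zero (restr_bd_ne_zero hA))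
  have e : ∀ j, B.matG A 1 j = (l2norm (restr A.bd))⁻¹ * ip (restr A.bd) (B.psiLong A j) :=
    fun j => ip_normalize_left _ _
  simp only [e, mul_assoc, ← Finset.mul_sum] at h
  exact (mul_eq_zero.1 h).resolve_left h1

theorem psiR_mem (i : Fin 2) :
    B.psiR A i ∈ (B.bdWav A A.bdLeft).map (restrL ∘ₗ dilL 1 1) := by
  refine gsPair_mem (fun i => ?_) i
  refine ⟨lincomb (B.bH i) (B.psiLong A), lincomb_mem_bdWav (hB.null_H.row_eq_zero 0 i) ?_, rfl⟩
  have h := hB.null_H.row_eq_zero 1 i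
  have h1 := inv_ne_zero (l2norm_ne_zero (restr_shift_bd_ne_zero hA))
  have e : ∀ j, B.matH A 1 j =
      (l2norm (restr (dil 1 1 A.bd)))⁻¹ * ip A.bdLeft (B.psiLong A j) := fun j => by
    rw [bdLeft, ip_dil_one_left, neg_neg, ← ip_normalize_left, ← phiR_eq]
    rfl
  simp only [e, mul_assoc, ← Finset.mul_sum] at h
  exact (mul_eq_zero.1 h).resolve_left h1

section bdWav

variable {l f : ℝ → ℝ} (hf : f ∈ B.bdWav A l)

include hf

theorem bdWav_wav : f ∈ A.wav ∧ f ∈ SuppIn (-1) 1 := by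
  have : Submodule.span ℝ (Set.range (B.psiLong A)) ≤ A.wav ⊓ SuppIn (-1) 1 := by
    refine Submodule.span_le.2 ?_
    rintro _ ⟨j, rfl⟩
    exact ⟨psiLong_mem_wav hA hB.null_S hB.null_T j, psiLong_supp hA j⟩
  exact this hf.1.1

theorem ip_bdWav_psi {p : Fin 6 × ℤ} (hp : p.1 < 2 ∨ p.2 ≠ 0) :
    ip f (dil 1 p.2 (B.psi A p.1)) = 0 := by
  refine ip_eq_zero_of_mem_span_left ?_ ?_ hf.1.1
  · rintro _ ⟨j, rfl⟩; infer_instance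
  · rintro _ ⟨j, rfl⟩
    have h := (psi_translates hA hB.null_S hB.null_T).ip_eq (j.natAdd 2, 0) p
    rw [if_neg] at h
    · simpa [psiLong_eq, dil_one_zero] using h
    · rintro rfl
      rcases hp with hp | hp
      · have : (2 : Fin 6) ≤ Fin.natAdd 2 j := by
          simp [Fin.le_def]
        exact absurd hp (not_lt.2 this)
      · exact hp rfl

/-- Subtracting a multiple of `bd` gives `g` a double zero at 0; the truncation of the difference
stays in `V`, to which the wavelet `f` is orthogonal. The `bd` term vanishes by the second condition
imposed on `f`. `ip_restr_shift_bdWav` is the mirror image at the right end. -/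
theorem ip_restr_bdWav (hl : l = restr A.bd) {g : ℝ → ℝ} (hg : g ∈ A.V) (h0 : g 0 = 0) :
    ip (restr f) g = 0 := by
  obtain ⟨hw, hs⟩ := bdWav_wav hA hB hf
  have hLf := isL2_of_mem_Vs hw.1
  have hLg := isL2_of_mem_V hg
  obtain ⟨c, hc⟩ := exists_sub_bd_mem_Z hA hg (m := 0) (by simpa using h0)
  set g0 := g - c • dil 1 ((0 : ℤ) : ℝ) A.bd with hg0
  have hg0V : g0 ∈ A.V := Submodule.sub_mem _ hg (Submodule.smul_mem _ _ (shift_bd_mem 0))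
  have hcut := cut_mem_V hA hg0V hc
  have h1 : ip (restr f) g0 = 0 := by
    rw [← ip_wav hw hcut]
    refine ip_congr fun x => ?_
    by_cases hx : x ∈ Set.Icc (0 : ℝ) 1
    · rw [restr_of_mem hx, Set.indicator_of_mem (by simpa using hx.1)]
    · rw [restr_mem f x hx, zero_mul]
      rcases lt_or_ge x 0 with h | h
      · rw [Set.indicator_of_notMem (by simpa using h), mul_zero]
      · rw [hs x fun h' => hx ⟨h, h'.2⟩, zero_mul]
  have h2 : ip (restr f) A.bd = 0 := by
    rw [ip_comm (restr f), ← hf.2.2 l rfl (by rw [hl]; infer_instance), hl, ip_comm f]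
    refine ip_congr fun x => ?_
    by_cases hx : x ∈ Set.Icc (0 : ℝ) 1
    · rw [restr_of_mem hx, restr_of_mem hx]
    · rw [restr_mem _ x hx, restr_mem _ x hx]; ring
  have hLg0 := isL2_of_mem_V hg0V
  have e : g = g0 + c • A.bd := by rw [hg0, Int.cast_zero, dil_one_zero]; abel
  rw [e, ip_add_right, ip_smul_right, h1, h2]; ring

theorem ip_restr_shift_bdWav (hl : l = A.bdLeft) {g : ℝ → ℝ} (hg : g ∈ A.V) (h0 : g 1 = 0) :
    ip (restr (dil 1 1 f)) g = 0 := by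
  obtain ⟨hw, hs⟩ := bdWav_wav hA hB hf
  have hLf := isL2_of_mem_Vs hw.1
  have hLg := isL2_of_mem_V hg
  obtain ⟨c, hc⟩ := exists_sub_bd_mem_Z hA hg (m := 1) (by simpa using h0)
  set g0 := g - c • dil 1 ((1 : ℤ) : ℝ) A.bd with hg0
  have hg0V : g0 ∈ A.V := Submodule.sub_mem _ hg (Submodule.smul_mem _ _ (shift_bd_mem 1))
  have hcut := Submodule.sub_mem _ hg0V (cut_mem_V hA hg0V hc)
  have hw1 : dil 1 1 f ∈ A.wav := by simpa using shift_mem_wav hw 1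
  have hs1 := dil_one_one_supp hs
  have h1 : ip (restr (dil 1 1 f)) g0 = 0 := by
    rw [← ip_wav hw1 hcut]
    refine ip_congr fun x => ?_
    by_cases hx : x ∈ Set.Icc (0 : ℝ) 1
    · rw [restr_of_mem hx, Pi.sub_apply]
      rcases hx.2.lt_or_eq with h | rfl
      · rw [Set.indicator_of_notMem (by simpa using h), sub_zero]
      · have : g0 1 = 0 := by simpa using hc.2.1
        simp [this]
    · rw [restr_mem _ x hx, zero_mul, Pi.sub_apply]
      rcases lt_or_ge x 0 with h | h
      · rw [hs1 x fun h' => absurd h'.1 (not_le.2 h), zero_mul]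
      · have : (1 : ℝ) ≤ x := le_of_not_gt fun h' => hx ⟨h, h'.le⟩
        rw [Set.indicator_of_mem (by simpa using this), sub_self, mul_zero]
  have h2 : ip (restr (dil 1 1 f)) (dil 1 1 A.bd) = 0 := by
    rw [← hf.2.2 l rfl (by rw [hl]; infer_instance), hl, ip_comm f, bdLeft, ip_dil_one_left,
      neg_neg, ip_comm (restr (dil 1 1 A.bd))]
    refine ip_congr fun x => ?_
    by_cases hx : x ∈ Set.Icc (0 : ℝ) 1
    · rw [restr_of_mem hx, restr_of_mem hx]
    · rw [restr_mem _ x hx, restr_mem _ x hx]; ring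
  have hLg0 := isL2_of_mem_V hg0V
  have e : g = g0 + c • dil 1 1 A.bd := by rw [hg0, Int.cast_one]; abel
  rw [e, ip_add_right, ip_smul_right, h1, h2]; ring

end bdWav

/-! ### The wavelets on `[0, N]` -/

omit hA hB in
/-- The indices of the wavelets on the real line with support in `[0, N]`. -/
def innerIdx (N : ℕ) : Set (Fin 6 × ℤ) :=
  {p | (p.1 < 2 ∧ 0 ≤ p.2 ∧ p.2 < N) ∨ (2 ≤ p.1 ∧ 1 ≤ p.2 ∧ p.2 < N)}

omit hA hB in
/-- The wavelets on `[0, N]`. -/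
def wavN (B : WaveletChoice) (A : ScalingChoice) (N : ℕ) :
    Fin 2 ⊕ innerIdx N ⊕ Fin 2 → ℝ → ℝ :=
  Sum.elim (B.psiL A) (Sum.elim (fun p => dil 1 (p : Fin 6 × ℤ).2 (B.psi A (p : Fin 6 × ℤ).1))
    fun i => dil 1 (N - 1) (B.psiR A i))

omit hA hB in
theorem psi_supp_short (i : Fin 6) (hA : A.Admissible) (hi : i < 2) : B.psi A i ∈ SuppIn 0 1 := by
  have hi' : i = 0 ∨ i = 1 := by omega
  rcases hi' with rfl | rfl
  exacts [psi12_supp hA 0, psi12_supp hA 1]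

omit hB in
theorem inner_supp {N : ℕ} {p : Fin 6 × ℤ} (hp : p ∈ innerIdx N) :
    dil 1 p.2 (B.psi A p.1) ∈ SuppIn 0 N := by
  rcases hp with h | h
  · refine SuppIn_mono ?_ ?_ (dil_one_supp (psi_supp_short p.1 hA h.1))
    · have := h.2.1
      rw [zero_add]; exact_mod_cast this
    · have : 1 + p.2 ≤ N := by omega
      exact_mod_cast this
  · refine SuppIn_mono ?_ ?_ (dil_one_supp (psi_supp hA p.1))
    · have : 0 ≤ -1 + p.2 := by omega
      exact_mod_cast this
    · have : 1 + p.2 ≤ N := by omega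
      exact_mod_cast this

omit hA hB in
instance gL_isL2 (i : Fin 2) : IsL2 (B.gL A i) := by unfold gL; infer_instance

omit hA hB in
instance hR_isL2 (i : Fin 2) : IsL2 (B.hR A i) := by unfold hR; infer_instance

omit hA hB in
instance psiR_isL2 (i : Fin 2) : IsL2 (B.psiR A i) := by unfold psiR; infer_instance

theorem psi_translate_continuous (p : Fin 6 × ℤ) : Continuous (dil 1 p.2 (B.psi A p.1)) :=
  continuous_dil (Vs_continuous (psi_mem_wav hA hB.null_S hB.null_T p.1).1).2 _ _

/-- Inner wavelets live in [0, N], so pairing them with a boundary wavelet does not feel the cut at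
the end point, and orthogonality is inherited from the line. -/
theorem wavN_on {N : ℕ} (hN : 1 ≤ N) : ON (B.wavN A N) := by
  have hL : ON (B.psiL A) := gsPair_on (gL_indep hA hB.null_S hB.null_T hB.null_G.1)
  have hR0 : ON (B.psiR A) := gsPair_on (hR_indep hA hB.null_S hB.null_T hB.null_H.1)
  have hR : ON fun i => dil 1 (N - 1) (B.psiR A i) :=
    ⟨inferInstance, fun i j => by rw [ip_dil_one, hR0.ip_eq]⟩
  have hI : ON fun p : innerIdx N => dil 1 (p : Fin 6 × ℤ).2 (B.psi A (p : Fin 6 × ℤ).1) :=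
    (psi_translates hA hB.null_S hB.null_T).comp Subtype.val_injective
  refine hL.sumElim (hI.sumElim hR ?_) ?_
  · rintro ⟨p, hp⟩ i
    obtain ⟨f, hf, hfi⟩ := psiR_mem hA hB i
    obtain ⟨hw, hs⟩ := bdWav_wav hA hB hf
    rw [← hfi]
    simp only [LinearMap.comp_apply, dilL_apply, restrL_apply]
    rw [ip_comm, ip_dil_one_left, ip_comm]
    have hp1 : dil 1 (-((N : ℝ) - 1)) (dil 1 p.2 (B.psi A p.1)) ∈ SuppIn (1 - N) 1 := by
      have := dil_one_supp (c := -((N : ℝ) - 1)) (inner_supp (B := B) hA hp)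
      simpa using this
    rw [(ip_restr_half hp1 (dil_one_one_supp hs)).2, ip_comm, ip_dil_one_left, dil_one_dil_one,
      dil_one_dil_one]
    have := ip_bdWav_psi hA hB hf (p := (p.1, p.2 - N)) (Or.inr (by
      rcases hp with h | h <;> simp only <;> omega))
    push_cast at this
    rw [show -1 + -((N : ℝ) - 1) + (p.2 : ℝ) = p.2 - N by ring]
    exact this
  · rintro i (⟨p, hp⟩ | k)
    · obtain ⟨f, hf, hfi⟩ := psiL_mem hA hB i
      obtain ⟨hw, hs⟩ := bdWav_wav hA hB hf
      rw [← hfi]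
      simp only [Sum.elim_inl, restrL_apply]
      rw [(ip_restr_half hs (inner_supp hA hp)).1]
      exact ip_bdWav_psi hA hB hf (by
        rcases hp with h | h
        · exact Or.inl h.1
        · right; omega)
    · obtain ⟨f, hf, hfi⟩ := psiL_mem hA hB i
      obtain ⟨hw, hs⟩ := bdWav_wav hA hB hf
      obtain ⟨g, hg, hgi⟩ := psiR_mem hA hB k
      obtain ⟨hw', hs'⟩ := bdWav_wav hA hB hg
      rw [← hfi]
      simp only [Sum.elim_inr, ← hgi, LinearMap.comp_apply, dilL_apply, restrL_apply]
      -- For N = 1 both kinds of boundary wavelets share the interval [0,1], which is exactly the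
      -- overlap of the uncut functions; for larger N their supports meet in at most one point.
      rcases hN.eq_or_lt with rfl | hN
      · rw [Nat.cast_one, sub_self, dil_one_zero, ip_restr_restr hs (dil_one_one_supp hs'), ip_comm,
          ip_dil_one_left]
        have := isL2_of_mem_Vs hw.1
        refine ip_eq_zero_of_mem_span_left (by rintro _ ⟨j, rfl⟩; infer_instance) ?_ hg.1.1
        · rintro _ ⟨j, rfl⟩
          have := ip_bdWav_psi hA hB hf (p := (j.natAdd 2, 1)) (Or.inr one_ne_zero)
          rw [Int.cast_one] at this
          rw [ip_comm, ip_dil_one_left, neg_neg, psiLong_eq]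
          exact this
      · have hN2 : (2 : ℝ) ≤ N := by exact_mod_cast hN
        refine ip_eq_zero_of_mul fun x => ?_
        rcases lt_or_ge x 1 with hx | hx
        · rw [dil_eq, restr_mem _ (1 * x - ((N : ℝ) - 1)) (fun h => by
            have := h.1; linarith), mul_zero]
        · rw [restr, Set.indicator_apply, SuppIn.eq_zero_right hs (Vs_continuous hw.1).2 hx, ite_self,
            zero_mul]

end WaveletChoice

end SplineWavelet

end

/-! ### The spaces on the interval, orthonormality between levels and spanning -/

open MeasureTheory

noncomputable section

set_option synthInstance.maxSize 100000

namespace SplineWavelet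

namespace WaveletChoice

open ScalingChoice

variable {B : WaveletChoice} {A : ScalingChoice}

theorem dil_mem_Vs_succ {f : ℝ → ℝ} (hf : f ∈ A.Vs 1) (j : ℕ) :
    dil (2 ^ j) 0 f ∈ A.Vs (j + 1) := by
  obtain ⟨g, hg, rfl⟩ := hf
  have := dil_mem_Vs hg (j + 1)
  have e : dil (2 ^ j) 0 (dilL (2 ^ 1) 0 g) = dil (2 ^ (j + 1)) 0 g := by
    ext x
    simp only [dilL_apply, dil_eq]
    congr 1
    ring
  rwa [e]

/-- The restrictions to `[0, 1]` of the functions of `V_j` which vanish at `0` and `1`. -/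
def VI (A : ScalingChoice) (j : ℕ) : Submodule ℝ (ℝ → ℝ) :=
  (A.Vs j ⊓ LinearMap.ker (evL 0) ⊓ LinearMap.ker (evL 1)).map restrL

theorem restr_mem_VI {j : ℕ} {f : ℝ → ℝ} (hf : f ∈ A.Vs j) (h0 : f 0 = 0) (h1 : f 1 = 0) :
    restr f ∈ VI A j := ⟨f, ⟨⟨hf, h0⟩, h1⟩, rfl⟩

theorem VI_mono : Monotone (VI A) := by
  refine monotone_nat_of_le_succ fun j => ?_
  rintro _ ⟨f, ⟨⟨hf, h0⟩, h1⟩, rfl⟩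
  exact restr_mem_VI (Vs_le_succ j hf) h0 h1

variable (hA : A.Admissible) (hB : B.Admissible A)

include hA hB

/-- The wavelets on `[0, N]` are restrictions of functions of `V₁` which vanish at `0` and `N`. -/
theorem wavN_eq {N : ℕ} (hN : 1 ≤ N) (a : Fin 2 ⊕ innerIdx N ⊕ Fin 2) :
    ∃ f ∈ A.Vs 1, f 0 = 0 ∧ f N = 0 ∧ B.wavN A N a = (Set.Icc (0 : ℝ) N).indicator f := by
  have hN' : (1 : ℝ) ≤ N := by exact_mod_cast hN
  rcases a with i | ⟨p, hp⟩ | i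
  · obtain ⟨f, hf, hfi⟩ := psiL_mem hA hB i
    obtain ⟨hw, hs⟩ := bdWav_wav hA hB hf
    have hz := fun x (hx : 1 ≤ x) => SuppIn.eq_zero_right hs (Vs_continuous hw.1).2 hx
    refine ⟨f, hw.1, hf.1.2, hz _ hN', ?_⟩
    rw [wavN, Sum.elim_inl, ← hfi]
    ext x
    simp only [restrL_apply, restr, Set.indicator_apply]
    split_ifs with h1 h2 h2
    · rfl
    · exact absurd ⟨h1.1, h1.2.trans hN'⟩ h2
    · exact (hz x (le_of_not_gt fun h => h1 ⟨h2.1, h.le⟩)).symm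
    · rfl
  · have hs := inner_supp (B := B) hA hp
    have hc := psi_translate_continuous hA hB p
    refine ⟨_, (shift_mem_wav (psi_mem_wav hA hB.null_S hB.null_T p.1) p.2).1,
      SuppIn.eq_zero_left hs hc le_rfl, SuppIn.eq_zero_right hs hc le_rfl, ?_⟩
    ext x
    rw [Set.indicator_apply]
    split_ifs with h
    · rfl
    · exact hs x h
  · obtain ⟨f, hf, hfi⟩ := psiR_mem hA hB i
    obtain ⟨hw, hs⟩ := bdWav_wav hA hB hf
    have hz := fun x (hx : x ≤ -1) => SuppIn.eq_zero_left hs (Vs_continuous hw.1).2 hx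
    refine ⟨dil 1 ((N : ℤ) : ℝ) f, (shift_mem_wav hw N).1, ?_, ?_, ?_⟩
    · rw [dil_eq]; exact hz _ (by simpa using hN')
    · rw [dil_eq, Int.cast_natCast, one_mul, sub_self]; exact hf.1.2
    · rw [wavN, Sum.elim_inr, Sum.elim_inr, ← hfi]
      ext x
      simp only [LinearMap.comp_apply, dilL_apply, dil_eq, restrL_apply, restr, Set.indicator_apply,
        Set.mem_Icc, Int.cast_natCast]
      split_ifs with h1 h2 h2
      · congr 1; ring
      · exact absurd ⟨by linarith [h1.1], by linarith [h1.2]⟩ h2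
      · exact (hz _ (le_of_not_gt fun h => h1 ⟨by linarith, by linarith [h2.2]⟩)).symm
      · rfl

theorem ip_wavN {N : ℕ} (a : Fin 2 ⊕ innerIdx N ⊕ Fin 2) {g : ℝ → ℝ} (hg : g ∈ A.V)
    (h0 : g 0 = 0) (h1 : g N = 0) : ip (B.wavN A N a) g = 0 := by
  rcases a with i | ⟨p, hp⟩ | i
  · obtain ⟨f, hf, hfi⟩ := psiL_mem hA hB i
    rw [wavN, Sum.elim_inl, ← hfi]
    exact ip_restr_bdWav hA hB hf rfl hg h0
  · exact ip_wav (shift_mem_wav (psi_mem_wav hA hB.null_S hB.null_T p.1) p.2) hg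
  · obtain ⟨f, hf, hfi⟩ := psiR_mem hA hB i
    rw [wavN, Sum.elim_inr, Sum.elim_inr, ← hfi, ip_dil_one_left]
    have h : dil 1 (-((N : ℝ) - 1)) g ∈ A.V := by
      simpa using shift_mem_V hg (-((N : ℤ) - 1))
    exact ip_restr_shift_bdWav hA hB hf rfl h (by rw [dil_eq, ← h1]; congr 1; ring)

omit hA hB in
/-- The wavelet on `[0, 2^j]` which gives rise to `ψ_{j,n}`. -/
def LevelRel (j : ℕ) (n : ℤ) : Fin 2 ⊕ innerIdx (2 ^ j) ⊕ Fin 2 → Prop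
  | Sum.inl i => n = (i : ℕ) + 1
  | Sum.inr (Sum.inl p) => lineIdx 2 (n - 2) = p
  | Sum.inr (Sum.inr i) => n = 6 * 2 ^ j - 1 + (i : ℕ)

omit hA hB in
theorem LevelRel.unique {j : ℕ} {m n : ℤ} {a : Fin 2 ⊕ innerIdx (2 ^ j) ⊕ Fin 2}
    (hm : LevelRel j m a) (hn : LevelRel j n a) : m = n := by
  rcases a with i | p | i
  · exact hm.trans hn.symm
  · have := lineIdx_injective 2 (Eq.trans hm (Eq.symm hn))
    omega
  · exact hm.trans hn.symm

omit hA hB in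
theorem lineIdx_mem_innerIdx (n : ℤ) (N : ℕ) :
    lineIdx 2 (n - 2) ∈ innerIdx N ↔ 3 ≤ n ∧ n ≤ 6 * N - 2 := by
  have e2 : ((2 : Fin 6) : ℕ) = 2 := rfl
  simp only [e2, innerIdx, lineIdx, Set.mem_ofPred_eq, Fin.lt_def, Fin.le_def]
  split_ifs <;> omega

omit hA hB in
theorem psiInt_inner {j : ℕ} {n : ℤ} (h3 : 3 ≤ n) (h : n ≤ 6 * 2 ^ j - 2) :
    B.psiInt A j n = B.psiLine A j (n - 2) := by
  rw [psiInt, if_neg (by omega), if_neg (by omega), if_neg (by omega), if_neg (by omega)]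

omit hA hB in
theorem exists_levelRel {j : ℕ} {n : ℤ} (hn : n ∈ levelIndex j) :
    ∃ a, LevelRel j n a ∧
      B.psiInt A j n = (2 : ℝ) ^ ((j : ℝ) / 2) • dil (2 ^ j) 0 (B.wavN A (2 ^ j) a) := by
  obtain ⟨h1, h2⟩ := hn
  have hp : (1 : ℤ) ≤ 2 ^ j := one_le_pow₀ (by norm_num)
  have hR : ∀ i (x : ℝ), dil (2 ^ j) 0 (dil 1 (((2 ^ j : ℕ) : ℝ) - 1) (B.psiR A i)) x =
      B.psiR A i (1 - (2 : ℝ) ^ j * (1 - x)) := fun i x => by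
    simp only [dil_eq]; congr 1; push_cast; ring
  by_cases e1 : n = 1
  · refine ⟨Sum.inl 0, e1, ?_⟩
    rw [psiInt, if_pos e1]
    ext x
    simp [wavN, dil_eq]
  by_cases e2 : n = 2
  · refine ⟨Sum.inl 1, e2, ?_⟩
    rw [psiInt, if_neg e1, if_pos e2]
    ext x
    simp [wavN, dil_eq]
  by_cases e3 : n = 6 * 2 ^ j - 1
  · refine ⟨Sum.inr (Sum.inr 0), by simp [LevelRel, e3], ?_⟩
    rw [psiInt, if_neg e1, if_neg e2, if_pos e3]
    ext x
    rw [wavN, Sum.elim_inr, Sum.elim_inr, Pi.smul_apply, hR, smul_eq_mul]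
  by_cases e4 : n = 6 * 2 ^ j
  · refine ⟨Sum.inr (Sum.inr 1), by simp [LevelRel, e4], ?_⟩
    rw [psiInt, if_neg e1, if_neg e2, if_neg e3, if_pos e4]
    ext x
    rw [wavN, Sum.elim_inr, Sum.elim_inr, Pi.smul_apply, hR, smul_eq_mul]
  have hi : lineIdx 2 (n - 2) ∈ innerIdx (2 ^ j) := by
    rw [lineIdx_mem_innerIdx]; push_cast; omega
  refine ⟨Sum.inr (Sum.inl ⟨_, hi⟩), rfl, ?_⟩
  rw [psiInt_inner (by omega) (by omega), psiLine, lineFamily_eq]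
  rfl

theorem psiInt_on (j : ℕ) : ON fun n : levelIndex j => B.psiInt A j n := by
  choose a ha hpsi using fun n : levelIndex j => exists_levelRel (B := B) (A := A) n.2
  have hinj : Function.Injective a := fun m n h =>
    Subtype.ext ((ha m).unique (h ▸ ha n))
  have := ((wavN_on hA hB (Nat.one_le_two_pow (n := j))).dilate j).comp hinj
  have e : (fun n : levelIndex j => B.psiInt A j n) =
      (fun i => (2 : ℝ) ^ ((j : ℝ) / 2) • dil (2 ^ j) 0 (B.wavN A (2 ^ j) i)) ∘ a := funext hpsi
  rwa [e]

theorem psiInt_mem_VI {j : ℕ} {n : ℤ} (hn : n ∈ levelIndex j) : B.psiInt A j n ∈ VI A (j + 1) := by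
  obtain ⟨a, -, ha⟩ := exists_levelRel (B := B) (A := A) hn
  obtain ⟨f, hf, h0, h1, hfa⟩ := wavN_eq hA hB (Nat.one_le_two_pow (n := j)) a
  have h2 : (0 : ℝ) < 2 ^ j := by positivity
  rw [ha, hfa]
  have e : dil (2 ^ j) 0 ((Set.Icc (0 : ℝ) ((2 ^ j : ℕ) : ℝ)).indicator f) =
      restr (dil (2 ^ j) 0 f) := by
    ext x
    simp only [dil_eq, restr, Set.indicator_apply, Set.mem_Icc, sub_zero, Nat.cast_pow,
      Nat.cast_ofNat, mul_nonneg_iff_of_pos_left h2, mul_le_iff_le_one_right h2]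
  rw [e]
  refine Submodule.smul_mem _ _ (restr_mem_VI (dil_mem_Vs_succ hf j) ?_ ?_)
  · simpa [dil_eq] using h0
  · simpa [dil_eq] using h1

omit hA hB in
theorem VI_le_SuppIn (j : ℕ) : VI A j ≤ SuppIn 0 1 := by
  rintro _ ⟨f, -, rfl⟩
  exact restr_mem f

omit hA hB in
theorem isL2_of_mem_VI {j : ℕ} {f : ℝ → ℝ} (hf : f ∈ VI A j) : IsL2 f := by
  obtain ⟨g, hg, rfl⟩ := hf
  have := isL2_of_mem_Vs hg.1.1
  exact inferInstanceAs (IsL2 (restr g))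

/-- After rescaling to [0, 2^j] the element of `VI A j` is the restriction of an element of `V`
vanishing at both ends, and `ip_wavN` applies. Orthogonality between different levels follows since
the earlier wavelets lie in `VI A j`. -/
theorem ip_psiInt_VI {j : ℕ} {n : ℤ} (hn : n ∈ levelIndex j) {g : ℝ → ℝ} (hg : g ∈ VI A j) :
    ip (B.psiInt A j n) g = 0 := by
  have hs := VI_le_SuppIn _ (psiInt_mem_VI hA hB hn)
  obtain ⟨g, ⟨⟨⟨f, hf, rfl⟩, h0⟩, h1⟩, rfl⟩ := hg
  rw [restrL_apply, ip_comm, ip_restr_left _ hs, ip_comm]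
  obtain ⟨a, -, ha⟩ := exists_levelRel (B := B) (A := A) hn
  rw [ha, ip_smul_left, dilL_apply, ip_dil,
    ip_wavN hA hB a hf, mul_zero, mul_zero]
  · have := mem_ker_evL.1 h0
    simpa [dilL_apply, dil_eq] using this
  · have := mem_ker_evL.1 h1
    simpa [dilL_apply, dil_eq] using this

omit hA hB in
theorem phi_four_five : A.phi5 = A.e (4, 0) ∧ A.phi6 = A.e (5, 0) := ⟨(phi_e 4).symm, (phi_e 5).symm⟩

omit hA hB in
theorem ip_bd (f : ℝ → ℝ) [IsL2 f] :
    ip A.bd f = A.phi6 0 * ip (A.e (4, 0)) f - A.phi5 0 * ip (A.e (5, 0)) f := by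
  rw [bd, ip_sub_left, ip_smul_left, ip_smul_left, phi_four_five.1, phi_four_five.2]

omit hA hB in
theorem shift_bd : dil 1 1 A.bd = A.phi6 0 • A.e (4, 1) - A.phi5 0 • A.e (5, 1) := by
  ext x
  simp only [bd, dil_eq, e, Int.cast_one, Pi.sub_apply, Pi.smul_apply]
  rfl

omit hB in
theorem ip_bd_short (i : Fin 4) : ip A.bd (A.short i) = 0 ∧ ip (dil 1 1 A.bd) (A.short i) = 0 := by
  have h : A.short i = A.e (i.castAdd 2, 0) := by
    rw [phi_e]
    fin_cases i <;> rfl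
  have h4 : ∀ k : ℤ, (4, k) ≠ ((i.castAdd 2, 0) : Fin 6 × ℤ) := fun k h => by
    have := congrArg (fun p : Fin 6 × ℤ => (p.1 : ℕ)) h
    simp at this
    omega
  have h5 : ∀ k : ℤ, (5, k) ≠ ((i.castAdd 2, 0) : Fin 6 × ℤ) := fun k h => by
    have := congrArg (fun p : Fin 6 × ℤ => (p.1 : ℕ)) h
    simp at this
    omega
  rw [h, ip_bd, shift_bd, ip_sub_left, ip_smul_left, ip_smul_left]
  simp only [(e_on hA).ip_eq, if_neg (h4 _), if_neg (h5 _), mul_zero, sub_zero, and_self]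

omit hB in
theorem ip_bd_shift_bd : ip A.bd (dil 1 1 A.bd) = 0 := by
  rw [ip_bd, shift_bd]
  simp only [ip_sub_right, ip_smul_right, (e_on hA).ip_eq, Prod.mk.injEq]
  norm_num

omit hB in
theorem phiInt_on : ON A.phiInt := by
  have hL : ON ![A.phiL] := by
    rw [phiL_eq]; exact ON.single (restr_bd_ne_zero hA)
  have hR : ON ![A.phiR] := by
    rw [phiR_eq]; exact ON.single (restr_shift_bd_ne_zero hA)
  have h1 := (short_on hA).sumElim hR (fun i j => by
    rw [Fin.fin_one_eq_zero j, Matrix.cons_val_zero, phiR_eq, ip_comm, ip_normalize_left,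
      ip_restr_left _ (A.short_supp i), (ip_bd_short hA i).2, mul_zero])
  have h2 := hL.sumElim h1 (fun i j => by
    rw [Fin.fin_one_eq_zero i, Matrix.cons_val_zero, phiL_eq, ip_normalize_left]
    rcases j with j | j
    · rw [Sum.elim_inl, ip_restr_left _ (A.short_supp j), (ip_bd_short hA j).1, mul_zero]
    · rw [Sum.elim_inr, Fin.fin_one_eq_zero j, Matrix.cons_val_zero, phiR_eq, ip_comm,
        ip_normalize_left, ip_comm, ip_restr_restr (bd_supp hA) (dil_one_one_supp (bd_supp hA)),
        ip_bd_shift_bd hA, mul_zero, mul_zero])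
  let k : Fin 6 → Fin 1 ⊕ Fin 4 ⊕ Fin 1 := ![Sum.inl 0, Sum.inr (Sum.inl 0), Sum.inr (Sum.inl 1),
    Sum.inr (Sum.inl 2), Sum.inr (Sum.inl 3), Sum.inr (Sum.inr 0)]
  have hk : Function.Injective k := by decide
  have h3 := h2.comp hk
  have e : A.phiInt = Sum.elim ![A.phiL] (Sum.elim A.short ![A.phiR]) ∘ k := by
    funext i
    fin_cases i <;> rfl
  rwa [e]

omit hB in
theorem phiInt_mem_VI (k : Fin 6) : A.phiInt k ∈ VI A 0 := by
  have hshort : ∀ i : Fin 6, i < 4 → A.phi i ∈ VI A 0 := fun i hi => by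
    have hs := A.phi_supp_short i hi
    have hc := A.phi_continuous i
    rw [← restr_eq_self hs]
    refine restr_mem_VI (by rw [Vs_zero]; exact A.phi_mem_V i) (SuppIn.eq_zero_left hs hc le_rfl)
      (SuppIn.eq_zero_right hs hc le_rfl)
  have hbc : Continuous A.bd := (A.V_le_Sp bd_mem).1.continuous
  fin_cases k
  · refine normalize_mem (restr_mem_VI ?_ bd_zero ?_)
    · rw [Vs_zero]; exact bd_mem
    · exact SuppIn.eq_zero_right (bd_supp hA) hbc le_rfl
  · exact hshort 0 (by decide)
  · exact hshort 1 (by decide)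
  · exact hshort 2 (by decide)
  · exact hshort 3 (by decide)
  · change A.phiR ∈ _
    rw [phiR_eq]
    refine normalize_mem (restr_mem_VI ?_ ?_ ?_)
    · rw [Vs_zero]; simpa using shift_mem_V bd_mem 1
    · rw [dil_eq]; exact SuppIn.eq_zero_left (bd_supp hA) hbc (by norm_num)
    · simp [dil_eq, bd_zero]

theorem ip_psiInt_psiInt {i j : ℕ} {m n : ℤ} (hm : m ∈ levelIndex i) (hn : n ∈ levelIndex j) :
    ip (B.psiInt A i m) (B.psiInt A j n) = if i = j ∧ m = n then 1 else 0 := by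
  rcases lt_trichotomy i j with h | rfl | h
  · rw [if_neg (fun h' => h.ne h'.1), ip_comm]
    exact ip_psiInt_VI hA hB hn (VI_mono h (psiInt_mem_VI hA hB hm))
  · have := (psiInt_on hA hB i).ip_eq ⟨m, hm⟩ ⟨n, hn⟩
    simpa using this
  · rw [if_neg (fun h' => h.ne' h'.1)]
    exact ip_psiInt_VI hA hB hm (VI_mono h (psiInt_mem_VI hA hB hn))

theorem ip_phiInt_psiInt (k : Fin 6) {j : ℕ} {n : ℤ} (hn : n ∈ levelIndex j) :
    ip (A.phiInt k) (B.psiInt A j n) = 0 := by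
  rw [ip_comm]
  exact ip_psiInt_VI hA hB hn (VI_mono (Nat.zero_le j) (phiInt_mem_VI hA k))

theorem basisFun_on : ON (basisFun A B) := by
  refine ⟨?_, ?_⟩
  · rintro (k | ⟨j, n⟩)
    exacts [(phiInt_on hA).l2 k, (psiInt_on hA hB j).l2 n]
  · rintro (k | ⟨i, m⟩) (l | ⟨j, n⟩)
    · simp [basisFun, (phiInt_on hA).ip_eq]
    · simp [basisFun, ip_phiInt_psiInt hA hB k n.2]
    · simp [basisFun, ip_comm (B.psiInt A i m), ip_phiInt_psiInt hA hB l m.2]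
    · have e : ((Sum.inr ⟨i, m⟩ : BasisIndex) = Sum.inr ⟨j, n⟩) ↔ (i = j ∧ (m : ℤ) = n) := by
        constructor
        · rintro h
          cases h
          exact ⟨rfl, rfl⟩
        · rintro ⟨rfl, h⟩
          rw [Subtype.ext h]
      simp only [e]
      exact ip_psiInt_psiInt hA hB m.2 n.2

theorem basisFun_mem_VI {J : ℕ} : (∀ k, basisFun A B (Sum.inl k) ∈ VI A J) ∧
    ∀ i < J, ∀ n, basisFun A B (Sum.inr ⟨i, n⟩) ∈ VI A J :=
  ⟨fun k => VI_mono (Nat.zero_le J) (phiInt_mem_VI hA k),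
    fun _ hi n => VI_mono hi (psiInt_mem_VI hA hB n.2)⟩

theorem exists_basisFun_mem_VI (i : BasisIndex) : ∃ j, basisFun A B i ∈ VI A j := by
  rcases i with k | ⟨j, n⟩
  exacts [⟨0, phiInt_mem_VI hA k⟩, ⟨j + 1, psiInt_mem_VI hA hB n.2⟩]

/-! ### Spanning -/

omit hB in
-- An element of `V` vanishing at 0 and N = 2^j has, after subtracting multiples of two translates
-- of `bd`, double zeros at both ends. It can then be cut to [0, N] and expanded in the 6N - 2
-- scaling functions supported there; with the two boundary functions this makes 6N.
theorem VI_le_span (j : ℕ) : ∃ b : Fin (6 * 2 ^ j) → ℝ → ℝ,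
    VI A j ≤ Submodule.span ℝ (Set.range b) := by
  set N : ℕ := 2 ^ j with hN
  have hN1 : 1 ≤ N := Nat.one_le_two_pow
  have hN1' : (1 : ℝ) ≤ N := by exact_mod_cast hN1
  let d : (ℝ → ℝ) →ₗ[ℝ] (ℝ → ℝ) := restrL ∘ₗ dilL (2 ^ j) 0
  let b' : Fin (6 * N - 2) ⊕ Fin 2 → ℝ → ℝ := Sum.elim
    -- The offset by one makes the indices run from 1 to 6N - 2, the range describing the functions
    -- inside [0, N].
    (fun i => d (A.e (lineIdx 4 ((i : ℤ) - (-1))))) ![d A.bd, d (dil 1 N A.bd)]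
  have hcard : Fintype.card (Fin (6 * N - 2) ⊕ Fin 2) = 6 * N := by
    simp only [Fintype.card_sum, Fintype.card_fin]; omega
  let ε := (Fintype.equivFinOfCardEq hcard).symm
  refine ⟨b' ∘ ε, ?_⟩
  rw [ε.surjective.range_comp]
  rintro _ ⟨g, ⟨⟨⟨g, hg, rfl⟩, h0⟩, h1⟩, rfl⟩
  have h0' : g ((0 : ℤ) : ℝ) = 0 := by
    have := mem_ker_evL.1 h0
    simpa [dilL_apply, dil_eq] using this
  have h1' : g ((N : ℤ) : ℝ) = 0 := by
    have := mem_ker_evL.1 h1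
    simpa [dilL_apply, dil_eq, hN] using this
  obtain ⟨c, hc⟩ := exists_sub_bd_mem_Z hA hg h0'
  obtain ⟨c', hc'⟩ := exists_sub_bd_mem_Z hA hg h1'
  have hb0 : dil 1 ((0 : ℤ) : ℝ) A.bd ∈ A.V := shift_bd_mem 0
  have hbN : dil 1 ((N : ℤ) : ℝ) A.bd ∈ A.V := shift_bd_mem N
  have hz0 : dil 1 ((0 : ℤ) : ℝ) A.bd ∈ Z ((N : ℤ) : ℝ) :=
    mem_Z_of_supp (A.V_le_Sp hb0).1 (dil_one_supp (bd_supp hA)) (Or.inr (by simpa using hN1'))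
  have hzN : dil 1 ((N : ℤ) : ℝ) A.bd ∈ Z ((0 : ℤ) : ℝ) :=
    mem_Z_of_supp (A.V_le_Sp hbN).1 (dil_one_supp (bd_supp hA)) (Or.inl (by simpa using hN1'))
  set g2 := g - c • dil 1 ((0 : ℤ) : ℝ) A.bd - c' • dil 1 ((N : ℤ) : ℝ) A.bd with hg2
  have hg2V : g2 ∈ A.V := Submodule.sub_mem _ (Submodule.sub_mem _ hg (Submodule.smul_mem _ _ hb0))
    (Submodule.smul_mem _ _ hbN)
  have hg20 : g2 ∈ Z ((0 : ℤ) : ℝ) := Submodule.sub_mem _ hc (Submodule.smul_mem _ _ hzN)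
  have hg2N : g2 ∈ Z ((N : ℤ) : ℝ) := by
    have := Submodule.sub_mem _ hc' (Submodule.smul_mem _ c hz0)
    rwa [sub_right_comm] at this
  set g3 := (Set.Ici ((0 : ℤ) : ℝ)).indicator g2 - (Set.Ici ((N : ℤ) : ℝ)).indicator g2 with hg3
  have hg3V : g3 ∈ A.V := Submodule.sub_mem _ (cut_mem_V hA hg2V hg20) (cut_mem_V hA hg2V hg2N)
  have e3 : ∀ x, g3 x = if x ∈ Set.Icc (0 : ℝ) N then g2 x else 0 := by
    intro x
    simp only [hg3, Pi.sub_apply, Set.indicator_apply, Set.mem_Ici, Int.cast_zero, Int.cast_natCast,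
      Set.mem_Icc]
    rcases lt_trichotomy x N with h | rfl | h
    · rw [if_neg h.not_ge, sub_zero]
      simp [h.le]
    · have : g2 N = 0 := by simpa using hg2N.2.1
      simp [this]
    · rw [if_pos h.le, if_pos (by linarith), sub_self, if_neg (fun h' => absurd h'.2 h.not_ge)]
  have hs3 : g3 ∈ SuppIn ((0 : ℤ) : ℝ) ((N : ℤ) : ℝ) := fun x hx => by
    rw [e3, if_neg (by simpa using hx)]
  have hspan := mem_span_inside hA hg3V hs3
  rw [← range_comp_lineIdx 4 (6 * N - 2) (-1) (inside 0 N) (fun n => by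
    rw [lineIdx_mem_inside]; omega), ← Set.range_comp] at hspan
  have hd3 : d g3 ∈ Submodule.span ℝ (Set.range b') := by
    have := Submodule.mem_map_of_mem (f := d) hspan
    rw [Submodule.map_span, ← Set.range_comp] at this
    refine Submodule.span_mono ?_ this
    rintro _ ⟨i, rfl⟩
    exact ⟨Sum.inl i, rfl⟩
  have hd : d g = d g3 + c • d A.bd + c' • d (dil 1 N A.bd) := by
    have h2 : d g2 = d g3 := by
      ext x
      have h2 : (0 : ℝ) < 2 ^ j := by positivity
      simp only [d, LinearMap.comp_apply, restrL_apply, dilL_apply, restr, Set.indicator_apply]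
      split_ifs with hx
      · rw [dil_eq, dil_eq, e3, if_pos]
        rw [sub_zero, hN, Nat.cast_pow, Nat.cast_ofNat]
        exact ⟨mul_nonneg h2.le hx.1, mul_le_of_le_one_right h2.le hx.2⟩
      · rfl
    have h3 : g = g2 + c • A.bd + c' • dil 1 N A.bd := by
      rw [hg2, Int.cast_zero, dil_one_zero, Int.cast_natCast]
      abel
    rw [← h2, ← map_smul, ← map_smul, ← map_add, ← map_add, ← h3]
  change d g ∈ _
  rw [hd]
  exact Submodule.add_mem _ (Submodule.add_mem _ hd3
    (Submodule.smul_mem _ _ (Submodule.subset_span ⟨Sum.inr 0, rfl⟩)))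
    (Submodule.smul_mem _ _ (Submodule.subset_span ⟨Sum.inr 1, rfl⟩))

/-- The basis functions of the levels below J are 6 + ∑_{i<J} 6·2^i = 6·2^J orthonormal elements of
`VI A J`, and this space has dimension at most 6·2^J by `VI_le_span`. -/
theorem VI_le_span_basisFun (J : ℕ) :
    VI A J ≤ Submodule.span ℝ (Set.range (basisFun A B)) := by
  obtain ⟨b, hb⟩ := VI_le_span hA J
  let ι := Fin 6 ⊕ Σ i : Fin J, levelIndex i
  let k : ι → BasisIndex := Sum.map id fun p => ⟨(p.1 : ℕ), p.2⟩
  have hk : Function.Injective k := by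
    refine Function.injective_id.sumMap ?_
    rintro ⟨⟨i, hi⟩, m⟩ ⟨⟨j, hj⟩, n⟩ h
    simp only [Sigma.mk.injEq] at h
    obtain ⟨rfl, h⟩ := h
    simpa using h
  have hon := (basisFun_on hA hB).comp hk
  have hmem : Submodule.span ℝ (Set.range (basisFun A B ∘ k)) ≤ VI A J := by
    refine Submodule.span_le.2 ?_
    rintro _ ⟨k | ⟨i, n⟩, rfl⟩
    · exact (basisFun_mem_VI hA hB).1 k
    · exact (basisFun_mem_VI hA hB).2 i i.2 n
  have hcard : Fintype.card ι = 6 * 2 ^ J := by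
    have h1 : ∀ i : ℕ, Fintype.card (levelIndex i) = 6 * 2 ^ i := fun i => by
      have h2 : (0 : ℤ) < 2 ^ i := by positivity
      have h3 := Int.card_fintype_Icc_of_le (a := 1) (b := 6 * 2 ^ i) (by omega)
      have h4 : (Fintype.card (levelIndex i) : ℤ) = ((6 * 2 ^ i : ℕ) : ℤ) := by
        rw [h3]; push_cast; ring
      exact_mod_cast h4
    rw [Fintype.card_sum, Fintype.card_sigma]
    simp only [h1, Fintype.card_fin, ← Finset.mul_sum]
    rw [Fin.sum_univ_eq_sum_range (fun i => 2 ^ i) J]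
    have := Nat.geomSum_eq (le_refl 2) J
    have h2 : 1 ≤ 2 ^ J := Nat.one_le_two_pow
    rw [this]
    omega
  have hfin : Module.finrank ℝ (Submodule.span ℝ (Set.range (basisFun A B ∘ k))) = 6 * 2 ^ J := by
    rw [finrank_span_eq_card hon.linearIndependent, hcard]
  have hfin' : Module.finrank ℝ (Submodule.span ℝ (Set.range b)) ≤ 6 * 2 ^ J := by
    simpa [Set.finrank] using finrank_range_le_card (R := ℝ) (b := b)
  have : FiniteDimensional ℝ (Submodule.span ℝ (Set.range b)) :=
    FiniteDimensional.span_of_finite ℝ (Set.finite_range b)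
  have heq := Submodule.eq_of_le_of_finrank_le (hmem.trans hb) (hfin'.trans hfin.ge)
  rw [← heq] at hb
  exact hb.trans (Submodule.span_mono (Set.range_comp_subset_range _ _))

end WaveletChoice

end SplineWavelet

end

open MeasureTheory

noncomputable section

set_option synthInstance.maxSize 100000

namespace SplineWavelet

/-! ### The Hilbert space `L²(0, 1)` -/

theorem ip01_eq {f : ℝ → ℝ} (hf : f ∈ SuppIn 0 1) (g : ℝ → ℝ) : ip01 f g = ip f g := by
  rw [ip01, ← integral_Icc_eq_integral_Ioo, ip]
  exact setIntegral_eq_integral_of_forall_compl_eq_zero fun x hx => by rw [hf x hx, zero_mul]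

/-- Orthonormality passes to the classes in L²(0,1), and a class orthogonal to all of them, extended
by zero, is null by `hd`; a maximal orthonormal family is a Hilbert basis. -/
theorem exists_hilbertBasis_of_on {ι : Type} [DecidableEq ι] {g : ι → ℝ → ℝ} (hg : ON g)
    (hs : ∀ i, g i ∈ SuppIn 0 1)
    (hd : ∀ f : ℝ → ℝ, IsL2 f → f ∈ SuppIn 0 1 → (∀ i, ip f (g i) = 0) → f =ᵐ[volume] 0) :
    ∃ e : HilbertBasis ι ℝ (Lp ℝ 2 (volume.restrict (Set.Ioo (0 : ℝ) 1))),
      ∀ i, (e i : ℝ → ℝ) =ᵐ[volume.restrict (Set.Ioo (0 : ℝ) 1)] g i := by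
  have hL : ∀ i, MemLp (g i) 2 (volume.restrict (Set.Ioo (0 : ℝ) 1)) := fun i =>
    (hg.l2 i).memLp.restrict _
  have hinner : ∀ (F : Lp ℝ 2 (volume.restrict (Set.Ioo (0 : ℝ) 1))) (i : ι),
      inner ℝ F ((hL i).toLp (g i)) = ∫ x in Set.Ioo (0 : ℝ) 1, F x * g i x := fun F i => by
    rw [L2.inner_def]
    refine integral_congr_ae ?_
    filter_upwards [(hL i).coeFn_toLp] with x hx
    rw [hx, real_inner_eq_re_inner]
    simp [mul_comm]
  have hon : Orthonormal ℝ fun i => (hL i).toLp (g i) := by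
    rw [orthonormal_iff_ite]
    intro i j
    rw [hinner, ← hg.ip_eq i j, ← ip01_eq (hs i), ip01]
    refine integral_congr_ae ?_
    filter_upwards [(hL i).coeFn_toLp] with x hx
    rw [hx]
  have hbot : (Submodule.span ℝ (Set.range fun i => (hL i).toLp (g i)))ᗮ = ⊥ := by
    rw [eq_bot_iff]
    intro F hF
    rw [Submodule.mem_bot]
    have hF2 : IsL2 ((Set.Ioo (0 : ℝ) 1).indicator F) :=
      ⟨(memLp_indicator_iff_restrict measurableSet_Ioo).2 (Lp.memLp F)⟩
    have h0 := hd _ hF2 (fun x hx => Set.indicator_of_notMem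
      (fun h => hx (Set.Ioo_subset_Icc_self h)) _) (fun i => ?_)
    · rw [Lp.eq_zero_iff_ae_eq_zero]
      rw [Filter.EventuallyEq, ae_restrict_iff' measurableSet_Ioo]
      filter_upwards [h0] with x hx hx'
      rwa [Set.indicator_of_mem hx'] at hx
    · have h1 := Submodule.inner_left_of_mem_orthogonal
        (Submodule.subset_span (Set.mem_range_self (f := fun i => (hL i).toLp (g i)) i)) hF
      rw [hinner, ← integral_indicator measurableSet_Ioo] at h1
      rw [ip]
      refine Eq.trans (integral_congr_ae ?_) h1
      refine Filter.Eventually.of_forall fun x => ?_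
      simp only [Set.indicator_apply]
      split_ifs <;> simp
  refine ⟨HilbertBasis.mkOfOrthogonalEqBot hon hbot, fun i => ?_⟩
  rw [HilbertBasis.coe_mkOfOrthogonalEqBot]
  exact (hL i).coeFn_toLp

/-! ### Approximation by splines -/

theorem xi1_partition {t : ℝ} (ht : t ∈ Set.Icc (0 : ℝ) 1) :
    0 ≤ xi1 t ∧ 0 ≤ xi1 (t - 1) ∧ xi1 t + xi1 (t - 1) = 1 := by
  rw [xi1_right ht, xi1_left ht]
  have h0 := ht.1
  have h1 : 0 ≤ 3 - 2 * t := by linarith [ht.2]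
  refine ⟨by positivity, by positivity, by ring⟩

/-- The interpolation of the values of `u` at the points `n / N`, `0 ≤ n ≤ N`. -/
def interp (N : ℕ) (u : ℝ → ℝ) : ℝ → ℝ :=
  ∑ n ∈ Finset.range (N + 1), u (n / N) • dil N n xi1

theorem interp_apply {N : ℕ} (u : ℝ → ℝ) {k : ℕ} (hk : k < N) {x : ℝ}
    (hx : (N : ℝ) * x - k ∈ Set.Icc (0 : ℝ) 1) :
    interp N u x = u (k / N) * xi1 (N * x - k) +
      u (((k + 1 : ℕ) : ℝ) / N) * xi1 (N * x - k - 1) := by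
  rw [interp, Finset.sum_apply]
  have hsub : ({k, k + 1} : Finset ℕ) ⊆ Finset.range (N + 1) := by
    intro n hn
    simp only [Finset.mem_insert, Finset.mem_singleton] at hn
    rw [Finset.mem_range]; omega
  rw [← Finset.sum_subset hsub, Finset.sum_pair (by omega)]
  · simp only [Pi.smul_apply, smul_eq_mul, dil_eq]
    push_cast
    ring_nf
  · intro n _ hn
    simp only [Finset.mem_insert, Finset.mem_singleton, not_or] at hn
    rw [Pi.smul_apply, dil_eq, xi1_of_abs, smul_zero]
    rcases lt_or_gt_of_ne hn.1 with h | h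
    · have : (n : ℝ) + 1 ≤ k := by exact_mod_cast h
      exact le_abs.2 (Or.inl (by linarith [hx.1]))
    · have : (k : ℝ) + 2 ≤ n := by exact_mod_cast (show k + 2 ≤ n by omega)
      exact le_abs.2 (Or.inr (by linarith [hx.2]))

theorem interp_zero {N : ℕ} (hN : 0 < N) (u : ℝ → ℝ) : interp N u 0 = u 0 := by
  rw [interp_apply u hN (by simp), xi1_of_abs (t := (N : ℝ) * 0 - ((0 : ℕ) : ℝ) - 1) (by simp)]
  simp [xi1_zero.1]

theorem interp_one {N : ℕ} (hN : 0 < N) (u : ℝ → ℝ) : interp N u 1 = u 1 := by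
  have hN' : (N : ℝ) ≠ 0 := by positivity
  have e : ((N - 1 : ℕ) : ℝ) = N - 1 := by rw [Nat.cast_pred hN]
  rw [interp_apply u (Nat.sub_lt hN one_pos) (by rw [e]; simp), Nat.sub_add_cancel (show 1 ≤ N from hN), e,
    xi1_of_abs (t := (N : ℝ) * 1 - (N - 1)) (by simp), div_self hN']
  simp [xi1_zero.1]

/-- On each cell the interpolant is a convex combination of the two end point values, since the
translates of `xi1` form a nonnegative partition of unity; each of these values is within C/N of
u(x). -/
theorem abs_sub_interp_le {N : ℕ} (hN : 0 < N) {u : ℝ → ℝ} {C : NNReal} (hu : LipschitzWith C u)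
    {x : ℝ} (hx : x ∈ Set.Icc (0 : ℝ) 1) : |u x - interp N u x| ≤ C / N := by
  have hN' : (0 : ℝ) < N := by exact_mod_cast hN
  obtain ⟨k, hk, hxk⟩ : ∃ k < N, (N : ℝ) * x - k ∈ Set.Icc (0 : ℝ) 1 := by
    rcases hx.2.eq_or_lt with rfl | h
    · refine ⟨N - 1, Nat.sub_lt hN one_pos, ?_⟩
      rw [Nat.cast_pred hN]; simp
    · have h0 : 0 ≤ (N : ℝ) * x := mul_nonneg hN'.le hx.1
      refine ⟨⌊(N : ℝ) * x⌋₊, (Nat.floor_lt h0).2 (by nlinarith), ?_, ?_⟩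
      · linarith [Nat.floor_le h0]
      · linarith [Nat.lt_floor_add_one ((N : ℝ) * x)]
  obtain ⟨p0, p1, ps⟩ := xi1_partition hxk
  rw [interp_apply u hk hxk]
  set a := xi1 (N * x - k)
  set b := xi1 (N * x - k - 1)
  have key : ∀ n : ℕ, |(N : ℝ) * x - n| ≤ 1 → |u x - u (n / N)| ≤ C / N := fun n hn => by
    refine (hu.dist_le_mul x (n / N)).trans ?_
    have e : x - n / N = (N * x - n) / N := by field_simp
    rw [div_eq_mul_one_div (C : ℝ), Real.dist_eq, e, abs_div, abs_of_pos hN']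
    exact mul_le_mul_of_nonneg_left (by gcongr) C.2
  have e1 := key k (abs_le.2 ⟨by linarith [hxk.1], hxk.2⟩)
  have e2 := key (k + 1) (abs_le.2 ⟨by push_cast; linarith [hxk.1], by push_cast; linarith [hxk.2]⟩)
  have e : u x - (u (k / N) * a + u (((k + 1 : ℕ) : ℝ) / N) * b) =
      a * (u x - u (k / N)) + b * (u x - u (((k + 1 : ℕ) : ℝ) / N)) := by
    linear_combination (-u x) * ps
  rw [e]
  refine (abs_add_le _ _).trans ?_
  rw [abs_mul, abs_mul, abs_of_nonneg p0, abs_of_nonneg p1]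
  calc _ ≤ a * (C / N) + b * (C / N) := by gcongr
    _ = C / N := by rw [← add_mul, ps, one_mul]

namespace WaveletChoice

open ScalingChoice

variable {B : WaveletChoice} {A : ScalingChoice}

theorem interp_mem_Vs (m : ℕ) (u : ℝ → ℝ) : interp (2 ^ m) u ∈ A.Vs m := by
  refine Submodule.sum_mem _ fun n _ => Submodule.smul_mem _ _ (Sp_le_Vs m ?_)
  have := dil_pow_mem_Sp xi1_mem m n
  rw [zero_add] at this
  refine Sp_le_succ m ?_
  simpa using this

/-- It suffices to test against smooth u supported inside (0,1). The interpolant of u lies in `Vs m`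
and vanishes at 0 and 1, so `f` is orthogonal to its restriction, while the uniform error is at most
C·2⁻ᵐ and `f` is integrable. Hence ⟨f,u⟩ = 0. -/
theorem ae_eq_zero_of_ip_VI {f : ℝ → ℝ} (hf : IsL2 f) (hs : f ∈ SuppIn 0 1)
    (h : ∀ j, ∀ g ∈ VI A j, ip f g = 0) : f =ᵐ[volume] 0 := by
  have hint : Integrable f volume := by
    have h1 : IntegrableOn f (Set.Icc 0 1) :=
      (hf.memLp.restrict (Set.Icc (0 : ℝ) 1)).integrable one_le_two
    exact (integrableOn_iff_integrable_of_support_subset fun x hx => by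
      by_contra h'; exact hx (hs x h')).1 h1
  have key : ∀ (g : ℝ → ℝ), ContDiff ℝ (↑(⊤ : ℕ∞)) g → HasCompactSupport g →
      tsupport g ⊆ Set.Ioo 0 1 → ∫ x, g x • f x = 0 := by
    intro u hu hc ht
    obtain ⟨C, hC⟩ := hu.lipschitzWith_of_hasCompactSupport hc (by simp)
    have huL : IsL2 u := ⟨hu.continuous.memLp_of_hasCompactSupport hc⟩
    have hz : ∀ x ∉ Set.Ioo (0 : ℝ) 1, u x = 0 := fun x hx =>
      image_eq_zero_of_notMem_tsupport fun h' => hx (ht h')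
    have hb : ∀ m : ℕ, |ip f u| ≤ (∫ x, |f x|) * C * (1 / 2) ^ m := by
      intro m
      set g := interp (2 ^ m) u
      have hN : 0 < 2 ^ m := by positivity
      have hg : restr g ∈ VI A m := restr_mem_VI (interp_mem_Vs m u)
        ((interp_zero hN u).trans (hz 0 (by simp))) ((interp_one hN u).trans (hz 1 (by simp)))
      have := isL2_of_mem_VI hg
      have e : ip f u = ip f (u - restr g) := by rw [ip_sub_right, h m _ hg, sub_zero]
      rw [e, ip, ← Real.norm_eq_abs, mul_assoc, ← integral_mul_const]
      refine norm_integral_le_of_norm_le (hint.abs.mul_const _) (Filter.Eventually.of_forall ?_)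
      intro x
      rw [Real.norm_eq_abs, abs_mul]
      by_cases hx : x ∈ Set.Icc (0 : ℝ) 1
      · refine mul_le_mul_of_nonneg_left ?_ (abs_nonneg _)
        rw [Pi.sub_apply, restr_of_mem hx]
        refine (abs_sub_interp_le hN hC hx).trans (le_of_eq ?_)
        push_cast
        rw [one_div, inv_pow]; rfl
      · rw [hs x hx]; simp
    have h0 : |ip f u| ≤ 0 := by
      have ht := (tendsto_pow_atTop_nhds_zero_of_lt_one (r := (1 / 2 : ℝ)) (by norm_num)
        (by norm_num)).const_mul ((∫ x, |f x|) * C)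
      rw [mul_zero] at ht
      exact ge_of_tendsto' ht hb
    have h1 := abs_nonpos_iff.1 h0
    rw [ip] at h1
    rw [← h1]
    exact integral_congr_ae (Filter.Eventually.of_forall fun x => mul_comm _ _)
  have h1 := isOpen_Ioo.ae_eq_zero_of_integral_contDiff_smul_eq_zero
    (hint.locallyIntegrable.locallyIntegrableOn (Set.Ioo 0 1)) key
  have h2 : ∀ᵐ x : ℝ, x ≠ 0 ∧ x ≠ 1 := by
    have a0 := Measure.ae_ne volume (0 : ℝ)
    have a1 := Measure.ae_ne volume (1 : ℝ)
    filter_upwards [a0, a1] with x h0 h1 using ⟨h0, h1⟩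
  filter_upwards [h1, h2] with x hx hx'
  by_cases h' : x ∈ Set.Icc (0 : ℝ) 1
  · exact hx ⟨lt_of_le_of_ne h'.1 hx'.1.symm, lt_of_le_of_ne h'.2 hx'.2⟩
  · exact hs x h'

variable (hA : A.Admissible) (hB : B.Admissible A)

include hA hB

theorem basisFun_supp (i : BasisIndex) : basisFun A B i ∈ SuppIn 0 1 := by
  obtain ⟨j, hj⟩ := exists_basisFun_mem_VI hA hB i
  exact VI_le_SuppIn j hj

theorem exists_hilbertBasis :
    ∃ e : HilbertBasis BasisIndex ℝ (Lp ℝ 2 (volume.restrict (Set.Ioo (0 : ℝ) 1))),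
      ∀ i, (e i : ℝ → ℝ) =ᵐ[volume.restrict (Set.Ioo (0 : ℝ) 1)] basisFun A B i := by
  refine exists_hilbertBasis_of_on (basisFun_on hA hB) (basisFun_supp hA hB) fun f hf hs h => ?_
  refine ae_eq_zero_of_ip_VI (A := A) hf hs fun j g hg => ?_
  refine ip_eq_zero_of_mem_span_right ?_ ?_ (VI_le_span_basisFun hA hB j hg)
  · rintro _ ⟨i, rfl⟩; exact (basisFun_on hA hB).l2 i
  · rintro _ ⟨i, rfl⟩; exact h i

end WaveletChoice

end SplineWavelet

end

open MeasureTheory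

noncomputable section

set_option synthInstance.maxSize 100000

namespace SplineWavelet

/-! ### Regularity, supports and moments -/

theorem isPiecewiseCubicOn_restr {j : ℕ} {f : ℝ → ℝ} (hf : f ∈ Sp j) :
    IsPiecewiseCubicOn (restr f) 0 1 := by
  have h2 : (0 : ℝ) < 2 ^ j := by positivity
  refine ⟨2 ^ j, fun i => (i : ℕ) / 2 ^ j, fun a b h => ?_, by simp, ?_, fun i => ?_⟩
  · simp only
    gcongr
    exact_mod_cast h
  · simp [Fin.val_last]
  · obtain ⟨P, hP, h⟩ := hf.2.2 ((i : ℕ) : ℤ)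
    refine ⟨P, hP, fun x hx => ?_⟩
    simp only [Fin.val_castSucc, Fin.val_succ, Nat.cast_add, Nat.cast_one] at hx
    rw [restr_of_mem, h x (by simpa using hx)]
    refine ⟨le_trans (by positivity) hx.1, hx.2.trans ((div_le_one h2).2 ?_)⟩
    have : (i : ℕ) + 1 ≤ 2 ^ j := i.2
    exact_mod_cast this

theorem SuppIn.tsupport_subset {a b : ℝ} {f : ℝ → ℝ} (hf : f ∈ SuppIn a b) :
    tsupport f ⊆ Set.Icc a b :=
  closure_minimal (fun x hx => by by_contra h; exact hx (hf x h)) isClosed_Icc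

theorem SuppIn.locality {a b d : ℝ} {f : ℝ → ℝ} (hf : f ∈ SuppIn a b) (hab : a ≤ b)
    (hd : b - a ≤ d) : HasCompactSupport f ∧ Metric.diam (tsupport f) ≤ d :=
  ⟨hasCompactSupport_of_Icc a b hf,
    ((Metric.diam_mono (SuppIn.tsupport_subset hf) (Metric.isBounded_Icc a b)).trans
      (Real.diam_Icc hab).le).trans hd⟩

/-- On `[-1, 1]`, a cubic polynomial coincides with a spline with integer nodes. -/
theorem exists_Sp_eq_polynomial {Q : Polynomial ℝ} (hQ : Q.natDegree ≤ 3) :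
    ∃ g ∈ Sp 0, ∀ x ∈ Set.Icc (-1 : ℝ) 1, g x = Q.eval x := by
  have h1 : ∀ n : ℤ, dil 1 n xi1 ∈ Sp 0 := fun n => shift_mem_Sp xi1_mem n
  have h2 : ∀ n : ℤ, dil 1 n xi2 ∈ Sp 0 := fun n => shift_mem_Sp xi2_mem n
  refine ⟨∑ n ∈ ({-1, 0, 1} : Finset ℤ),
    (Q.eval (n : ℝ) • dil 1 n xi1 + Q.derivative.eval (n : ℝ) • dil 1 n xi2),
    Submodule.sum_mem _ fun n _ => Submodule.add_mem _ (Submodule.smul_mem _ _ (h1 n))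
      (Submodule.smul_mem _ _ (h2 n)), fun x hx => ?_⟩
  rw [Finset.sum_insert (by decide), Finset.sum_pair (by decide)]
  simp only [Pi.add_apply, Pi.smul_apply, smul_eq_mul, dil_eq, one_mul]
  push_cast
  rcases le_total x 0 with h | h
  · have ht : x + 1 ∈ Set.Icc (0 : ℝ) 1 := ⟨by linarith [hx.1], by linarith⟩
    have e1 := xi1_left ht
    have e2 := xi2_left ht
    rw [add_sub_cancel_right] at e1 e2
    have h3 : 1 ≤ |x - 1| := le_abs.2 (Or.inr (by linarith))
    rw [polynomial_herm hQ (-1) x one_ne_zero, xi1_of_abs h3, xi2_of_abs h3, sub_zero, sub_neg_eq_add,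
      xi1_right ht, xi2_right ht, e1, e2]
    simp [herm]
    ring
  · have ht : x ∈ Set.Icc (0 : ℝ) 1 := ⟨h, hx.2⟩
    have h3 : 1 ≤ |x - -1| := le_abs.2 (Or.inl (by linarith))
    rw [polynomial_herm hQ 0 x one_ne_zero, xi1_of_abs h3, xi2_of_abs h3, sub_zero,
      xi1_right ht, xi2_right ht, xi1_left ht, xi2_left ht]
    simp [herm]
    ring

theorem dil_polynomial {P : Polynomial ℝ} (hP : P.natDegree ≤ 3) (s c : ℝ) :
    ∃ Q : Polynomial ℝ, Q.natDegree ≤ 3 ∧ dil s c (fun x => P.eval x) = fun x => Q.eval x := by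
  refine ⟨P.comp (Polynomial.C s * Polynomial.X - Polynomial.C c), ?_, ?_⟩
  · refine Polynomial.natDegree_comp_le.trans ?_
    have : (Polynomial.C s * Polynomial.X - Polynomial.C c).natDegree ≤ 1 := by
      compute_degree
    nlinarith
  · ext x
    simp [dil_eq]

namespace ScalingChoice

variable {A : ScalingChoice}

/-- Only the values on [-1,1] matter, where the polynomial agrees with a spline with integer nodes;
such splines lie in `V`, which is orthogonal to wavelets. -/
theorem ip_wav_polynomial {f : ℝ → ℝ} (hf : f ∈ A.wav) (hs : f ∈ SuppIn (-1) 1)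
    {Q : Polynomial ℝ} (hQ : Q.natDegree ≤ 3) : ip f (fun x => Q.eval x) = 0 := by
  obtain ⟨g, hg, hgQ⟩ := exists_Sp_eq_polynomial hQ
  rw [← ip_wav hf (A.Sp_one_le_V (Sp_le_succ 0 hg))]
  refine ip_congr fun x => ?_
  by_cases hx : x ∈ Set.Icc (-1 : ℝ) 1
  · rw [hgQ x hx]
  · rw [hs x hx, zero_mul, zero_mul]

end ScalingChoice

namespace WaveletChoice

open ScalingChoice

variable {B : WaveletChoice} {A : ScalingChoice}

theorem regularity_of_mem_VI {j : ℕ} {f : ℝ → ℝ} (hf : f ∈ VI A j) :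
    IsPiecewiseCubicOn f 0 1 ∧ ContDiffOn ℝ 1 f (Set.Ioo 0 1) := by
  obtain ⟨g, ⟨⟨hg, -⟩, -⟩, rfl⟩ := hf
  exact ⟨isPiecewiseCubicOn_restr (Vs_le_Sp j hg), (Vs_continuous hg).1.contDiffOn.congr
    fun x hx => restr_of_mem (Set.Ioo_subset_Icc_self hx)⟩

variable (hA : A.Admissible) (hB : B.Admissible A)

include hA

theorem wavN_short_supp {N : ℕ} (a : Fin 2 ⊕ innerIdx N ⊕ Fin 2) :
    ∃ c : ℝ, B.wavN A N a ∈ SuppIn c (c + 2) := by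
  rcases a with i | ⟨p, hp⟩ | i
  · refine ⟨0, SuppIn_mono le_rfl (by norm_num) (gsPair_mem (U := SuppIn 0 1) (fun i => ?_) i)⟩
    exact restr_mem _
  · exact ⟨-1 + p.2, SuppIn_mono le_rfl (by linarith) (dil_one_supp (psi_supp hA p.1))⟩
  · refine ⟨0 + (N - 1), SuppIn_mono le_rfl (by linarith) (dil_one_supp (a := 0) (b := 1)
      (gsPair_mem (U := SuppIn 0 1) (fun i => ?_) i))⟩
    exact restr_mem _

theorem psiInt_locality {j : ℕ} {n : ℤ} (hn : n ∈ levelIndex j) :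
    HasCompactSupport (B.psiInt A j n) ∧
      Metric.diam (tsupport (B.psiInt A j n)) ≤ (2 : ℝ) ^ (1 - (j : ℤ)) := by
  obtain ⟨a, -, ha⟩ := exists_levelRel (B := B) (A := A) hn
  obtain ⟨c, hc⟩ := wavN_short_supp (B := B) hA a
  have h2 : (0 : ℝ) < 2 ^ j := by positivity
  have hs : B.psiInt A j n ∈ SuppIn (c / 2 ^ j) ((c + 2) / 2 ^ j) := by
    rw [ha]
    refine Submodule.smul_mem _ _ (dil_mem_SuppIn hc h2 ?_ ?_) <;> field_simp <;> ring
  refine SuppIn.locality hs (by gcongr; linarith) (le_of_eq ?_)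
  rw [zpow_sub₀ two_ne_zero, zpow_one, zpow_natCast]
  ring

theorem phiInt_locality (k : Fin 6) :
    HasCompactSupport (A.phiInt k) ∧ Metric.diam (tsupport (A.phiInt k)) ≤ 2 :=
  SuppIn.locality (VI_le_SuppIn 0 (phiInt_mem_VI hA k)) zero_le_one (by norm_num)

include hB

theorem psiInt_moments {j : ℕ} {k : ℤ} (h3 : 3 ≤ k) (hk : k ≤ 6 * 2 ^ j - 2)
    {P : Polynomial ℝ} (hP : P.degree < 4) :
    ∫ x in Set.Ioo (0 : ℝ) 1, P.eval x * B.psiInt A j k x = 0 := by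
  have hP3 : P.natDegree ≤ 3 := Polynomial.natDegree_le_of_degree_le (Order.lt_succ_iff.1 hP)
  have hn : k ∈ levelIndex j := ⟨by omega, by omega⟩
  have hs := VI_le_SuppIn _ (psiInt_mem_VI hA hB hn)
  have h1 := ip01_eq hs fun x => P.eval x
  simp only [ip01, mul_comm (B.psiInt A j k _)] at h1
  rw [h1, psiInt_inner h3 hk, psiLine, lineFamily_eq, ip_smul_left]
  set p := lineIdx 2 (k - 2)
  have h2 : (2 : ℝ) ^ j ≠ 0 := by positivity
  obtain ⟨Q, hQ, hQe⟩ := dil_polynomial hP3 (1 / 2 ^ j) 0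
  have e : (fun x => P.eval x) = dil (2 ^ j) 0 fun x => Q.eval x := by
    rw [← hQe]
    ext x
    simp only [dil_eq, sub_zero]
    congr 1
    field_simp
  obtain ⟨R, hR, hRe⟩ := dil_polynomial hQ 1 (-(p.2 : ℝ))
  rw [e, ip_dil, ip_dil_one_left, hRe,
    ip_wav_polynomial (psi_mem_wav hA hB.null_S hB.null_T p.1) (psi_supp hA p.1) hR, mul_zero,
    mul_zero]

end WaveletChoice

end SplineWavelet

end

/-! ### Assembly of the main theorem -/

theorem mainTheorem4 :
    -- the construction can be carried out: admissible parameters exist at each stage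
    (∃ A : SplineWavelet.ScalingChoice, A.Admissible) ∧
    (∀ A : SplineWavelet.ScalingChoice, A.Admissible →
      ∃ B : SplineWavelet.WaveletChoice, B.Admissible A) ∧
    -- and every basis it produces has the stated properties
    ∀ (A : SplineWavelet.ScalingChoice) (B : SplineWavelet.WaveletChoice),
      A.Admissible → B.Admissible A →
      -- cubic splines of class `C^1`
      (∀ i, SplineWavelet.IsPiecewiseCubicOn (SplineWavelet.basisFun A B i) 0 1 ∧
        ContDiffOn ℝ 1 (SplineWavelet.basisFun A B i) (Set.Ioo 0 1)) ∧
      -- orthonormality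
      ((∀ k l : Fin 6,
          SplineWavelet.ip01 (A.phiInt k) (A.phiInt l) = if k = l then 1 else 0) ∧
        (∀ (i j : ℕ), ∀ k ∈ SplineWavelet.levelIndex i, ∀ l ∈ SplineWavelet.levelIndex j,
          SplineWavelet.ip01 (B.psiInt A i k) (B.psiInt A j l) =
            if i = j ∧ k = l then 1 else 0) ∧
        (∀ (k : Fin 6) (j : ℕ), ∀ l ∈ SplineWavelet.levelIndex j,
          SplineWavelet.ip01 (A.phiInt k) (B.psiInt A j l) = 0)) ∧
      -- four vanishing moments of the inner wavelets
      (∀ (j : ℕ) (k : ℤ), 3 ≤ k → k ≤ 6 * 2 ^ j - 2 →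
        ∀ P : Polynomial ℝ, P.degree < 4 →
          ∫ x in Set.Ioo (0 : ℝ) 1, P.eval x * B.psiInt A j k x = 0) ∧
      -- orthonormal basis of `L²(0, 1)`
      (∃ e : HilbertBasis SplineWavelet.BasisIndex ℝ
          (MeasureTheory.Lp ℝ 2
            (MeasureTheory.volume.restrict (Set.Ioo (0 : ℝ) 1))),
        ∀ i, (e i : ℝ → ℝ) =ᵐ[MeasureTheory.volume.restrict (Set.Ioo (0 : ℝ) 1)]
          SplineWavelet.basisFun A B i) ∧
      -- locality
      ((∀ k : Fin 6, HasCompactSupport (A.phiInt k) ∧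
          Metric.diam (tsupport (A.phiInt k)) ≤ 2) ∧
        (∀ (j : ℕ), ∀ k ∈ SplineWavelet.levelIndex j, HasCompactSupport (B.psiInt A j k) ∧
          Metric.diam (tsupport (B.psiInt A j k)) ≤ (2 : ℝ) ^ (1 - (j : ℤ)))) := by
  refine ⟨SplineWavelet.ScalingChoice.exists_admissible,
    fun A hA => SplineWavelet.WaveletChoice.exists_admissible hA, fun A B hA hB =>
    ⟨fun i => ?_, ⟨fun k l => ?_, fun i j k hk l hl => ?_, fun k j l hl => ?_⟩,
      fun j k h3 hk P hP => SplineWavelet.WaveletChoice.psiInt_moments hA hB h3 hk hP,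
      SplineWavelet.WaveletChoice.exists_hilbertBasis hA hB,
      SplineWavelet.WaveletChoice.phiInt_locality hA,
      fun j k hk => SplineWavelet.WaveletChoice.psiInt_locality hA hk⟩⟩
  · obtain ⟨j, hj⟩ := SplineWavelet.WaveletChoice.exists_basisFun_mem_VI hA hB i
    exact SplineWavelet.WaveletChoice.regularity_of_mem_VI hj
  · refine (SplineWavelet.ip01_eq
      (SplineWavelet.WaveletChoice.basisFun_supp hA hB (Sum.inl k)) _).trans ?_
    exact (SplineWavelet.WaveletChoice.phiInt_on hA).ip_eq k l
  · refine (SplineWavelet.ip01_eq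
      (SplineWavelet.WaveletChoice.basisFun_supp hA hB (Sum.inr ⟨i, k, hk⟩)) _).trans ?_
    exact SplineWavelet.WaveletChoice.ip_psiInt_psiInt hA hB hk hl
  · refine (SplineWavelet.ip01_eq
      (SplineWavelet.WaveletChoice.basisFun_supp hA hB (Sum.inl k)) _).trans ?_
    exact SplineWavelet.WaveletChoice.ip_phiInt_psiInt hA hB k hl
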